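/- Define polynomials $p_k$ by $p_1(\omega)=\omega+1$ and $p_k(\omega)=\bigl((2k-1)\,\omega\,p_{k-1}(\omega)\bigr)^{2k}$ for $k\ge 2$. For $n\ge 2$ let $c_1,\dots,c_{2n}\in\{\mathbb 1,X,Y,Z\}^{\otimes n}$ be any $2n$ Pauli operators on $n$ qubits with $c_ac_b+c_bc_a=2\delta_{ab}\mathbb 1$ (a fermion-to-qubit mapping), let $\Gamma(x)=i^{|x|(|x|-1)/2}c_1^{x_1}\cdots c_{2n}^{x_{2n}}$ for $x\in\{0,1\}^{2n}$, and let $\mathcal F^{(n)}_k=\{\Gamma(x):|x|=2k\}$ be the set of $k$-body fermionic observables. There is an absolute constant $C>0$ such that for every fixed integer $k\ge 1$ there is a triply efficient shadow tomography protocol for $\mathcal F^{(n)}_k$ that uses only two-copy Clifford measurements. That is, there is one randomized algorithm (a fixed program of a random access machine with logarithmic cost and fair coins) with the following properties. Its input is $n$, a rational precision $\epsilon\in(0,1)$, and the table of the Pauli operators $c_1,\dots,c_{2n}$. Its only access to the unknown $n$-qubit state $\rho$ is that it can repeatedly, and adaptively, take two fresh copies of $\rho$, apply to $\rho\otimes\rho$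 a Clifford circuit of Hadamard, phase and CNOT gates that it has computed, and measure all $2n$ qubits in the computational basis. For all $n\ge 2$, all $c_1,\dots,c_{2n}$ as above, all $\epsilon$ and all $\rho$: 1. with probability at least $99\%$ its output consists of estimates $y_x$ with $|y_x-\mathrm{Tr}(\Gamma(x)\rho)|\le\epsilon$ for all $x$ with $|x|=2k$ simultaneously; 2. it always uses at most $C\,k\log n\cdot p_k(4/\epsilon^2)/\epsilon^2$ copies of $\rho$; 3. its running time, including the quantum gates and measurements, is always at most polynomial in $n$, $1/\epsilon$ and the bit length of $\epsilon$, where the polynomial depends only on $k$. -/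

import Mathlib

open scoped ENNReal Polynomial Matrix ComplexOrder

noncomputable section

namespace ShadowTomography

/-! ## Qubits, Pauli operators, density matrices -/

/-- Operators on `m` qubits, as matrices in the computational basis `{0,1}^m`. -/
abbrev Op (m : ℕ) : Type := Matrix (Fin m → Fin 2) (Fin m → Fin 2) ℂ

/-- The tensor product `M 0 ⊗ M 1 ⊗ ⋯ ⊗ M (m-1)` of single-qubit operators. -/
def tensor {m : ℕ} (M : Fin m → Matrix (Fin 2) (Fin 2) ℂ) : Op m :=
  Matrix.of fun x y => ∏ i, M i (x i) (y i)

/-- The labels of the single-qubit Pauli operators. -/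
inductive Pauli
  | I | X | Y | Z

/-- The matrix of a single-qubit Pauli operator. -/
def Pauli.mat : Pauli → Matrix (Fin 2) (Fin 2) ℂ
  | .I => 1
  | .X => !![0, 1; 1, 0]
  | .Y => !![0, -Complex.I; Complex.I, 0]
  | .Z => !![1, 0; 0, -1]

/-- The number that represents a Pauli label in the memory of a machine. -/
def Pauli.code : Pauli → ℕ
  | .I => 0
  | .X => 1
  | .Y => 2
  | .Z => 3

/-- The `n`-qubit Pauli operator with the given labels, an element of `{1, X, Y, Z}^{⊗ n}`. -/
def pauliOp {n : ℕ} (P : Fin n → Pauli) : Op n := tensor fun i => (P i).mat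

/-- An `n`-qubit quantum state. -/
structure DensityMatrix (n : ℕ) where
  mat : Op n
  posSemidef : mat.PosSemidef
  trace_eq_one : mat.trace = 1

/-! ## Majorana operators -/

/-- A fermion-to-qubit mapping: `2n` Pauli operators `c_a` on `n` qubits with
`c_a c_b + c_b c_a = 2 δ_{ab} 1`. -/
def IsMajorana {n : ℕ} (c : Fin (2 * n) → Fin n → Pauli) : Prop :=
  ∀ a b, pauliOp (c a) * pauliOp (c b) + pauliOp (c b) * pauliOp (c a)
    = if a = b then (2 : ℂ) • (1 : Op n) else 0

/-- The Majorana monomial `Γ(x) = i^{|x|(|x|-1)/2} c_1^{x_1} ⋯ c_{2n}^{x_{2n}}`, where the bit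
string `x` is given by its support (so the factors `c_a`, `a ∈ x`, are multiplied in increasing
order of `a`). -/
def majoranaMonomial {n : ℕ} (c : Fin (2 * n) → Fin n → Pauli) (x : Finset (Fin (2 * n))) : Op n :=
  Complex.I ^ (x.card * (x.card - 1) / 2) • (x.sort.map fun a => pauliOp (c a)).prod

/-! ## Clifford circuits and two-copy Clifford measurements -/

/-- Clifford gates on `m` qubits. -/
inductive Gate (m : ℕ)
  | H (q : Fin m)
  | S (q : Fin m)
  | CNOT (control target : Fin m) (h : control ≠ target)

/-- The Hadamard matrix. -/
def hadamardMat : Matrix (Fin 2) (Fin 2) ℂ := ((√2 : ℝ) : ℂ)⁻¹ • !![1, 1; 1, -1]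

/-- The phase gate. -/
def phaseMat : Matrix (Fin 2) (Fin 2) ℂ := !![1, 0; 0, Complex.I]

/-- The unitary matrix of a gate; `CNOT` maps the basis state `y` to the one in which the target
bit `y t` is replaced with `y t + y c` modulo 2. -/
def Gate.mat {m : ℕ} : Gate m → Op m
  | .H q => tensor (Function.update (fun _ => 1) q hadamardMat)
  | .S q => tensor (Function.update (fun _ => 1) q phaseMat)
  | .CNOT c t _ => Matrix.of fun x y => if x = Function.update y t (y t + y c) then 1 else 0

/-- The unitary matrix of a circuit; the head of the list is the gate that is applied last. -/
def circuitMat {m : ℕ} (L : List (Gate m)) : Op m := (L.map Gate.mat).prod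

/-- Two copies `ρ ⊗ ρ` of a state: the qubits `0, …, n-1` carry the first copy and the qubits
`n, …, 2n-1` carry the second one. -/
def twoCopies {n : ℕ} (ρ : DensityMatrix n) : Op (n + n) :=
  Matrix.of fun x y =>
    ρ.mat (fun i => x (Fin.castAdd n i)) (fun i => y (Fin.castAdd n i)) *
      ρ.mat (fun i => x (Fin.natAdd n i)) (fun i => y (Fin.natAdd n i))

/-- Born's rule: the weight of the outcome `z` when `ρ ⊗ ρ` is measured in the computational basis
after the circuit `L` has been applied. -/
def bornWeight {n : ℕ} (ρ : DensityMatrix n) (L : List (Gate (n + n))) (z : Fin (n + n) → Fin 2) :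
    ℝ≥0∞ :=
  ENNReal.ofReal ((circuitMat L * twoCopies ρ * (circuitMat L)ᴴ) z z).re

theorem tensor_mul {m : ℕ} (M N : Fin m → Matrix (Fin 2) (Fin 2) ℂ) :
    tensor M * tensor N = tensor (fun i => M i * N i) := by
  ext x y
  simp only [tensor, Matrix.mul_apply, Matrix.of_apply, ← Finset.prod_mul_distrib]
  rw [Finset.prod_univ_sum]
  simp [Fintype.piFinset_univ]

theorem tensor_one {m : ℕ} : tensor (fun _ : Fin m => 1) = 1 := by
  ext x y
  simp only [tensor, Matrix.of_apply, Matrix.one_apply]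
  split_ifs with h
  · subst h; simp
  · obtain ⟨i, hi⟩ := Function.ne_iff.mp h
    exact Finset.prod_eq_zero (Finset.mem_univ i) (by simp [hi])

theorem tensor_conjTranspose {m : ℕ} (M : Fin m → Matrix (Fin 2) (Fin 2) ℂ) :
    (tensor M)ᴴ = tensor (fun i => (M i)ᴴ) := by
  ext x y
  simp [tensor, Matrix.conjTranspose_apply]

theorem hadamardMat_unitary : hadamardMatᴴ * hadamardMat = 1 := by
  have h : ((√2 : ℝ) : ℂ) * ((√2 : ℝ) : ℂ) = 2 := by
    rw [← Complex.ofReal_mul, Real.mul_self_sqrt (by norm_num)]; norm_num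
  have h2 : ((√2 : ℝ) : ℂ)⁻¹ * ((√2 : ℝ) : ℂ)⁻¹ = 1 / 2 := by
    rw [← mul_inv, h]; norm_num
  ext i j
  fin_cases i <;> fin_cases j <;>
    simp [hadamardMat, Matrix.mul_apply, Matrix.conjTranspose_apply, Fin.sum_univ_two, h2] <;>
    norm_num

theorem phaseMat_unitary : phaseMatᴴ * phaseMat = 1 := by
  ext i j
  fin_cases i <;> fin_cases j <;>
    simp [phaseMat, Matrix.mul_apply, Matrix.conjTranspose_apply, Fin.sum_univ_two]

theorem tensor_update_unitary {m : ℕ} (q : Fin m) {U : Matrix (Fin 2) (Fin 2) ℂ}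
    (hU : Uᴴ * U = 1) :
    (tensor (Function.update (fun _ => 1) q U))ᴴ * tensor (Function.update (fun _ => 1) q U)
      = 1 := by
  rw [tensor_conjTranspose, tensor_mul, ← tensor_one]
  congr 1
  funext i
  by_cases h : i = q
  · subst h; simpa using hU
  · simp [Function.update_of_ne h]

theorem Gate.mat_unitary {m : ℕ} (g : Gate m) : g.matᴴ * g.mat = 1 := by
  cases g with
  | H q => exact tensor_update_unitary q hadamardMat_unitary
  | S q => exact tensor_update_unitary q phaseMat_unitary
  | CNOT c t h =>
    have inv : ∀ y : Fin m → Fin 2, Function.update (Function.update y t (y t + y c)) t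
        ((Function.update y t (y t + y c)) t + (Function.update y t (y t + y c)) c) = y := by
      intro y
      funext i
      by_cases hi : i = t
      · subst hi
        have : ∀ a b : Fin 2, a + b + b = a := by decide
        simp [Function.update_of_ne h, this]
      · simp [Function.update_of_ne hi]
    have inj : ∀ x y : Fin m → Fin 2,
        Function.update y t (y t + y c) = Function.update x t (x t + x c) ↔ x = y := by
      intro x y
      constructor
      · intro e
        rw [← inv x, ← inv y, e]
      · rintro rfl; rfl
    ext x y
    simp [Gate.mat, Matrix.mul_apply, Matrix.conjTranspose_apply, Matrix.one_apply, inj]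

theorem circuitMat_unitary {m : ℕ} (L : List (Gate m)) :
    (circuitMat L)ᴴ * circuitMat L = 1 := by
  induction L with
  | nil => simp [circuitMat]
  | cons g L ih =>
    have e : circuitMat (g :: L) = g.mat * circuitMat L := by simp [circuitMat]
    rw [e, Matrix.conjTranspose_mul, Matrix.mul_assoc, ← Matrix.mul_assoc g.matᴴ, g.mat_unitary,
      Matrix.one_mul, ih]

theorem twoCopies_eq {n : ℕ} (ρ : DensityMatrix n) :
    twoCopies ρ = (Matrix.kronecker ρ.mat ρ.mat).submatrix
      (Fin.appendEquiv (α := Fin 2) n n).symm (Fin.appendEquiv (α := Fin 2) n n).symm := by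
  ext x y
  rfl

theorem twoCopies_posSemidef {n : ℕ} (ρ : DensityMatrix n) : (twoCopies ρ).PosSemidef := by
  rw [twoCopies_eq]
  exact (ρ.posSemidef.kronecker ρ.posSemidef).submatrix _

theorem twoCopies_trace {n : ℕ} (ρ : DensityMatrix n) : (twoCopies ρ).trace = 1 := by
  have h := Matrix.trace_kronecker ρ.mat ρ.mat
  rw [ρ.trace_eq_one, mul_one] at h
  rw [← h, twoCopies_eq]
  exact Equiv.sum_comp (Fin.appendEquiv (α := Fin 2) n n).symm
    (fun p => (Matrix.kronecker ρ.mat ρ.mat) p p)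

theorem sum_bornWeight {n : ℕ} (ρ : DensityMatrix n) (L : List (Gate (n + n))) :
    ∑ z, bornWeight ρ L z = 1 := by
  have hp : (circuitMat L * twoCopies ρ * (circuitMat L)ᴴ).PosSemidef :=
    (twoCopies_posSemidef ρ).mul_mul_conjTranspose_same _
  have ht : (circuitMat L * twoCopies ρ * (circuitMat L)ᴴ).trace = 1 := by
    rw [Matrix.trace_mul_comm, ← Matrix.mul_assoc, circuitMat_unitary, Matrix.one_mul,
      twoCopies_trace]
  unfold bornWeight
  rw [← ENNReal.ofReal_sum_of_nonneg]
  · rw [← ENNReal.ofReal_one]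
    congr 1
    have := congrArg Complex.re ht
    simpa [Matrix.trace] using this
  · intro z _
    exact (Complex.le_def.mp (hp.diag_nonneg (i := z))).1

/-- The distribution of the outcome of the two-copy Clifford measurement of `ρ ⊗ ρ` given by the
circuit `L`. -/
def cliffordMeasurement {n : ℕ} (ρ : DensityMatrix n) (L : List (Gate (n + n))) :
    PMF (Fin (n + n) → Fin 2) :=
  PMF.ofFintype (bornWeight ρ L) (sum_bornWeight ρ L)

/-! ## The machine model

A random access machine with logarithmic cost, fair coins, and a quantum device that holds `2n`
qubits. Its memory consists of cells that hold natural numbers, each addressed by the (constant)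
number of an array and a tuple of indices; every access is charged the bit length of the address
and of the contents. Programs have assignments, branching, and loops whose number of iterations is
fixed on entry (so every program halts). The program text is fixed: it does not depend on the
input. -/

/-- The memory: the value of the cell with a given array number and tuple of indices. -/
abbrev Memory : Type := ℕ → List ℕ → ℕ

/-- The binary operations of the machine. -/
inductive BinOp
  | add | sub | mul | div | mod | lt | eq

/-- The value of a binary operation on natural numbers (truncated subtraction, integer division;
truth values are `0` and `1`). -/
def BinOp.eval : BinOp → ℕ → ℕ → ℕ
  | .add, a, b => a + b
  | .sub, a, b => a - b
  | .mul, a, b => a * b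
  | .div, a, b => a / b
  | .mod, a, b => a % b
  | .lt, a, b => if a < b then 1 else 0
  | .eq, a, b => if a = b then 1 else 0

/-- Expressions: constants, contents of memory cells (with computed indices), operations. -/
inductive Expr : Type
  | const (v : ℕ)
  | cell (array : ℕ) {d : ℕ} (idx : Fin d → Expr)
  | bin (op : BinOp) (e₁ e₂ : Expr)

/-- The value of an expression. -/
def Expr.eval (μ : Memory) : Expr → ℕ
  | .const v => v
  | .cell a idx => μ a (List.ofFn fun i => (idx i).eval μ)
  | .bin op e₁ e₂ => op.eval (e₁.eval μ) (e₂.eval μ)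

/-- The time to evaluate an expression. A memory access costs the bit length of the address and
of the contents, an operation the product of the bit lengths of its operands. -/
def Expr.cost (μ : Memory) : Expr → ℕ
  | .const v => 1 + v.size
  | .cell a idx => 1 + (∑ i, ((idx i).cost μ + ((idx i).eval μ).size)) +
      (μ a (List.ofFn fun i => (idx i).eval μ)).size
  | .bin _ e₁ e₂ => e₁.cost μ + e₂.cost μ + (1 + (e₁.eval μ).size) * (1 + (e₂.eval μ).size)

/-- Programs. -/
inductive Program : Type
  /-- do nothing -/
  | skip
  /-- store the value of an expression in a memory cell -/
  | assign (array : ℕ) {d : ℕ} (idx : Fin d → Expr) (e : Expr)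
  /-- store a fair random bit in a memory cell -/
  | coin (array : ℕ) {d : ℕ} (idx : Fin d → Expr)
  /-- run one program, then another one -/
  | seq (p₁ p₂ : Program)
  /-- run the first program if the expression is not `0`, else the second one -/
  | ite (e : Expr) (p₁ p₂ : Program)
  /-- run a program as many times as the value that the expression has at the start -/
  | rep (e : Expr) (p : Program)
  /-- append a Hadamard gate to the Clifford circuit -/
  | hadamard (q : Expr)
  /-- append a phase gate to the Clifford circuit -/
  | phase (q : Expr)
  /-- append a `CNOT` gate to the Clifford circuit -/
  | cnot (control target : Expr)
  /-- take two fresh copies of `ρ`, apply the Clifford circuit, measure all `2n` qubits, store the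
  outcome in the cells `0, …, 2n-1` of the array, and start a new circuit -/
  | measure (array : ℕ)

/-- The configuration of a machine with `2n` qubits: memory, Clifford circuit for the next
measurement, time spent, and copies of `ρ` consumed so far. -/
structure Config (n : ℕ) where
  mem : Memory
  circuit : List (Gate (n + n))
  time : ℕ
  copies : ℕ

namespace Config

variable {n : ℕ}

/-- Spend time. -/
def tick (s : Config n) (t : ℕ) : Config n := { s with time := s.time + t }

/-- Write into a memory cell. -/
def write (s : Config n) (a : ℕ) (idx : List ℕ) (v : ℕ) : Config n :=
  { s with mem := Function.update s.mem a (Function.update (s.mem a) idx v) }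

/-- Append gates to the circuit. -/
def emit (s : Config n) (L : List (Gate (n + n))) : Config n := { s with circuit := L ++ s.circuit }

/-- Record the outcome of a measurement. -/
def record (s : Config n) (a : ℕ) (z : Fin (n + n) → Fin 2) : Config n where
  mem := Function.update s.mem a fun idx =>
    match idx with
    | [j] => if h : j < n + n then (z ⟨j, h⟩ : ℕ) else s.mem a [j]
    | l => s.mem a l
  circuit := []
  time := s.time
  copies := s.copies + 2

end Config

/-- Run a randomized step repeatedly. -/
def iterate {α : Type} (f : α → PMF α) : ℕ → α → PMF α
  | 0, s => PMF.pure s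
  | m + 1, s => (f s).bind (iterate f m)

/-- The distribution of the final configuration when a program is run on copies of `ρ`. Gates
whose qubits are out of range (or coincide) are ignored. -/
def Program.run {n : ℕ} (ρ : DensityMatrix n) : Program → Config n → PMF (Config n)
  | .skip, s => PMF.pure (s.tick 1)
  | .assign a idx e, s =>
      PMF.pure ((s.tick (1 + (Expr.cell a idx).cost s.mem + e.cost s.mem)).write a
        (List.ofFn fun i => (idx i).eval s.mem) (e.eval s.mem))
  | .coin a idx, s =>
      (PMF.uniformOfFintype (Fin 2)).bind fun b =>
        PMF.pure ((s.tick (1 + (Expr.cell a idx).cost s.mem)).write a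
          (List.ofFn fun i => (idx i).eval s.mem) (b : ℕ))
  | .seq p₁ p₂, s => (p₁.run ρ (s.tick 1)).bind (p₂.run ρ)
  | .ite e p₁ p₂, s =>
      if e.eval s.mem ≠ 0 then p₁.run ρ (s.tick (1 + e.cost s.mem))
      else p₂.run ρ (s.tick (1 + e.cost s.mem))
  | .rep e p, s =>
      iterate (fun t => p.run ρ (t.tick 1)) (e.eval s.mem) (s.tick (1 + e.cost s.mem))
  | .hadamard q, s =>
      PMF.pure ((s.tick (1 + q.cost s.mem)).emit
        (if h : q.eval s.mem < n + n then [Gate.H ⟨q.eval s.mem, h⟩] else []))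
  | .phase q, s =>
      PMF.pure ((s.tick (1 + q.cost s.mem)).emit
        (if h : q.eval s.mem < n + n then [Gate.S ⟨q.eval s.mem, h⟩] else []))
  | .cnot c t, s =>
      PMF.pure ((s.tick (1 + c.cost s.mem + t.cost s.mem)).emit
        (if h : c.eval s.mem < n + n ∧ t.eval s.mem < n + n ∧ c.eval s.mem ≠ t.eval s.mem then
          [Gate.CNOT ⟨c.eval s.mem, h.1⟩ ⟨t.eval s.mem, h.2.1⟩
            (fun e => h.2.2 (congrArg Fin.val e))]
        else []))
  | .measure a, s =>
      (cliffordMeasurement ρ s.circuit).bind fun z =>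
        PMF.pure ((s.tick (1 + ∑ j ∈ Finset.range (n + n), (2 + j.size))).record a z)

/-! ## Input, output, and the sample bound -/

/-- The initial configuration. The input is `n` in the cell `0[]`, the precision `ε` (a positive
rational number) as numerator and denominator in the cells `1[]` and `2[]`, and the table of the
Pauli labels of the Majorana operators `c_a` in the cells `3[a, q]`. All other cells hold `0`. -/
def initial {n : ℕ} (c : Fin (2 * n) → Fin n → Pauli) (ε : ℚ) : Config n where
  mem := fun a idx =>
    match a, idx with
    | 0, [] => n
    | 1, [] => ε.num.toNat
    | 2, [] => ε.den
    | 3, [i, q] => if h : i < 2 * n ∧ q < n then (c ⟨i, h.1⟩ ⟨q, h.2⟩).code else 0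
    | _, _ => 0
  circuit := []
  time := 0
  copies := 0

/-- The estimate that the final memory contains for the observable `Γ(x)`, where `x` has the
elements `a_1 < ⋯ < a_m`: the fraction `(u - v) / w` with `u`, `v`, `w` in the cells
`4[a_1, …, a_m]`, `5[a_1, …, a_m]`, `6[a_1, …, a_m]`. -/
def Config.estimate {n : ℕ} (s : Config n) (x : Finset (Fin (2 * n))) : ℚ :=
  ((s.mem 4 (x.sort.map Fin.val) : ℚ) - (s.mem 5 (x.sort.map Fin.val) : ℚ)) /
    (s.mem 6 (x.sort.map Fin.val) : ℚ)

/-- The final memory contains estimates of `Tr(Γ(x) ρ)` to within `ε` for all `k`-body fermionic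
observables `Γ(x)`, `|x| = 2k`. -/
def Config.Succeeds {n : ℕ} (s : Config n) (k : ℕ) (c : Fin (2 * n) → Fin n → Pauli) (ε : ℚ)
    (ρ : DensityMatrix n) : Prop :=
  ∀ x : Finset (Fin (2 * n)), x.card = 2 * k →
    ‖((s.estimate x : ℚ) : ℂ) - (majoranaMonomial c x * ρ.mat).trace‖ ≤ (ε : ℝ)

/-- The polynomials `p_k` of the chi-binding lemma for `k`-body fermionic observables:
`p_1(ω) = ω + 1` and `p_k(ω) = ((2k - 1) ω p_{k-1}(ω))^{2k}` for `k ≥ 2`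
(the value at `k = 0` is not used). -/
def chiPoly : ℕ → ℝ[X]
  | 0 => 1
  | 1 => Polynomial.X + 1
  | k + 2 => (Polynomial.C (2 * ((k : ℝ) + 2) - 1) * Polynomial.X * chiPoly (k + 1)) ^ (2 * (k + 2))

end ShadowTomography

end

open ShadowTomography

/-! Write `m_X` for the expectation value of the monomial with support `X`, `|X| = 2k`, let `E =
⌊10/ε⌋ + 1`, and let `L` be the bit length of `n`. The protocol finds the magnitudes first and the
signs afterwards.

Magnitudes. The operators `Γ(X) ⊗ Γ(X)` commute for all `X`, even where the `Γ(X)` anticommute, and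
one Bell measurement of `ρ ⊗ ρ` diagonalizes all of them at once. It yields for every `X` a sign
with mean `m_X ^ 2` (`bell_law`). After `k L E^4` such measurements the observables split into those
with `m_X ^ 2 ≤ 100 / E^2`, for which `0` is a sufficient estimate because `10 / E < ε`, and the
selected ones, for which `m_X ^ 2 ≥ 62.5 / E^2` (`expect_goodSelection`).

Few selected observables anticommute pairwise. For a pairwise anticommuting family the squares `m_X
^ 2` add up to at most one (`IsMajorana.sum_sq_le_one`), so such a family of selected observables
has at most `W = ⌊8 E^2 / 500⌋` members. Since all supports are even, two monomials anticommute
exactly when their supports meet in an odd number of indices (`IsMajorana.monomial_mul`).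

Random commuting families. Fix an odd set `A` and take greedily a maximal family of selected `X ⊇ A`
that pairwise meet exactly in `A`, a sunflower with kernel `A`. Its members anticommute, so there
are at most `W` petals `X \ A`, and their elements can be numbered with at most `(2k+2) W` labels.
By maximality every selected `X ⊇ A` that is processed for `A` has a labelled element outside `A`
(`labelSet_spec`, `labelAll_spec`). A round draws a random number for every odd set, and marks a
selected `X` if for every odd `A ⊂ X` the set `X \ A` contains the element whose label for `A` was
drawn. If two marked sets had an odd intersection `A`, both would contain the single element outside
`A` that carries the drawn label, which is absurd (`Marked.even_inter`). So marked observables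
commute, and a selected observable is marked with a probability of at least `(2 (2k+2) W)` to the
power minus the number of odd subsets, which does not involve `n` (`expect_marked`). For `k = 1`
both odd subsets would cost a square too much. There only the kernel that consists of the smaller
index is used, and the remaining conflicts are removed by a union bound (`expect_covered_one`).

Signs. A table holds the images of the `2n` Majorana operators under the current Clifford circuit,
as Pauli words. Symplectic elimination on this table extends the circuit until the marked
observables are diagonal (`diagonalize_spec`, `markLoop_spec`). A measurement in the computational
basis then gives a sign with mean `m_X` for each diagonal `X` (`sign_law`); only the first copy
matters here. Averages over `k L E^2 / q` rounds, with `q` the lower bound for the probability of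
being covered, give the estimates.

Concentration. Exponential potentials of the counters are pushed through the program semantics as
supermartingales (`expect_iterate_le`, `expect_bellRound_le`, `expect_signRound_le`). This handles
the random number of samples per observable without conditioning. A union bound over at most
`(2n)^(2k)` observables finishes the error analysis (`expect_main_failure`, `sum_failure_le`).

Resources. The number of copies is twice the number of rounds, and the power of `(2k+2) · 4/ε^2`
that occurs in it is dominated by `chiPoly k` (`pow_posSets_le`, `rounds_le`). The time bound is
compositional: `Program.Poly` is closed under all constructors, and `Program.Eff` covers the
computation of the parameters (`protocol_time`). -/

noncomputable section

namespace ShadowTomography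

/-! ## Expectations -/

/-- The expectation of a nonnegative function of a random variable. -/
def expect {α : Type} (p : PMF α) (f : α → ℝ≥0∞) : ℝ≥0∞ := ∑' a, p a * f a

section expect
variable {α β : Type}

theorem expect_pure (a : α) (f : α → ℝ≥0∞) : expect (PMF.pure a) f = f a := by
  unfold expect
  rw [tsum_eq_single a]
  · simp
  · intro b hb; simp [PMF.pure_apply, hb]

theorem expect_bind (p : PMF α) (g : α → PMF β) (f : β → ℝ≥0∞) :
    expect (p.bind g) f = expect p fun a => expect (g a) f := by
  simp only [expect, PMF.bind_apply, ← ENNReal.tsum_mul_right, ← ENNReal.tsum_mul_left]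
  rw [ENNReal.tsum_comm]
  simp only [mul_assoc]

theorem expect_mono {p : PMF α} {f g : α → ℝ≥0∞} (h : ∀ a ∈ p.support, f a ≤ g a) :
    expect p f ≤ expect p g := by
  refine ENNReal.tsum_le_tsum fun a => ?_
  by_cases ha : p a = 0
  · simp [ha]
  · exact mul_le_mul_right (h a ((PMF.mem_support_iff _ _).2 ha)) _

theorem expect_congr {p : PMF α} {f g : α → ℝ≥0∞} (h : ∀ a ∈ p.support, f a = g a) :
    expect p f = expect p g :=
  le_antisymm (expect_mono fun a ha => (h a ha).le) (expect_mono fun a ha => (h a ha).ge)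

theorem expect_const (p : PMF α) (c : ℝ≥0∞) : expect p (fun _ => c) = c := by
  simp [expect, ENNReal.tsum_mul_right, p.tsum_coe]

theorem expect_mul_left (p : PMF α) (c : ℝ≥0∞) (f : α → ℝ≥0∞) :
    expect p (fun a => c * f a) = c * expect p f := by
  simp only [expect, ← ENNReal.tsum_mul_left]
  exact tsum_congr fun a => by ring

theorem expect_add (p : PMF α) (f g : α → ℝ≥0∞) :
    expect p (fun a => f a + g a) = expect p f + expect p g := by
  simp only [expect, mul_add, ENNReal.tsum_add]

theorem expect_sum {ι : Type} (p : PMF α) (s : Finset ι) (f : ι → α → ℝ≥0∞) :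
    expect p (fun a => ∑ i ∈ s, f i a) = ∑ i ∈ s, expect p (f i) := by
  classical
  induction s using Finset.induction_on with
  | empty => simp [expect]
  | insert i s hi ih => simp only [Finset.sum_insert hi, expect_add, ih]

theorem expect_fintype [Fintype α] (p : PMF α) (f : α → ℝ≥0∞) :
    expect p f = ∑ a, p a * f a := tsum_fintype _

theorem toOuterMeasure_eq_expect (p : PMF α) (s : Set α) :
    p.toOuterMeasure s = expect p (s.indicator 1) := by
  rw [PMF.toOuterMeasure_apply]
  refine tsum_congr fun a => ?_
  by_cases h : a ∈ s <;> simp [h]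

theorem one_sub_le_toOuterMeasure (p : PMF α) (s : Set α) {δ : ℝ≥0∞}
    (h : expect p (sᶜ.indicator 1) ≤ δ) : 1 - δ ≤ p.toOuterMeasure s := by
  rw [toOuterMeasure_eq_expect, tsub_le_iff_right]
  calc (1 : ℝ≥0∞) = expect p (fun _ => 1) := (expect_const p 1).symm
    _ = expect p (fun a => s.indicator 1 a + sᶜ.indicator 1 a) := by
        congr 1; funext a; by_cases ha : a ∈ s <;> simp [ha]
    _ = expect p (s.indicator 1) + expect p (sᶜ.indicator 1) := expect_add _ _ _
    _ ≤ _ := by gcongr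

/-- The supermartingale argument behind all tail bounds: each round contracts the expected potential
by the factor `r` as long as the invariant holds, whatever happened before. -/
theorem expect_iterate_le {f : α → PMF α} {Inv : α → Prop} {Φ : α → ℝ≥0∞} {r : ℝ≥0∞}
    (hInv : ∀ a, Inv a → ∀ b ∈ (f a).support, Inv b)
    (h : ∀ a, Inv a → expect (f a) Φ ≤ r * Φ a) (T : ℕ) (a : α) (ha : Inv a) :
    expect (iterate f T a) Φ ≤ r ^ T * Φ a := by
  induction T generalizing a with
  | zero => simp [iterate, expect_pure]
  | succ T ih =>
    rw [iterate, expect_bind]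
    calc _ ≤ expect (f a) (fun b => r ^ T * Φ b) :=
          expect_mono fun b hb => ih b (hInv a ha b hb)
      _ = r ^ T * expect (f a) Φ := expect_mul_left _ _ _
      _ ≤ r ^ T * (r * Φ a) := by gcongr; exact h a ha
      _ = _ := by ring

/-- The predicate is indexed by the number of completed rounds so that quantities which grow with
every round, such as time and copies, can be tracked. -/
theorem iterate_support {f : α → PMF α} {T : ℕ} (P : ℕ → α → Prop) {a : α} (h0 : P 0 a)
    (h : ∀ t < T, ∀ a, P t a → ∀ b ∈ (f a).support, P (t + 1) b) :
    ∀ b ∈ (iterate f T a).support, P T b := by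
  induction T generalizing P a with
  | zero =>
    intro b hb
    rw [iterate, PMF.mem_support_pure_iff] at hb
    exact hb ▸ h0
  | succ T ih =>
    intro b hb
    rw [iterate, PMF.mem_support_bind_iff] at hb
    obtain ⟨a', ha', hb⟩ := hb
    exact ih (fun t => P (t + 1)) (h 0 (by omega) a h0 a' ha')
      (fun t ht => h (t + 1) (by omega)) b hb

theorem iterate_pure (g : α → α) (T : ℕ) (a : α) :
    iterate (fun t => PMF.pure (g t)) T a = PMF.pure (g^[T] a) := by
  induction T generalizing a with
  | zero => rfl
  | succ T ih => rw [iterate, PMF.pure_bind, ih]; rfl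

end expect

/-! ## Programming notation -/

instance : Add Expr := ⟨.bin .add⟩
instance : Sub Expr := ⟨.bin .sub⟩
instance : Mul Expr := ⟨.bin .mul⟩
instance : Div Expr := ⟨.bin .div⟩
instance : Mod Expr := ⟨.bin .mod⟩
instance (v : ℕ) : OfNat Expr v := ⟨.const v⟩

/-- The truth value of `e₁ < e₂`. -/
def ltE (e₁ e₂ : Expr) : Expr := .bin .lt e₁ e₂
/-- The truth value of `e₁ = e₂`. -/
def eqE (e₁ e₂ : Expr) : Expr := .bin .eq e₁ e₂
/-- The cell of an array whose indices are given by a list. -/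
def cellE (a : ℕ) (l : List Expr) : Expr := .cell a fun i : Fin l.length => l.get i
/-- The value of a variable. -/
def var (a : ℕ) : Expr := cellE a []
/-- The sum of a list of expressions. -/
def sumE (l : List Expr) : Expr := l.foldr (· + ·) 0
/-- The product of a list of expressions. -/
def prodE (l : List Expr) : Expr := l.foldr (· * ·) 1
/-- A power with a constant exponent. -/
def powE (e : Expr) (j : ℕ) : Expr := prodE (List.replicate j e)
/-- Assignment to an array cell. -/
def setE (a : ℕ) (l : List Expr) (e : Expr) : Program :=
  .assign a (fun i : Fin l.length => l.get i) e
/-- Assignment of a random bit to a variable. -/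
def coinV (a : ℕ) : Program := .coin a (![] : Fin 0 → Expr)
/-- Sequential execution of a list of programs. -/
def seqs : List Program → Program
  | [] => .skip
  | p :: l => .seq p (seqs l)
/-- Run a program for the values `0, 1, …, e - 1` of a variable. -/
def forE (v : ℕ) (e : Expr) (p : Program) : Program :=
  .seq (setE v [] 0) (.rep e (.seq p (setE v [] (var v + 1))))

section eval
variable (μ : Memory)

@[simp] theorem eval_const (v : ℕ) : (Expr.const v).eval μ = v := rfl
@[simp] theorem eval_ofNat (v : ℕ) : (no_index (OfNat.ofNat v : Expr)).eval μ = v := rfl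
@[simp] theorem eval_zero : (0 : Expr).eval μ = 0 := rfl
@[simp] theorem eval_one : (1 : Expr).eval μ = 1 := rfl
@[simp] theorem eval_add (e f : Expr) : (e + f).eval μ = e.eval μ + f.eval μ := rfl
@[simp] theorem eval_sub (e f : Expr) : (e - f).eval μ = e.eval μ - f.eval μ := rfl
@[simp] theorem eval_mul (e f : Expr) : (e * f).eval μ = e.eval μ * f.eval μ := rfl
@[simp] theorem eval_div (e f : Expr) : (e / f).eval μ = e.eval μ / f.eval μ := rfl
@[simp] theorem eval_mod (e f : Expr) : (e % f).eval μ = e.eval μ % f.eval μ := rfl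
@[simp] theorem eval_ltE (e f : Expr) :
    (ltE e f).eval μ = if e.eval μ < f.eval μ then 1 else 0 := rfl
@[simp] theorem eval_eqE (e f : Expr) :
    (eqE e f).eval μ = if e.eval μ = f.eval μ then 1 else 0 := rfl

theorem ofFn_get_map {α β : Type} (l : List α) (f : α → β) :
    List.ofFn (fun i : Fin l.length => f (l.get i)) = l.map f := by
  rw [show (fun i : Fin l.length => f (l.get i)) = f ∘ l.get from rfl, ← List.map_ofFn,
    List.ofFn_get]

@[simp] theorem eval_cellE (a : ℕ) (l : List Expr) :
    (cellE a l).eval μ = μ a (l.map fun e => e.eval μ) := by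
  rw [cellE, Expr.eval, ofFn_get_map l fun e => e.eval μ]

@[simp] theorem eval_var (a : ℕ) : (var a).eval μ = μ a [] := by simp [var]

@[simp] theorem eval_sumE (l : List Expr) :
    (sumE l).eval μ = (l.map fun e => e.eval μ).sum := by
  induction l with
  | nil => rfl
  | cons e l ih => simpa [sumE] using ih

@[simp] theorem eval_prodE (l : List Expr) :
    (prodE l).eval μ = (l.map fun e => e.eval μ).prod := by
  induction l with
  | nil => rfl
  | cons e l ih => simpa [prodE] using Or.inl ih

@[simp] theorem eval_powE (e : Expr) (j : ℕ) : (powE e j).eval μ = e.eval μ ^ j := by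
  simp [powE]

end eval

/-! ## Deterministic programs -/

/-- Programs without coin tosses and measurements. -/
def Program.Det : Program → Prop
  | .coin _ _ => False
  | .seq p q => p.Det ∧ q.Det
  | .ite _ p q => p.Det ∧ q.Det
  | .rep _ p => p.Det
  | .measure _ => False
  | _ => True

/-- The program does not write to an array. -/
def Program.Keeps : Program → ℕ → Prop
  | .assign b _ _, a => a ≠ b
  | .coin b _, a => a ≠ b
  | .seq p q, a => p.Keeps a ∧ q.Keeps a
  | .ite _ p q, a => p.Keeps a ∧ q.Keeps a
  | .rep _ p, a => p.Keeps a
  | .measure b, a => a ≠ b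
  | _, _ => True

/-- The program has no measurements. -/
def Program.NoMeas : Program → Prop
  | .seq p q => p.NoMeas ∧ q.NoMeas
  | .ite _ p q => p.NoMeas ∧ q.NoMeas
  | .rep _ p => p.NoMeas
  | .measure _ => False
  | _ => True

/-- The program has no gates and no measurements. -/
def Program.Classical : Program → Prop
  | .seq p q => p.Classical ∧ q.Classical
  | .ite _ p q => p.Classical ∧ q.Classical
  | .rep _ p => p.Classical
  | .measure _ => False
  | .hadamard _ => False
  | .phase _ => False
  | .cnot _ _ => False
  | _ => True

section
variable {n : ℕ}

/-- Append a gate for the qubits with the given numbers, if they are in range. -/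
def Config.emitH (s : Config n) (q : ℕ) : Config n :=
  s.emit (if h : q < n + n then [Gate.H ⟨q, h⟩] else [])
/-- Append a phase gate. -/
def Config.emitS (s : Config n) (q : ℕ) : Config n :=
  s.emit (if h : q < n + n then [Gate.S ⟨q, h⟩] else [])
/-- Append a `CNOT` gate. -/
def Config.emitCNOT (s : Config n) (c t : ℕ) : Config n :=
  s.emit (if h : c < n + n ∧ t < n + n ∧ c ≠ t then
    [Gate.CNOT ⟨c, h.1⟩ ⟨t, h.2.1⟩ (fun e => h.2.2 (congrArg Fin.val e))] else [])

/-- The result of a deterministic program. -/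
def Program.ex : Program → Config n → Config n
  | .skip, s => s.tick 1
  | .assign a idx e, s => (s.tick (1 + (Expr.cell a idx).cost s.mem + e.cost s.mem)).write a
        (List.ofFn fun i => (idx i).eval s.mem) (e.eval s.mem)
  | .coin _ _, s => s
  | .seq p₁ p₂, s => p₂.ex (p₁.ex (s.tick 1))
  | .ite e p₁ p₂, s => if e.eval s.mem ≠ 0 then p₁.ex (s.tick (1 + e.cost s.mem))
      else p₂.ex (s.tick (1 + e.cost s.mem))
  | .rep e p, s => (fun t => p.ex (t.tick 1))^[e.eval s.mem] (s.tick (1 + e.cost s.mem))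
  | .hadamard q, s => (s.tick (1 + q.cost s.mem)).emitH (q.eval s.mem)
  | .phase q, s => (s.tick (1 + q.cost s.mem)).emitS (q.eval s.mem)
  | .cnot c t, s => (s.tick (1 + c.cost s.mem + t.cost s.mem)).emitCNOT (c.eval s.mem)
      (t.eval s.mem)
  | .measure _, s => s

/-- Classical computation becomes function evaluation; probability has to be treated only at coins
and measurements. -/
theorem Program.run_det (ρ : DensityMatrix n) (p : Program) (hp : p.Det) (s : Config n) :
    p.run ρ s = PMF.pure (p.ex s) := by
  induction p generalizing s with
  | seq p q ihp ihq => simp only [run, ihp hp.1, ihq hp.2, PMF.pure_bind, ex]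
  | ite e p q ihp ihq =>
    simp only [run, ihp hp.1, ihq hp.2, ex]
    split_ifs <;> rfl
  | rep e p ih => simp only [run, ih hp, iterate_pure, ex]
  | coin => exact hp.elim
  | measure => exact hp.elim
  | _ => rfl

theorem Program.run_seq (ρ : DensityMatrix n) (p q : Program) (s : Config n) :
    (Program.seq p q).run ρ s = (p.run ρ (s.tick 1)).bind (q.run ρ) := rfl

/-! ### Effect of single instructions on memory and circuit -/

@[simp] theorem Config.tick_mem (s : Config n) (t : ℕ) : (s.tick t).mem = s.mem := rfl
@[simp] theorem Config.tick_circuit (s : Config n) (t : ℕ) :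
    (s.tick t).circuit = s.circuit := rfl
@[simp] theorem Config.tick_copies (s : Config n) (t : ℕ) : (s.tick t).copies = s.copies := rfl
@[simp] theorem Config.emitH_mem (s : Config n) (q : ℕ) : (s.emitH q).mem = s.mem := rfl
@[simp] theorem Config.emitS_mem (s : Config n) (q : ℕ) : (s.emitS q).mem = s.mem := rfl
@[simp] theorem Config.emitCNOT_mem (s : Config n) (q t : ℕ) :
    (s.emitCNOT q t).mem = s.mem := rfl
@[simp] theorem Config.write_circuit (s : Config n) (a : ℕ) (l : List ℕ) (v : ℕ) :
    (s.write a l v).circuit = s.circuit := rfl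
@[simp] theorem Config.write_time (s : Config n) (a : ℕ) (l : List ℕ) (v : ℕ) :
    (s.write a l v).time = s.time := rfl
@[simp] theorem Config.record_circuit (s : Config n) (a : ℕ) (z : Fin (n + n) → Fin 2) :
    (s.record a z).circuit = [] := rfl

@[simp] theorem Config.write_mem_self (s : Config n) (a : ℕ) (l : List ℕ) (v : ℕ) :
    (s.write a l v).mem a = Function.update (s.mem a) l v := by simp [Config.write]
@[simp] theorem Config.write_mem_ne (s : Config n) {a b : ℕ} (h : b ≠ a) (l : List ℕ) (v : ℕ) :
    (s.write a l v).mem b = s.mem b := by simp [Config.write, Function.update_of_ne h]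
theorem Config.record_mem_ne (s : Config n) {a b : ℕ} (h : b ≠ a) (z : Fin (n + n) → Fin 2) :
    (s.record a z).mem b = s.mem b := by simp [Config.record, Function.update_of_ne h]
theorem Config.record_mem_self (s : Config n) (a : ℕ) (z : Fin (n + n) → Fin 2)
    (j : Fin (n + n)) : (s.record a z).mem a [j] = z j := by
  simp [Config.record]

@[simp] theorem ex_seq (p q : Program) (s : Config n) :
    (Program.seq p q).ex s = q.ex (p.ex (s.tick 1)) := rfl

/-- The elapsed time is hidden behind an existential quantifier because correctness depends on
memory and circuit only; costs are bounded separately. -/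
theorem ex_setE (a : ℕ) (l : List Expr) (e : Expr) (s : Config n) :
    ∃ t, (setE a l e).ex s = (s.tick t).write a (l.map fun f => f.eval s.mem) (e.eval s.mem) :=
  ⟨_, by rw [setE, Program.ex, ofFn_get_map l fun f => f.eval s.mem]⟩

@[simp] theorem ex_setE_mem_self (a : ℕ) (l : List Expr) (e : Expr) (s : Config n) :
    ((setE a l e).ex s).mem a
      = Function.update (s.mem a) (l.map fun f => f.eval s.mem) (e.eval s.mem) := by
  obtain ⟨t, h⟩ := ex_setE a l e s
  simp [h]
@[simp] theorem ex_setE_mem_ne {a b : ℕ} (h : b ≠ a) (l : List Expr) (e : Expr) (s : Config n) :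
    ((setE a l e).ex s).mem b = s.mem b := by
  obtain ⟨t, h'⟩ := ex_setE a l e s
  simp [h', h]
@[simp] theorem ex_setE_circuit (a : ℕ) (l : List Expr) (e : Expr) (s : Config n) :
    ((setE a l e).ex s).circuit = s.circuit := rfl
@[simp] theorem ex_skip_mem (s : Config n) : (Program.skip.ex s).mem = s.mem := rfl
@[simp] theorem ex_skip_circuit (s : Config n) : (Program.skip.ex s).circuit = s.circuit := rfl

theorem ex_ite_pos {e : Expr} {p q : Program} {s : Config n} (h : e.eval s.mem ≠ 0) :
    (Program.ite e p q).ex s = p.ex (s.tick (1 + e.cost s.mem)) := by simp [Program.ex, h]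
theorem ex_ite_neg {e : Expr} {p q : Program} {s : Config n} (h : e.eval s.mem = 0) :
    (Program.ite e p q).ex s = q.ex (s.tick (1 + e.cost s.mem)) := by simp [Program.ex, h]

/-- The frame rule. Its premise is purely syntactic, so that survival of a cell across a large
program is settled by `simp` on the program text. -/
theorem run_support_keeps (ρ : DensityMatrix n) {p : Program} {a : ℕ} (hp : p.Keeps a)
    (s : Config n) : ∀ s' ∈ (p.run ρ s).support, s'.mem a = s.mem a := by
  induction p generalizing s with
  | seq p q ihp ihq =>
    intro s' hs'
    rw [Program.run, PMF.mem_support_bind_iff] at hs'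
    obtain ⟨t, ht, hs'⟩ := hs'
    rw [ihq hp.2 _ _ hs', ihp hp.1 _ _ ht, Config.tick_mem]
  | ite e p q ihp ihq =>
    intro s' hs'
    rw [Program.run] at hs'
    split_ifs at hs'
    · rw [ihp hp.1 _ _ hs', Config.tick_mem]
    · rw [ihq hp.2 _ _ hs', Config.tick_mem]
  | rep e p ih =>
    refine iterate_support (fun _ (t : Config n) => t.mem a = s.mem a) rfl fun t _ b hb b' hb' => ?_
    rw [ih hp _ _ hb', Config.tick_mem, hb]
  | assign b idx e =>
    intro s' hs'
    rw [Program.run, PMF.mem_support_pure_iff] at hs'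
    subst hs'
    exact Config.write_mem_ne _ hp _ _
  | coin b idx =>
    intro s' hs'
    rw [Program.run, PMF.mem_support_bind_iff] at hs'
    obtain ⟨t, ht, hs'⟩ := hs'
    rw [PMF.mem_support_pure_iff] at hs'
    subst hs'
    exact Config.write_mem_ne _ hp _ _
  | measure b =>
    intro s' hs'
    rw [Program.run, PMF.mem_support_bind_iff] at hs'
    obtain ⟨t, ht, hs'⟩ := hs'
    rw [PMF.mem_support_pure_iff] at hs'
    subst hs'
    exact Config.record_mem_ne _ hp _
  | _ =>
    intro s' hs'
    rw [Program.run, PMF.mem_support_pure_iff] at hs'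
    subst hs'
    rfl

theorem ex_keeps {p : Program} {a : ℕ} (hp : p.Keeps a) (s : Config n) :
    (p.ex s).mem a = s.mem a := by
  induction p generalizing s with
  | seq p q ihp ihq => simp [ihq hp.2, ihp hp.1]
  | ite e p q ihp ihq => rw [Program.ex]; split_ifs <;> simp [ihq hp.2, ihp hp.1]
  | rep e p ih =>
    rw [Program.ex]
    generalize e.eval s.mem = T
    generalize ht : s.tick (1 + e.cost s.mem) = t
    have : s.mem a = t.mem a := by rw [← ht]; rfl
    rw [this]; clear this ht
    induction T generalizing t with
    | zero => rfl
    | succ T ihT => rw [Function.iterate_succ_apply, ihT, ih hp]; rfl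
  | assign b idx e => exact Config.write_mem_ne _ hp _ _
  | _ => rfl

theorem run_support_classical (ρ : DensityMatrix n) {p : Program} (hp : p.Classical)
    (s : Config n) : ∀ s' ∈ (p.run ρ s).support, s'.circuit = s.circuit := by
  induction p generalizing s with
  | seq p q ihp ihq =>
    intro s' hs'
    rw [Program.run, PMF.mem_support_bind_iff] at hs'
    obtain ⟨t, ht, hs'⟩ := hs'
    rw [ihq hp.2 _ _ hs', ihp hp.1 _ _ ht, Config.tick_circuit]
  | ite e p q ihp ihq =>
    intro s' hs'
    rw [Program.run] at hs'
    split_ifs at hs'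
    · rw [ihp hp.1 _ _ hs', Config.tick_circuit]
    · rw [ihq hp.2 _ _ hs', Config.tick_circuit]
  | rep e p ih =>
    refine iterate_support (fun _ (t : Config n) => t.circuit = s.circuit) rfl fun t _ b hb b' hb' => ?_
    rw [ih hp _ _ hb', Config.tick_circuit, hb]
  | coin b idx =>
    intro s' hs'
    rw [Program.run, PMF.mem_support_bind_iff] at hs'
    obtain ⟨t, ht, hs'⟩ := hs'
    rw [PMF.mem_support_pure_iff] at hs'
    subst hs'
    rfl
  | skip | assign =>
    intro s' hs'
    rw [Program.run, PMF.mem_support_pure_iff] at hs'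
    subst hs'
    rfl
  | measure | hadamard | phase | cnot => exact hp.elim

theorem run_support_noMeas (ρ : DensityMatrix n) {p : Program} (hp : p.NoMeas)
    (s : Config n) : ∀ s' ∈ (p.run ρ s).support, s'.copies = s.copies := by
  induction p generalizing s with
  | seq p q ihp ihq =>
    intro s' hs'
    rw [Program.run, PMF.mem_support_bind_iff] at hs'
    obtain ⟨t, ht, hs'⟩ := hs'
    rw [ihq hp.2 _ _ hs', ihp hp.1 _ _ ht, Config.tick_copies]
  | ite e p q ihp ihq =>
    intro s' hs'
    rw [Program.run] at hs'
    split_ifs at hs'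
    · rw [ihp hp.1 _ _ hs', Config.tick_copies]
    · rw [ihq hp.2 _ _ hs', Config.tick_copies]
  | rep e p ih =>
    refine iterate_support (fun _ (t : Config n) => t.copies = s.copies) rfl fun t _ b hb b' hb' => ?_
    rw [ih hp _ _ hb', Config.tick_copies, hb]
  | coin b idx =>
    intro s' hs'
    rw [Program.run, PMF.mem_support_bind_iff] at hs'
    obtain ⟨t, ht, hs'⟩ := hs'
    rw [PMF.mem_support_pure_iff] at hs'
    subst hs'
    rfl
  | measure => exact hp.elim
  | _ =>
    intro s' hs'
    rw [Program.run, PMF.mem_support_pure_iff] at hs'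
    subst hs'
    rfl

theorem ex_classical {p : Program} (hd : p.Det) (hp : p.Classical) (s : Config n) :
    (p.ex s).circuit = s.circuit := by
  induction p generalizing s with
  | seq p q ihp ihq => simp [ihq hd.2 hp.2, ihp hd.1 hp.1]
  | ite e p q ihp ihq =>
    rw [Program.ex]; split_ifs <;> simp [ihq hd.2 hp.2, ihp hd.1 hp.1]
  | rep e p ih =>
    rw [Program.ex]
    generalize e.eval s.mem = T
    generalize ht : s.tick (1 + e.cost s.mem) = t
    have : s.circuit = t.circuit := by rw [← ht]; rfl
    rw [this]; clear this ht
    induction T generalizing t with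
    | zero => rfl
    | succ T ihT => rw [Function.iterate_succ_apply, ihT, ih hd hp]; rfl
  | measure | hadamard | phase | cnot => exact hp.elim
  | _ => rfl

/-! ### Syntactic side conditions -/

@[simp] theorem det_setE (a : ℕ) (l : List Expr) (e : Expr) : (setE a l e).Det ↔ True :=
  Iff.rfl
@[simp] theorem keeps_setE (a b : ℕ) (l : List Expr) (e : Expr) :
    (setE a l e).Keeps b ↔ b ≠ a := Iff.rfl
@[simp] theorem classical_setE (a : ℕ) (l : List Expr) (e : Expr) :
    (setE a l e).Classical ↔ True := Iff.rfl
@[simp] theorem noMeas_setE (a : ℕ) (l : List Expr) (e : Expr) :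
    (setE a l e).NoMeas ↔ True := Iff.rfl
@[simp] theorem det_forE (v : ℕ) (e : Expr) (p : Program) : (forE v e p).Det ↔ p.Det := by
  simp [forE, Program.Det]
@[simp] theorem keeps_forE (v a : ℕ) (e : Expr) (p : Program) :
    (forE v e p).Keeps a ↔ a ≠ v ∧ p.Keeps a := by
  simp [forE, Program.Keeps]; tauto
@[simp] theorem classical_forE (v : ℕ) (e : Expr) (p : Program) :
    (forE v e p).Classical ↔ p.Classical := by
  simp [forE, Program.Classical]
@[simp] theorem noMeas_forE (v : ℕ) (e : Expr) (p : Program) :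
    (forE v e p).NoMeas ↔ p.NoMeas := by
  simp [forE, Program.NoMeas]
@[simp] theorem det_seqs (l : List Program) : (seqs l).Det ↔ ∀ p ∈ l, p.Det := by
  induction l with
  | nil => simp [seqs, Program.Det]
  | cons p l ih => simp [seqs, Program.Det, ih]
@[simp] theorem keeps_seqs (l : List Program) (a : ℕ) :
    (seqs l).Keeps a ↔ ∀ p ∈ l, p.Keeps a := by
  induction l with
  | nil => simp [seqs, Program.Keeps]
  | cons p l ih => simp [seqs, Program.Keeps, ih]
@[simp] theorem classical_seqs (l : List Program) :
    (seqs l).Classical ↔ ∀ p ∈ l, p.Classical := by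
  induction l with
  | nil => simp [seqs, Program.Classical]
  | cons p l ih => simp [seqs, Program.Classical, ih]
@[simp] theorem noMeas_seqs (l : List Program) :
    (seqs l).NoMeas ↔ ∀ p ∈ l, p.NoMeas := by
  induction l with
  | nil => simp [seqs, Program.NoMeas]
  | cons p l ih => simp [seqs, Program.NoMeas, ih]

/-! ### Loop invariants -/

theorem ex_rep_induct {e : Expr} {p : Program} {s : Config n} (P : ℕ → Config n → Prop)
    (h0 : ∀ c, P 0 (s.tick c))
    (h : ∀ t < e.eval s.mem, ∀ s', P t s' → P (t + 1) (p.ex (s'.tick 1))) :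
    P (e.eval s.mem) ((Program.rep e p).ex s) := by
  rw [Program.ex]
  have : ∀ t ≤ e.eval s.mem,
      P t ((fun t => p.ex (t.tick 1))^[t] (s.tick (1 + e.cost s.mem))) := by
    intro t
    induction t with
    | zero => intro _; exact h0 _
    | succ t ih =>
      intro ht
      rw [Function.iterate_succ_apply']
      exact h t (by omega) _ (ih (by omega))
  exact this _ le_rfl

/-- The rule for loops: an invariant that concerns the memory and the circuit, and is not affected
by the loop variable. -/
theorem ex_forE_induct {v : ℕ} {e : Expr} {p : Program} {s : Config n} {T : ℕ}
    (hp : p.Keeps v) (P : ℕ → Memory → List (Gate (n + n)) → Prop)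
    (hv : ∀ t μ f L, P t μ L → P t (Function.update μ v f) L)
    (hT : e.eval (Function.update s.mem v (Function.update (s.mem v) [] 0)) = T)
    (h0 : P 0 s.mem s.circuit)
    (h : ∀ t < T, ∀ s' : Config n, s'.mem v [] = t → P t s'.mem s'.circuit →
      P (t + 1) (p.ex s').mem (p.ex s').circuit) :
    P T ((forE v e p).ex s).mem ((forE v e p).ex s).circuit := by
  obtain ⟨c, hc⟩ := ex_setE v [] 0 (s.tick 1)
  have e1 : (forE v e p).ex s = (Program.rep e (.seq p (setE v [] (var v + 1)))).ex
    (((s.tick 1).tick c).write v [] 0) := by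
    rw [forE, ex_seq, hc]; rfl
  have e2 : e.eval (((s.tick 1).tick c).write v [] 0).mem = T := hT
  rw [e1]
  have key := ex_rep_induct (e := e) (p := .seq p (setE v [] (var v + 1)))
    (s := ((s.tick 1).tick c).write v [] 0)
    -- The value of the counter is part of the invariant, so that the body of the loop sees `t` in
    -- the variable `v`.
    (fun t s' => s'.mem v [] = t ∧ P t s'.mem s'.circuit)
    (fun c => ⟨by simp, hv 0 _ _ _ h0⟩) (fun t ht s' hs' => by
      rw [e2] at ht
      obtain ⟨c, hc⟩ := ex_setE v [] (var v + 1) (p.ex ((s'.tick 1).tick 1))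
      rw [ex_seq, hc]
      have := h t ht ((s'.tick 1).tick 1) hs'.1 hs'.2
      refine ⟨?_, hv _ _ _ _ this⟩
      simp [ex_keeps hp, hs'.1])
  rw [e2] at key
  exact key.2

end

/-! ## The protocol

The arrays from number 100 on hold parameters: `100` is `n`, `101` is `2 n`, `102` is the inverse
precision, `105` bounds the number of labels, `106` and `107` are the bit lengths of `100` and
`105`. The table of the images of the Majorana operators under the current circuit is in the
arrays `30` (exponents of `X`), `31` (exponents of `Z`) and `32` (phases). -/

/-- The `i`-th element of the current tuple, whose number is in the variable `20`. -/
def dgE (i : ℕ) : Expr := var 20 / powE (var 101) i % var 101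

/-- The elements of the current tuple at the given positions. -/
def keyE (J : Finset ℕ) : List Expr := J.sort.map dgE

/-- The current tuple is increasing. -/
def incE (d : ℕ) : Expr := prodE ((List.range (d - 1)).map fun i => ltE (dgE i) (dgE (i + 1)))

/-- The sets of positions that are used to select commuting families. -/
def posSets (k : ℕ) : List (Finset ℕ) :=
  if k = 1 then [{0}] else ((Finset.range (2 * k)).powerset.filter fun J => Odd J.card).toList

/-- The positions outside of a set of positions. -/
def coPos (k : ℕ) (J : Finset ℕ) : List ℕ := (Finset.range (2 * k) \ J).sort

/-- Loop over the increasing `2k`-tuples. -/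
def forTuples (k : ℕ) (p : Program) : Program :=
  forE 20 (powE (var 101) (2 * k)) (.ite (incE (2 * k)) p .skip)

/-- Set the table to the given Majorana operators. -/
def resetTable : Program :=
  forE 49 (var 101) <| seqs [setE 32 [var 49] 0,
    forE 43 (var 100) <| seqs
      [setE 30 [var 49, var 43]
        (eqE (cellE 3 [var 49, var 43]) 1 + eqE (cellE 3 [var 49, var 43]) 2),
       setE 31 [var 49, var 43]
        (eqE (cellE 3 [var 49, var 43]) 2 + eqE (cellE 3 [var 49, var 43]) 3),
       setE 32 [var 49] ((cellE 32 [var 49] + eqE (cellE 3 [var 49, var 43]) 2) % 4)]]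

/-- Compute the image of the current Majorana monomial. -/
def image (k : ℕ) : Program := seqs
  [setE 42 [] ((.const (k * (2 * k - 1)) +
      sumE ((List.range (2 * k)).map fun i => cellE 32 [dgE i])) % 4),
   forE 43 (var 100) <| seqs
    [setE 40 [var 43] (sumE ((List.range (2 * k)).map fun i => cellE 30 [dgE i, var 43]) % 2),
     setE 41 [var 43] (sumE ((List.range (2 * k)).map fun i => cellE 31 [dgE i, var 43]) % 2),
     setE 42 [] ((var 42 + 2 * sumE ((List.range (2 * k)).map fun t =>
        sumE ((List.range t).map fun i => cellE 31 [dgE i, var 43]) *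
          cellE 30 [dgE t, var 43])) % 4)]]

/-- The circuit for Bell measurements. -/
def bellCircuit : Program :=
  forE 43 (var 100) <| seqs [.cnot (var 43) (var 100 + var 43), .hadamard (var 43)]

/-- The number of Bell measurements. -/
def bellRounds (k : ℕ) : Expr := .const k * var 106 * powE (var 102) 4

/-- Evaluate the outcome of a Bell measurement. -/
def bellUpdate (k : ℕ) : Program := seqs
  [image k, setE 46 [] (var 42 % 2),
   forE 43 (var 100) (setE 46 [] ((var 46 + cellE 40 [var 43] * cellE 50 [var 43] +
     cellE 41 [var 43] * cellE 50 [var 100 + var 43]) % 2)),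
   .ite (var 46) (setE 28 (keyE (Finset.range (2 * k))) (cellE 28 (keyE (Finset.range (2 * k))) + 1))
     (setE 27 (keyE (Finset.range (2 * k))) (cellE 27 (keyE (Finset.range (2 * k))) + 1))]

/-- One Bell measurement. -/
def bellRound (k : ℕ) : Program :=
  .seq bellCircuit (.seq (.measure 50) (forTuples k (bellUpdate k)))

/-- Select the observables with a large expectation value. -/
def selectLarge (k : ℕ) : Program :=
  forTuples k (setE 26 (keyE (Finset.range (2 * k)))
    (ltE (75 * bellRounds k + cellE 28 (keyE (Finset.range (2 * k))) * powE (var 102) 2)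
      (cellE 27 (keyE (Finset.range (2 * k))) * powE (var 102) 2 + 1)))

/-- Label the elements of the current tuple outside of a set of positions, unless one of them
already has a label. -/
def labelSet (k : ℕ) (J : Finset ℕ) : Program :=
  .ite (sumE ((coPos k J).map fun i => cellE 24 (dgE i :: keyE J))) .skip
    (seqs ((coPos k J).map fun i => .seq (setE 25 (keyE J) (cellE 25 (keyE J) + 1))
      (setE 24 (dgE i :: keyE J) (cellE 25 (keyE J)))))

/-- Compute the labels. -/
def labelAll (k : ℕ) : Program :=
  forTuples k (.ite (cellE 26 (keyE (Finset.range (2 * k))))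
    (seqs ((posSets k).map (labelSet k))) .skip)

/-- Draw a random label for the cell with the given address. -/
def drawOne (l : List Expr) : Program :=
  .seq (setE 23 l 0) (.rep (var 107) (.seq (coinV 22)
    (setE 23 l ((2 * cellE 23 l + var 22) % (2 * var 105 + 1)))))

/-- Draw random labels for all tuples of a given length. -/
def drawLength (j : ℕ) : Program :=
  forE 21 (powE (var 101) j)
    (drawOne ((List.range j).map fun i => var 21 / powE (var 101) i % var 101))

/-- Draw random labels for all tuples of odd length. -/
def drawAll (k : ℕ) : Program := seqs ((List.range k).map fun i => drawLength (2 * i + 1))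

/-- Apply a Hadamard gate. -/
def gateH (q : Expr) : Program :=
  .seq (.hadamard q) <| forE 49 (var 101) <| seqs
    [setE 32 [var 49]
      ((cellE 32 [var 49] + 2 * (cellE 30 [var 49, q] * cellE 31 [var 49, q])) % 4),
     setE 47 [] (cellE 30 [var 49, q]),
     setE 30 [var 49, q] (cellE 31 [var 49, q]),
     setE 31 [var 49, q] (var 47)]

/-- Apply a phase gate. -/
def gateS (q : Expr) : Program :=
  .seq (.phase q) <| forE 49 (var 101) <| seqs
    [setE 32 [var 49] ((cellE 32 [var 49] + cellE 30 [var 49, q] % 2) % 4),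
     setE 31 [var 49, q] ((cellE 31 [var 49, q] + cellE 30 [var 49, q]) % 2)]

/-- Apply a `CNOT` gate. -/
def gateCNOT (c t : Expr) : Program :=
  .seq (.cnot c t) <| forE 49 (var 101) <| seqs
    [setE 30 [var 49, t] ((cellE 30 [var 49, t] + cellE 30 [var 49, c]) % 2),
     setE 31 [var 49, c] ((cellE 31 [var 49, c] + cellE 31 [var 49, t]) % 2)]

/-- Search for a qubit on which the current image is not diagonal. -/
def findPivot : Program :=
  .seq (setE 45 [] (var 100))
    (forE 44 (var 100) (.ite (cellE 40 [var 44]) (setE 45 [] (var 44)) .skip))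

/-- Remove the factors `X` of the current image outside of the pivot. -/
def clearX : Program :=
  forE 44 (var 100) (.ite (cellE 40 [var 44] * (1 - eqE (var 44) (var 45)))
    (gateCNOT (var 45) (var 44)) .skip)

/-- Remove the factors `Z` of the current image outside of the pivot. -/
def clearZ : Program :=
  forE 44 (var 100) (.ite (cellE 41 [var 44] * (1 - eqE (var 44) (var 45)))
    (.seq (gateH (var 44)) (.seq (gateCNOT (var 45) (var 44)) (gateH (var 44)))) .skip)

/-- Extend the circuit so that the image of the current monomial becomes diagonal. -/
def diagonalize (k : ℕ) : Program := .seq (image k) <| .seq findPivot <|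
  .ite (ltE (var 45) (var 100))
    (.seq clearX <| .seq (image k) <| .seq clearZ <| .seq (image k) <|
      .seq (.ite (cellE 41 [var 45]) (gateS (var 45)) .skip) (gateH (var 45))) .skip

/-- The current tuple is selected by the random labels. -/
def markE (k : ℕ) : Expr :=
  cellE 26 (keyE (Finset.range (2 * k))) * prodE ((posSets k).map fun J =>
    sumE ((coPos k J).map fun i => eqE (cellE 24 (dgE i :: keyE J)) (cellE 23 (keyE J) + 1)))

/-- Evaluate the outcome of a measurement. -/
def signUpdate (k : ℕ) : Program := .seq (image k) <|
  .seq (setE 46 [] (var 42 / 2)) <| .seq (setE 48 [] 0) <|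
  .seq (forE 43 (var 100) (.seq
      (setE 46 [] ((var 46 + cellE 41 [var 43] * cellE 50 [var 43]) % 2))
      (.ite (cellE 40 [var 43]) (setE 48 [] 1) .skip)))
    (.ite (var 48) .skip (.seq
      (.ite (var 46)
        (setE 5 (keyE (Finset.range (2 * k))) (cellE 5 (keyE (Finset.range (2 * k))) + 1))
        (setE 4 (keyE (Finset.range (2 * k))) (cellE 4 (keyE (Finset.range (2 * k))) + 1)))
      (setE 6 (keyE (Finset.range (2 * k))) (cellE 6 (keyE (Finset.range (2 * k))) + 1))))

/-- The number of measurements for the signs. -/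
def signRounds (k : ℕ) : Expr :=
  .const k * var 106 * powE (var 102) 2 * (2 * powE (2 * var 105) (posSets k).length)

/-- One measurement for the signs. -/
def signRound (k : ℕ) : Program := .seq (drawAll k) <| .seq resetTable <|
  .seq (forTuples k (.ite (markE k) (diagonalize k) .skip)) <| .seq (.measure 50) <|
    forTuples k (.ite (cellE 26 (keyE (Finset.range (2 * k)))) (signUpdate k) .skip)

/-- Compute the bit length of a parameter in the variable `9`. -/
def bitLength (a : ℕ) : Program := .seq (setE 8 [] (var a)) <| .seq (setE 9 [] 0) <|
  .rep (var a) (.seq (setE 9 [] (var 9 + ltE 0 (var 8))) (setE 8 [] (var 8 / 2)))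

/-- The part of the protocol that runs after the parameters have been computed. -/
def mainPart (k : ℕ) : Program := .seq resetTable <| .seq (.rep (bellRounds k) (bellRound k)) <|
  .seq (selectLarge k) <| .seq (labelAll k) (.rep (signRounds k) (signRound k))

/-! ## Running times -/

/-- Functions that are bounded by a polynomial. -/
def PolyBdd (f : ℕ → ℕ) : Prop := ∃ c : ℕ, ∀ K, 1 ≤ K → f K ≤ c * K ^ c

namespace PolyBdd
variable {f g : ℕ → ℕ}

theorem const (v : ℕ) : PolyBdd fun _ => v :=
  ⟨v, fun _ hK => Nat.le_mul_of_pos_right _ (Nat.pow_pos hK)⟩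

theorem id : PolyBdd fun K => K := ⟨1, fun _ _ => by simp⟩

/-- The inner function has to be at least `1` because the polynomial bound says nothing at `0`. -/
theorem comp (hf : PolyBdd f) (hg : PolyBdd g) (h : ∀ K, 1 ≤ K → 1 ≤ g K) :
    PolyBdd fun K => f (g K) := by
  obtain ⟨a, ha⟩ := hf
  obtain ⟨b, hb⟩ := hg
  refine ⟨a * b ^ a + b * a, fun K hK => (ha _ (h K hK)).trans ?_⟩
  calc a * g K ^ a ≤ a * (b * K ^ b) ^ a := by gcongr; exact hb K hK
    _ = a * b ^ a * K ^ (b * a) := by rw [mul_pow, pow_mul, mul_assoc]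
    _ ≤ _ := Nat.mul_le_mul (Nat.le_add_right _ _)
        (Nat.pow_le_pow_right hK (Nat.le_add_left _ _))

theorem add (hf : PolyBdd f) (hg : PolyBdd g) : PolyBdd fun K => f K + g K := by
  obtain ⟨a, ha⟩ := hf
  obtain ⟨b, hb⟩ := hg
  refine ⟨a + b, fun K hK => (add_le_add (ha K hK) (hb K hK)).trans ?_⟩
  rw [add_mul]
  gcongr <;> omega

theorem mul (hf : PolyBdd f) (hg : PolyBdd g) : PolyBdd fun K => f K * g K := by
  obtain ⟨a, ha⟩ := hf
  obtain ⟨b, hb⟩ := hg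
  refine ⟨a * b + (a + b), fun K hK => (Nat.mul_le_mul (ha K hK) (hb K hK)).trans ?_⟩
  calc a * K ^ a * (b * K ^ b) = a * b * K ^ (a + b) := by ring
    _ ≤ _ := Nat.mul_le_mul (Nat.le_add_right _ _) (Nat.pow_le_pow_right hK (Nat.le_add_left _ _))

theorem pow (hf : PolyBdd f) (j : ℕ) : PolyBdd fun K => f K ^ j := by
  induction j with
  | zero => simpa using const 1
  | succ j ih => simpa [pow_succ] using ih.mul hf

end PolyBdd

/-- All cells hold numbers of at most `M`. -/
def MemLe (μ : Memory) (M : ℕ) : Prop := ∀ a l, μ a l ≤ M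
/-- All parameters are at most `K`. -/
def ParLe (μ : Memory) (K : ℕ) : Prop := ∀ a, 100 ≤ a → ∀ l, μ a l ≤ K

/-- The value is polynomial in the parameters. -/
def Expr.Abs (e : Expr) : Prop :=
  ∃ g, PolyBdd g ∧ ∀ μ K, 1 ≤ K → ParLe μ K → e.eval μ ≤ g K
/-- The value exceeds the contents of the memory by at most a polynomial in the parameters. -/
def Expr.Rel (e : Expr) : Prop :=
  ∃ g, PolyBdd g ∧ ∀ μ K M, 1 ≤ K → ParLe μ K → MemLe μ M → e.eval μ ≤ M + g K

namespace Expr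

theorem Abs.const (v : ℕ) : (Expr.const v).Abs :=
  ⟨_, .const v, fun _ _ _ _ => le_rfl⟩
theorem Abs.ofNat (v : ℕ) : (OfNat.ofNat v : Expr).Abs :=
  ⟨_, .const v, fun _ _ _ _ => le_rfl⟩
theorem Abs.var {a : ℕ} (ha : 100 ≤ a) : (var a).Abs :=
  ⟨_, .id, fun μ _ _ h => by simpa using h a ha []⟩
theorem Abs.ltE (e f : Expr) : (ltE e f).Abs :=
  ⟨_, .const 1, fun μ _ _ h => by simp only [eval_ltE]; split_ifs <;> simp⟩
theorem Abs.eqE (e f : Expr) : (eqE e f).Abs :=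
  ⟨_, .const 1, fun μ _ _ h => by simp only [eval_eqE]; split_ifs <;> simp⟩
theorem Abs.add {e f : Expr} (he : e.Abs) (hf : f.Abs) : (e + f).Abs := by
  obtain ⟨g, hg, h⟩ := he
  obtain ⟨g', hg', h'⟩ := hf
  exact ⟨_, hg.add hg', fun μ K hK hp => add_le_add (h μ K hK hp) (h' μ K hK hp)⟩
theorem Abs.mul {e f : Expr} (he : e.Abs) (hf : f.Abs) : (e * f).Abs := by
  obtain ⟨g, hg, h⟩ := he
  obtain ⟨g', hg', h'⟩ := hf
  exact ⟨_, hg.mul hg', fun μ K hK hp => Nat.mul_le_mul (h μ K hK hp) (h' μ K hK hp)⟩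
theorem Abs.powE {e : Expr} (he : e.Abs) (j : ℕ) : (powE e j).Abs := by
  obtain ⟨g, hg, h⟩ := he
  exact ⟨_, hg.pow j, fun μ K hK hp => by
    simpa using Nat.pow_le_pow_left (h μ K hK hp) j⟩
-- The modulus has the form `f + 1` because reduction modulo `0` is the identity and would give no
-- bound.
theorem Abs.mod {e f : Expr} (hf : f.Abs) : (e % (f + 1)).Abs := by
  obtain ⟨g, hg, h⟩ := hf
  exact ⟨_, hg, fun μ K hK hp =>
    (Nat.lt_succ_iff.1 (Nat.mod_lt _ (Nat.succ_pos _))).trans (h μ K hK hp)⟩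
theorem Abs.mod_two (e : Expr) : (e % 2).Abs :=
  ⟨_, .const 1, fun _ _ _ _ => Nat.lt_succ_iff.1 (Nat.mod_lt _ (show 0 < _ from Nat.succ_pos _))⟩
theorem Abs.mod_four (e : Expr) : (e % 4).Abs :=
  ⟨_, .const 3, fun _ _ _ _ => Nat.lt_succ_iff.1 (Nat.mod_lt _ (show 0 < _ from Nat.succ_pos _))⟩

theorem Abs.rel {e : Expr} (he : e.Abs) : e.Rel := by
  obtain ⟨g, hg, h⟩ := he
  exact ⟨g, hg, fun μ K M hK hp _ => (h μ K hK hp).trans (Nat.le_add_left _ _)⟩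
theorem Rel.cellE (a : ℕ) (l : List Expr) : (cellE a l).Rel :=
  ⟨_, .const 0, fun μ K M _ _ h => by simpa using h a _⟩
theorem Rel.var (a : ℕ) : (ShadowTomography.var a).Rel := Rel.cellE a []
-- Only additive growth is admitted: it stays polynomial when a loop repeats it polynomially often,
-- whereas repeated doubling would not.
theorem Rel.add {e f : Expr} (he : e.Rel) (hf : f.Abs) : (e + f).Rel := by
  obtain ⟨g, hg, h⟩ := he
  obtain ⟨g', hg', h'⟩ := hf
  exact ⟨_, hg.add hg', fun μ K M hK hp hM => by
    have := h μ K M hK hp hM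
    have := h' μ K hK hp
    simp only [eval_add]
    omega⟩
theorem Rel.div {e : Expr} (he : e.Rel) (f : Expr) : (e / f).Rel := by
  obtain ⟨g, hg, h⟩ := he
  exact ⟨_, hg, fun μ K M hK hp hM => (Nat.div_le_self _ _).trans (h μ K M hK hp hM)⟩

end Expr

/-! ### Bit lengths and costs of expressions -/

theorem size_add_le (M x : ℕ) : (M + x).size ≤ M.size + x := by
  rw [Nat.size_le, pow_add]
  have h1 : M < 2 ^ M.size := Nat.lt_size_self M
  have h2 : x + 1 ≤ 2 ^ x := Nat.lt_two_pow_self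
  have h3 : 1 ≤ 2 ^ M.size := Nat.one_le_two_pow
  nlinarith [Nat.mul_le_mul_left (2 ^ M.size) h2]

theorem size_mul_le (a b : ℕ) : (a * b).size ≤ a.size + b.size := by
  rw [Nat.size_le, pow_add]
  exact Nat.mul_lt_mul'' (Nat.lt_size_self a) (Nat.lt_size_self b)

theorem size_binOp_le (op : BinOp) (a b : ℕ) : (op.eval a b).size ≤ a.size + b.size + 1 := by
  cases op with
  | add =>
    rw [BinOp.eval, Nat.size_le]
    have h1 := Nat.lt_size_self a
    have h2 := Nat.lt_size_self b
    have h3 : 2 ^ a.size ≤ 2 ^ (a.size + b.size) := Nat.pow_le_pow_right (by norm_num) (by omega)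
    have h4 : 2 ^ b.size ≤ 2 ^ (a.size + b.size) := Nat.pow_le_pow_right (by norm_num) (by omega)
    rw [pow_succ]
    omega
  | sub => exact (Nat.size_le_size (Nat.sub_le a b)).trans (by omega)
  | mul => exact (size_mul_le a b).trans (by omega)
  | div => exact (Nat.size_le_size (Nat.div_le_self a b)).trans (by omega)
  | mod => exact (Nat.size_le_size (Nat.mod_le a b)).trans (by omega)
  | lt =>
    rw [BinOp.eval]; split_ifs <;> simp
  | eq =>
    rw [BinOp.eval]; split_ifs <;> simp

/-- Bit lengths of values, and costs of expressions, are linear and quadratic in the bit lengths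
of the memory contents. -/
theorem exists_cost_le (e : Expr) : ∃ c : ℕ, ∀ (μ : Memory) (w : ℕ), 1 ≤ w →
    (∀ a l, (μ a l).size ≤ w) → (e.eval μ).size ≤ c * w ∧ e.cost μ ≤ c * w ^ 2 := by
  induction e with
  | const v =>
    refine ⟨1 + v.size, fun μ w hw _ => ?_⟩
    have : 1 ≤ w ^ 2 := Nat.one_le_pow _ _ hw
    simp only [Expr.eval, Expr.cost]
    constructor <;> nlinarith
  | bin op e f ihe ihf =>
    obtain ⟨a, ha⟩ := ihe
    obtain ⟨b, hb⟩ := ihf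
    refine ⟨a + b + (1 + a) * (1 + b), fun μ w hw hμ => ?_⟩
    obtain ⟨ha1, ha2⟩ := ha μ w hw hμ
    obtain ⟨hb1, hb2⟩ := hb μ w hw hμ
    constructor
    · refine (size_binOp_le op _ _).trans ?_
      nlinarith [Nat.zero_le (a * b * w), Nat.zero_le (a * w), Nat.zero_le (b * w)]
    · rw [Expr.cost]
      have h1 : 1 + (e.eval μ).size ≤ (1 + a) * w := by nlinarith
      have h2 : 1 + (f.eval μ).size ≤ (1 + b) * w := by nlinarith
      have := Nat.mul_le_mul h1 h2
      nlinarith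
  | cell a idx ih =>
    choose c hc using ih
    refine ⟨2 + 2 * ∑ i, c i, fun μ w hw hμ => ?_⟩
    have hw2 : w ≤ w ^ 2 := Nat.le_self_pow (by norm_num) w
    constructor
    · rw [Expr.eval]
      exact (hμ _ _).trans (Nat.le_mul_of_pos_left _ (by omega))
    · rw [Expr.cost]
      have : ∑ i, ((idx i).cost μ + ((idx i).eval μ).size) ≤ ∑ i, 2 * c i * w ^ 2 := by
        refine Finset.sum_le_sum fun i _ => ?_
        obtain ⟨h1, h2⟩ := hc i μ w hw hμ
        nlinarith [Nat.mul_le_mul_left (c i) hw2]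
      rw [← Finset.sum_mul, ← Finset.mul_sum] at this
      have := hμ a (List.ofFn fun i => (idx i).eval μ)
      nlinarith

/-- Programs that are efficient, and keep the parameters fixed. -/
def Program.Poly (p : Program) : Prop := ∃ g, PolyBdd g ∧
  ∀ (n : ℕ) (ρ : DensityMatrix n) (s : Config n) (M K : ℕ), 1 ≤ K → n ≤ K →
    ParLe s.mem K → MemLe s.mem M → ∀ s' ∈ (p.run ρ s).support,
      (∀ a, 100 ≤ a → s'.mem a = s.mem a) ∧ MemLe s'.mem (M + g K) ∧
        s'.time ≤ s.time + g K * (M.size + 1) ^ 2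

namespace Program.Poly

theorem cost_le {μ : Memory} {M : ℕ} (e : Expr) {c : ℕ}
    (hc : ∀ (μ : Memory) (w : ℕ), 1 ≤ w →
      (∀ a l, (μ a l).size ≤ w) → (e.eval μ).size ≤ c * w ∧ e.cost μ ≤ c * w ^ 2)
    (h : MemLe μ M) : e.cost μ ≤ c * (M.size + 1) ^ 2 :=
  (hc μ (M.size + 1) (by omega) fun a l => (Nat.size_le_size (h a l)).trans (by omega)).2

theorem memLe_write {n : ℕ} {s : Config n} {M v : ℕ} (h : MemLe s.mem M) (a : ℕ) (l : List ℕ)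
    {M' : ℕ} (hM : M ≤ M') (hv : v ≤ M') : MemLe (s.write a l v).mem M' := by
  intro b l'
  by_cases hb : b = a
  · subst hb
    rw [Config.write_mem_self, Function.update_apply]
    split_ifs
    · exact hv
    · exact (h _ _).trans hM
  · rw [Config.write_mem_ne _ hb]
    exact (h _ _).trans hM

theorem skip : Program.skip.Poly :=
  ⟨_, .const 1, fun n ρ s M K _ _ _ hM s' hs' => by
    rw [Program.run, PMF.mem_support_pure_iff] at hs'
    subst hs'
    refine ⟨fun _ _ => rfl, fun a l => (hM a l).trans (by omega), ?_⟩
    have : 1 ≤ (M.size + 1) ^ 2 := Nat.one_le_pow _ _ (by omega)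
    simpa [Config.tick] using this⟩

theorem assign (a : ℕ) {d : ℕ} (idx : Fin d → Expr) {e : Expr} (ha : a < 100) (he : e.Rel) :
    (Program.assign a idx e).Poly := by
  obtain ⟨g, hg, h⟩ := he
  obtain ⟨c₁, h₁⟩ := exists_cost_le (Expr.cell a idx)
  obtain ⟨c₂, h₂⟩ := exists_cost_le e
  refine ⟨_, hg.add (.const (1 + c₁ + c₂)), fun n ρ s M K hK hn hp hM s' hs' => ?_⟩
  rw [Program.run, PMF.mem_support_pure_iff] at hs'
  subst hs'
  refine ⟨fun b hb => Config.write_mem_ne _ (by omega) _ _,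
    memLe_write (s := s.tick _) hM _ _ (by omega) ((h _ K M hK hp hM).trans (by omega)), ?_⟩
  have := cost_le _ h₁ hM
  have := cost_le _ h₂ hM
  have : 1 ≤ (M.size + 1) ^ 2 := Nat.one_le_pow _ _ (by omega)
  simp only [Config.write_time, Config.tick]
  nlinarith [Nat.zero_le (g K * (M.size + 1) ^ 2)]

theorem coin (a : ℕ) {d : ℕ} (idx : Fin d → Expr) (ha : a < 100) :
    (Program.coin a idx).Poly := by
  obtain ⟨c₁, h₁⟩ := exists_cost_le (Expr.cell a idx)
  refine ⟨_, .const (1 + c₁), fun n ρ s M K hK hn hp hM s' hs' => ?_⟩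
  rw [Program.run, PMF.mem_support_bind_iff] at hs'
  obtain ⟨b, -, hs'⟩ := hs'
  rw [PMF.mem_support_pure_iff] at hs'
  subst hs'
  refine ⟨fun b hb => Config.write_mem_ne _ (by omega) _ _,
    memLe_write (s := s.tick _) hM _ _ (by omega) (by have := b.isLt; omega), ?_⟩
  have := cost_le _ h₁ hM
  have : 1 ≤ (M.size + 1) ^ 2 := Nat.one_le_pow _ _ (by omega)
  simp only [Config.write_time, Config.tick]
  nlinarith

theorem hadamard (q : Expr) : (Program.hadamard q).Poly := by
  obtain ⟨c₁, h₁⟩ := exists_cost_le q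
  refine ⟨_, .const (1 + c₁), fun n ρ s M K hK hn hp hM s' hs' => ?_⟩
  rw [Program.run, PMF.mem_support_pure_iff] at hs'
  subst hs'
  refine ⟨fun _ _ => rfl, fun a l => (hM a l).trans (by omega), ?_⟩
  have := cost_le _ h₁ hM
  have : 1 ≤ (M.size + 1) ^ 2 := Nat.one_le_pow _ _ (by omega)
  simp only [Config.emit, Config.tick]
  nlinarith

theorem phase (q : Expr) : (Program.phase q).Poly := by
  obtain ⟨c₁, h₁⟩ := exists_cost_le q
  refine ⟨_, .const (1 + c₁), fun n ρ s M K hK hn hp hM s' hs' => ?_⟩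
  rw [Program.run, PMF.mem_support_pure_iff] at hs'
  subst hs'
  refine ⟨fun _ _ => rfl, fun a l => (hM a l).trans (by omega), ?_⟩
  have := cost_le _ h₁ hM
  have : 1 ≤ (M.size + 1) ^ 2 := Nat.one_le_pow _ _ (by omega)
  simp only [Config.emit, Config.tick]
  nlinarith

theorem cnot (q t : Expr) : (Program.cnot q t).Poly := by
  obtain ⟨c₁, h₁⟩ := exists_cost_le q
  obtain ⟨c₂, h₂⟩ := exists_cost_le t
  refine ⟨_, .const (1 + c₁ + c₂), fun n ρ s M K hK hn hp hM s' hs' => ?_⟩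
  rw [Program.run, PMF.mem_support_pure_iff] at hs'
  subst hs'
  refine ⟨fun _ _ => rfl, fun a l => (hM a l).trans (by omega), ?_⟩
  have := cost_le _ h₁ hM
  have := cost_le _ h₂ hM
  have : 1 ≤ (M.size + 1) ^ 2 := Nat.one_le_pow _ _ (by omega)
  simp only [Config.emit, Config.tick]
  nlinarith

theorem measure {a : ℕ} (ha : a < 100) : (Program.measure a).Poly := by
  refine ⟨fun K => 1 + (K + K) * (2 + (K + K)),
    (PolyBdd.const 1).add ((PolyBdd.id.add .id).mul ((PolyBdd.const 2).add (PolyBdd.id.add .id))),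
    fun n ρ s M K hK hn hp hM s' hs' => ?_⟩
  rw [Program.run, PMF.mem_support_bind_iff] at hs'
  obtain ⟨z, -, hs'⟩ := hs'
  rw [PMF.mem_support_pure_iff] at hs'
  subst hs'
  refine ⟨fun b hb => Config.record_mem_ne _ (by omega) _, fun b l => ?_, ?_⟩
  · by_cases hb : b = a
    · subst hb
      simp only [Config.record, Function.update_self, Config.tick_mem]
      split
      · split_ifs
        · rename_i j h
          have := (z ⟨j, h⟩).isLt
          omega
        · exact (hM _ _).trans (by omega)
      · exact (hM _ _).trans (by omega)
    · rw [Config.record_mem_ne _ hb]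
      exact (hM _ _).trans (by omega)
  · have h1 : ∑ j ∈ Finset.range (n + n), (2 + j.size) ≤ (K + K) * (2 + (K + K)) := by
      calc _ ≤ ∑ j ∈ Finset.range (n + n), (2 + (K + K)) := by
            refine Finset.sum_le_sum fun j hj => ?_
            have : j.size ≤ j := by simpa using size_add_le 0 j
            have := Finset.mem_range.1 hj
            omega
        _ ≤ _ := by simp; gcongr
    have : 1 ≤ (M.size + 1) ^ 2 := Nat.one_le_pow _ _ (by omega)
    simp only [Config.record, Config.tick]
    nlinarith [Nat.zero_le ((K + K) * (2 + (K + K))),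
      Nat.mul_le_mul_left (1 + (K + K) * (2 + (K + K))) this]

/-- Growth of the memory by `x` costs only the factor `(x + 1)^2` in the time bound, which is
polynomial when `x` is. This is what makes `Program.Poly` composable. -/
theorem size_succ_le (M x : ℕ) : ((M + x).size + 1) ^ 2 ≤ (x + 1) ^ 2 * (M.size + 1) ^ 2 := by
  rw [← mul_pow]
  refine Nat.pow_le_pow_left ?_ 2
  nlinarith [size_add_le M x, Nat.zero_le (x * M.size)]

/-- The second program starts from cells bounded by `M + g K`; `size_succ_le` converts its cost back
to the original bound `M`. -/
theorem seq {p q : Program} (hp : p.Poly) (hq : q.Poly) : (Program.seq p q).Poly := by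
  obtain ⟨g, hg, h⟩ := hp
  obtain ⟨g', hg', h'⟩ := hq
  refine ⟨fun K => 1 + g K + g' K * (g K + 1) ^ 2,
    ((PolyBdd.const 1).add hg).add (hg'.mul ((hg.add (.const 1)).pow 2)),
    fun n ρ s M K hK hn hp hM s' hs' => ?_⟩
  rw [Program.run, PMF.mem_support_bind_iff] at hs'
  obtain ⟨t, ht, hs'⟩ := hs'
  obtain ⟨h1, h2, h3⟩ := h n ρ (s.tick 1) M K hK hn hp hM t ht
  obtain ⟨h4, h5, h6⟩ := h' n ρ t (M + g K) K hK hn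
    (fun a ha l => by rw [h1 a ha]; exact hp a ha l) h2 s' hs'
  have e1 : 1 ≤ (M.size + 1) ^ 2 := Nat.one_le_pow _ _ (by omega)
  have e2 : 1 ≤ (g K + 1) ^ 2 := Nat.one_le_pow _ _ (by omega)
  refine ⟨fun a ha => by rw [h4 a ha, h1 a ha]; rfl, fun a l => (h5 a l).trans ?_, ?_⟩
  · nlinarith
  · have h3' : t.time ≤ s.time + 1 + g K * (M.size + 1) ^ 2 := h3
    have h7 := Nat.mul_le_mul_left (g' K) (size_succ_le M (g K))
    rw [← mul_assoc] at h7
    rw [add_mul, add_mul, one_mul]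
    linarith

theorem ite {e : Expr} {p q : Program} (hp : p.Poly) (hq : q.Poly) :
    (Program.ite e p q).Poly := by
  obtain ⟨g, hg, h⟩ := hp
  obtain ⟨g', hg', h'⟩ := hq
  obtain ⟨c, hc⟩ := exists_cost_le e
  refine ⟨fun K => 1 + c + g K + g' K, ((PolyBdd.const (1 + c)).add hg).add hg',
    fun n ρ s M K hK hn hp hM s' hs' => ?_⟩
  have e1 : 1 ≤ (M.size + 1) ^ 2 := Nat.one_le_pow _ _ (by omega)
  have e2 := cost_le _ hc hM
  rw [Program.run] at hs'
  split_ifs at hs'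
  · obtain ⟨h1, h2, h3⟩ := h n ρ (s.tick _) M K hK hn hp hM s' hs'
    refine ⟨h1, fun a l => (h2 a l).trans (by dsimp only; omega), ?_⟩
    have h3' : s'.time ≤ s.time + (1 + e.cost s.mem) + g K * (M.size + 1) ^ 2 := h3
    nlinarith [Nat.zero_le (g' K * (M.size + 1) ^ 2)]
  · obtain ⟨h1, h2, h3⟩ := h' n ρ (s.tick _) M K hK hn hp hM s' hs'
    refine ⟨h1, fun a l => (h2 a l).trans (by dsimp only; omega), ?_⟩
    have h3' : s'.time ≤ s.time + (1 + e.cost s.mem) + g' K * (M.size + 1) ^ 2 := h3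
    nlinarith [Nat.zero_le (g K * (M.size + 1) ^ 2)]

/-- After `t` rounds the cells are bounded by `M + t * g K`. Since `t` is at most the polynomial `b
K`, every round can be charged as if the memory were already at `M + b K * g K`. -/
theorem rep {e : Expr} {p : Program} (he : e.Abs) (hp : p.Poly) : (Program.rep e p).Poly := by
  obtain ⟨g, hg, h⟩ := hp
  obtain ⟨b, hb, hb'⟩ := he
  obtain ⟨c, hc⟩ := exists_cost_le e
  refine ⟨fun K => 1 + c + b K * g K + b K * (1 + g K * (b K * g K + 1) ^ 2),
    ((PolyBdd.const (1 + c)).add (hb.mul hg)).add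
      (hb.mul ((PolyBdd.const 1).add (hg.mul (((hb.mul hg).add (.const 1)).pow 2)))),
    fun n ρ s M K hK hn hp hM => ?_⟩
  have e1 : 1 ≤ (M.size + 1) ^ 2 := Nat.one_le_pow _ _ (by omega)
  have e2 := cost_le _ hc hM
  have e3 := hb' s.mem K hK hp
  have key := iterate_support (f := fun t : Config n => p.run ρ (t.tick 1))
    (T := e.eval s.mem) (a := s.tick (1 + e.cost s.mem))
    (fun t s' => (∀ a, 100 ≤ a → s'.mem a = s.mem a) ∧ MemLe s'.mem (M + t * g K) ∧
      s'.time ≤ s.time + (1 + e.cost s.mem) +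
        t * (1 + g K * (b K * g K + 1) ^ 2 * (M.size + 1) ^ 2))
    ⟨fun _ _ => rfl, by simpa using hM, by simp [Config.tick]⟩
    (fun t ht s₁ h₁ s₂ h₂ => by
      obtain ⟨i1, i2, i3⟩ := h₁
      obtain ⟨h3, h4, h5⟩ := h n ρ (s₁.tick 1) (M + t * g K) K hK hn
        (fun a ha l => by rw [Config.tick_mem, i1 a ha]; exact hp a ha l) i2 s₂ h₂
      refine ⟨fun a ha => by rw [h3 a ha]; exact i1 a ha, fun a l => (h4 a l).trans ?_, ?_⟩
      · rw [add_mul, one_mul, add_assoc]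
      · have h5' : s₂.time ≤ s₁.time + 1 + g K * ((M + t * g K).size + 1) ^ 2 := h5
        have h6 : ((M + t * g K).size + 1) ^ 2 ≤ ((M + b K * g K).size + 1) ^ 2 := by
          gcongr
          refine Nat.size_le_size ?_
          gcongr
          omega
        have h7 := Nat.mul_le_mul_left (g K) (h6.trans (size_succ_le M (b K * g K)))
        rw [← mul_assoc] at h7
        rw [add_mul t 1, one_mul]
        linarith)
  intro s' hs'
  obtain ⟨h1, h2, h3⟩ := key s' hs'
  refine ⟨h1, fun a l => (h2 a l).trans ?_, h3.trans ?_⟩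
  · have := Nat.mul_le_mul_right (g K) e3
    dsimp only
    omega
  · have h8 : e.eval s.mem * (1 + g K * (b K * g K + 1) ^ 2 * (M.size + 1) ^ 2) ≤
        b K * (1 + g K * (b K * g K + 1) ^ 2 * (M.size + 1) ^ 2) := Nat.mul_le_mul_right _ e3
    have h9 : b K * (1 + g K * (b K * g K + 1) ^ 2 * (M.size + 1) ^ 2) ≤
        b K * (1 + g K * (b K * g K + 1) ^ 2) * (M.size + 1) ^ 2 := by
      rw [mul_assoc (b K)]
      refine Nat.mul_le_mul_left _ ?_
      rw [add_mul, one_mul]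
      omega
    have h10 : 0 ≤ b K * g K * (M.size + 1) ^ 2 := Nat.zero_le _
    nlinarith

theorem setE {a : ℕ} (ha : a < 100) (l : List Expr) {e : Expr} (he : e.Rel) :
    (setE a l e).Poly := assign a _ ha he
theorem coinV {a : ℕ} (ha : a < 100) : (coinV a).Poly := coin a _ ha
theorem forE {v : ℕ} (hv : v < 100) {e : Expr} (he : e.Abs) {p : Program} (hp : p.Poly) :
    (forE v e p).Poly :=
  (setE hv _ (Expr.Abs.ofNat 0).rel).seq
    (.rep he (hp.seq (setE hv _ ((Expr.Rel.var v).add (Expr.Abs.ofNat 1)))))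
theorem seqs {l : List Program} (h : ∀ p ∈ l, p.Poly) : (seqs l).Poly := by
  induction l with
  | nil => exact skip
  | cons p l ih =>
    exact (h p (by simp)).seq (ih fun q hq => h q (by simp [hq]))
theorem seqs_nil : (ShadowTomography.seqs []).Poly := skip
theorem seqs_cons {p : Program} {l : List Program} (hp : p.Poly)
    (hl : (ShadowTomography.seqs l).Poly) : (ShadowTomography.seqs (p :: l)).Poly := hp.seq hl

end Program.Poly

/-! ### Running times of the parts of the protocol -/

theorem poly_resetTable : resetTable.Poly := by
  refine .forE (by norm_num) (.var (by norm_num)) (.seqs_cons ?_ (.seqs_cons ?_ .seqs_nil))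
  · exact .setE (by norm_num) _ (Expr.Abs.ofNat 0).rel
  · refine .forE (by norm_num) (.var (by norm_num))
      (.seqs_cons ?_ (.seqs_cons ?_ (.seqs_cons ?_ .seqs_nil)))
    · exact .setE (by norm_num) _ ((Expr.Abs.eqE _ _).add (.eqE _ _)).rel
    · exact .setE (by norm_num) _ ((Expr.Abs.eqE _ _).add (.eqE _ _)).rel
    · exact .setE (by norm_num) _ (Expr.Abs.mod_four _).rel

theorem poly_forTuples {k : ℕ} {p : Program} (hp : p.Poly) : (forTuples k p).Poly :=
  .forE (by norm_num) ((Expr.Abs.var (by norm_num)).powE _) (.ite hp .skip)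

theorem poly_image (k : ℕ) : (image k).Poly := by
  refine .seqs_cons ?_ (.seqs_cons (.forE (by norm_num) (.var (by norm_num))
    (.seqs_cons ?_ (.seqs_cons ?_ (.seqs_cons ?_ .seqs_nil)))) .seqs_nil)
  · exact .setE (by norm_num) _ (Expr.Abs.mod_four _).rel
  · exact .setE (by norm_num) _ (Expr.Abs.mod_two _).rel
  · exact .setE (by norm_num) _ (Expr.Abs.mod_two _).rel
  · exact .setE (by norm_num) _ (Expr.Abs.mod_four _).rel

theorem poly_count {a : ℕ} (ha : a < 100) (l : List Expr) :
    (setE a l (cellE a l + 1)).Poly :=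
  .setE ha _ ((Expr.Rel.cellE _ _).add (.ofNat 1))

theorem abs_bellRounds (k : ℕ) : (bellRounds k).Abs :=
  ((Expr.Abs.const k).mul (.var (by norm_num))).mul ((Expr.Abs.var (by norm_num)).powE _)

theorem poly_bellRound (k : ℕ) : (bellRound k).Poly := by
  refine .seq ?_ (.seq (.measure (by norm_num)) (poly_forTuples ?_))
  · exact .forE (by norm_num) (.var (by norm_num))
      (.seqs_cons (.cnot _ _) (.seqs_cons (.hadamard _) .seqs_nil))
  · refine .seqs_cons (poly_image k) (.seqs_cons ?_ (.seqs_cons ?_ (.seqs_cons ?_ .seqs_nil)))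
    · exact .setE (by norm_num) _ (Expr.Abs.mod_two _).rel
    · exact .forE (by norm_num) (.var (by norm_num))
        (.setE (by norm_num) _ (Expr.Abs.mod_two _).rel)
    · exact .ite (poly_count (by norm_num) _) (poly_count (by norm_num) _)

theorem poly_selectLarge (k : ℕ) : (selectLarge k).Poly :=
  poly_forTuples (.setE (by norm_num) _ (Expr.Abs.ltE _ _).rel)

theorem poly_labelAll (k : ℕ) : (labelAll k).Poly := by
  refine poly_forTuples (.ite (.seqs fun p hp => ?_) .skip)
  obtain ⟨J, -, rfl⟩ := List.mem_map.1 hp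
  refine .ite .skip (.seqs fun p hp => ?_)
  obtain ⟨i, -, rfl⟩ := List.mem_map.1 hp
  exact (poly_count (by norm_num) _).seq (.setE (by norm_num) _ (.cellE _ _))

theorem poly_drawAll (k : ℕ) : (drawAll k).Poly := by
  refine .seqs fun p hp => ?_
  obtain ⟨i, -, rfl⟩ := List.mem_map.1 hp
  refine .forE (by norm_num) ((Expr.Abs.var (by norm_num)).powE _)
    (.seq (.setE (by norm_num) _ (Expr.Abs.ofNat 0).rel)
      (.rep (.var (by norm_num)) (.seq (.coinV (by norm_num)) (.setE (by norm_num) _ ?_))))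
  exact (Expr.Abs.mod ((Expr.Abs.ofNat 2).mul (.var (by norm_num)))).rel

theorem poly_gateH (q : Expr) : (gateH q).Poly := by
  refine .seq (.hadamard _) (.forE (by norm_num) (.var (by norm_num))
    (.seqs_cons ?_ (.seqs_cons ?_ (.seqs_cons ?_ (.seqs_cons ?_ .seqs_nil)))))
  · exact .setE (by norm_num) _ (Expr.Abs.mod_four _).rel
  · exact .setE (by norm_num) _ (.cellE _ _)
  · exact .setE (by norm_num) _ (.cellE _ _)
  · exact .setE (by norm_num) _ (.cellE _ _)

theorem poly_gateS (q : Expr) : (gateS q).Poly := by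
  refine .seq (.phase _) (.forE (by norm_num) (.var (by norm_num))
    (.seqs_cons ?_ (.seqs_cons ?_ .seqs_nil)))
  · exact .setE (by norm_num) _ (Expr.Abs.mod_four _).rel
  · exact .setE (by norm_num) _ (Expr.Abs.mod_two _).rel

theorem poly_gateCNOT (c t : Expr) : (gateCNOT c t).Poly := by
  refine .seq (.cnot _ _) (.forE (by norm_num) (.var (by norm_num))
    (.seqs_cons ?_ (.seqs_cons ?_ .seqs_nil)))
  · exact .setE (by norm_num) _ (Expr.Abs.mod_two _).rel
  · exact .setE (by norm_num) _ (Expr.Abs.mod_two _).rel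

theorem poly_diagonalize (k : ℕ) : (diagonalize k).Poly := by
  have hn : (var 100).Abs := .var (by norm_num)
  refine (poly_image k).seq (.seq ?_ (.ite (.seq ?_ ((poly_image k).seq
    (.seq ?_ ((poly_image k).seq (.seq (.ite (poly_gateS _) .skip) (poly_gateH _)))))) .skip))
  · exact .seq (.setE (by norm_num) _ hn.rel) (.forE (by norm_num) hn
      (.ite (.setE (by norm_num) _ (.var _)) .skip))
  · exact .forE (by norm_num) hn (.ite (poly_gateCNOT _ _) .skip)
  · exact .forE (by norm_num) hn
      (.ite (.seq (poly_gateH _) (.seq (poly_gateCNOT _ _) (poly_gateH _))) .skip)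

theorem poly_signUpdate (k : ℕ) : (signUpdate k).Poly := by
  refine (poly_image k).seq (.seq ?_ (.seq ?_ (.seq ?_ ?_)))
  · exact .setE (by norm_num) _ ((Expr.Rel.var _).div _)
  · exact .setE (by norm_num) _ (Expr.Abs.ofNat 0).rel
  · exact .forE (by norm_num) (.var (by norm_num))
      (.seq (.setE (by norm_num) _ (Expr.Abs.mod_two _).rel)
        (.ite (.setE (by norm_num) _ (Expr.Abs.ofNat 1).rel) .skip))
  · exact .ite .skip (.seq (.ite (poly_count (by norm_num) _) (poly_count (by norm_num) _))
      (poly_count (by norm_num) _))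

theorem poly_signRound (k : ℕ) : (signRound k).Poly :=
  (poly_drawAll k).seq (poly_resetTable.seq ((poly_forTuples (.ite (poly_diagonalize k) .skip)).seq
    (.seq (.measure (by norm_num)) (poly_forTuples (.ite (poly_signUpdate k) .skip)))))

theorem abs_signRounds (k : ℕ) : (signRounds k).Abs :=
  (((Expr.Abs.const k).mul (.var (by norm_num))).mul ((Expr.Abs.var (by norm_num)).powE _)).mul
    ((Expr.Abs.ofNat 2).mul (((Expr.Abs.ofNat 2).mul (.var (by norm_num))).powE _))

theorem poly_mainPart (k : ℕ) : (mainPart k).Poly :=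
  poly_resetTable.seq (.seq (.rep (abs_bellRounds k) (poly_bellRound k))
    ((poly_selectLarge k).seq ((poly_labelAll k).seq
      (.rep (abs_signRounds k) (poly_signRound k)))))

theorem poly_bitLength {a : ℕ} (ha : 100 ≤ a) : (bitLength a).Poly :=
  .seq (.setE (by norm_num) _ (Expr.Abs.var ha).rel) <|
    .seq (.setE (by norm_num) _ (Expr.Abs.ofNat 0).rel) <|
    .rep (.var ha) (.seq (.setE (by norm_num) _ ((Expr.Rel.var _).add (.ltE _ _)))
      (.setE (by norm_num) _ ((Expr.Rel.var _).div _)))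

/-! ### Running times in terms of bit lengths -/

/-- All cells hold numbers of at most `w` bits. -/
def SizeLe (μ : Memory) (w : ℕ) : Prop := ∀ a l, (μ a l).size ≤ w

/-- Programs whose running time is polynomial in the parameters and the bit lengths. -/
def Program.Eff (p : Program) : Prop := ∃ g, PolyBdd g ∧
  ∀ (n : ℕ) (ρ : DensityMatrix n) (s : Config n) (w K : ℕ), 1 ≤ w → 1 ≤ K → n ≤ K →
    ParLe s.mem K → SizeLe s.mem w → ∀ s' ∈ (p.run ρ s).support,
      SizeLe s'.mem (g (w + K)) ∧ s'.time ≤ s.time + g (w + K)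

/-- A cell of `w` bits holds at most `2 ^ w`, and adding `g K` to that lengthens it by at most `g K`
bits. The weaker notion `Program.Eff` is needed for the parameters, which arise from products and
quotients of the input: the denominator of `ε` may be exponential in its length, so such values are
not within an additive polynomial of the memory. -/
theorem Program.Poly.eff {p : Program} (hp : p.Poly) : p.Eff := by
  obtain ⟨g, ⟨c, hc⟩, h⟩ := hp
  have hg : PolyBdd fun K => c * K ^ c := ⟨c, fun _ _ => le_rfl⟩
  refine ⟨fun K => K + 1 + c * K ^ c + c * K ^ c * (K + 2) ^ 2,
    ((PolyBdd.id.add (.const 1)).add hg).add (hg.mul ((PolyBdd.id.add (.const 2)).pow 2)),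
    fun n ρ s w K hw hK hn hp hs s' hs' => ?_⟩
  obtain ⟨-, h1, h2⟩ := h n ρ s (2 ^ w) K hK hn hp
    (fun a l => (Nat.lt_pow_of_log_lt one_lt_two (by
      have := hs a l
      rw [Nat.size_le] at this
      by_cases h0 : s.mem a l = 0
      · simp [h0]; omega
      · exact (Nat.log_lt_iff_lt_pow one_lt_two h0).2 this)).le) s' hs'
  have hgK : g K ≤ c * (w + K) ^ c := (hc K hK).trans (by gcongr; omega)
  rw [Nat.size_pow] at h2
  refine ⟨fun a l => ?_, h2.trans ?_⟩
  · refine (Nat.size_le_size (h1 a l)).trans ((size_add_le _ _).trans ?_)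
    rw [Nat.size_pow]
    dsimp only
    have := Nat.zero_le (c * (w + K) ^ c * (w + K + 2) ^ 2)
    omega
  · have : g K * (w + 1 + 1) ^ 2 ≤ c * (w + K) ^ c * (w + K + 2) ^ 2 :=
      Nat.mul_le_mul hgK (Nat.pow_le_pow_left (by omega) 2)
    dsimp only
    omega

theorem Program.Eff.setE (a : ℕ) (l : List Expr) (e : Expr) :
    (ShadowTomography.setE a l e).Eff := by
  obtain ⟨c₁, h₁⟩ := exists_cost_le (Expr.cell a fun i : Fin l.length => l.get i)
  obtain ⟨c₂, h₂⟩ := exists_cost_le e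
  refine ⟨fun K => K + c₂ * K + (1 + c₁ * K ^ 2 + c₂ * K ^ 2),
    (PolyBdd.id.add ((PolyBdd.const _).mul .id)).add
      (((PolyBdd.const 1).add ((PolyBdd.const _).mul (PolyBdd.id.pow 2))).add
        ((PolyBdd.const _).mul (PolyBdd.id.pow 2))),
    fun n ρ s w K hw hK hn hp hs s' hs' => ?_⟩
  rw [ShadowTomography.setE, Program.run, PMF.mem_support_pure_iff] at hs'
  subst hs'
  have i1 := h₁ s.mem w hw hs
  have i2 := h₂ s.mem w hw hs
  have i3 : c₂ * w ≤ c₂ * (w + K) := by gcongr; omega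
  have i4 : c₂ * w ^ 2 ≤ c₂ * (w + K) ^ 2 := by gcongr; omega
  have i5 : c₁ * w ^ 2 ≤ c₁ * (w + K) ^ 2 := by gcongr; omega
  refine ⟨fun b l' => ?_, ?_⟩
  · by_cases hb : b = a
    · subst hb
      rw [Config.write_mem_self, Function.update_apply]
      split_ifs
      · dsimp only; omega
      · refine (hs _ _).trans ?_
        dsimp only; omega
    · rw [Config.write_mem_ne _ hb]
      refine (hs _ _).trans ?_
      dsimp only; omega
  · simp only [Config.write_time, Config.tick]
    omega

/-! ## Words in the Pauli operators -/

/-- The matrix of `X`. -/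
def matX : Matrix (Fin 2) (Fin 2) ℂ := Pauli.X.mat
/-- The matrix of `Z`. -/
def matZ : Matrix (Fin 2) (Fin 2) ℂ := Pauli.Z.mat

theorem matX_sq : matX * matX = 1 := by
  ext i j; fin_cases i <;> fin_cases j <;> simp [matX, Pauli.mat, Matrix.mul_apply]
theorem matZ_sq : matZ * matZ = 1 := by
  ext i j; fin_cases i <;> fin_cases j <;> simp [matZ, Pauli.mat, Matrix.mul_apply]
theorem matZ_mul_matX : matZ * matX = -(matX * matZ) := by
  ext i j; fin_cases i <;> fin_cases j <;> simp [matX, matZ, Pauli.mat, Matrix.mul_apply]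

theorem pow_eq_of_sq {M : Type*} [Monoid M] {a : M} (h : a * a = 1) {x y : ℕ}
    (hxy : x % 2 = y % 2) : a ^ x = a ^ y := by
  have key : ∀ x, a ^ x = a ^ (x % 2) := fun x => by
    conv_lhs => rw [← Nat.div_add_mod x 2, pow_add, pow_mul, pow_two, h, one_pow, one_mul]
  rw [key x, key y, hxy]

theorem matZ_pow_mul_matX_pow (z x : ℕ) :
    matZ ^ z * matX ^ x = ((-1 : ℂ) ^ (z * x)) • (matX ^ x * matZ ^ z) := by
  have h1 : ∀ x, matZ * matX ^ x = ((-1 : ℂ) ^ x) • (matX ^ x * matZ) := by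
    intro x
    induction x with
    | zero => simp
    | succ x ih =>
      rw [pow_succ, ← mul_assoc, ih, Matrix.smul_mul, mul_assoc, matZ_mul_matX, mul_neg,
        ← mul_assoc, pow_succ, smul_neg, mul_neg_one, neg_smul]
  induction z with
  | zero => simp
  | succ z ih =>
    rw [pow_succ', mul_assoc, ih, Matrix.mul_smul, ← mul_assoc, h1, Matrix.smul_mul, smul_smul,
      ← pow_add, mul_assoc, Nat.succ_mul]

/-- The operator `i^φ (X^{x_1} Z^{z_1}) ⊗ (X^{x_2} Z^{z_2}) ⊗ ⋯`. -/
def word {m : ℕ} (φ : ℕ) (x z : Fin m → ℕ) : Op m :=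
  Complex.I ^ φ • tensor fun i => matX ^ x i * matZ ^ z i

theorem tensor_smul {m : ℕ} (a : Fin m → ℂ) (M : Fin m → Matrix (Fin 2) (Fin 2) ℂ) :
    tensor (fun i => a i • M i) = (∏ i, a i) • tensor M := by
  ext x y
  simp [tensor, Finset.prod_mul_distrib]

theorem word_mul {m : ℕ} (φ φ' : ℕ) (x z x' z' : Fin m → ℕ) :
    word φ x z * word φ' x' z' =
      word (φ + φ' + 2 * ∑ i, z i * x' i) (fun i => x i + x' i) (fun i => z i + z' i) := by
  have h : ∀ i, matX ^ x i * matZ ^ z i * (matX ^ x' i * matZ ^ z' i) =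
      ((-1 : ℂ) ^ (z i * x' i)) • (matX ^ (x i + x' i) * matZ ^ (z i + z' i)) := by
    intro i
    rw [mul_assoc, ← mul_assoc (matZ ^ z i), matZ_pow_mul_matX_pow, Matrix.smul_mul,
      Matrix.mul_smul, pow_add, pow_add]
    simp only [mul_assoc]
  simp only [word, Matrix.smul_mul, Matrix.mul_smul, tensor_mul, h, tensor_smul, smul_smul]
  congr 1
  rw [Finset.prod_pow_eq_pow_sum, pow_add, pow_add, pow_mul, Complex.I_sq]
  ring

theorem I_pow_congr {a b : ℕ} (h : a % 4 = b % 4) : Complex.I ^ a = Complex.I ^ b := by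
  rw [Complex.I_pow_eq_pow_mod a, Complex.I_pow_eq_pow_mod b, h]

theorem word_congr {m : ℕ} {φ φ' : ℕ} {x z x' z' : Fin m → ℕ} (hφ : φ % 4 = φ' % 4)
    (hx : ∀ i, x i % 2 = x' i % 2) (hz : ∀ i, z i % 2 = z' i % 2) :
    word φ x z = word φ' x' z' := by
  simp only [word, I_pow_congr hφ, pow_eq_of_sq matX_sq (hx _), pow_eq_of_sq matZ_sq (hz _)]

theorem word_zero {m : ℕ} : word (m := m) 0 (fun _ => 0) (fun _ => 0) = 1 := by
  simp [word, tensor_one]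

/-- Every word has an inverse that is again a word. -/
theorem word_ne_zero {m : ℕ} (φ : ℕ) (x z : Fin m → ℕ) : word φ x z ≠ 0 := by
  intro h
  -- The exponent of the second factor makes the total phase `4φ + 4 ∑ z x`, which vanishes modulo
  -- `4`; all other exponents double.
  have h1 := word_mul φ (3 * (φ + 0) + 2 * ∑ i, z i * x i) x z x z
  rw [h, zero_mul] at h1
  have h2 : word (φ + (3 * (φ + 0) + 2 * ∑ i, z i * x i) + 2 * ∑ i, z i * x i)
      (fun i => x i + x i) (fun i => z i + z i) = 1 := by
    rw [← word_zero]
    exact word_congr (by omega) (fun i => by omega) (fun i => by omega)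
  rw [h2] at h1
  exact zero_ne_one h1

/-- The two products are the same word up to the sign given by the symplectic form. If the parities
differed, a word would equal its own negative, hence be zero. -/
theorem word_commute {m : ℕ} {φ φ' : ℕ} {x z x' z' : Fin m → ℕ}
    (h : word φ x z * word φ' x' z' = word φ' x' z' * word φ x z) :
    (∑ i, z i * x' i) % 2 = (∑ i, z' i * x i) % 2 := by
  rw [word_mul, word_mul] at h
  by_contra hne
  have h2 : word (φ' + φ + 2 * ∑ i, z' i * x i) (fun i => x' i + x i) (fun i => z' i + z i) =
      -word (φ + φ' + 2 * ∑ i, z i * x' i) (fun i => x i + x' i) (fun i => z i + z' i) := by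
    have : ∀ (a : ℕ) (u v : Fin m → ℕ), -word a u v = word (a + 2) u v := by
      intro a u v
      simp [word, pow_add]
    rw [this]
    exact word_congr (by omega) (fun i => by omega) (fun i => by omega)
  rw [h2] at h
  have h3 := add_eq_zero_iff_eq_neg.2 h
  rw [← two_smul ℂ] at h3
  exact word_ne_zero _ _ _ ((smul_eq_zero.1 h3).resolve_left two_ne_zero)

theorem update_tensor_mul {m : ℕ} (q : Fin m) (U : Matrix (Fin 2) (Fin 2) ℂ)
    (M N : Fin m → Matrix (Fin 2) (Fin 2) ℂ) (h : ∀ i, i ≠ q → M i = N i)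
    (hq : U * M q = N q * U) :
    tensor (Function.update (fun _ => 1) q U) * tensor M =
      tensor N * tensor (Function.update (fun _ => 1) q U) := by
  rw [tensor_mul, tensor_mul]
  congr 1
  funext i
  by_cases hi : i = q
  · subst hi; simpa using hq
  · simp [Function.update_of_ne hi, h i hi]

theorem hadamard_X : hadamardMat * matX = matZ * hadamardMat := by
  ext i j; fin_cases i <;> fin_cases j <;>
    simp [hadamardMat, matX, matZ, Pauli.mat, Matrix.mul_apply]
theorem hadamard_Z : hadamardMat * matZ = matX * hadamardMat := by
  ext i j; fin_cases i <;> fin_cases j <;>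
    simp [hadamardMat, matX, matZ, Pauli.mat, Matrix.mul_apply]
theorem phase_X : phaseMat * matX = (Complex.I • (matX * matZ)) * phaseMat := by
  ext i j; fin_cases i <;> fin_cases j <;>
    simp [phaseMat, matX, matZ, Pauli.mat, Matrix.mul_apply]
theorem phase_Z : phaseMat * matZ = matZ * phaseMat := by
  ext i j; fin_cases i <;> fin_cases j <;>
    simp [phaseMat, matZ, Pauli.mat, Matrix.mul_apply]

/-- Conjugation exchanges `X` and `Z`; restoring the normal order `X` before `Z` costs the sign
`(-1)^(x z)`. -/
theorem gateH_word {m : ℕ} (q : Fin m) (φ : ℕ) (x z : Fin m → ℕ) :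
    (Gate.H q).mat * word φ x z =
      word (φ + 2 * (x q * z q)) (Function.update x q (z q)) (Function.update z q (x q)) *
        (Gate.H q).mat := by
  have e1 : ∀ y, hadamardMat * matX ^ y = matZ ^ y * hadamardMat := fun y =>
    (SemiconjBy.pow_right (show SemiconjBy hadamardMat matX matZ from hadamard_X) y)
  have e2 : ∀ y, hadamardMat * matZ ^ y = matX ^ y * hadamardMat := fun y =>
    (SemiconjBy.pow_right (show SemiconjBy hadamardMat matZ matX from hadamard_Z) y)
  have key : word (φ + 2 * (x q * z q)) (Function.update x q (z q)) (Function.update z q (x q)) =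
      Complex.I ^ φ • tensor (Function.update (fun i => matX ^ x i * matZ ^ z i) q
        (matZ ^ x q * matX ^ z q)) := by
    rw [word, pow_add, mul_smul, pow_mul, Complex.I_sq]
    congr 1
    rw [matZ_pow_mul_matX_pow]
    have := tensor_smul (Function.update (fun _ => (1 : ℂ)) q ((-1) ^ (x q * z q)))
      (fun i => matX ^ Function.update x q (z q) i * matZ ^ Function.update z q (x q) i)
    rw [Finset.prod_update_of_mem (Finset.mem_univ q), Finset.prod_const_one, mul_one] at this
    rw [← this]
    congr 1
    funext i
    by_cases hi : i = q
    · subst hi; simp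
    · simp [Function.update_of_ne hi]
  rw [key, word, Matrix.mul_smul, Matrix.smul_mul, Gate.mat]
  congr 1
  refine update_tensor_mul q _ _ _ (fun i hi => by simp [Function.update_of_ne hi]) ?_
  rw [Function.update_self, ← mul_assoc, e1, mul_assoc, e2, mul_assoc]

/-- Conjugation sends `X` to `i X Z`. The exponent has to be reduced modulo `2` before it enters the
phase: `X^2` is the identity and must not contribute `i^2`. -/
theorem gateS_word {m : ℕ} (q : Fin m) (φ : ℕ) (x z : Fin m → ℕ) :
    (Gate.S q).mat * word φ x z =
      word (φ + x q % 2) x (Function.update z q (z q + x q)) * (Gate.S q).mat := by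
  have e2 : ∀ y, phaseMat * matZ ^ y = matZ ^ y * phaseMat := fun y =>
    (SemiconjBy.pow_right (show SemiconjBy phaseMat matZ matZ from phase_Z) y)
  have e1 : phaseMat * matX ^ x q =
      (Complex.I ^ (x q % 2)) • (matX ^ x q * matZ ^ x q) * phaseMat := by
    rw [pow_eq_of_sq matX_sq (Nat.mod_mod (x q) 2).symm,
      pow_eq_of_sq matZ_sq (Nat.mod_mod (x q) 2).symm]
    rcases Nat.mod_two_eq_zero_or_one (x q) with h | h
    · simp [h]
    · simpa [h] using phase_X
  have key : word (φ + x q % 2) x (Function.update z q (z q + x q)) =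
      Complex.I ^ φ • tensor (Function.update (fun i => matX ^ x i * matZ ^ z i) q
        (Complex.I ^ (x q % 2) • (matX ^ x q * matZ ^ (z q + x q)))) := by
    rw [word, pow_add, mul_smul]
    congr 1
    have := tensor_smul (Function.update (fun _ => (1 : ℂ)) q (Complex.I ^ (x q % 2)))
      (fun i => matX ^ x i * matZ ^ Function.update z q (z q + x q) i)
    rw [Finset.prod_update_of_mem (Finset.mem_univ q), Finset.prod_const_one, mul_one] at this
    rw [← this]
    congr 1
    funext i
    by_cases hi : i = q
    · subst hi; simp
    · simp [Function.update_of_ne hi]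
  rw [key, word, Matrix.mul_smul, Matrix.smul_mul, Gate.mat]
  congr 1
  refine update_tensor_mul q _ _ _ (fun i hi => by simp [Function.update_of_ne hi]) ?_
  rw [Function.update_self, ← mul_assoc, e1, mul_assoc, e2, ← mul_assoc, add_comm, pow_add]
  simp only [Matrix.smul_mul, mul_assoc]

/-- Entries of a word. -/
theorem word_apply {m : ℕ} (φ : ℕ) (x z : Fin m → ℕ) (u y : Fin m → Fin 2) :
    word φ x z u y = if (∀ i, u i = y i + Fin.ofNat 2 (x i)) then
      Complex.I ^ φ * (-1) ^ ∑ i, z i * (y i : ℕ) else 0 := by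
  have hZ : ∀ (a : ℕ), matZ ^ a = !![1, 0; 0, (-1) ^ a] := by
    intro a
    induction a with
    | zero => ext i j; fin_cases i <;> fin_cases j <;> simp
    | succ a ih =>
      rw [pow_succ, ih]
      ext i j
      fin_cases i <;> fin_cases j <;> simp [matZ, Pauli.mat, Matrix.mul_apply, pow_succ]
  have h1 : ∀ (a b : ℕ) (s t : Fin 2), (matX ^ a * matZ ^ b) s t =
      if s = t + Fin.ofNat 2 a then (-1 : ℂ) ^ (b * (t : ℕ)) else 0 := by
    intro a b s t
    have ha : (Fin.ofNat 2 a) = Fin.ofNat 2 (a % 2) := by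
      ext; simp
    rw [hZ, pow_eq_of_sq matX_sq (Nat.mod_mod a 2).symm, ha]
    rcases Nat.mod_two_eq_zero_or_one a with h | h <;> rw [h] <;> fin_cases s <;> fin_cases t <;>
      simp [matX, Pauli.mat, Matrix.mul_apply]
  simp only [word, Matrix.smul_apply, tensor, Matrix.of_apply, h1, smul_eq_mul]
  split_ifs with h
  · rw [← Finset.prod_pow_eq_pow_sum]
    congr 1
    exact Finset.prod_congr rfl fun i _ => if_pos (h i)
  · push Not at h
    obtain ⟨i, hi⟩ := h
    rw [Finset.prod_eq_zero (Finset.mem_univ i) (if_neg hi), mul_zero]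

/-- The gate is not a tensor product of single-qubit operators, so entries are compared. It permutes
basis states by an involution `f`, and moving `f` to the other side acts on the exponents of `X` as
`f` does and on the exponents of `Z` by the transpose. -/
theorem gateCNOT_word {m : ℕ} (c t : Fin m) (h : c ≠ t) (φ : ℕ) (x z : Fin m → ℕ) :
    (Gate.CNOT c t h).mat * word φ x z =
      word φ (Function.update x t (x t + x c)) (Function.update z c (z c + z t)) *
        (Gate.CNOT c t h).mat := by
  set f : (Fin m → Fin 2) → (Fin m → Fin 2) := fun y => Function.update y t (y t + y c) with hf
  have ff : ∀ y, f (f y) = y := by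
    intro y
    funext i
    by_cases hi : i = t
    · subst hi
      have : ∀ a b : Fin 2, a + b + b = a := by decide
      simp [hf, Function.update_of_ne h, this]
    · simp [hf, Function.update_of_ne hi]
  ext u y
  rw [Matrix.mul_apply, Matrix.mul_apply]
  have e1 : ∀ w, (Gate.CNOT c t h).mat u w = if w = f u then 1 else 0 := by
    intro w
    simp only [Gate.mat, Matrix.of_apply]
    congr 1
    exact propext ⟨fun e => by rw [e]; exact (ff w).symm, fun e => by rw [e]; exact (ff u).symm⟩
  have e2 : ∀ w, (Gate.CNOT c t h).mat w y = if w = f y then 1 else 0 := fun w => rfl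
  simp only [e1, e2, ite_mul, one_mul, zero_mul, mul_ite, mul_one, mul_zero,
    Finset.sum_ite_eq', Finset.mem_univ, if_true]
  rw [word_apply, word_apply]
  have hcond : (∀ i, f u i = y i + Fin.ofNat 2 (x i)) ↔
      ∀ i, u i = f y i + Fin.ofNat 2 (Function.update x t (x t + x c) i) := by
    have hadd : ∀ a b : ℕ, Fin.ofNat 2 (a + b) = Fin.ofNat 2 a + Fin.ofNat 2 b := by
      intro a b; ext; simp [Fin.val_add]
    have a1 : ∀ p q r s v : Fin 2, p + s = q + v → s = r → p = q + v + r := by decide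
    constructor
    · intro hu i
      by_cases hi : i = t
      · subst hi
        have k1 := hu i
        have k2 := hu c
        simp only [hf, Function.update_self, Function.update_of_ne h] at k1 k2 ⊢
        rw [hadd]
        revert k1 k2
        generalize u i = a; generalize u c = b; generalize y i = a'; generalize y c = b'
        generalize Fin.ofNat 2 (x i) = p; generalize Fin.ofNat 2 (x c) = q
        revert a b a' b' p q; decide
      · have k1 := hu i
        simp only [hf, Function.update_of_ne hi] at k1 ⊢
        exact k1
    · intro hu i
      by_cases hi : i = t
      · subst hi
        have k1 := hu i
        have k2 := hu c
        simp only [hf, Function.update_self, Function.update_of_ne h] at k1 k2 ⊢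
        rw [hadd] at k1
        revert k1 k2
        generalize u i = a; generalize u c = b; generalize y i = a'; generalize y c = b'
        generalize Fin.ofNat 2 (x i) = p; generalize Fin.ofNat 2 (x c) = q
        revert a b a' b' p q; decide
      · have k1 := hu i
        simp only [hf, Function.update_of_ne hi] at k1 ⊢
        exact k1
  -- The exponents differ by `2 * z t * y c` modulo reductions of bits, which does not affect the
  -- sign.
  have hsum : ((-1 : ℂ)) ^ ∑ i, z i * (y i : ℕ) =
      (-1) ^ ∑ i, Function.update z c (z c + z t) i * (f y i : ℕ) := by
    rw [← Finset.prod_pow_eq_pow_sum, ← Finset.prod_pow_eq_pow_sum]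
    have hct : c ∈ Finset.univ.erase t := Finset.mem_erase.2 ⟨h, Finset.mem_univ _⟩
    rw [← Finset.mul_prod_erase _ _ (Finset.mem_univ t), ← Finset.mul_prod_erase _ _ hct,
      ← Finset.mul_prod_erase _ _ (Finset.mem_univ t), ← Finset.mul_prod_erase _ _ hct,
      ← mul_assoc, ← mul_assoc]
    congr 1
    · simp only [hf, Function.update_self, Function.update_of_ne h, Function.update_of_ne h.symm]
      generalize y t = a; generalize y c = b
      fin_cases a <;> fin_cases b <;> simp [pow_add]
      · rw [mul_left_comm, ← pow_add, ← two_mul, pow_mul]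
        simp
      · rw [mul_comm]
    · refine Finset.prod_congr rfl fun i hi => ?_
      simp only [Finset.mem_erase] at hi
      simp only [hf, Function.update_of_ne hi.1, Function.update_of_ne hi.2.1]
  simp only [hcond, hsum]

/-! ## Two copies -/

/-- The tensor product of operators on the two copies. -/
def kron {n : ℕ} (A B : Op n) : Op (n + n) := Matrix.of fun x y =>
  A (fun i => x (Fin.castAdd n i)) (fun i => y (Fin.castAdd n i)) *
    B (fun i => x (Fin.natAdd n i)) (fun i => y (Fin.natAdd n i))

theorem kron_eq {n : ℕ} (A B : Op n) : kron A B = (Matrix.kronecker A B).submatrix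
    (Fin.appendEquiv (α := Fin 2) n n).symm (Fin.appendEquiv (α := Fin 2) n n).symm := rfl

theorem kron_mul {n : ℕ} (A B C D : Op n) : kron A B * kron C D = kron (A * C) (B * D) := by
  rw [kron_eq, kron_eq, kron_eq, Matrix.submatrix_mul_equiv]
  congr 1
  exact (Matrix.mul_kronecker_mul A C B D).symm

theorem trace_kron {n : ℕ} (A B : Op n) : (kron A B).trace = A.trace * B.trace := by
  rw [← Matrix.trace_kronecker, kron_eq]
  exact Equiv.sum_comp (Fin.appendEquiv (α := Fin 2) n n).symm
    (fun p => (Matrix.kronecker A B) p p)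

theorem kron_one {n : ℕ} : kron (1 : Op n) 1 = 1 := by
  rw [kron_eq]
  have : Matrix.kronecker (1 : Op n) (1 : Op n) = 1 := Matrix.one_kronecker_one
  rw [this, Matrix.submatrix_one_equiv]

theorem kron_word {n : ℕ} (φ φ' : ℕ) (x z x' z' : Fin n → ℕ) :
    kron (word φ x z) (word φ' x' z') =
      word (φ + φ') (Fin.append x x') (Fin.append z z') := by
  ext u y
  simp only [kron, Matrix.of_apply, word, Matrix.smul_apply, tensor, smul_eq_mul,
    Fin.prod_univ_add, Fin.append_left, Fin.append_right, pow_add]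
  ring

/-- The second copy contributes the factor `Tr ρ = 1`. -/
theorem trace_kron_one_mul {n : ℕ} (A : Op n) (ρ : DensityMatrix n) :
    (kron A 1 * twoCopies ρ).trace = (A * ρ.mat).trace := by
  rw [show twoCopies ρ = kron ρ.mat ρ.mat from rfl, kron_mul, trace_kron, one_mul,
    ρ.trace_eq_one, mul_one]

theorem trace_kron_self_mul {n : ℕ} (A : Op n) (ρ : DensityMatrix n) :
    (kron A A * twoCopies ρ).trace = (A * ρ.mat).trace ^ 2 := by
  rw [show twoCopies ρ = kron ρ.mat ρ.mat from rfl, kron_mul, trace_kron, sq]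

theorem bornWeight_toReal {n : ℕ} (ρ : DensityMatrix n) (L : List (Gate (n + n)))
    (y : Fin (n + n) → Fin 2) : ((bornWeight ρ L y).toReal : ℂ) =
      (circuitMat L * twoCopies ρ * (circuitMat L)ᴴ) y y := by
  have hp : (circuitMat L * twoCopies ρ * (circuitMat L)ᴴ).PosSemidef :=
    (twoCopies_posSemidef ρ).mul_mul_conjTranspose_same _
  obtain ⟨h1, h2⟩ := Complex.le_def.mp (hp.diag_nonneg (i := y))
  rw [bornWeight, ENNReal.toReal_ofReal h1]
  exact Complex.ext rfl h2

/-- The expectation value of an operator that a circuit makes diagonal. -/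
theorem trace_eq_sum_born {n : ℕ} (ρ : DensityMatrix n) (L : List (Gate (n + n)))
    {A : Op (n + n)} {φ : ℕ} {x z : Fin (n + n) → ℕ}
    (h : circuitMat L * A = word φ x z * circuitMat L) (hx : ∀ i, x i % 2 = 0) :
    (A * twoCopies ρ).trace = ∑ y, ((bornWeight ρ L y).toReal : ℂ) *
      (Complex.I ^ φ * (-1) ^ ∑ i, z i * (y i : ℕ)) := by
  have hU := circuitMat_unitary L
  have h1 : A * twoCopies ρ = (circuitMat L)ᴴ * (word φ x z * circuitMat L * twoCopies ρ) := by
    rw [← h]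
    simp only [← Matrix.mul_assoc]
    rw [hU, Matrix.one_mul]
  -- A word without factors `X` is diagonal, so its trace against the rotated state only sees the
  -- diagonal entries, which are the Born weights.
  have hdiag : word φ x z = Matrix.diagonal fun y : Fin (n + n) → Fin 2 =>
      Complex.I ^ φ * (-1) ^ ∑ i, z i * (y i : ℕ) := by
    ext u y
    rw [word_apply, Matrix.diagonal_apply]
    have h0 : ∀ i, Fin.ofNat 2 (x i) = 0 := fun i => by
      ext; simpa using hx i
    simp only [h0, add_zero]
    by_cases e : u = y
    · subst e; simp
    · rw [if_neg e, if_neg (fun h => e (funext h))]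
  rw [h1, Matrix.trace_mul_comm, hdiag]
  simp only [Matrix.mul_assoc, Matrix.trace, Matrix.diag_apply, Matrix.diagonal_mul]
  exact Finset.sum_congr rfl fun y _ => by
    rw [bornWeight_toReal, Matrix.mul_assoc, mul_comm]

/-! ## Majorana monomials -/

/-- Exponent of `X` in a Pauli operator. -/
def Pauli.xBit : Pauli → ℕ
  | .X => 1
  | .Y => 1
  | _ => 0
/-- Exponent of `Z` in a Pauli operator. -/
def Pauli.zBit : Pauli → ℕ
  | .Y => 1
  | .Z => 1
  | _ => 0
/-- Exponent of `i` in a Pauli operator. -/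
def Pauli.phase : Pauli → ℕ
  | .Y => 1
  | _ => 0

theorem Pauli.mat_eq (P : Pauli) :
    P.mat = Complex.I ^ P.phase • (matX ^ P.xBit * matZ ^ P.zBit) := by
  cases P <;> simp [Pauli.phase, Pauli.xBit, Pauli.zBit, matX, matZ]
  · rfl
  · ext i j; fin_cases i <;> fin_cases j <;> simp [Pauli.mat]

theorem pauliOp_eq_word {n : ℕ} (P : Fin n → Pauli) :
    pauliOp P = word (∑ i, (P i).phase) (fun i => (P i).xBit) (fun i => (P i).zBit) := by
  rw [pauliOp, word, ← Finset.prod_pow_eq_pow_sum, ← tensor_smul]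
  simp only [Pauli.mat_eq]

theorem Pauli.mat_hermitian (P : Pauli) : P.matᴴ = P.mat := by
  cases P <;> ext i j <;> fin_cases i <;> fin_cases j <;>
    simp [Pauli.mat, Matrix.conjTranspose_apply]

theorem pauliOp_hermitian {n : ℕ} (P : Fin n → Pauli) : (pauliOp P)ᴴ = pauliOp P := by
  rw [pauliOp, tensor_conjTranspose]
  simp only [Pauli.mat_hermitian]

section
variable {n : ℕ} {c : Fin (2 * n) → Fin n → Pauli}

/-- The product of the Majorana operators with the indices in a list. -/
def majProd (c : Fin (2 * n) → Fin n → Pauli) (l : List (Fin (2 * n))) : Op n :=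
  (l.map fun a => pauliOp (c a)).prod

theorem IsMajorana.sq (hc : IsMajorana c) (a : Fin (2 * n)) :
    pauliOp (c a) * pauliOp (c a) = 1 := by
  have h := hc a a
  rw [if_pos rfl, ← two_smul ℂ] at h
  exact smul_right_injective _ (two_ne_zero (α := ℂ)) h

theorem IsMajorana.anticomm (hc : IsMajorana c) {a b : Fin (2 * n)} (h : a ≠ b) :
    pauliOp (c a) * pauliOp (c b) = -(pauliOp (c b) * pauliOp (c a)) := by
  have := hc a b
  rw [if_neg h] at this
  exact add_eq_zero_iff_eq_neg.1 this

/-- Every factor different from `c a` contributes a sign; `c a` itself, which occurs at most once,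
contributes none, and the indicator in the exponent corrects for it. -/
theorem IsMajorana.mul_majProd (hc : IsMajorana c) (a : Fin (2 * n)) {l : List (Fin (2 * n))}
    (hl : l.Nodup) : pauliOp (c a) * majProd c l =
      ((-1 : ℂ) ^ (l.length + if a ∈ l then 1 else 0)) • (majProd c l * pauliOp (c a)) := by
  induction l with
  | nil => simp [majProd]
  | cons b l ih =>
    have ih := ih (List.nodup_cons.1 hl).2
    have e : majProd c (b :: l) = pauliOp (c b) * majProd c l := by simp [majProd]
    rw [e]
    by_cases hab : a = b
    · subst hab
      rw [if_neg (List.nodup_cons.1 hl).1, add_zero] at ih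
      rw [if_pos (by simp)]
      have h1 : (-1 : ℂ) ^ ((a :: l).length + 1) = (-1) ^ l.length := by
        rw [List.length_cons, pow_succ, pow_succ]; ring
      have h2 : pauliOp (c a) * majProd c l * pauliOp (c a) =
          ((-1 : ℂ) ^ l.length) • majProd c l := by
        rw [ih, smul_mul_assoc, mul_assoc, hc.sq, mul_one]
      rw [h1, h2, smul_smul, ← mul_pow, ← mul_assoc, hc.sq]
      simp
    · have hmem : (if a ∈ b :: l then 1 else 0) = if a ∈ l then 1 else 0 := by
        simp [hab]
      rw [hmem, ← mul_assoc, hc.anticomm hab, neg_mul, mul_assoc, ih, List.length_cons,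
        add_right_comm, pow_succ, mul_neg_one, neg_smul, Matrix.mul_smul, mul_assoc]

theorem IsMajorana.majProd_mul (hc : IsMajorana c) {l l' : List (Fin (2 * n))}
    (hl : l'.Nodup) : majProd c l * majProd c l' =
      ((-1 : ℂ) ^ (l.length * l'.length + (l.filter (· ∈ l')).length)) •
        (majProd c l' * majProd c l) := by
  induction l with
  | nil => simp [majProd]
  | cons a l ih =>
    have e : majProd c (a :: l) = pauliOp (c a) * majProd c l := by simp [majProd]
    rw [e, mul_assoc, ih, Matrix.mul_smul, ← mul_assoc, hc.mul_majProd a hl, smul_mul_assoc,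
      smul_smul, mul_assoc, ← pow_add]
    congr 2
    rw [List.length_cons, List.filter_cons]
    by_cases h : a ∈ l' <;> simp [h] <;> ring

theorem IsMajorana.majProd_reverse (hc : IsMajorana c) {l : List (Fin (2 * n))}
    (hl : l.Nodup) : majProd c l.reverse =
      ((-1 : ℂ) ^ (l.length * (l.length - 1) / 2)) • majProd c l := by
  induction l with
  | nil => simp [majProd]
  | cons a l ih =>
    have hl' := List.nodup_cons.1 hl
    have e : majProd c (a :: l) = pauliOp (c a) * majProd c l := by simp [majProd]
    have e2 : majProd c (a :: l).reverse = majProd c l.reverse * pauliOp (c a) := by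
      simp [majProd]
    rw [e2, ih hl'.2, e, hc.mul_majProd a hl'.2, if_neg hl'.1, smul_smul, List.length_cons,
      Nat.triangle_succ, pow_add, smul_mul_assoc, mul_assoc, add_zero, ← mul_pow]
    simp

theorem IsMajorana.majProd_reverse_mul (hc : IsMajorana c) (l : List (Fin (2 * n))) :
    majProd c l.reverse * majProd c l = 1 := by
  induction l with
  | nil => simp [majProd]
  | cons a l ih =>
    have e : majProd c (a :: l) = pauliOp (c a) * majProd c l := by simp [majProd]
    have e2 : majProd c (a :: l).reverse = majProd c l.reverse * pauliOp (c a) := by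
      simp [majProd]
    rw [e, e2, mul_assoc, ← mul_assoc (pauliOp (c a)), hc.sq, one_mul, ih]

theorem majProd_conjTranspose (c : Fin (2 * n) → Fin n → Pauli) (l : List (Fin (2 * n))) :
    (majProd c l)ᴴ = majProd c l.reverse := by
  induction l with
  | nil => simp [majProd]
  | cons a l ih =>
    have e : majProd c (a :: l) = pauliOp (c a) * majProd c l := by simp [majProd]
    have e2 : majProd c (a :: l).reverse = majProd c l.reverse * pauliOp (c a) := by
      simp [majProd]
    rw [e, e2, Matrix.conjTranspose_mul, ih, pauliOp_hermitian]

theorem majoranaMonomial_eq (c : Fin (2 * n) → Fin n → Pauli) (X : Finset (Fin (2 * n))) :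
    majoranaMonomial c X = Complex.I ^ (X.card * (X.card - 1) / 2) • majProd c X.sort := rfl

/-- The phase in the definition of `majoranaMonomial` is chosen for this: its conjugate differs from
it by exactly the sign of reversing the product. -/
theorem IsMajorana.monomial_hermitian (hc : IsMajorana c) (X : Finset (Fin (2 * n))) :
    (majoranaMonomial c X)ᴴ = majoranaMonomial c X := by
  rw [majoranaMonomial_eq, Matrix.conjTranspose_smul, majProd_conjTranspose,
    hc.majProd_reverse (X.sort_nodup _), smul_smul, Finset.length_sort]
  congr 1
  rw [star_pow, ← mul_pow]
  simp

theorem IsMajorana.monomial_sq (hc : IsMajorana c) (X : Finset (Fin (2 * n))) :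
    majoranaMonomial c X * majoranaMonomial c X = 1 := by
  nth_rewrite 1 [← hc.monomial_hermitian X]
  rw [majoranaMonomial_eq, Matrix.conjTranspose_smul, majProd_conjTranspose,
    Matrix.smul_mul, Matrix.mul_smul, hc.majProd_reverse_mul, smul_smul, star_pow, ← mul_pow]
  simp

/-- The general sign is `(-1)^(|X| |Y| + |X ∩ Y|)`, and an even support removes the first summand.
Anticommutation becomes a combinatorial condition on intersections. -/
theorem IsMajorana.monomial_mul (hc : IsMajorana c) {X Y : Finset (Fin (2 * n))} (hY : Even Y.card) :
    majoranaMonomial c X * majoranaMonomial c Y =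
      ((-1 : ℂ) ^ (X ∩ Y).card) • (majoranaMonomial c Y * majoranaMonomial c X) := by
  rw [majoranaMonomial_eq, majoranaMonomial_eq, Matrix.smul_mul, Matrix.mul_smul,
    hc.majProd_mul (Y.sort_nodup _), Matrix.smul_mul, Matrix.mul_smul]
  simp only [smul_smul]
  congr 1
  have h1 : (X.sort.filter (· ∈ Y.sort)).length = (X ∩ Y).card := by
    rw [← List.toFinset_card_of_nodup ((X.sort_nodup _).filter _)]
    congr 1
    ext a
    simp
  rw [h1, Finset.length_sort, Finset.length_sort, pow_add, (hY.mul_left _).neg_one_pow]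
  ring

/-- The expectation value of a Majorana monomial. -/
def expVal (c : Fin (2 * n) → Fin n → Pauli) (ρ : DensityMatrix n) (X : Finset (Fin (2 * n))) :
    ℝ := (majoranaMonomial c X * ρ.mat).trace.re

theorem IsMajorana.trace_eq (hc : IsMajorana c) (ρ : DensityMatrix n)
    (X : Finset (Fin (2 * n))) :
    (majoranaMonomial c X * ρ.mat).trace = expVal c ρ X := by
  refine Complex.ext rfl ?_
  have h : star (majoranaMonomial c X * ρ.mat).trace = (majoranaMonomial c X * ρ.mat).trace := by
    rw [← Matrix.trace_conjTranspose, Matrix.conjTranspose_mul, hc.monomial_hermitian,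
      ρ.posSemidef.isHermitian.eq, Matrix.trace_mul_comm]
  simpa using Complex.conj_eq_iff_im.1 h

/-- The squares of the expectation values of anticommuting observables add up to at most one. -/
theorem IsMajorana.sum_sq_le_one (hc : IsMajorana c) (ρ : DensityMatrix n)
    (F : Finset (Finset (Fin (2 * n))))
    (heven : ∀ X ∈ F, Even X.card)
    (hF : ∀ X ∈ F, ∀ Y ∈ F, X ≠ Y → Odd (X ∩ Y).card) : ∑ X ∈ F, expVal c ρ X ^ 2 ≤ 1 := by
  set A : Finset (Finset (Fin (2 * n))) → Op n :=
    fun G => ∑ X ∈ G, (expVal c ρ X : ℂ) • majoranaMonomial c X with hA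
  -- The cross terms cancel in pairs by anticommutation, so the weighted sum squares to a scalar.
  have hsq : ∀ G ⊆ F, A G * A G = ((∑ X ∈ G, expVal c ρ X ^ 2 : ℝ) : ℂ) • 1 := by
    intro G
    induction G using Finset.induction_on with
    | empty => simp [hA]
    | insert X G hX ih =>
      intro hG
      have hXF : X ∈ F := hG (Finset.mem_insert_self _ _)
      have hGF : G ⊆ F := fun Y hY => hG (Finset.mem_insert_of_mem hY)
      have e : A (insert X G) = (expVal c ρ X : ℂ) • majoranaMonomial c X + A G := by
        simp [hA, Finset.sum_insert hX]
      have hcross : majoranaMonomial c X * A G = -(A G * majoranaMonomial c X) := by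
        simp only [hA, Finset.mul_sum, Finset.sum_mul, ← Finset.sum_neg_distrib]
        refine Finset.sum_congr rfl fun Y hY => ?_
        have hne : X ≠ Y := fun h => hX (h ▸ hY)
        rw [Matrix.mul_smul, hc.monomial_mul (heven Y (hGF hY)),
          (hF X hXF Y (hGF hY) hne).neg_one_pow, Matrix.smul_mul, neg_one_smul, smul_neg]
      rw [e, add_mul, mul_add, mul_add, ih hGF, Finset.sum_insert hX, Matrix.smul_mul,
        Matrix.smul_mul, hcross, Matrix.mul_smul, Matrix.mul_smul, hc.monomial_sq, smul_smul]
      push_cast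
      rw [add_smul, pow_two]
      simp only [smul_neg]
      abel
  set t : ℝ := ∑ X ∈ F, expVal c ρ X ^ 2 with ht
  have hherm : (A F)ᴴ = A F := by
    simp only [hA, Matrix.conjTranspose_sum, Matrix.conjTranspose_smul, hc.monomial_hermitian]
    simp
  have htr : (A F * ρ.mat).trace = t := by
    simp only [hA, Finset.sum_mul, Matrix.trace_sum, Matrix.smul_mul, Matrix.trace_smul,
      hc.trace_eq, ht]
    push_cast
    exact Finset.sum_congr rfl fun X _ => by rw [smul_eq_mul, pow_two]
  -- Nonnegativity of the variance of `A F`: its mean and its second moment are both `t`, so `t - t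
  -- ^ 2 ≥ 0`.
  have hpos := (ρ.posSemidef.mul_mul_conjTranspose_same (A F - (t : ℂ) • 1)).trace_nonneg
  have hB : (A F - (t : ℂ) • (1 : Op n))ᴴ = A F - (t : ℂ) • 1 := by
    rw [Matrix.conjTranspose_sub, hherm, Matrix.conjTranspose_smul, Matrix.conjTranspose_one]
    simp
  have hval : ((A F - (t : ℂ) • 1) * ρ.mat * (A F - (t : ℂ) • (1 : Op n))ᴴ).trace =
      ((t - t ^ 2 : ℝ) : ℂ) := by
    rw [Matrix.trace_mul_comm, hB, ← mul_assoc]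
    have : (A F - (t : ℂ) • (1 : Op n)) * (A F - (t : ℂ) • 1) =
        ((t : ℂ) + (t : ℂ) ^ 2) • 1 - (2 * t : ℂ) • A F := by
      rw [sub_mul, mul_sub, mul_sub, hsq F subset_rfl]
      simp only [Matrix.mul_smul, Matrix.smul_mul, mul_one, one_mul, smul_smul]
      rw [← ht, add_smul, two_mul (t : ℂ), add_smul, pow_two]
      abel
    rw [this, sub_mul, Matrix.trace_sub, Matrix.smul_mul, Matrix.smul_mul, Matrix.trace_smul,
      Matrix.trace_smul, one_mul, htr, ρ.trace_eq_one]
    push_cast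
    simp only [smul_eq_mul]
    ring
  rw [hval] at hpos
  have h0 : 0 ≤ t - t ^ 2 := by exact_mod_cast hpos
  nlinarith

end

/-! ## Enumeration of the observables -/

/-- A digit of a number in base `N`. -/
def dg (N t i : ℕ) : ℕ := t / N ^ i % N

section
variable {N : ℕ}

/-- The address of the cells for a set of indices. -/
def key (X : Finset (Fin N)) : List ℕ := X.sort.map Fin.val

/-- The `i`-th element of a set of indices. -/
def el (X : Finset (Fin N)) (i : ℕ) : ℕ := (key X).getD i 0

/-- The number of a set of indices in the enumeration. -/
def codeOf (X : Finset (Fin N)) : ℕ := Nat.ofDigits N (key X)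

theorem length_key (X : Finset (Fin N)) : (key X).length = X.card := by simp [key]

theorem mem_key {X : Finset (Fin N)} {a : Fin N} : a.val ∈ key X ↔ a ∈ X := by
  simp [key, Fin.val_inj]

theorem lt_of_mem_key {X : Finset (Fin N)} {v : ℕ} (h : v ∈ key X) : v < N := by
  simp only [key, List.mem_map] at h
  obtain ⟨a, -, rfl⟩ := h
  exact a.isLt

theorem sortedLT_key (X : Finset (Fin N)) : (key X).SortedLT := by
  have h := X.sortedLT_sort.pairwise
  exact (h.map Fin.val fun a b hab => hab).sortedLT

theorem key_injective : Function.Injective (key (N := N)) := by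
  intro X Y h
  ext a
  rw [← mem_key, h, mem_key]

theorem key_eq_of_sorted {X : Finset (Fin N)} {l : List ℕ} (hl : l.SortedLT)
    (h : ∀ v, v ∈ l ↔ ∃ a ∈ X, a.val = v) : key X = l := by
  refine (sortedLT_key X).eq_of_mem_iff hl fun v => ?_
  rw [h]
  simp [key]

theorem key_eq_map (X : Finset (Fin N)) : key X = (List.range X.card).map (el X) := by
  refine List.ext_getElem (by simp [length_key]) fun i h1 h2 => ?_
  simp [el, h1]

theorem el_lt {X : Finset (Fin N)} {i : ℕ} (h : i < X.card) : el X i < N := by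
  apply lt_of_mem_key (X := X)
  rw [key_eq_map]
  exact List.mem_map.2 ⟨i, List.mem_range.2 h, rfl⟩

/-- The `i`-th element, as an index. -/
def elF {X : Finset (Fin N)} {i : ℕ} (h : i < X.card) : Fin N := ⟨el X i, el_lt h⟩

theorem elF_mem {X : Finset (Fin N)} {i : ℕ} (h : i < X.card) : elF h ∈ X := by
  rw [← mem_key, key_eq_map]
  exact List.mem_map.2 ⟨i, List.mem_range.2 h, rfl⟩

theorem exists_el {X : Finset (Fin N)} {a : Fin N} (h : a ∈ X) : ∃ i < X.card, el X i = a := by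
  rw [← mem_key, key_eq_map] at h
  simpa using h

theorem el_strictMono {X : Finset (Fin N)} {i j : ℕ} (hij : i < j) (hj : j < X.card) :
    el X i < el X j := by
  have hj' : j < (key X).length := by rwa [length_key]
  have := (sortedLT_key X).pairwise.rel_get_of_lt (a := ⟨i, hij.trans hj'⟩) (b := ⟨j, hj'⟩) hij
  simpa [el, hij.trans hj', hj'] using this

theorem el_inj {X : Finset (Fin N)} {i j : ℕ} (hi : i < X.card) (hj : j < X.card)
    (h : el X i = el X j) : i = j := by
  rcases lt_trichotomy i j with h' | h' | h'
  · exact absurd h (el_strictMono h' hj).ne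
  · exact h'
  · exact absurd h (el_strictMono h' hi).ne'

theorem ofDigits_div_mod {l : List ℕ} (hl : ∀ v ∈ l, v < N) (i : ℕ) :
    Nat.ofDigits N l / N ^ i % N = l.getD i 0 := by
  induction l generalizing i with
  | nil => simp
  | cons a l ih =>
    have ha : a < N := hl a (by simp)
    have hN : 0 < N := by omega
    rw [Nat.ofDigits_cons]
    cases i with
    | zero => simp [Nat.mod_eq_of_lt ha]
    | succ i =>
      rw [pow_succ', ← Nat.div_div_eq_div_mul, Nat.add_mul_div_left _ _ hN, Nat.div_eq_of_lt ha,
        zero_add]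
      simpa using ih (fun v hv => hl v (by simp [hv])) i

theorem dg_codeOf (X : Finset (Fin N)) (i : ℕ) : dg N (codeOf X) i = el X i :=
  ofDigits_div_mod (fun _ => lt_of_mem_key) i

theorem codeOf_lt (hN : 1 < N) (X : Finset (Fin N)) : codeOf X < N ^ X.card := by
  rw [← length_key]
  exact Nat.ofDigits_lt_base_pow_length hN fun _ => lt_of_mem_key

theorem codeOf_inj {X Y : Finset (Fin N)} (hc : X.card = Y.card) (h : codeOf X = codeOf Y) :
    X = Y := by
  apply key_injective
  rw [key_eq_map, key_eq_map, hc]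
  refine List.map_congr_left fun i _ => ?_
  rw [← dg_codeOf, h, dg_codeOf]

theorem ofDigits_map_dg {d t : ℕ} (ht : t < N ^ d) :
    Nat.ofDigits N ((List.range d).map (dg N t)) = t := by
  induction d generalizing t with
  | zero => simp at ht; simp [ht]
  | succ d ih =>
    have e : ∀ i, dg N t (i + 1) = dg N (t / N) i := fun i => by
      simp only [dg]
      rw [pow_succ', Nat.div_div_eq_div_mul]
    have h : t / N < N ^ d := Nat.div_lt_of_lt_mul (by rwa [← pow_succ'])
    rw [List.range_succ_eq_map, List.map_cons, List.map_map, Nat.ofDigits_cons]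
    have e' : dg N t ∘ Nat.succ = dg N (t / N) := funext e
    rw [e', ih h]
    simp [dg, Nat.mod_add_div]

/-- Every number with increasing digits is the number of a set of indices. -/
theorem exists_codeOf (hN : 0 < N) {d t : ℕ} (ht : t < N ^ d)
    (h : ∀ i, i + 1 < d → dg N t i < dg N t (i + 1)) :
    ∃ X : Finset (Fin N), X.card = d ∧ codeOf X = t := by
  set l := (List.range d).map (dg N t) with hl
  have hs : l.SortedLT := by
    rw [List.sortedLT_iff_getElem_lt_getElem_of_lt]
    intro i j hi hj hij
    simp only [hl, List.getElem_map, List.getElem_range, List.length_map, List.length_range]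
      at hi hj ⊢
    obtain ⟨m, rfl⟩ := Nat.exists_eq_add_of_lt hij
    clear hij hi
    induction m with
    | zero => exact h i hj
    | succ m ih => exact (ih (by omega)).trans (h (i + m + 1) hj)
  refine ⟨Finset.univ.filter fun a => a.val ∈ l, ?_⟩
  have hk : key (Finset.univ.filter fun a : Fin N => a.val ∈ l) = l := by
    refine key_eq_of_sorted hs fun v => ⟨fun hv => ?_, ?_⟩
    · have : v < N := by
        simp only [hl, List.mem_map] at hv
        obtain ⟨i, -, rfl⟩ := hv
        exact Nat.mod_lt _ hN
      exact ⟨⟨v, this⟩, by simpa using hv, rfl⟩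
    · rintro ⟨a, ha, rfl⟩
      simpa using ha
  refine ⟨by rw [← length_key, hk]; simp [hl], ?_⟩
  rw [codeOf, hk, hl, ofDigits_map_dg ht]

/-- The elements at the given positions. -/
def subAt (X : Finset (Fin N)) (J : Finset ℕ) : Finset (Fin N) :=
  Finset.univ.filter fun a => ∃ i ∈ J, el X i = a.val

theorem mem_subAt {X : Finset (Fin N)} {J : Finset ℕ} {a : Fin N} :
    a ∈ subAt X J ↔ ∃ i ∈ J, el X i = a := by simp [subAt]

/-- Positions in increasing order pick elements in increasing order. Hence the address that the
program computes depends on the subset alone and not on the observable it was taken from, so that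
all observables containing `A` share the labels for `A`. -/
theorem key_subAt {X : Finset (Fin N)} {J : Finset ℕ} (hJ : J ⊆ Finset.range X.card) :
    key (subAt X J) = J.sort.map (el X) := by
  refine key_eq_of_sorted ?_ fun v => ?_
  · refine (List.pairwise_map.2 ((J.sortedLT_sort.pairwise).imp_of_mem ?_)).sortedLT
    intro i j _ hj hij
    exact el_strictMono hij (Finset.mem_range.1 (hJ (by simpa using hj)))
  · simp only [List.mem_map, Finset.mem_sort, mem_subAt]
    constructor
    · rintro ⟨i, hi, rfl⟩
      exact ⟨⟨el X i, el_lt (Finset.mem_range.1 (hJ hi))⟩, ⟨i, hi, rfl⟩, rfl⟩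
    · rintro ⟨a, ⟨i, hi, h⟩, rfl⟩
      exact ⟨i, hi, h⟩

theorem subAt_range (X : Finset (Fin N)) : subAt X (Finset.range X.card) = X := by
  apply key_injective
  rw [key_subAt subset_rfl, key_eq_map, Finset.sort_range]

theorem card_subAt {X : Finset (Fin N)} {J : Finset ℕ} (hJ : J ⊆ Finset.range X.card) :
    (subAt X J).card = J.card := by
  rw [← length_key, key_subAt hJ]; simp

theorem subAt_subset {X : Finset (Fin N)} {J : Finset ℕ} (hJ : J ⊆ Finset.range X.card) :
    subAt X J ⊆ X := by
  intro a ha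
  obtain ⟨i, hi, h⟩ := mem_subAt.1 ha
  have := elF_mem (Finset.mem_range.1 (hJ hi))
  rwa [show elF (Finset.mem_range.1 (hJ hi)) = a from Fin.ext h] at this

theorem elF_mem_subAt {X : Finset (Fin N)} {J : Finset ℕ} (hJ : J ⊆ Finset.range X.card) {i : ℕ}
    (hi : i < X.card) : elF hi ∈ subAt X J ↔ i ∈ J := by
  rw [mem_subAt]
  constructor
  · rintro ⟨j, hj, h⟩
    rwa [← el_inj (Finset.mem_range.1 (hJ hj)) hi h]
  · exact fun h => ⟨i, h, rfl⟩

theorem exists_subAt {X A : Finset (Fin N)} (h : A ⊆ X) :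
    ∃ J ⊆ Finset.range X.card, subAt X J = A := by
  refine ⟨(Finset.range X.card).filter fun i => ∃ a ∈ A, el X i = a, Finset.filter_subset _ _, ?_⟩
  ext a
  rw [mem_subAt]
  constructor
  · rintro ⟨i, hi, h'⟩
    obtain ⟨-, b, hb, h2⟩ := Finset.mem_filter.1 hi
    rwa [show a = b from Fin.ext (h'.symm.trans h2)]
  · intro ha
    obtain ⟨i, hi, h'⟩ := exists_el (h ha)
    exact ⟨i, Finset.mem_filter.2 ⟨Finset.mem_range.2 hi, a, ha, h'⟩, h'⟩

theorem subAt_injective {X : Finset (Fin N)} {J J' : Finset ℕ} (hJ : J ⊆ Finset.range X.card)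
    (hJ' : J' ⊆ Finset.range X.card) (h : subAt X J = subAt X J') : J = J' := by
  ext i
  by_cases hi : i < X.card
  · rw [← elF_mem_subAt hJ hi, h, elF_mem_subAt hJ' hi]
  · exact ⟨fun h => absurd (Finset.mem_range.1 (hJ h)) hi,
      fun h => absurd (Finset.mem_range.1 (hJ' h)) hi⟩

theorem mem_posSets {k : ℕ} {J : Finset ℕ} (hJ : J ∈ posSets k) :
    J ⊆ Finset.range (2 * k) ∧ Odd J.card := by
  unfold posSets at hJ
  split_ifs at hJ with h
  · simp only [List.mem_singleton] at hJ
    subst hJ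
    simp [h]
  · simpa using hJ

theorem nodup_posSets (k : ℕ) : (posSets k).Nodup := by
  unfold posSets
  split_ifs
  · simp
  · exact Finset.nodup_toList _

theorem mem_coPos {k i : ℕ} {J : Finset ℕ} : i ∈ coPos k J ↔ i < 2 * k ∧ i ∉ J := by
  simp [coPos]

/-! ### Evaluation of the expressions for the current tuple -/

variable {μ : Memory} {k : ℕ} {X : Finset (Fin N)}

theorem eval_dgE (i : ℕ) : (dgE i).eval μ = dg (μ 101 []) (μ 20 []) i := by
  simp [dgE, dg]

theorem eval_incE {d : ℕ} : (incE d).eval μ ≠ 0 ↔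
    ∀ i, i + 1 < d → dg (μ 101 []) (μ 20 []) i < dg (μ 101 []) (μ 20 []) (i + 1) := by
  simp only [incE, eval_prodE, List.map_map, ne_eq, List.prod_eq_zero_iff, List.mem_map,
    List.mem_range, Function.comp_apply, eval_ltE, eval_dgE, not_exists, not_and,
    ite_eq_right_iff, one_ne_zero, imp_false, not_not]
  exact forall_congr' fun i => by rw [Nat.lt_sub_iff_add_lt]

/-- The variables hold the number of a set of indices. -/
def AtTuple (k : ℕ) (X : Finset (Fin N)) (μ : Memory) : Prop :=
  X.card = 2 * k ∧ μ 101 [] = N ∧ μ 20 [] = codeOf X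

theorem AtTuple.eval_dgE (h : AtTuple k X μ) (i : ℕ) : (dgE i).eval μ = el X i := by
  rw [ShadowTomography.eval_dgE, h.2.1, h.2.2, dg_codeOf]

theorem AtTuple.eval_keyE (h : AtTuple k X μ) {J : Finset ℕ} (hJ : J ⊆ Finset.range (2 * k)) :
    (keyE J).map (fun e => e.eval μ) = key (subAt X J) := by
  rw [key_subAt (by rwa [h.1]), keyE, List.map_map]
  exact List.map_congr_left fun i _ => h.eval_dgE i

theorem AtTuple.eval_keyE_range (h : AtTuple k X μ) :
    (keyE (Finset.range (2 * k))).map (fun e => e.eval μ) = key X := by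
  rw [h.eval_keyE subset_rfl, ← h.1, subAt_range]

theorem AtTuple.update (h : AtTuple k X μ) {a : ℕ} (f : List ℕ → ℕ) (h1 : a ≠ 101) (h2 : a ≠ 20) :
    AtTuple k X (Function.update μ a f) := by
  refine ⟨h.1, ?_, ?_⟩
  · rw [Function.update_of_ne h1.symm, h.2.1]
  · rw [Function.update_of_ne h2.symm, h.2.2]

theorem AtTuple.congr {μ' : Memory} (h : AtTuple k X μ) (h1 : μ' 101 = μ 101)
    (h2 : μ' 20 = μ 20) : AtTuple k X μ' :=
  ⟨h.1, by rw [h1, h.2.1], by rw [h2, h.2.2]⟩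

theorem AtTuple.incE (h : AtTuple k X μ) : (incE (2 * k)).eval μ ≠ 0 := by
  rw [eval_incE, h.2.1, h.2.2]
  intro i hi
  rw [dg_codeOf, dg_codeOf]
  exact el_strictMono (Nat.lt_succ_self i) (by rw [h.1]; exact hi)

end

section
variable {n : ℕ}

/-- The rule for loops over the observables. -/
theorem ex_forTuples_induct {N k : ℕ} (hN : 1 < N) {p : Program} {s : Config n}
    (hp : p.Keeps 20) (hs : s.mem 101 [] = N)
    (P : ℕ → Memory → List (Gate (n + n)) → Prop)
    (hv : ∀ t μ f L, P t μ L → P t (Function.update μ 20 f) L)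
    (h0 : P 0 s.mem s.circuit)
    (hpar : ∀ t μ L, P t μ L → μ 101 [] = N)
    (hskip : ∀ t μ L, (∀ X : Finset (Fin N), X.card = 2 * k → codeOf X ≠ t) → P t μ L →
      P (t + 1) μ L)
    (h : ∀ (X : Finset (Fin N)) (s' : Config n), AtTuple k X s'.mem →
      P (codeOf X) s'.mem s'.circuit → P (codeOf X + 1) (p.ex s').mem (p.ex s').circuit) :
    P (N ^ (2 * k)) ((forTuples k p).ex s).mem ((forTuples k p).ex s).circuit := by
  refine ex_forE_induct (p := .ite (incE (2 * k)) p .skip) (by simp [Program.Keeps, hp]) P hv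
    (by simp [hs]) h0 fun t ht s' hs' hP => ?_
  have h101 := hpar _ _ _ hP
  by_cases hinc : (incE (2 * k)).eval s'.mem = 0
  · rw [ex_ite_neg hinc]
    refine hskip t _ _ (fun X hX e => ?_) hP
    exact (AtTuple.incE (k := k) (X := X) ⟨hX, h101, by rw [hs', e]⟩) hinc
  · rw [ex_ite_pos hinc]
    have h1 := eval_incE.1 hinc
    rw [h101, hs'] at h1
    obtain ⟨X, hX, rfl⟩ := exists_codeOf (by omega) ht h1
    exact h X (s'.tick _) ⟨hX, h101, hs'⟩ hP

end

/-! ## The table of the images of the Majorana operators -/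

section
variable {n : ℕ}

/-- The word in the row `a` of the table. -/
def tabWord (n : ℕ) (μ : Memory) (a : ℕ) : Op (n + n) :=
  word (μ 32 [a]) (fun i => if i.val < n then μ 30 [a, i] else 0)
    (fun i => if i.val < n then μ 31 [a, i] else 0)

/-- The table holds the images of the Majorana operators under the circuit. -/
def TabInv (c : Fin (2 * n) → Fin n → Pauli) (μ : Memory) (L : List (Gate (n + n))) : Prop :=
  ∀ a : Fin (2 * n), circuitMat L * kron (pauliOp (c a)) 1 = tabWord n μ a * circuitMat L

/-- The parameters for the size of the problem. -/
def Dims (n : ℕ) (μ : Memory) : Prop := μ 100 [] = n ∧ μ 101 [] = 2 * n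

theorem Dims.congr {μ μ' : Memory} (h : Dims n μ) (h1 : μ' 100 = μ 100) (h2 : μ' 101 = μ 101) :
    Dims n μ' := by rw [Dims, h1, h2]; exact h

theorem Dims.update {μ : Memory} (h : Dims n μ) {a : ℕ} (f : List ℕ → ℕ) (ha : a < 100) :
    Dims n (Function.update μ a f) :=
  h.congr (Function.update_of_ne (by omega) _ _) (Function.update_of_ne (by omega) _ _)

theorem TabInv.congr {c : Fin (2 * n) → Fin n → Pauli} {μ μ' : Memory} {L : List (Gate (n + n))}
    (h : TabInv c μ L) (h1 : μ' 30 = μ 30) (h2 : μ' 31 = μ 31) (h3 : μ' 32 = μ 32) :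
    TabInv c μ' L := by
  intro a
  rw [h a]
  simp only [tabWord, h1, h2, h3]

/-- The input table. -/
def InputTable (c : Fin (2 * n) → Fin n → Pauli) (μ : Memory) : Prop :=
  ∀ (a : Fin (2 * n)) (q : Fin n), μ 3 [a.val, q.val] = (c a q).code

/-- The phases are described modulo `4` only, which is all that a word depends on. -/
theorem resetTable_raw (s : Config n) (hd : Dims n s.mem) :
    ∀ a < 2 * n, (∀ q < n,
      (resetTable.ex s).mem 30 [a, q] = (if s.mem 3 [a, q] = 1 then 1 else 0) +
        (if s.mem 3 [a, q] = 2 then 1 else 0) ∧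
      (resetTable.ex s).mem 31 [a, q] = (if s.mem 3 [a, q] = 2 then 1 else 0) +
        (if s.mem 3 [a, q] = 3 then 1 else 0)) ∧
      (resetTable.ex s).mem 32 [a] % 4 =
        (∑ q ∈ Finset.range n, if s.mem 3 [a, q] = 2 then 1 else 0) % 4 := by
  refine (ex_forE_induct (T := 2 * n) (by simp) (fun t μ _ => Dims n μ ∧ μ 3 = s.mem 3 ∧
    ∀ a < t, (∀ q < n,
      μ 30 [a, q] = (if s.mem 3 [a, q] = 1 then 1 else 0) +
        (if s.mem 3 [a, q] = 2 then 1 else 0) ∧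
      μ 31 [a, q] = (if s.mem 3 [a, q] = 2 then 1 else 0) +
        (if s.mem 3 [a, q] = 3 then 1 else 0)) ∧
      μ 32 [a] % 4 = (∑ q ∈ Finset.range n, if s.mem 3 [a, q] = 2 then 1 else 0) % 4)
    ?_ ?_ ?_ ?_).2.2
  · intro t μ f L h
    refine ⟨h.1.update f (by norm_num), ?_⟩
    simpa using h.2
  · simpa using hd.2
  · exact ⟨hd, rfl, by simp⟩
  · intro t ht s' ht' ⟨hd', h3, hdone⟩
    simp only [seqs, ex_seq, ex_skip_mem]
    have key := ex_forE_induct (v := 43) (e := var 100) (T := n)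
      (p := seqs
      [setE 30 [var 49, var 43]
        (eqE (cellE 3 [var 49, var 43]) 1 + eqE (cellE 3 [var 49, var 43]) 2),
       setE 31 [var 49, var 43]
        (eqE (cellE 3 [var 49, var 43]) 2 + eqE (cellE 3 [var 49, var 43]) 3),
       setE 32 [var 49] ((cellE 32 [var 49] + eqE (cellE 3 [var 49, var 43]) 2) % 4)])
      (s := (((setE 32 [var 49] 0).ex (s'.tick 1)).tick 1)) (by simp)
      (fun u μ _ => Dims n μ ∧ μ 3 = s.mem 3 ∧ μ 49 [] = t ∧
        (∀ a < t, (∀ q < n,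
          μ 30 [a, q] = (if s.mem 3 [a, q] = 1 then 1 else 0) +
            (if s.mem 3 [a, q] = 2 then 1 else 0) ∧
          μ 31 [a, q] = (if s.mem 3 [a, q] = 2 then 1 else 0) +
            (if s.mem 3 [a, q] = 3 then 1 else 0)) ∧
          μ 32 [a] % 4 = (∑ q ∈ Finset.range n, if s.mem 3 [a, q] = 2 then 1 else 0) % 4) ∧
        (∀ q < u, μ 30 [t, q] = (if s.mem 3 [t, q] = 1 then 1 else 0) +
            (if s.mem 3 [t, q] = 2 then 1 else 0) ∧
          μ 31 [t, q] = (if s.mem 3 [t, q] = 2 then 1 else 0) +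
            (if s.mem 3 [t, q] = 3 then 1 else 0)) ∧
        μ 32 [t] % 4 = (∑ q ∈ Finset.range u, if s.mem 3 [t, q] = 2 then 1 else 0) % 4)
      ?_ ?_ ?_ ?_
    · obtain ⟨g1, g2, g3, g4, g5, g6⟩ := key
      refine ⟨g1, g2, fun a ha => ?_⟩
      rcases Nat.lt_succ_iff_lt_or_eq.1 ha with h | rfl
      · exact g4 a h
      · exact ⟨g5, g6⟩
    · intro u μ f L h
      refine ⟨h.1.update f (by norm_num), ?_⟩
      simpa using h.2
    · simpa using hd'.1
    · refine ⟨hd'.congr (by simp) (by simp), by simpa using h3, by simpa using ht', ?_, by simp,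
        by simp [ht']⟩
      intro a ha
      have : a ≠ t := by omega
      simpa [ht', Function.update_apply, this] using hdone a ha
    · intro u hu s2 hu2 ⟨e1, e2, e3, e4, e5, e6⟩
      refine ⟨e1.congr (by simp [seqs]) (by simp [seqs]), by simp [seqs, e2],
        by simp [seqs, e3], ?_, ?_, ?_⟩
      · intro a ha
        have : a ≠ t := by omega
        simpa [seqs, e3, hu2, Function.update_apply, this] using e4 a ha
      · intro q hq
        rcases Nat.lt_succ_iff_lt_or_eq.1 hq with h | rfl
        · have : q ≠ u := by omega
          simpa [seqs, e3, hu2, Function.update_apply, this] using e5 q h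
        · simp [seqs, e3, hu2, e2]
      · rw [Finset.sum_range_succ, Nat.add_mod, ← e6]
        simp [seqs, e3, hu2, e2]

theorem resetTable_spec {c : Fin (2 * n) → Fin n → Pauli} (s : Config n) (hd : Dims n s.mem)
    (hin : InputTable c s.mem) (hs : s.circuit = []) :
    TabInv c (resetTable.ex s).mem (resetTable.ex s).circuit := by
  have hc : (resetTable.ex s).circuit = [] := by
    rw [← hs]
    exact ex_classical (by simp [resetTable]) (by simp [resetTable]) s
  intro a
  rw [hc]
  simp only [circuitMat, List.map_nil, List.prod_nil, one_mul, mul_one]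
  have h1 : (1 : Op n) = word 0 (fun _ => 0) (fun _ => 0) := word_zero.symm
  rw [pauliOp_eq_word, h1, kron_word, tabWord]
  obtain ⟨hrow, hph⟩ := resetTable_raw s hd a a.isLt
  -- `Y = i X Z` contributes to the exponents of `X` and of `Z` and to the phase.
  have hcode : ∀ P : Pauli, P.xBit = (if P.code = 1 then 1 else 0) + (if P.code = 2 then 1 else 0) ∧
      P.zBit = (if P.code = 2 then 1 else 0) + (if P.code = 3 then 1 else 0) ∧
      P.phase = if P.code = 2 then 1 else 0 := by
    intro P
    cases P <;> simp [Pauli.xBit, Pauli.zBit, Pauli.phase, Pauli.code]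
  refine word_congr ?_ (fun i => ?_) (fun i => ?_)
  · simp only [(hcode _).2.2, add_zero]
    rw [hph, Finset.sum_range]
    refine congrArg (· % 4) (Finset.sum_congr rfl fun q _ => ?_)
    rw [hin]
  · refine Fin.addCases (fun q => ?_) (fun q => ?_) i
    · rw [Fin.append_left, Fin.val_castAdd, if_pos q.isLt, (hrow q q.isLt).1, hin, (hcode _).1]
    · rw [Fin.append_right]; simp
  · refine Fin.addCases (fun q => ?_) (fun q => ?_) i
    · rw [Fin.append_left, Fin.val_castAdd, if_pos q.isLt, (hrow q q.isLt).2, hin, (hcode _).2.1]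
    · rw [Fin.append_right]; simp

/-! ### Images of monomials -/

/-- Normal ordering moves the factor `X` of position `t` past the factors `Z` of all earlier
positions; each such crossing on the same qubit is a sign. This is the phase formula that `image`
evaluates. -/
theorem prod_word {m : ℕ} (φ : ℕ → ℕ) (x z : ℕ → Fin m → ℕ) (d : ℕ) :
    ((List.range d).map fun t => word (φ t) (x t) (z t)).prod =
      word ((∑ t ∈ Finset.range d, φ t) +
          2 * ∑ i, ∑ t ∈ Finset.range d, (∑ j ∈ Finset.range t, z j i) * x t i)
        (fun i => ∑ t ∈ Finset.range d, x t i) (fun i => ∑ t ∈ Finset.range d, z t i) := by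
  induction d with
  | zero => simp [word_zero]
  | succ d ih =>
    rw [List.range_succ, List.map_append, List.prod_append, ih]
    simp only [List.map_cons, List.map_nil, List.prod_cons, List.prod_nil, mul_one, word_mul,
      Finset.sum_range_succ, Finset.sum_add_distrib]
    congr 1
    ring

theorem circuitMat_mul_majProd {c : Fin (2 * n) → Fin n → Pauli} {μ : Memory}
    {L : List (Gate (n + n))} (h : TabInv c μ L) (l : List (Fin (2 * n))) :
    circuitMat L * kron (majProd c l) 1 =
      ((l.map Fin.val).map (tabWord n μ)).prod * circuitMat L := by
  induction l with
  | nil => simp [majProd, kron_one]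
  | cons a l ih =>
    have e : kron (majProd c (a :: l)) 1 = kron (pauliOp (c a)) 1 * kron (majProd c l) 1 := by
      rw [kron_mul, mul_one]; simp [majProd]
    rw [e, ← mul_assoc, h a, mul_assoc, ih, ← mul_assoc]
    simp

/-- The parity of an exponent of the image of a monomial. -/
def bit (b : ℕ) (X : Finset (Fin (2 * n))) (μ : Memory) (q : ℕ) : ℕ :=
  (∑ i ∈ Finset.range X.card, μ b [el X i, q]) % 2

/-- The phase of the image of a monomial. -/
def phaseOf (X : Finset (Fin (2 * n))) (μ : Memory) : ℕ :=
  (X.card * (X.card - 1) / 2 + ∑ i ∈ Finset.range X.card, μ 32 [el X i]) +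
    2 * ∑ q ∈ Finset.range n, ∑ t ∈ Finset.range X.card,
      (∑ j ∈ Finset.range t, μ 31 [el X j, q]) * μ 30 [el X t, q]

/-- The image of a monomial. -/
def imageWord (X : Finset (Fin (2 * n))) (μ : Memory) : Op (n + n) :=
  word (phaseOf X μ) (fun i => if i.val < n then bit 30 X μ i else 0)
    (fun i => if i.val < n then bit 31 X μ i else 0)

theorem circuitMat_mul_monomial {c : Fin (2 * n) → Fin n → Pauli} {μ : Memory}
    {L : List (Gate (n + n))} (h : TabInv c μ L) (X : Finset (Fin (2 * n))) :
    circuitMat L * kron (majoranaMonomial c X) 1 = imageWord X μ * circuitMat L := by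
  have e : kron (majoranaMonomial c X) (1 : Op n) =
      Complex.I ^ (X.card * (X.card - 1) / 2) • kron (majProd c X.sort) 1 := by
    rw [majoranaMonomial_eq]
    ext u y
    simp [kron, mul_assoc]
  rw [e, Matrix.mul_smul, circuitMat_mul_majProd h, ← Matrix.smul_mul]
  congr 1
  rw [show (X.sort (fun a b => a ≤ b)).map Fin.val = key X from rfl, key_eq_map, List.map_map]
  have := prod_word (m := n + n) (fun t => μ 32 [el X t])
    (fun t i => if i.val < n then μ 30 [el X t, i] else 0)
    (fun t i => if i.val < n then μ 31 [el X t, i] else 0) X.card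
  rw [show (tabWord n μ ∘ el X) = fun t => word (μ 32 [el X t])
    (fun i => if i.val < n then μ 30 [el X t, i] else 0)
    (fun i => if i.val < n then μ 31 [el X t, i] else 0) from rfl, this]
  rw [word, smul_smul, ← pow_add, ← word, imageWord]
  refine word_congr ?_ (fun i => ?_) (fun i => ?_)
  · rw [phaseOf, ← add_assoc, Fin.sum_univ_add, Finset.sum_range (n := n)]
    simp
  · by_cases hi : i.val < n <;> simp [hi, bit]
  · by_cases hi : i.val < n <;> simp [hi, bit]

theorem sum_list_range {f : ℕ → ℕ} (d : ℕ) :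
    ((List.range d).map f).sum = ∑ i ∈ Finset.range d, f i := by
  induction d with
  | zero => simp
  | succ d ih => rw [List.range_succ, Finset.sum_range_succ, ← ih]; simp

theorem image_spec {k : ℕ} {X : Finset (Fin (2 * n))} (s : Config n) (hd : Dims n s.mem)
    (hX : AtTuple k X s.mem) :
    (∀ q < n, ((image k).ex s).mem 40 [q] = bit 30 X s.mem q ∧
      ((image k).ex s).mem 41 [q] = bit 31 X s.mem q) ∧
    ((image k).ex s).mem 42 [] = phaseOf X s.mem % 4 := by
  have hcard := hX.1
  simp only [image, seqs, ex_seq, ex_skip_mem]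
  have key := ex_forE_induct (v := 43) (e := var 100) (T := n)
    (p := seqs
      [setE 40 [var 43] (sumE ((List.range (2 * k)).map fun i => cellE 30 [dgE i, var 43]) % 2),
       setE 41 [var 43] (sumE ((List.range (2 * k)).map fun i => cellE 31 [dgE i, var 43]) % 2),
       setE 42 [] ((var 42 + 2 * sumE ((List.range (2 * k)).map fun t =>
          sumE ((List.range t).map fun i => cellE 31 [dgE i, var 43]) *
            cellE 30 [dgE t, var 43])) % 4)])
    (s := (((setE 42 [] ((.const (k * (2 * k - 1)) +
      sumE ((List.range (2 * k)).map fun i => cellE 32 [dgE i])) % 4)).ex (s.tick 1)).tick 1))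
    (by simp)
    (fun u μ _ => Dims n μ ∧ AtTuple k X μ ∧ μ 30 = s.mem 30 ∧ μ 31 = s.mem 31 ∧
      (∀ q < u, μ 40 [q] = bit 30 X s.mem q ∧ μ 41 [q] = bit 31 X s.mem q) ∧
      μ 42 [] = ((X.card * (X.card - 1) / 2 + ∑ i ∈ Finset.range X.card, s.mem 32 [el X i]) +
        2 * ∑ q ∈ Finset.range u, ∑ t ∈ Finset.range X.card,
        (∑ j ∈ Finset.range t, s.mem 31 [el X j, q]) * s.mem 30 [el X t, q]) % 4) ?_ ?_ ?_ ?_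
  · obtain ⟨-, -, -, -, g4, g5⟩ := key
    exact ⟨g4, g5⟩
  · intro u μ f L h
    refine ⟨h.1.update f (by norm_num), h.2.1.update f (by norm_num) (by norm_num), ?_⟩
    simpa using h.2.2
  · simpa using hd.1
  · refine ⟨hd.congr (by simp) (by simp), hX.congr (by simp) (by simp), by simp, by simp,
      by simp, ?_⟩
    -- The phase of the monomial in its definition is a constant of the program.
    have : X.card * (X.card - 1) / 2 = k * (2 * k - 1) := by
      rw [hcard, mul_assoc, Nat.mul_div_cancel_left _ (by norm_num)]
    rw [this]
    simp only [ex_setE_mem_self, Config.tick_mem, List.map_nil, Function.update_self, eval_mod,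
      eval_add, eval_const, eval_sumE, List.map_map, eval_ofNat, Finset.range_zero,
      Finset.sum_empty, mul_zero, add_zero]
    rw [hcard, ← sum_list_range]
    have hm : List.map ((fun e => Expr.eval s.mem e) ∘ fun i => cellE 32 [dgE i])
        (List.range (2 * k)) = List.map (fun i => s.mem 32 [el X i]) (List.range (2 * k)) :=
      List.map_congr_left fun i _ => by simp [hX.eval_dgE]
    rw [hm]
  · intro u hu s2 hu2 ⟨e1, e2, e3, e4, e5, e6⟩
    refine ⟨e1.congr (by simp [seqs]) (by simp [seqs]),
      e2.congr (by simp [seqs]) (by simp [seqs]), by simp [seqs, e3], by simp [seqs, e4], ?_, ?_⟩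
    · intro q hq
      rcases Nat.lt_succ_iff_lt_or_eq.1 hq with h | rfl
      · have : q ≠ u := by omega
        simpa [seqs, hu2, Function.update_apply, this] using e5 q h
      · have h1 : ∀ μ : Memory, μ 30 = s.mem 30 → μ 43 [] = q → AtTuple k X μ →
            (sumE ((List.range (2 * k)).map fun i => cellE 30 [dgE i, var 43])).eval μ % 2
              = bit 30 X s.mem q := by
          intro μ h30 h43 hμ
          simp only [eval_sumE, List.map_map, bit, hcard, ← sum_list_range]
          refine congrArg (· % 2) (congrArg List.sum (List.map_congr_left fun i _ => ?_))
          simp [hμ.eval_dgE, h30, h43]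
        have h2 : ∀ μ : Memory, μ 31 = s.mem 31 → μ 43 [] = q → AtTuple k X μ →
            (sumE ((List.range (2 * k)).map fun i => cellE 31 [dgE i, var 43])).eval μ % 2
              = bit 31 X s.mem q := by
          intro μ h30 h43 hμ
          simp only [eval_sumE, List.map_map, bit, hcard, ← sum_list_range]
          refine congrArg (· % 2) (congrArg List.sum (List.map_congr_left fun i _ => ?_))
          simp [hμ.eval_dgE, h30, h43]
        constructor
        · simp only [seqs, ex_seq, ex_skip_mem]
          rw [ex_setE_mem_ne (by norm_num), Config.tick_mem, ex_setE_mem_ne (by norm_num),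
            Config.tick_mem, ex_setE_mem_self]
          simp only [List.map_cons, List.map_nil, eval_var, Config.tick_mem, hu2,
            Function.update_self, eval_mod, eval_ofNat]
          exact h1 _ e3 hu2 e2
        · simp only [seqs, ex_seq, ex_skip_mem]
          rw [ex_setE_mem_ne (by norm_num), Config.tick_mem, ex_setE_mem_self]
          simp only [List.map_cons, List.map_nil, eval_var, Config.tick_mem, eval_mod, eval_ofNat]
          rw [ex_setE_mem_ne (by norm_num : 43 ≠ 40), Config.tick_mem, hu2, Function.update_self]
          refine h2 _ ?_ ?_ ?_
          · simp [e4]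
          · simp [hu2]
          · exact e2.congr (by simp) (by simp)
    · have h3 : ∀ μ : Memory, μ 30 = s.mem 30 → μ 31 = s.mem 31 → μ 43 [] = u → AtTuple k X μ →
          (sumE ((List.range (2 * k)).map fun t =>
            sumE ((List.range t).map fun i => cellE 31 [dgE i, var 43]) *
            cellE 30 [dgE t, var 43])).eval μ = ∑ t ∈ Finset.range X.card,
            (∑ j ∈ Finset.range t, s.mem 31 [el X j, u]) * s.mem 30 [el X t, u] := by
        intro μ h30 h31 h43 hμ
        simp only [eval_sumE, List.map_map, hcard]
        rw [← sum_list_range]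
        refine congrArg List.sum (List.map_congr_left fun t _ => ?_)
        simp only [Function.comp_apply, eval_mul, eval_sumE, List.map_map, eval_cellE,
          List.map_cons, List.map_nil, hμ.eval_dgE, eval_var, h30, h43, ← sum_list_range]
        congr 2
        refine List.map_congr_left fun i _ => ?_
        simp [hμ.eval_dgE, h31, h43]
      simp only [seqs, ex_seq, ex_skip_mem]
      rw [ex_setE_mem_self]
      simp only [List.map_nil, Function.update_self, eval_mod, eval_add, eval_mul, eval_ofNat,
        Config.tick_mem]
      rw [h3 _ (by simp [e3]) (by simp [e4]) (by simp [hu2]) (e2.congr (by simp) (by simp))]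
      rw [Finset.sum_range_succ, mul_add, ← add_assoc]
      simp only [eval_var, ne_eq, Nat.reduceEqDiff, not_false_eq_true, ex_setE_mem_ne, Config.tick_mem]
      rw [e6, Nat.mod_add_mod]

end

/-! ## Gates -/

/-- A row of the table. -/
@[ext] structure Row where
  x : ℕ → ℕ
  z : ℕ → ℕ
  φ : ℕ

/-- The row with the given number. -/
def rowOf (μ : Memory) (a : ℕ) : Row := ⟨fun j => μ 30 [a, j], fun j => μ 31 [a, j], μ 32 [a]⟩

/-- The effect of a Hadamard gate. -/
def Row.H (q : ℕ) (r : Row) : Row :=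
  ⟨Function.update r.x q (r.z q), Function.update r.z q (r.x q), (r.φ + 2 * (r.x q * r.z q)) % 4⟩

/-- The effect of a phase gate. -/
def Row.S (q : ℕ) (r : Row) : Row :=
  ⟨r.x, Function.update r.z q ((r.z q + r.x q) % 2), (r.φ + r.x q % 2) % 4⟩

/-- The effect of a `CNOT` gate. -/
def Row.CNOT (c t : ℕ) (r : Row) : Row :=
  ⟨Function.update r.x t ((r.x t + r.x c) % 2), Function.update r.z c ((r.z c + r.z t) % 2), r.φ⟩

/-- The operator that a row represents. -/
def Row.word (n : ℕ) (r : Row) : Op (n + n) :=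
  ShadowTomography.word r.φ (fun i => if i.val < n then r.x i else 0)
    (fun i => if i.val < n then r.z i else 0)

section
variable {n : ℕ}

theorem tabWord_eq (μ : Memory) (a : ℕ) : tabWord n μ a = (rowOf μ a).word n := rfl

theorem Row.H_word {q : ℕ} (hq : q < n) (r : Row) :
    (Gate.H (⟨q, by omega⟩ : Fin (n + n))).mat * r.word n =
      (r.H q).word n * (Gate.H (⟨q, by omega⟩ : Fin (n + n))).mat := by
  rw [Row.word, gateH_word]
  congr 1
  refine word_congr (by simp [Row.H, hq]) (fun i => ?_) (fun i => ?_)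
  all_goals
    by_cases hi : i = (⟨q, by omega⟩ : Fin (n + n))
    · subst hi; simp [Row.H, hq]
    · have : i.val ≠ q := fun h => hi (Fin.ext h)
      simp [Row.H, Function.update_of_ne hi, Function.update_of_ne this]

theorem Row.S_word {q : ℕ} (hq : q < n) (r : Row) :
    (Gate.S (⟨q, by omega⟩ : Fin (n + n))).mat * r.word n =
      (r.S q).word n * (Gate.S (⟨q, by omega⟩ : Fin (n + n))).mat := by
  rw [Row.word, gateS_word]
  congr 1
  refine word_congr (by simp [Row.S, hq]) (fun i => by simp [Row.S]) (fun i => ?_)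
  by_cases hi : i = (⟨q, by omega⟩ : Fin (n + n))
  · subst hi; simp [Row.S, hq]
  · have : i.val ≠ q := fun h => hi (Fin.ext h)
    simp [Row.S, Function.update_of_ne hi, Function.update_of_ne this]

theorem Row.CNOT_word {u t : ℕ} (hu : u < n) (ht : t < n)
    (h : (⟨u, by omega⟩ : Fin (n + n)) ≠ ⟨t, by omega⟩) (r : Row) :
    (Gate.CNOT (⟨u, by omega⟩ : Fin (n + n)) ⟨t, by omega⟩ h).mat * r.word n =
      (r.CNOT u t).word n * (Gate.CNOT (⟨u, by omega⟩ : Fin (n + n)) ⟨t, by omega⟩ h).mat := by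
  rw [Row.word, gateCNOT_word]
  congr 1
  refine word_congr rfl (fun i => ?_) (fun i => ?_)
  · by_cases hi : i = (⟨t, by omega⟩ : Fin (n + n))
    · subst hi; simp [Row.CNOT, hu, ht]
    · have : i.val ≠ t := fun h => hi (Fin.ext h)
      simp [Row.CNOT, Function.update_of_ne hi, Function.update_of_ne this]
  · by_cases hi : i = (⟨u, by omega⟩ : Fin (n + n))
    · subst hi; simp [Row.CNOT, hu, ht]
    · have : i.val ≠ u := fun h => hi (Fin.ext h)
      simp [Row.CNOT, Function.update_of_ne hi, Function.update_of_ne this]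

/-- Prepending a gate conjugates every image once more, so it suffices that the row update describes
the conjugation. -/
theorem TabInv.cons {c : Fin (2 * n) → Fin n → Pauli} {μ μ' : Memory} {L : List (Gate (n + n))}
    (h : TabInv c μ L) {g : Gate (n + n)} {F : Row → Row}
    (hF : ∀ r : Row, g.mat * r.word n = (F r).word n * g.mat)
    (hr : ∀ a < 2 * n, rowOf μ' a = F (rowOf μ a)) : TabInv c μ' (g :: L) := by
  intro a
  have e : circuitMat (g :: L) = g.mat * circuitMat L := by simp [circuitMat]
  rw [e, mul_assoc, h a, ← mul_assoc, tabWord_eq, hF, tabWord_eq, hr a a.isLt, mul_assoc]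

/-- The body may change one row at a time only. The variables `44` and `45` must survive because the
qubits on which the gate acts are read from them in every iteration. -/
theorem ex_rows {p : Program} {s : Config n} (hd : Dims n s.mem) (h49 : p.Keeps 49)
    (h44 : p.Keeps 44) (h45 : p.Keeps 45) (F : Row → Row)
    (h : ∀ (s' : Config n) (a : ℕ), s'.mem 49 [] = a → s'.mem 44 = s.mem 44 →
      s'.mem 45 = s.mem 45 → ∀ b, rowOf (p.ex s').mem b =
        if b = a then F (rowOf s'.mem a) else rowOf s'.mem b) :
    ∀ a < 2 * n, rowOf ((forE 49 (var 101) p).ex s).mem a = F (rowOf s.mem a) := by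
  have key := ex_forE_induct (v := 49) (e := var 101) (T := 2 * n) (p := p) (s := s) h49
    (fun t μ _ => μ 44 = s.mem 44 ∧ μ 45 = s.mem 45 ∧
      ∀ b, rowOf μ b = if b < t then F (rowOf s.mem b) else rowOf s.mem b) ?_ ?_ ?_ ?_
  · intro a ha
    simpa [ha] using key.2.2 a
  · intro t μ f L hP
    simpa [rowOf] using hP
  · simpa using hd.2
  · exact ⟨rfl, rfl, by simp⟩
  · intro t ht s' ht' ⟨e1, e2, e3⟩
    refine ⟨by rw [ex_keeps h44, e1], by rw [ex_keeps h45, e2], fun b => ?_⟩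
    rw [h s' t ht' e1 e2 b]
    rcases lt_trichotomy b t with hb | hb | hb
    · rw [if_neg hb.ne, e3, if_pos hb, if_pos (by omega)]
    · subst hb
      rw [if_pos rfl, e3, if_neg (by omega), if_pos (by omega)]
    · rw [if_neg hb.ne', e3, if_neg (by omega), if_neg (by omega)]

variable {c : Fin (2 * n) → Fin n → Pauli} {q v : ℕ}

theorem gateH_spec (hv : v = 44 ∨ v = 45) (s : Config n) (hd : Dims n s.mem)
    (hq : s.mem v [] = q) (hqn : q < n) (hT : TabInv c s.mem s.circuit) :
    TabInv c ((gateH (var v)).ex s).mem ((gateH (var v)).ex s).circuit ∧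
      ∀ a < 2 * n, rowOf ((gateH (var v)).ex s).mem a = (rowOf s.mem a).H q := by
  have hrow : ∀ a < 2 * n, rowOf ((gateH (var v)).ex s).mem a = (rowOf s.mem a).H q := by
    rw [gateH, ex_seq]
    refine ex_rows (s := (Program.hadamard (var v)).ex (s.tick 1)) hd (by simp [seqs, Program.Keeps])
      (by simp [seqs, Program.Keeps]) (by simp [seqs, Program.Keeps]) _ fun s' a ha h44 h45 b => ?_
    have hq' : s'.mem v [] = q := by
      rcases hv with rfl | rfl
      · rw [h44]; exact hq
      · rw [h45]; exact hq
    have v1 : v ≠ 30 := by omega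
    have v3 : v ≠ 32 := by omega
    have v4 : v ≠ 47 := by omega
    by_cases hb : b = a
    · subst hb
      ext <;> simp [rowOf, seqs, Row.H, hq', ha, v1, v3, v4, Function.update_apply]
    · ext <;> simp [rowOf, seqs, hq', ha, hb, v1, v3, v4, Function.update_apply]
  refine ⟨?_, hrow⟩
  have hc : ((gateH (var v)).ex s).circuit = Gate.H ⟨q, by omega⟩ :: s.circuit := by
    rw [gateH, ex_seq, ex_classical (by simp) (by simp)]
    simp [Program.ex, Config.emitH, Config.emit, hq, show q < n + n by omega]
  rw [hc]
  exact hT.cons (Row.H_word hqn) hrow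

theorem gateS_spec (hv : v = 44 ∨ v = 45) (s : Config n) (hd : Dims n s.mem)
    (hq : s.mem v [] = q) (hqn : q < n) (hT : TabInv c s.mem s.circuit) :
    TabInv c ((gateS (var v)).ex s).mem ((gateS (var v)).ex s).circuit ∧
      ∀ a < 2 * n, rowOf ((gateS (var v)).ex s).mem a = (rowOf s.mem a).S q := by
  have hrow : ∀ a < 2 * n, rowOf ((gateS (var v)).ex s).mem a = (rowOf s.mem a).S q := by
    rw [gateS, ex_seq]
    refine ex_rows (s := (Program.phase (var v)).ex (s.tick 1)) hd (by simp [seqs, Program.Keeps])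
      (by simp [seqs, Program.Keeps]) (by simp [seqs, Program.Keeps]) _ fun s' a ha h44 h45 b => ?_
    have hq' : s'.mem v [] = q := by
      rcases hv with rfl | rfl
      · rw [h44]; exact hq
      · rw [h45]; exact hq
    have v3 : v ≠ 32 := by omega
    by_cases hb : b = a
    · subst hb
      ext <;> simp [rowOf, seqs, Row.S, hq', ha, v3, Function.update_apply]
    · ext <;> simp [rowOf, seqs, hq', ha, hb, v3]
  refine ⟨?_, hrow⟩
  have hc : ((gateS (var v)).ex s).circuit = Gate.S ⟨q, by omega⟩ :: s.circuit := by
    rw [gateS, ex_seq, ex_classical (by simp) (by simp)]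
    simp [Program.ex, Config.emitS, Config.emit, hq, show q < n + n by omega]
  rw [hc]
  exact hT.cons (Row.S_word hqn) hrow

theorem gateCNOT_spec {t : ℕ} (s : Config n) (hd : Dims n s.mem) (hq : s.mem 45 [] = q)
    (ht : s.mem 44 [] = t) (hqn : q < n) (htn : t < n) (hqt : q ≠ t)
    (hT : TabInv c s.mem s.circuit) :
    TabInv c ((gateCNOT (var 45) (var 44)).ex s).mem
        ((gateCNOT (var 45) (var 44)).ex s).circuit ∧
      ∀ a < 2 * n, rowOf ((gateCNOT (var 45) (var 44)).ex s).mem a = (rowOf s.mem a).CNOT q t := by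
  have hrow : ∀ a < 2 * n,
      rowOf ((gateCNOT (var 45) (var 44)).ex s).mem a = (rowOf s.mem a).CNOT q t := by
    rw [gateCNOT, ex_seq]
    refine ex_rows (s := (Program.cnot (var 45) (var 44)).ex (s.tick 1)) hd
      (by simp [seqs, Program.Keeps])
      (by simp [seqs, Program.Keeps]) (by simp [seqs, Program.Keeps]) _ fun s' a ha h44 h45 b => ?_
    have hq' : s'.mem 45 [] = q := by rw [h45]; exact hq
    have ht' : s'.mem 44 [] = t := by rw [h44]; exact ht
    by_cases hb : b = a
    · subst hb
      ext <;> simp [rowOf, seqs, Row.CNOT, hq', ht', ha, Function.update_apply]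
    · ext <;> simp [rowOf, seqs, hq', ht', ha, hb]
  refine ⟨?_, hrow⟩
  have hc : ((gateCNOT (var 45) (var 44)).ex s).circuit =
      Gate.CNOT ⟨q, by omega⟩ ⟨t, by omega⟩ (fun e => hqt (congrArg Fin.val e)) ::
        s.circuit := by
    rw [gateCNOT, ex_seq, ex_classical (by simp) (by simp)]
    simp [Program.ex, Config.emitCNOT, Config.emit, hq, ht, show q < n + n by omega,
      show t < n + n by omega, hqt]
  rw [hc]
  exact hT.cons (Row.CNOT_word hqn htn (fun e => hqt (congrArg Fin.val e))) hrow

/-! ### The effect of gates on the images of monomials -/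

section
variable {μ μ' : Memory} {q : ℕ} (X : Finset (Fin (2 * n))) (j : ℕ)

theorem bit_x : bit 30 X μ j = (∑ i ∈ Finset.range X.card, (rowOf μ (el X i)).x j) % 2 := rfl
theorem bit_z : bit 31 X μ j = (∑ i ∈ Finset.range X.card, (rowOf μ (el X i)).z j) % 2 := rfl
theorem bit_lt (b : ℕ) : bit b X μ j < 2 := Nat.mod_lt _ (by norm_num)

/-- The exponents of a monomial are sums of exponents of rows modulo `2`, so it is enough to know
what a gate does to single rows; since gates act linearly on exponents, monomials transform in the
same way. -/
theorem bit_of_rows {F : Row → Row} (h : ∀ a < 2 * n, rowOf μ' a = F (rowOf μ a)) :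
    bit 30 X μ' j = (∑ i ∈ Finset.range X.card, (F (rowOf μ (el X i))).x j) % 2 ∧
      bit 31 X μ' j = (∑ i ∈ Finset.range X.card, (F (rowOf μ (el X i))).z j) % 2 := by
  have h' : ∀ i ∈ Finset.range X.card, rowOf μ' (el X i) = F (rowOf μ (el X i)) :=
    fun i hi => h _ (el_lt (Finset.mem_range.1 hi))
  rw [bit_x, bit_z]
  exact ⟨congrArg (· % 2) (Finset.sum_congr rfl fun i hi => by rw [h' i hi]),
    congrArg (· % 2) (Finset.sum_congr rfl fun i hi => by rw [h' i hi])⟩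

theorem bit_H (h : ∀ a < 2 * n, rowOf μ' a = (rowOf μ a).H q) :
    bit 30 X μ' j = (if j = q then bit 31 X μ q else bit 30 X μ j) ∧
      bit 31 X μ' j = (if j = q then bit 30 X μ q else bit 31 X μ j) := by
  rw [(bit_of_rows X j h).1, (bit_of_rows X j h).2]
  simp only [bit_x, bit_z]
  by_cases hj : j = q
  · subst hj; simp [Row.H]
  · simp [Row.H, hj]

theorem bit_S (h : ∀ a < 2 * n, rowOf μ' a = (rowOf μ a).S q) :
    bit 30 X μ' j = bit 30 X μ j ∧
      bit 31 X μ' j = (if j = q then (bit 31 X μ q + bit 30 X μ q) % 2 else bit 31 X μ j) := by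
  rw [(bit_of_rows X j h).1, (bit_of_rows X j h).2]
  simp only [bit_x, bit_z]
  by_cases hj : j = q
  · subst hj
    simp only [Row.S, Function.update_self, if_true, true_and]
    rw [← Finset.sum_nat_mod, Finset.sum_add_distrib, Nat.add_mod]
  · simp [Row.S, hj]

theorem bit_CNOT {t : ℕ} (h : ∀ a < 2 * n, rowOf μ' a = (rowOf μ a).CNOT q t) :
    bit 30 X μ' j = (if j = t then (bit 30 X μ t + bit 30 X μ q) % 2 else bit 30 X μ j) ∧
      bit 31 X μ' j = (if j = q then (bit 31 X μ q + bit 31 X μ t) % 2 else bit 31 X μ j) := by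
  rw [(bit_of_rows X j h).1, (bit_of_rows X j h).2]
  simp only [bit_x, bit_z]
  constructor
  · by_cases hj : j = t
    · subst hj
      simp only [Row.CNOT, Function.update_self, if_true]
      rw [← Finset.sum_nat_mod, Finset.sum_add_distrib, Nat.add_mod]
    · simp [Row.CNOT, hj]
  · by_cases hj : j = q
    · subst hj
      simp only [Row.CNOT, Function.update_self, if_true]
      rw [← Finset.sum_nat_mod, Finset.sum_add_distrib, Nat.add_mod]
    · simp [Row.CNOT, hj]

theorem bit_congr {b : ℕ} (h : μ' b = μ b) : bit b X μ' j = bit b X μ j := by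
  simp only [bit, h]

end

end

/-! ## Simultaneous diagonalization -/

section
variable {n k : ℕ} {c : Fin (2 * n) → Fin n → Pauli}

/-- The image of the monomial is diagonal. -/
def Diag (X : Finset (Fin (2 * n))) (μ : Memory) : Prop := ∀ j < n, bit 30 X μ j = 0

theorem Diag.congr {X : Finset (Fin (2 * n))} {μ μ' : Memory} (h : Diag X μ)
    (h1 : μ' 30 = μ 30) : Diag X μ' := fun j hj => by rw [bit_congr X j h1, h j hj]

/-- Images are conjugates by one unitary matrix, which preserves commutation. -/
theorem imageWord_commute {μ : Memory} {L : List (Gate (n + n))} (hT : TabInv c μ L)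
    {X M : Finset (Fin (2 * n))} (h : majoranaMonomial c M * majoranaMonomial c X =
      majoranaMonomial c X * majoranaMonomial c M) :
    imageWord M μ * imageWord X μ = imageWord X μ * imageWord M μ := by
  have hU : circuitMat L * (circuitMat L)ᴴ = 1 := mul_eq_one_comm.1 (circuitMat_unitary L)
  have h1 := circuitMat_mul_monomial hT X
  have h2 := circuitMat_mul_monomial hT M
  have e : ∀ A B : Finset (Fin (2 * n)), circuitMat L *
      kron (majoranaMonomial c A * majoranaMonomial c B) 1 =
      imageWord A μ * imageWord B μ * circuitMat L := by
    intro A B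
    rw [← mul_one (1 : Op n), ← kron_mul, ← mul_assoc, circuitMat_mul_monomial hT A, mul_assoc,
      circuitMat_mul_monomial hT B, ← mul_assoc]
  have e2 : imageWord M μ * imageWord X μ * circuitMat L =
      imageWord X μ * imageWord M μ * circuitMat L := by rw [← e, ← e, h]
  have := congrArg (· * (circuitMat L)ᴴ) e2
  simpa [mul_assoc, hU] using this

/-- A diagonal image that commutes with an image that has a single factor `X`. -/
theorem bit_z_eq_zero {μ : Memory} {L : List (Gate (n + n))} (hT : TabInv c μ L)
    {X M : Finset (Fin (2 * n))} (h : majoranaMonomial c M * majoranaMonomial c X =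
      majoranaMonomial c X * majoranaMonomial c M) (hM : Diag M μ) {q : ℕ} (hq : q < n)
    (hX : ∀ j < n, bit 30 X μ j = if j = q then 1 else 0) : bit 31 M μ q = 0 := by
  have := word_commute (imageWord_commute hT h)
  -- One side of the symplectic form reduces to the exponent of `Z` at the pivot, the other one
  -- vanishes because `M` is diagonal.
  have e1 : ∑ i : Fin (n + n), (if i.val < n then bit 31 M μ i else 0) *
      (if i.val < n then bit 30 X μ i else 0) = bit 31 M μ q := by
    rw [Finset.sum_eq_single (⟨q, by omega⟩ : Fin (n + n))]
    · simp [hq, hX q hq]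
    · intro i _ hi
      have : i.val ≠ q := fun h => hi (Fin.ext h)
      by_cases hin : i.val < n
      · simp [hin, hX i hin, this]
      · simp [hin]
    · simp
  have e2 : ∑ i : Fin (n + n), (if i.val < n then bit 31 X μ i else 0) *
      (if i.val < n then bit 30 M μ i else 0) = 0 := by
    refine Finset.sum_eq_zero fun i _ => ?_
    by_cases hin : i.val < n
    · simp [hin, hM i hin]
    · simp [hin]
  rw [e1, e2] at this
  rwa [Nat.mod_eq_of_lt (bit_lt M q 31)] at this

/-- The pivot carries an `X`, so a `CNOT` from the pivot to `t` flips the exponent of `X` at `t`.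
Images without any `X` acquire none, hence diagonal monomials stay diagonal. The exponents may be
read from the snapshot in array `40` because each iteration alters only the exponent of `X` at its
own qubit. -/
theorem clearX_spec {X : Finset (Fin (2 * n))} (s : Config n) (hd : Dims n s.mem)
    (hT : TabInv c s.mem s.circuit) {q : ℕ} (h45 : s.mem 45 [] = q) (hq : q < n)
    (h40 : ∀ j < n, s.mem 40 [j] = bit 30 X s.mem j) (hXq : bit 30 X s.mem q = 1) :
    TabInv c (clearX.ex s).mem (clearX.ex s).circuit ∧
      (∀ M : Finset (Fin (2 * n)), Diag M s.mem → Diag M (clearX.ex s).mem) ∧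
      ∀ j < n, bit 30 X (clearX.ex s).mem j = if j = q then 1 else 0 := by
  have key := ex_forE_induct (v := 44) (e := var 100) (T := n) (s := s)
    (p := .ite (cellE 40 [var 44] * (1 - eqE (var 44) (var 45)))
      (gateCNOT (var 45) (var 44)) .skip) (by simp [Program.Keeps, gateCNOT])
    (fun t μ L => μ 40 = s.mem 40 ∧ μ 45 = s.mem 45 ∧ Dims n μ ∧ TabInv c μ L ∧
      (∀ M : Finset (Fin (2 * n)), Diag M s.mem → Diag M μ) ∧
      ∀ j < n, bit 30 X μ j = if j < t ∧ j ≠ q then 0 else bit 30 X s.mem j) ?_ ?_ ?_ ?_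
  · obtain ⟨-, -, -, g1, g2, g3⟩ := key
    refine ⟨g1, g2, fun j hj => (g3 j hj).trans ?_⟩
    by_cases h : j = q
    · simp [h, hXq]
    · simp [h, hj]
  · intro t μ f L ⟨g1, g2, g3, g4, g5, g6⟩
    refine ⟨by simpa using g1, by simpa using g2, g3.update f (by norm_num),
      g4.congr (by simp) (by simp) (by simp), fun M hM => (g5 M hM).congr (by simp),
      fun j hj => ?_⟩
    rw [bit_congr (μ := μ) X j (by simp), g6 j hj]
  · simpa using hd.1
  · exact ⟨rfl, rfl, hd, hT, fun M hM => hM, by simp⟩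
  · intro t ht s' ht' ⟨g1, g2, g3, g4, g5, g6⟩
    have hq' : s'.mem 45 [] = q := by rw [g2, h45]
    have hcond : (cellE 40 [var 44] * (1 - eqE (var 44) (var 45))).eval s'.mem =
        bit 30 X s.mem t * (1 - if t = q then 1 else 0) := by
      simp [g1, ht', hq', h40 t ht]
    by_cases hc : bit 30 X s.mem t ≠ 0 ∧ t ≠ q
    · rw [ex_ite_pos (by rw [hcond]; simp [hc.1, hc.2])]
      have hX1 : bit 30 X s.mem t = 1 := by have := bit_lt (μ := s.mem) X t 30; omega
      generalize hs2 : s'.tick _ = s2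
      have m2 : s2.mem = s'.mem := by rw [← hs2]; rfl
      have c2 : s2.circuit = s'.circuit := by rw [← hs2]; rfl
      obtain ⟨r1, r2⟩ := gateCNOT_spec s2 (by rwa [m2]) (by rw [m2]; exact hq')
        (by rw [m2]; exact ht') hq ht (Ne.symm hc.2) (by rwa [m2, c2])
      refine ⟨by rw [ex_keeps (by simp [Program.Keeps, gateCNOT]), m2, g1],
        by rw [ex_keeps (by simp [Program.Keeps, gateCNOT]), m2, g2],
        g3.congr (by rw [ex_keeps (by simp [Program.Keeps, gateCNOT]), m2])
          (by rw [ex_keeps (by simp [Program.Keeps, gateCNOT]), m2]), r1, ?_, ?_⟩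
      · intro M hM j hj
        rw [(bit_CNOT M j r2).1, m2, g5 M hM j hj, g5 M hM t ht, g5 M hM q hq]
        simp
      · intro j hj
        rw [(bit_CNOT X j r2).1, m2]
        rcases lt_trichotomy j t with h | h | h
        · rw [if_neg h.ne, g6 j hj]
          simp [h, Nat.lt_succ_of_lt h]
        · subst h
          rw [if_pos rfl, g6 j hj, g6 q hq]
          simp [hX1, hXq, hc.2]
        · rw [if_neg h.ne', g6 j hj]
          simp [h.not_gt, show ¬ j < t + 1 by omega]
    · rw [ex_ite_neg (by
        rw [hcond]
        by_cases h : t = q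
        · simp [h]
        · simp only [ne_eq, h, not_false_eq_true, and_true, not_not] at hc
          simp [hc])]
      refine ⟨g1, g2, g3, g4, g5, fun j hj => ?_⟩
      simp only [ex_skip_mem, Config.tick_mem]
      rw [g6 j hj]
      rcases lt_trichotomy j t with h | h | h
      · simp [h, Nat.lt_succ_of_lt h]
      · subst h
        by_cases h : j = q
        · simp [h]
        · simp only [ne_eq, h, not_false_eq_true, and_true, not_not] at hc
          simp [hc]
      · simp [h.not_gt, show ¬ j < t + 1 by omega]

/-- The gates `H t`, `CNOT q t`, `H t`, where `q` and `t` are in the variables `45` and `44`. -/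
def gateCZ : Program := .seq (gateH (var 44)) (.seq (gateCNOT (var 45) (var 44)) (gateH (var 44)))

theorem keeps_gateCZ {a : ℕ} (h : a ∉ ({30, 31, 32, 47, 49} : Finset ℕ)) : gateCZ.Keeps a := by
  simp only [Finset.mem_insert, Finset.mem_singleton, not_or] at h
  simp [gateCZ, gateH, gateCNOT, Program.Keeps, h]

/-- A `CNOT` between Hadamard gates on the target is a controlled `Z`: exponents of `X` are
untouched, and each of the two qubits adds its exponent of `X` to the exponent of `Z` of the other
one. -/
theorem gateCZ_spec {q t : ℕ} (s : Config n) (hd : Dims n s.mem) (hq : s.mem 45 [] = q)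
    (ht : s.mem 44 [] = t) (hqn : q < n) (htn : t < n) (hqt : q ≠ t)
    (hT : TabInv c s.mem s.circuit) :
    TabInv c (gateCZ.ex s).mem (gateCZ.ex s).circuit ∧ ∀ (M : Finset (Fin (2 * n))) (j : ℕ),
      bit 30 M (gateCZ.ex s).mem j = bit 30 M s.mem j ∧
      bit 31 M (gateCZ.ex s).mem j = if j = t then (bit 31 M s.mem t + bit 30 M s.mem q) % 2
        else if j = q then (bit 31 M s.mem q + bit 30 M s.mem t) % 2 else bit 31 M s.mem j := by
  obtain ⟨a1, a2⟩ := gateH_spec (Or.inl rfl) (s.tick 1) hd ht htn hT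
  generalize e1 : (gateH (var 44)).ex (s.tick 1) = s1 at a1 a2
  have k1 : ∀ a, (gateH (var 44)).Keeps a → s1.mem a = s.mem a := fun a ha => by
    rw [← e1, ex_keeps ha]; rfl
  have hd1 : Dims n s1.mem := hd.congr (k1 _ (by simp [gateH, Program.Keeps]))
    (k1 _ (by simp [gateH, Program.Keeps]))
  have hq1 : s1.mem 45 [] = q := by rw [k1 45 (by simp [gateH, Program.Keeps]), hq]
  have ht1 : s1.mem 44 [] = t := by rw [k1 44 (by simp [gateH, Program.Keeps]), ht]
  obtain ⟨b1, b2⟩ := gateCNOT_spec (s1.tick 1) hd1 hq1 ht1 hqn htn hqt a1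
  generalize e2 : (gateCNOT (var 45) (var 44)).ex (s1.tick 1) = s2 at b1 b2
  have k2 : ∀ a, (gateCNOT (var 45) (var 44)).Keeps a → s2.mem a = s1.mem a := fun a ha => by
    rw [← e2, ex_keeps ha]; rfl
  have hd2 : Dims n s2.mem := hd1.congr (k2 _ (by simp [gateCNOT, Program.Keeps]))
    (k2 _ (by simp [gateCNOT, Program.Keeps]))
  have ht2 : s2.mem 44 [] = t := by rw [k2 44 (by simp [gateCNOT, Program.Keeps]), ht1]
  obtain ⟨c1, c2⟩ := gateH_spec (Or.inl rfl) s2 hd2 ht2 htn b1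
  have e : gateCZ.ex s = (gateH (var 44)).ex s2 := by
    rw [gateCZ, ex_seq, ex_seq, e1, e2]
  rw [e]
  refine ⟨c1, fun M j => ?_⟩
  have hA := fun j => bit_H M j a2
  have hB := fun j => bit_CNOT M j b2
  have hC := fun j => bit_H M j c2
  simp only [Config.tick_mem] at hA hB hC
  refine ⟨?_, ?_⟩
  · rw [(hC j).1, (hB t).2, (hB j).1, if_neg (Ne.symm hqt), (hA t).2, (hA j).1, if_pos rfl]
    by_cases h : j = t
    · subst h; simp
    · simp [h]
  · rw [(hC j).2, (hB t).1, (hB j).2, if_pos rfl, (hA t).1, (hA q).1, (hA q).2, (hA t).2,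
      (hA j).2, if_pos rfl, if_neg hqt, if_neg hqt, if_pos rfl]
    by_cases h : j = t
    · subst h; simp
    · simp [h]

/-- The image has its only `X` at the pivot, so a controlled `Z` with the pivot toggles the `Z` at
`t`. No exponent of `X` of any monomial changes, and therefore diagonality is preserved for all of
them. -/
theorem clearZ_spec {X : Finset (Fin (2 * n))} (s : Config n) (hd : Dims n s.mem)
    (hT : TabInv c s.mem s.circuit) {q : ℕ} (h45 : s.mem 45 [] = q) (hq : q < n)
    (h41 : ∀ j < n, s.mem 41 [j] = bit 31 X s.mem j)
    (hX : ∀ j < n, bit 30 X s.mem j = if j = q then 1 else 0) :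
    TabInv c (clearZ.ex s).mem (clearZ.ex s).circuit ∧
      (∀ (M : Finset (Fin (2 * n))) (j : ℕ),
        bit 30 M (clearZ.ex s).mem j = bit 30 M s.mem j) ∧
      ∀ j < n, j ≠ q → bit 31 X (clearZ.ex s).mem j = 0 := by
  have key := ex_forE_induct (v := 44) (e := var 100) (T := n) (s := s)
    (p := .ite (cellE 41 [var 44] * (1 - eqE (var 44) (var 45))) gateCZ .skip)
    ⟨keeps_gateCZ (by simp), by simp [Program.Keeps]⟩
    (fun t μ L => μ 41 = s.mem 41 ∧ μ 45 = s.mem 45 ∧ Dims n μ ∧ TabInv c μ L ∧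
      (∀ (M : Finset (Fin (2 * n))) (j : ℕ), bit 30 M μ j = bit 30 M s.mem j) ∧
      ∀ j < n, j ≠ q → bit 31 X μ j = if j < t then 0 else bit 31 X s.mem j) ?_ ?_ ?_ ?_
  · obtain ⟨-, -, -, g1, g2, g3⟩ := key
    exact ⟨g1, g2, fun j hj hjq => (g3 j hj hjq).trans (if_pos hj)⟩
  · intro t μ f L ⟨g1, g2, g3, g4, g5, g6⟩
    refine ⟨by simpa using g1, by simpa using g2, g3.update f (by norm_num),
      g4.congr (by simp) (by simp) (by simp), fun M j => ?_, fun j hj hjq => ?_⟩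
    · rw [bit_congr (μ := μ) M j (by simp), g5]
    · rw [bit_congr (μ := μ) X j (by simp), g6 j hj hjq]
  · simpa using hd.1
  · exact ⟨rfl, rfl, hd, hT, fun M j => rfl, by simp⟩
  · intro t ht s' ht' ⟨g1, g2, g3, g4, g5, g6⟩
    have hq' : s'.mem 45 [] = q := by rw [g2, h45]
    have hcond : (cellE 41 [var 44] * (1 - eqE (var 44) (var 45))).eval s'.mem =
        bit 31 X s.mem t * (1 - if t = q then 1 else 0) := by
      simp [g1, ht', hq', h41 t ht]
    by_cases hc : bit 31 X s.mem t ≠ 0 ∧ t ≠ q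
    · rw [ex_ite_pos (by rw [hcond]; simp [hc.1, hc.2])]
      have hX1 : bit 31 X s.mem t = 1 := by have := bit_lt (μ := s.mem) X t 31; omega
      generalize hs2 : s'.tick _ = s2
      have m2 : s2.mem = s'.mem := by rw [← hs2]; rfl
      have c2 : s2.circuit = s'.circuit := by rw [← hs2]; rfl
      obtain ⟨r1, r2⟩ := gateCZ_spec s2 (by rwa [m2]) (by rw [m2]; exact hq')
        (by rw [m2]; exact ht') hq ht (Ne.symm hc.2) (by rwa [m2, c2])
      refine ⟨by rw [ex_keeps (keeps_gateCZ (by simp)), m2, g1],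
        by rw [ex_keeps (keeps_gateCZ (by simp)), m2, g2],
        g3.congr (by rw [ex_keeps (keeps_gateCZ (by simp)), m2])
          (by rw [ex_keeps (keeps_gateCZ (by simp)), m2]), r1, ?_, ?_⟩
      · intro M j
        rw [(r2 M j).1, m2, g5]
      · intro j hj hjq
        rw [(r2 X j).2, m2, g5, g5, hX q hq]
        rcases lt_trichotomy j t with h | h | h
        · rw [if_neg h.ne, if_neg hjq, g6 j hj hjq]
          simp [h, Nat.lt_succ_of_lt h]
        · subst h
          rw [if_pos rfl, g6 j hj hjq]
          simp [hX1]
        · rw [if_neg h.ne', if_neg hjq, g6 j hj hjq]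
          simp [h.not_gt, show ¬ j < t + 1 by omega]
    · rw [ex_ite_neg (by
        rw [hcond]
        by_cases h : t = q
        · simp [h]
        · simp only [ne_eq, h, not_false_eq_true, and_true, not_not] at hc
          simp [hc])]
      refine ⟨g1, g2, g3, g4, g5, fun j hj hjq => ?_⟩
      simp only [ex_skip_mem, Config.tick_mem]
      rw [g6 j hj hjq]
      rcases lt_trichotomy j t with h | h | h
      · simp [h, Nat.lt_succ_of_lt h]
      · subst h
        simp only [ne_eq, hjq, not_false_eq_true, and_true, not_not] at hc
        simp [hc]
      · simp [h.not_gt, show ¬ j < t + 1 by omega]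

/-- The value `n`, stored before the search, serves as the mark that no qubit was found. -/
theorem findPivot_spec (s : Config n) (hd : Dims n s.mem) :
    ((findPivot.ex s).mem 45 [] < n → s.mem 40 [(findPivot.ex s).mem 45 []] ≠ 0) ∧
      (¬ (findPivot.ex s).mem 45 [] < n → ∀ j < n, s.mem 40 [j] = 0) := by
  rw [findPivot, ex_seq]
  have key := ex_forE_induct (v := 44) (e := var 100) (T := n)
    (s := (setE 45 [] (var 100)).ex (s.tick 1))
    (p := .ite (cellE 40 [var 44]) (setE 45 [] (var 44)) .skip) (by simp [Program.Keeps])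
    (fun t μ _ => μ 40 = s.mem 40 ∧ (μ 45 [] < n → s.mem 40 [μ 45 []] ≠ 0) ∧
      (¬ μ 45 [] < n → ∀ j < t, s.mem 40 [j] = 0)) ?_ ?_ ?_ ?_
  · exact key.2
  · intro t μ f L h
    simpa using h
  · simpa using hd.1
  · simp [hd.1]
  · intro t ht s' ht' ⟨g1, g2, g3⟩
    by_cases hc : s.mem 40 [t] = 0
    · rw [ex_ite_neg (by simp [g1, ht', hc])]
      refine ⟨g1, g2, fun h j hj => ?_⟩
      rcases Nat.lt_succ_iff_lt_or_eq.1 hj with h' | rfl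
      · exact g3 h j h'
      · exact hc
    · rw [ex_ite_pos (by simp [g1, ht', hc])]
      refine ⟨by simp [g1], ?_, ?_⟩
      · simp [ht', hc]
      · simp [ht', ht]

theorem keeps_image {a : ℕ} (h : a ∉ ({40, 41, 42, 43} : Finset ℕ)) : (image k).Keeps a := by
  simp only [Finset.mem_insert, Finset.mem_singleton, not_or] at h
  simp [image, h]

theorem image_circuit (s : Config n) : ((image k).ex s).circuit = s.circuit :=
  ex_classical (by simp [image]) (by simp [image]) s

/-- One step of symplectic elimination: clear the other factors `X`, then the other factors `Z`,
turn a possible `Y` at the pivot into `X` by a phase gate, and turn `X` into `Z` by a Hadamard gate.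
Only the last gate can spoil a monomial that was diagonal before, and commutation with `X` excludes
that. -/
theorem diagonalize_spec {X : Finset (Fin (2 * n))} (s : Config n) (hd : Dims n s.mem)
    (hT : TabInv c s.mem s.circuit) (hX : AtTuple k X s.mem) :
    TabInv c ((diagonalize k).ex s).mem ((diagonalize k).ex s).circuit ∧
      Diag X ((diagonalize k).ex s).mem ∧
      ∀ M : Finset (Fin (2 * n)), Diag M s.mem → majoranaMonomial c M * majoranaMonomial c X =
        majoranaMonomial c X * majoranaMonomial c M → Diag M ((diagonalize k).ex s).mem := by
  obtain ⟨i1, -⟩ := image_spec (s.tick 1) hd hX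
  rw [diagonalize, ex_seq, ex_seq]
  generalize e1 : (image k).ex (s.tick 1) = s1 at *
  have k1 : ∀ a, a ∉ ({40, 41, 42, 43} : Finset ℕ) → s1.mem a = s.mem a := fun a ha => by
    rw [← e1, ex_keeps (keeps_image ha)]; rfl
  have c1 : s1.circuit = s.circuit := by rw [← e1, image_circuit]; rfl
  have hd1 : Dims n s1.mem := hd.congr (k1 _ (by simp)) (k1 _ (by simp))
  obtain ⟨p1, p2⟩ := findPivot_spec (s1.tick 1) hd1
  generalize e2 : findPivot.ex (s1.tick 1) = s2 at *
  have k2 : ∀ a, a ∉ ({44, 45} : Finset ℕ) → s2.mem a = s1.mem a := fun a ha => by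
    simp only [Finset.mem_insert, Finset.mem_singleton, not_or] at ha
    rw [← e2, ex_keeps (by simp [findPivot, Program.Keeps, ha])]; rfl
  have c2 : s2.circuit = s.circuit := by
    rw [← c1, ← e2, ex_classical (by simp [findPivot, Program.Det])
      (by simp [findPivot, Program.Classical])]; rfl
  have hd2 : Dims n s2.mem := hd1.congr (k2 _ (by simp)) (k2 _ (by simp))
  have k12 : ∀ a, a ∉ ({40, 41, 42, 43, 44, 45} : Finset ℕ) → s2.mem a = s.mem a := by
    intro a ha
    simp only [Finset.mem_insert, Finset.mem_singleton, not_or] at ha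
    rw [k2 a (by simp [ha]), k1 a (by simp [ha])]
  have hT2 : TabInv c s2.mem s2.circuit := by
    rw [c2]; exact hT.congr (k12 _ (by simp)) (k12 _ (by simp)) (k12 _ (by simp))
  have hX2 : AtTuple k X s2.mem := hX.congr (k12 _ (by simp)) (k12 _ (by simp))
  have b2 : ∀ M : Finset (Fin (2 * n)), ∀ j, bit 30 M s2.mem j = bit 30 M s.mem j :=
    fun M j => bit_congr M j (k12 _ (by simp))
  simp only [Config.tick_mem] at p1 p2 i1
  by_cases hq : s2.mem 45 [] < n
  swap
  · rw [ex_ite_neg (by simp [hd2.1, hq])]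
    refine ⟨hT2, fun j hj => ?_, fun M hM _ j hj => ?_⟩
    · simp only [ex_skip_mem, Config.tick_mem]
      rw [b2, ← (i1 j hj).1, p2 hq j hj]
    · simp only [ex_skip_mem, Config.tick_mem]
      rw [b2, hM j hj]
  rw [ex_ite_pos (by simp [hd2.1, hq])]
  generalize e2' : s2.tick _ = s2'
  have m2' : s2'.mem = s2.mem := by rw [← e2']; rfl
  have c2' : s2'.circuit = s2.circuit := by rw [← e2']; rfl
  rw [ex_seq, ex_seq, ex_seq, ex_seq, ex_seq]
  generalize hqq : s2.mem 45 [] = q at *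
  have hXq : bit 30 X s2.mem q = 1 := by
    have h1 := p1 hq
    rw [(i1 q hq).1, ← b2] at h1
    have := bit_lt (μ := s2.mem) X q 30
    omega
  obtain ⟨x1, x2, x3⟩ := clearX_spec (X := X) (s2'.tick 1) (by simpa [m2'] using hd2)
    (by simpa [m2', c2'] using hT2) (q := q) (by simp [m2', hqq]) hq
    (fun j hj => by simp only [Config.tick_mem]; rw [m2', k2 _ (by simp), (i1 j hj).1, b2])
    (by simpa [m2'] using hXq)
  generalize e3 : clearX.ex (s2'.tick 1) = s3 at *
  have k3 : ∀ a, a ∉ ({30, 31, 32, 44, 47, 49} : Finset ℕ) → s3.mem a = s2.mem a := fun a ha => by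
    simp only [Finset.mem_insert, Finset.mem_singleton, not_or] at ha
    rw [← e3, ex_keeps (by simp [clearX, gateCNOT, Program.Keeps, ha]), ← m2']; rfl
  have hd3 : Dims n s3.mem := hd2.congr (k3 _ (by simp)) (k3 _ (by simp))
  have hX3 : AtTuple k X s3.mem := hX2.congr (k3 _ (by simp)) (k3 _ (by simp))
  obtain ⟨i2, -⟩ := image_spec (s3.tick 1) hd3 hX3
  generalize e4 : (image k).ex (s3.tick 1) = s4 at *
  have k4 : ∀ a, a ∉ ({40, 41, 42, 43} : Finset ℕ) → s4.mem a = s3.mem a := fun a ha => by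
    rw [← e4, ex_keeps (keeps_image ha)]; rfl
  have c4 : s4.circuit = s3.circuit := by rw [← e4, image_circuit]; rfl
  have hd4 : Dims n s4.mem := hd3.congr (k4 _ (by simp)) (k4 _ (by simp))
  have b4 : ∀ M : Finset (Fin (2 * n)), ∀ j, bit 30 M s4.mem j = bit 30 M s3.mem j :=
    fun M j => bit_congr M j (k4 _ (by simp))
  have hT4 : TabInv c s4.mem s4.circuit := by
    rw [c4]; exact x1.congr (k4 _ (by simp)) (k4 _ (by simp)) (k4 _ (by simp))
  obtain ⟨z1, z2, z3⟩ := clearZ_spec (X := X) (s4.tick 1) hd4 hT4 (q := q)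
    (by simp only [Config.tick_mem]; rw [k4 _ (by simp), k3 _ (by simp), hqq]) hq
    (fun j hj => by
      simp only [Config.tick_mem]
      rw [(i2 j hj).2]
      exact (bit_congr X j (k4 31 (by simp))).symm)
    (fun j hj => by simp only [Config.tick_mem]; rw [b4, x3 j hj])
  generalize e5 : clearZ.ex (s4.tick 1) = s5 at *
  have k5 : ∀ a, a ∉ ({30, 31, 32, 44, 47, 49} : Finset ℕ) → s5.mem a = s4.mem a := fun a ha => by
    simp only [Finset.mem_insert, Finset.mem_singleton, not_or] at ha
    rw [← e5, ex_keeps (by simp [clearZ, gateH, gateCNOT, Program.Keeps, ha])]; rfl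
  have hd5 : Dims n s5.mem := hd4.congr (k5 _ (by simp)) (k5 _ (by simp))
  have hX5 : AtTuple k X s5.mem := hX3.congr (by rw [k5 _ (by simp), k4 _ (by simp)])
    (by rw [k5 _ (by simp), k4 _ (by simp)])
  have hb5 : ∀ j < n, bit 30 X s5.mem j = if j = q then 1 else 0 := fun j hj => by
    rw [z2, Config.tick_mem, b4, x3 j hj]
  have hM5 : ∀ M : Finset (Fin (2 * n)), Diag M s.mem → Diag M s5.mem := fun M hM j hj => by
    rw [z2, Config.tick_mem, b4]
    exact x2 M (fun j hj => by rw [Config.tick_mem, m2', b2, hM j hj]) j hj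
  obtain ⟨i3, -⟩ := image_spec (s5.tick 1) hd5 hX5
  generalize e6 : (image k).ex (s5.tick 1) = s6 at *
  have k6 : ∀ a, a ∉ ({40, 41, 42, 43} : Finset ℕ) → s6.mem a = s5.mem a := fun a ha => by
    rw [← e6, ex_keeps (keeps_image ha)]; rfl
  have c6 : s6.circuit = s5.circuit := by rw [← e6, image_circuit]; rfl
  have hd6 : Dims n s6.mem := hd5.congr (k6 _ (by simp)) (k6 _ (by simp))
  have hT6 : TabInv c s6.mem s6.circuit := by
    rw [c6]; exact z1.congr (k6 _ (by simp)) (k6 _ (by simp)) (k6 _ (by simp))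
  have q6 : s6.mem 45 [] = q := by
    rw [k6 _ (by simp), k5 _ (by simp), k4 _ (by simp), k3 _ (by simp), hqq]
  have b6 : ∀ M : Finset (Fin (2 * n)), ∀ j, bit 30 M s6.mem j = bit 30 M s5.mem j :=
    fun M j => bit_congr M j (k6 _ (by simp))
  have hp6 : s6.mem 41 [q] = bit 31 X s6.mem q := by
    rw [(i3 q hq).2]
    exact (bit_congr X q (k6 31 (by simp))).symm
  -- After this gate the image is a single `X` at the pivot, up to phase, in either case.
  obtain ⟨s7, e7, hd7, hT7, q7, b7, z7⟩ : ∃ s7,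
      (Program.ite (cellE 41 [var 45]) (gateS (var 45)) .skip).ex (s6.tick 1) = s7 ∧
      Dims n s7.mem ∧ TabInv c s7.mem s7.circuit ∧ s7.mem 45 [] = q ∧
      (∀ (M : Finset (Fin (2 * n))) (j : ℕ), bit 30 M s7.mem j = bit 30 M s5.mem j) ∧
      bit 31 X s7.mem q = 0 := by
    refine ⟨_, rfl, ?_⟩
    by_cases hz : bit 31 X s6.mem q = 0
    · rw [ex_ite_neg (by simp [q6, hp6, hz])]
      exact ⟨hd6, hT6, q6, b6, hz⟩
    · rw [ex_ite_pos (by simp [q6, hp6, hz])]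
      generalize e6' : (s6.tick 1).tick _ = s6'
      have m6' : s6'.mem = s6.mem := by rw [← e6']; rfl
      have c6' : s6'.circuit = s6.circuit := by rw [← e6']; rfl
      obtain ⟨g1, g2⟩ := gateS_spec (Or.inr rfl) s6' (by rwa [m6']) (by rw [m6']; exact q6) hq
        (by rwa [m6', c6'])
      refine ⟨hd6.congr (by rw [ex_keeps (by simp [gateS, Program.Keeps]), m6'])
        (by rw [ex_keeps (by simp [gateS, Program.Keeps]), m6']), g1,
        by rw [ex_keeps (by simp [gateS, Program.Keeps]), m6', q6], fun M j => ?_, ?_⟩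
      · rw [(bit_S M j g2).1, m6', b6]
      · rw [(bit_S X q g2).2, if_pos rfl, m6', b6, hb5 q hq]
        have := bit_lt (μ := s6.mem) X q 31
        rw [show bit 31 X s6.mem q = 1 by omega]
        simp
  rw [e7]
  obtain ⟨g1, g2⟩ := gateH_spec (Or.inr rfl) s7 hd7 q7 hq hT7
  refine ⟨g1, fun j hj => ?_, fun M hM hcomm j hj => ?_⟩
  · rw [(bit_H X j g2).1]
    by_cases h : j = q
    · rw [if_pos h, z7]
    · rw [if_neg h, b7, hb5 j hj, if_neg h]
  · rw [(bit_H M j g2).1]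
    -- A diagonal image that commutes with a single `X` at the pivot has no `Z` there, so the
    -- Hadamard gate cannot create an `X` in it.
    have hM7 : Diag M s7.mem := fun j hj => by rw [b7, hM5 M hM j hj]
    by_cases h : j = q
    · rw [if_pos h]
      exact bit_z_eq_zero hT7 hcomm hM7 hq fun j hj => by rw [b7, hb5 j hj]
    · rw [if_neg h, hM7 j hj]

end

/-! ## Loops over the observables -/

section
variable {n k : ℕ} {c : Fin (2 * n) → Fin n → Pauli}

/-- The observable is selected by the random labels. -/
def Marked (k : ℕ) (X : Finset (Fin (2 * n))) (μ : Memory) : Prop :=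
  μ 26 (key X) ≠ 0 ∧ ∀ J ∈ posSets k, ∃ i ∈ coPos k J,
    μ 24 (el X i :: key (subAt X J)) = μ 23 (key (subAt X J)) + 1

theorem eval_markE {X : Finset (Fin (2 * n))} {μ : Memory} (hX : AtTuple k X μ) :
    (markE k).eval μ ≠ 0 ↔ Marked k X μ := by
  rw [markE, eval_mul, mul_ne_zero_iff, eval_cellE, hX.eval_keyE_range, Marked]
  refine and_congr_right fun _ => ?_
  rw [eval_prodE, List.map_map, ne_eq, List.prod_eq_zero_iff, List.mem_map]
  simp only [not_exists, not_and, Function.comp_apply, eval_sumE, List.map_map]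
  refine forall₂_congr fun J hJ => ?_
  rw [List.sum_eq_zero_iff]
  simp only [List.mem_map, forall_exists_index, and_imp, forall_apply_eq_imp_iff₂, not_forall,
    Function.comp_apply, eval_eqE, eval_cellE, eval_add, eval_one, List.map_cons, hX.eval_dgE,
    hX.eval_keyE (mem_posSets hJ).1, ite_eq_right_iff, one_ne_zero, imp_false, not_not, exists_prop]

theorem Marked.congr {X : Finset (Fin (2 * n))} {μ μ' : Memory} (h23 : μ' 23 = μ 23)
    (h24 : μ' 24 = μ 24) (h26 : μ' 26 = μ 26) : Marked k X μ' ↔ Marked k X μ := by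
  simp only [Marked, h23, h24, h26]

theorem keeps_diagonalize {a : ℕ}
    (h : a ∉ ({30, 31, 32, 40, 41, 42, 43, 44, 45, 47, 49} : Finset ℕ)) :
    (diagonalize k).Keeps a := by
  simp only [Finset.mem_insert, Finset.mem_singleton, not_or] at h
  simp [diagonalize, image, findPivot, clearX, clearZ, gateH, gateS, gateCNOT, Program.Keeps, h]

/-- The part of the protocol that makes the marked observables diagonal. -/
def markLoop (k : ℕ) : Program := forTuples k (.ite (markE k) (diagonalize k) .skip)

/-- A marked monomial is made diagonal when the loop reaches it, and later steps preserve this for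
monomials that commute with the one being processed. A marked monomial in conflict with another may
be lost again, hence the restriction to those that commute with all marked ones. -/
theorem markLoop_spec (hn : 0 < n) (s : Config n) (hd : Dims n s.mem)
    (hT : TabInv c s.mem s.circuit) :
    TabInv c ((markLoop k).ex s).mem ((markLoop k).ex s).circuit ∧
      ∀ X : Finset (Fin (2 * n)), X.card = 2 * k → Marked k X s.mem →
        (∀ M : Finset (Fin (2 * n)), M.card = 2 * k → Marked k M s.mem →
          majoranaMonomial c X * majoranaMonomial c M =
            majoranaMonomial c M * majoranaMonomial c X) →
        Diag X ((markLoop k).ex s).mem := by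
  have key := ex_forTuples_induct (N := 2 * n) (k := k) (by omega)
    (p := .ite (markE k) (diagonalize k) .skip) (s := s)
    ⟨keeps_diagonalize (by simp), by simp [Program.Keeps]⟩ hd.2
    (fun t μ L => Dims n μ ∧ TabInv c μ L ∧ μ 23 = s.mem 23 ∧ μ 24 = s.mem 24 ∧
      -- The loop does not touch labels or selection, so being marked may refer to the initial
      -- memory throughout.
      μ 26 = s.mem 26 ∧ ∀ X : Finset (Fin (2 * n)), X.card = 2 * k → Marked k X s.mem →
        codeOf X < t →
        (∀ M : Finset (Fin (2 * n)), M.card = 2 * k → Marked k M s.mem →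
          majoranaMonomial c X * majoranaMonomial c M =
            majoranaMonomial c M * majoranaMonomial c X) →
        Diag X μ) ?_ ?_ ?_ ?_ ?_
  · obtain ⟨-, g1, -, -, -, g2⟩ := key
    exact ⟨g1, fun X hX hm hc => g2 X hX hm (hX ▸ codeOf_lt (by omega) X) hc⟩
  · intro t μ f L ⟨g1, g2, g3, g4, g5, g6⟩
    exact ⟨g1.update f (by norm_num), g2.congr (by simp) (by simp) (by simp), by simpa using g3,
      by simpa using g4, by simpa using g5, fun X hX hm ht hc => (g6 X hX hm ht hc).congr (by simp)⟩
  · exact ⟨hd, hT, rfl, rfl, rfl, by simp⟩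
  · exact fun t μ L h => h.1.2
  · intro t μ L hX ⟨g1, g2, g3, g4, g5, g6⟩
    refine ⟨g1, g2, g3, g4, g5, fun X hXc hm ht hc => g6 X hXc hm ?_ hc⟩
    have := hX X hXc
    omega
  · intro X s' hX ⟨g1, g2, g3, g4, g5, g6⟩
    have hme : ∀ Y : Finset (Fin (2 * n)), Marked k Y s'.mem ↔ Marked k Y s.mem := fun Y =>
      Marked.congr g3 g4 g5
    by_cases hm : (markE k).eval s'.mem = 0
    · rw [ex_ite_neg hm]
      refine ⟨g1, g2, g3, g4, g5, fun Y hY hYm ht hc => ?_⟩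
      rcases Nat.lt_succ_iff_lt_or_eq.1 ht with h | h
      · exact g6 Y hY hYm h hc
      · have := codeOf_inj (hY.trans hX.1.symm) h
        subst this
        exact absurd hm ((eval_markE hX).2 ((hme _).2 hYm))
    · rw [ex_ite_pos hm]
      generalize e : s'.tick _ = s2
      have m2 : s2.mem = s'.mem := by rw [← e]; rfl
      have c2 : s2.circuit = s'.circuit := by rw [← e]; rfl
      obtain ⟨r1, r2, r3⟩ := diagonalize_spec s2 (by rwa [m2]) (by rwa [m2, c2])
        (by rwa [m2] : AtTuple k X s2.mem)
      have kk : ∀ a, a ∉ ({30, 31, 32, 40, 41, 42, 43, 44, 45, 47, 49} : Finset ℕ) →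
          ((diagonalize k).ex s2).mem a = s'.mem a := fun a ha => by
        rw [ex_keeps (keeps_diagonalize ha), m2]
      refine ⟨g1.congr (kk _ (by simp)) (kk _ (by simp)), r1, by rw [kk _ (by simp), g3],
        by rw [kk _ (by simp), g4], by rw [kk _ (by simp), g5], fun Y hY hYm ht hc => ?_⟩
      rcases Nat.lt_succ_iff_lt_or_eq.1 ht with h | h
      · exact r3 Y (by rw [m2]; exact g6 Y hY hYm h hc)
          (hc X hX.1 ((hme _).1 ((eval_markE hX).1 hm)))
      · have := codeOf_inj (hY.trans hX.1.symm) h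
        subst this
        exact r2

/-- The rule for loops that update cells whose addresses are the observables. -/
theorem ex_forTuples_update (hn : 0 < n) {p : Program} {s : Config n} (h20 : p.Keeps 20)
    (hd : Dims n s.mem) (h100 : p.Keeps 100) (h101 : p.Keeps 101) (A : Finset ℕ)
    (hA : ∀ a ∈ A, p.Keeps a) (hA20 : 20 ∉ A) (b : ℕ) (hb : b ≠ 20)
    (G : Finset (Fin (2 * n)) → ℕ → ℕ)
    (h : ∀ (s' : Config n) (X : Finset (Fin (2 * n))), AtTuple k X s'.mem → Dims n s'.mem →
      (∀ a ∈ A, s'.mem a = s.mem a) → (p.ex s').mem b =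
        Function.update (s'.mem b) (key X) (G X (s'.mem b (key X))))
    {X : Finset (Fin (2 * n))} (hX : X.card = 2 * k) :
    ((forTuples k p).ex s).mem b (key X) = G X (s.mem b (key X)) := by
  have key := ex_forTuples_induct (N := 2 * n) (k := k) (by omega) (p := p) (s := s) h20 hd.2
    (fun t μ _ => Dims n μ ∧ (∀ a ∈ A, μ a = s.mem a) ∧
      ∀ X : Finset (Fin (2 * n)), X.card = 2 * k → μ b (key X) =
        if codeOf X < t then G X (s.mem b (key X)) else s.mem b (key X)) ?_ ?_ ?_ ?_ ?_
  · rw [key.2.2 X hX, if_pos (hX ▸ codeOf_lt (by omega) X)]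
  · intro t μ f L ⟨g1, g2, g3⟩
    refine ⟨g1.update f (by norm_num), fun a ha => ?_, fun X hX => ?_⟩
    · rw [Function.update_of_ne (fun h : a = 20 => hA20 (by rwa [← h])), g2 a ha]
    · rw [Function.update_of_ne hb, g3 X hX]
  · exact ⟨hd, fun a _ => rfl, by simp⟩
  · exact fun t μ L h => h.1.2
  · intro t μ L hX ⟨g1, g2, g3⟩
    refine ⟨g1, g2, fun X hXc => ?_⟩
    rw [g3 X hXc]
    have := hX X hXc
    by_cases h : codeOf X < t
    · rw [if_pos h, if_pos (by omega)]
    · rw [if_neg h, if_neg (by omega)]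
  · intro X s' hX ⟨g1, g2, g3⟩
    refine ⟨g1.congr (ex_keeps h100 _) (ex_keeps h101 _), fun a ha => by
      rw [ex_keeps (hA a ha), g2 a ha], fun Y hY => ?_⟩
    rw [h s' X hX g1 g2]
    by_cases hYX : Y = X
    · subst hYX
      rw [Function.update_self, g3 Y hY, if_neg (by omega), if_pos (by omega)]
    · have h1 : codeOf Y ≠ codeOf X := fun e => hYX (codeOf_inj (hY.trans hX.1.symm) e)
      rw [Function.update_of_ne (fun e => hYX (key_injective e)), g3 Y hY]
      by_cases h : codeOf Y < codeOf X
      · rw [if_pos h, if_pos (by omega)]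
      · rw [if_neg h, if_neg (by omega)]

/-! ### Evaluation of the outcomes of measurements -/

/-- The outcome of the Bell measurement for an observable. -/
def bellPar (X : Finset (Fin (2 * n))) (μ : Memory) : ℕ :=
  (phaseOf X μ + ∑ j ∈ Finset.range n,
    (bit 30 X μ j * μ 50 [j] + bit 31 X μ j * μ 50 [n + j])) % 2

/-- The outcome of the measurement for a diagonal observable. -/
def signPar (X : Finset (Fin (2 * n))) (μ : Memory) : ℕ :=
  (phaseOf X μ % 4 / 2 + ∑ j ∈ Finset.range n, bit 31 X μ j * μ 50 [j]) % 2

theorem bellUpdate_spec {X : Finset (Fin (2 * n))} (s : Config n) (hd : Dims n s.mem)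
    (hX : AtTuple k X s.mem) :
    ((bellUpdate k).ex s).mem 27 = Function.update (s.mem 27) (key X)
        (s.mem 27 (key X) + if bellPar X s.mem = 0 then 1 else 0) ∧
      ((bellUpdate k).ex s).mem 28 = Function.update (s.mem 28) (key X)
        (s.mem 28 (key X) + if bellPar X s.mem = 0 then 0 else 1) := by
  obtain ⟨i1, i2⟩ := image_spec (s.tick 1) hd hX
  simp only [bellUpdate, seqs, ex_seq]
  generalize e1 : (image k).ex (s.tick 1) = s1 at *
  have k1 : ∀ a, a ∉ ({40, 41, 42, 43} : Finset ℕ) → s1.mem a = s.mem a := fun a ha => by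
    rw [← e1, ex_keeps (keeps_image ha)]; rfl
  simp only [Config.tick_mem] at i1 i2
  have key1 := ex_forE_induct (v := 43) (e := var 100) (T := n)
    (s := ((setE 46 [] (var 42 % 2)).ex (s1.tick 1)).tick 1)
    (p := setE 46 [] ((var 46 + cellE 40 [var 43] * cellE 50 [var 43] +
     cellE 41 [var 43] * cellE 50 [var 100 + var 43]) % 2)) (by simp)
    (fun t μ _ => (∀ a, a ∉ ({40, 41, 42, 43, 46} : Finset ℕ) → μ a = s.mem a) ∧
      μ 40 = s1.mem 40 ∧ μ 41 = s1.mem 41 ∧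
      μ 46 [] = (phaseOf X s.mem + ∑ j ∈ Finset.range t,
        (bit 30 X s.mem j * s.mem 50 [j] + bit 31 X s.mem j * s.mem 50 [n + j])) % 2)
    ?_ ?_ ?_ ?_
  · generalize e2 : (forE 43 (var 100) _).ex (((setE 46 [] (var 42 % 2)).ex (s1.tick 1)).tick 1)
      = s2 at key1 ⊢
    obtain ⟨g1, -, -, g2⟩ := key1
    change s2.mem 46 [] = bellPar X s.mem at g2
    have hX2 : AtTuple k X s2.mem := hX.congr (g1 _ (by simp)) (g1 _ (by simp))
    by_cases hb : bellPar X s.mem = 0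
    · rw [ex_ite_neg (by simp [g2, hb])]
      simp [hX2.eval_keyE_range, hb, g1]
    · rw [ex_ite_pos (by simp [g2, hb])]
      simp [hX2.eval_keyE_range, hb, g1]
  · intro t μ f L ⟨g1, g2, g3, g4⟩
    refine ⟨fun a ha => ?_, by simpa using g2, by simpa using g3, by simpa using g4⟩
    rw [Function.update_of_ne (by rintro rfl; simp at ha), g1 a ha]
  · simp [k1, hd.1]
  · refine ⟨fun a ha => ?_, by simp, by simp, ?_⟩
    · simp only [Finset.mem_insert, Finset.mem_singleton, not_or] at ha
      simp [ha, k1]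
    · simp [i2, Nat.mod_mod_of_dvd]
  · intro t ht s' ht' ⟨g1, g2, g3, g4⟩
    refine ⟨fun a ha => ?_, by simp [g2], by simp [g3], ?_⟩
    · have h46 : a ≠ 46 := by rintro rfl; simp at ha
      simp [h46, g1 a ha]
    · simp [ht', g4, g2, g3, g1, hd.1, i1 t ht, Finset.sum_range_succ, add_assoc]

theorem signUpdate_spec {X : Finset (Fin (2 * n))} (s : Config n) (hd : Dims n s.mem)
    (hX : AtTuple k X s.mem) [Decidable (Diag X s.mem)] :
    ((signUpdate k).ex s).mem 4 = Function.update (s.mem 4) (key X)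
        (s.mem 4 (key X) + if Diag X s.mem ∧ signPar X s.mem = 0 then 1 else 0) ∧
      ((signUpdate k).ex s).mem 5 = Function.update (s.mem 5) (key X)
        (s.mem 5 (key X) + if Diag X s.mem ∧ ¬ signPar X s.mem = 0 then 1 else 0) ∧
      ((signUpdate k).ex s).mem 6 = Function.update (s.mem 6) (key X)
        (s.mem 6 (key X) + if Diag X s.mem then 1 else 0) := by
  obtain ⟨i1, i2⟩ := image_spec (s.tick 1) hd hX
  simp only [signUpdate, ex_seq]
  generalize e1 : (image k).ex (s.tick 1) = s1 at *
  have k1 : ∀ a, a ∉ ({40, 41, 42, 43} : Finset ℕ) → s1.mem a = s.mem a := fun a ha => by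
    rw [← e1, ex_keeps (keeps_image ha)]; rfl
  simp only [Config.tick_mem] at i1 i2
  have key1 := ex_forE_induct (v := 43) (e := var 100) (T := n)
    (s := ((setE 48 [] 0).ex (((setE 46 [] (var 42 / 2)).ex ((s1.tick 1))).tick 1)).tick 1)
    (p := .seq (setE 46 [] ((var 46 + cellE 41 [var 43] * cellE 50 [var 43]) % 2))
      (.ite (cellE 40 [var 43]) (setE 48 [] 1) .skip)) (by simp [Program.Keeps])
    (fun t μ _ => (∀ a, a ∉ ({40, 41, 42, 43, 46, 48} : Finset ℕ) → μ a = s.mem a) ∧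
      μ 40 = s1.mem 40 ∧ μ 41 = s1.mem 41 ∧
      μ 46 [] = (phaseOf X s.mem % 4 / 2 + ∑ j ∈ Finset.range t,
        bit 31 X s.mem j * s.mem 50 [j]) % 2 ∧
      (μ 48 [] = 0 ↔ ∀ j < t, bit 30 X s.mem j = 0))
    ?_ ?_ ?_ ?_
  · generalize e2 : (forE 43 (var 100) _).ex (((setE 48 [] 0).ex
      (((setE 46 [] (var 42 / 2)).ex ((s1.tick 1))).tick 1)).tick 1) = s2 at key1
    obtain ⟨g1, -, -, g2, g3⟩ := key1
    change s2.mem 46 [] = signPar X s.mem at g2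
    change _ ↔ Diag X s.mem at g3
    have hX2 : AtTuple k X s2.mem := hX.congr (g1 _ (by simp)) (g1 _ (by simp))
    by_cases hD : Diag X s.mem
    swap
    · rw [ex_ite_pos (by simpa [← g3] using hD)]
      simp [hD, g1]
    rw [ex_ite_neg (by simpa [← g3] using hD), ex_seq]
    generalize e3 : (s2.tick _).tick _ = s3
    have m3 : s3.mem = s2.mem := by rw [← e3]; rfl
    by_cases hb : signPar X s.mem = 0
    · rw [ex_ite_neg (by simp [m3, g2, hb])]
      generalize e4 : s3.tick _ = s4
      have m4 : s4.mem = s2.mem := by rw [← e4, ← m3]; rfl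
      have hX4 : AtTuple k X ((setE 4 (keyE (Finset.range (2 * k)))
        (cellE 4 (keyE (Finset.range (2 * k))) + 1)).ex s4).mem :=
        hX2.congr (by simp [m4]) (by simp [m4])
      simp [hX2.eval_keyE_range, hX4.eval_keyE_range, hb, hD, m4, g1]
    · rw [ex_ite_pos (by simp [m3, g2, hb])]
      generalize e4 : s3.tick _ = s4
      have m4 : s4.mem = s2.mem := by rw [← e4, ← m3]; rfl
      have hX4 : AtTuple k X ((setE 5 (keyE (Finset.range (2 * k)))
        (cellE 5 (keyE (Finset.range (2 * k))) + 1)).ex s4).mem :=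
        hX2.congr (by simp [m4]) (by simp [m4])
      simp [hX2.eval_keyE_range, hX4.eval_keyE_range, hb, hD, m4, g1]
  · intro t μ f L ⟨g1, g2, g3, g4⟩
    refine ⟨fun a ha => ?_, by simpa using g2, by simpa using g3, by simpa using g4⟩
    rw [Function.update_of_ne (by rintro rfl; simp at ha), g1 a ha]
  · simp [k1, hd.1]
  · refine ⟨fun a ha => ?_, by simp, by simp, ?_, by simp⟩
    · simp only [Finset.mem_insert, Finset.mem_singleton, not_or] at ha
      simp [ha, k1]
    · simp only [ne_eq, Nat.reduceEqDiff, not_false_eq_true, ex_setE_mem_ne, Config.tick_mem,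
        ex_setE_mem_self, List.map_nil, Function.update_self, eval_div, eval_var, i2, eval_ofNat,
        Finset.range_zero, Finset.sum_empty, add_zero]
      omega
  · intro t ht s' ht' ⟨g1, g2, g3, g4, g5⟩
    rw [ex_seq]
    generalize e2 : (setE 46 [] _).ex _ = s2
    have k2 : ∀ a, a ≠ 46 → s2.mem a = s'.mem a := fun a ha => by rw [← e2]; simp [ha]
    have k46 : s2.mem 46 [] = (phaseOf X s.mem % 4 / 2 + ∑ j ∈ Finset.range (t + 1),
        bit 31 X s.mem j * s.mem 50 [j]) % 2 := by
      rw [← e2]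
      simp [ht', g4, g3, g1, i1 t ht, Finset.sum_range_succ, add_assoc]
    have hall : (∀ j < t + 1, bit 30 X s.mem j = 0) ↔
        (∀ j < t, bit 30 X s.mem j = 0) ∧ bit 30 X s.mem t = 0 := by
      constructor
      · exact fun h => ⟨fun j hj => h j (by omega), h t (by omega)⟩
      · rintro ⟨h1, h2⟩ j hj
        rcases Nat.lt_succ_iff_lt_or_eq.1 hj with h | rfl
        · exact h1 j h
        · exact h2
    rw [hall, ← g5]
    by_cases hc : bit 30 X s.mem t = 0
    · rw [ex_ite_neg (by simp [k2, g2, ht', i1 t ht, hc])]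
      refine ⟨fun a ha => ?_, by simp [k2, g2], by simp [k2, g3], by simp [k46],
        by simp [k2, hc]⟩
      have h46 : a ≠ 46 := by rintro rfl; simp at ha
      simp [k2 a h46, g1 a ha]
    · rw [ex_ite_pos (by simp [k2, g2, ht', i1 t ht, hc])]
      refine ⟨fun a ha => ?_, by simp [k2, g2], by simp [k2, g3], by simp [k46],
        by simp [hc]⟩
      have h46 : a ≠ 46 := by rintro rfl; simp at ha
      have h48 : a ≠ 48 := by rintro rfl; simp at ha
      simp [h48, k2 a h46, g1 a ha]

end

/-! ## The laws of the outcomes of measurements -/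

section
variable {n k : ℕ} {c : Fin (2 * n) → Fin n → Pauli}

theorem expect_measurement (ρ : DensityMatrix n) (L : List (Gate (n + n)))
    (f : (Fin (n + n) → Fin 2) → ℝ≥0∞) :
    expect (cliffordMeasurement ρ L) f = ∑ z, bornWeight ρ L z * f z := by
  rw [expect_fintype]
  rfl

/-- A sign with mean `m` takes its two values with probabilities `(1 + m) / 2` and `(1 - m) / 2`. -/
theorem expect_measurement_ite (ρ : DensityMatrix n) (L : List (Gate (n + n)))
    (E : (Fin (n + n) → Fin 2) → Prop) [DecidablePred E] {m : ℝ}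
    (hm : ∑ z, (bornWeight ρ L z).toReal * (if E z then 1 else -1) = m) (a b : ℝ≥0∞) :
    expect (cliffordMeasurement ρ L) (fun z => if E z then a else b) =
      ENNReal.ofReal ((1 + m) / 2) * a + ENNReal.ofReal ((1 - m) / 2) * b := by
  have hfin : ∀ z, bornWeight ρ L z ≠ ∞ := fun z => ENNReal.ofReal_ne_top
  set P := ∑ z with E z, bornWeight ρ L z with hP
  set Q := ∑ z with ¬ E z, bornWeight ρ L z with hQ
  have hPQ : P + Q = 1 := by
    rw [hP, hQ, Finset.sum_filter_add_sum_filter_not, sum_bornWeight]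
  have hPf : P ≠ ∞ := ENNReal.sum_ne_top.2 fun z _ => hfin z
  have hQf : Q ≠ ∞ := ENNReal.sum_ne_top.2 fun z _ => hfin z
  have h1 : P.toReal + Q.toReal = 1 := by rw [← ENNReal.toReal_add hPf hQf, hPQ]; simp
  have h2 : P.toReal - Q.toReal = m := by
    rw [← hm, hP, hQ, ENNReal.toReal_sum fun z _ => hfin z, ENNReal.toReal_sum fun z _ => hfin z,
      ← Finset.sum_filter_add_sum_filter_not Finset.univ E, sub_eq_add_neg, ← Finset.sum_neg_distrib]
    congr 1
    · exact Finset.sum_congr rfl fun z hz => by simp [(Finset.mem_filter.1 hz).2]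
    · exact Finset.sum_congr rfl fun z hz => by simp [(Finset.mem_filter.1 hz).2]
  have e1 : ENNReal.ofReal ((1 + m) / 2) = P := by
    rw [show (1 + m) / 2 = P.toReal by linarith, ENNReal.ofReal_toReal hPf]
  have e2 : ENNReal.ofReal ((1 - m) / 2) = Q := by
    rw [show (1 - m) / 2 = Q.toReal by linarith, ENNReal.ofReal_toReal hQf]
  rw [e1, e2, expect_measurement, ← Finset.sum_filter_add_sum_filter_not Finset.univ E, hP, hQ,
    Finset.sum_mul, Finset.sum_mul]
  congr 1
  · exact Finset.sum_congr rfl fun z hz => by simp [(Finset.mem_filter.1 hz).2]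
  · exact Finset.sum_congr rfl fun z hz => by simp [(Finset.mem_filter.1 hz).2]

/-- The monomial squares to the identity and so does its image, but without factors `X` the square
of the word is `i^(2φ)`. Evenness makes the integer division by `2` in `signPar` exact. -/
theorem Diag.even_phase (hc : IsMajorana c) {μ : Memory} {L : List (Gate (n + n))}
    (hT : TabInv c μ L) {X : Finset (Fin (2 * n))} (hD : Diag X μ) : Even (phaseOf X μ) := by
  have hU : circuitMat L * (circuitMat L)ᴴ = 1 := mul_eq_one_comm.1 (circuitMat_unitary L)
  have h := circuitMat_mul_monomial hT X
  have h2 : imageWord X μ * imageWord X μ = 1 := by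
    have e : imageWord X μ * imageWord X μ * circuitMat L = circuitMat L := by
      rw [mul_assoc, ← h, ← mul_assoc, ← h, mul_assoc, kron_mul, hc.monomial_sq, mul_one, kron_one,
        mul_one]
    have := congrArg (· * (circuitMat L)ᴴ) e
    simpa [mul_assoc, hU] using this
  rw [imageWord, word_mul, word_congr (φ' := 2 * phaseOf X μ) (x' := fun _ => 0)
    (z' := fun _ => 0) ?_ (fun i => ?_) (fun i => ?_)] at h2
  · by_contra hodd
    have h4 : (2 * phaseOf X μ) % 4 = 2 := by
      obtain ⟨m, hm⟩ := Nat.not_even_iff_odd.1 hodd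
      omega
    -- An odd phase would make the square `-1`; a single diagonal entry refutes this.
    rw [word_congr (φ' := 2) (x' := fun _ => 0) (z' := fun _ => 0) (by omega) (fun _ => rfl)
      (fun _ => rfl)] at h2
    have := congrFun (congrFun h2 0) 0
    simp only [word, Complex.I_sq, pow_zero, mul_one, tensor_one] at this
    norm_num at this
  · rw [Finset.sum_eq_zero]
    · ring_nf
    · intro i _
      by_cases hi : i.val < n
      · simp [hi, hD i hi]
      · simp [hi]
  · by_cases hi : i.val < n
    · simp [hi, hD i hi]
    · simp [hi]
  · by_cases hi : i.val < n
    · simp [hi, ← two_mul]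
    · simp [hi]

theorem I_pow_mul_neg_one_pow {φ S : ℕ} (hφ : Even φ) :
    Complex.I ^ φ * (-1) ^ S = if (φ % 4 / 2 + S) % 2 = 0 then 1 else -1 := by
  have e : Complex.I ^ φ = (-1) ^ (φ % 4 / 2) := by
    rw [← Complex.I_sq, ← pow_mul]
    refine I_pow_congr ?_
    obtain ⟨m, hm⟩ := hφ
    omega
  rw [e, ← pow_add]
  split_ifs with h
  · exact (Nat.even_iff.2 h).neg_one_pow
  · exact (Nat.not_even_iff_odd.1 fun h' => h (Nat.even_iff.1 h')).neg_one_pow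

/-- The image is a signed product of factors `Z` on the first copy, so its eigenvalue is the parity
of the outcome bits, corrected by the phase. -/
theorem sign_law (hc : IsMajorana c) (ρ : DensityMatrix n) (s : Config n)
    (hT : TabInv c s.mem s.circuit) {X : Finset (Fin (2 * n))} (hD : Diag X s.mem)
    (a b : ℝ≥0∞) :
    expect (cliffordMeasurement ρ s.circuit)
      (fun z => if signPar X (s.record 50 z).mem = 0 then a else b) =
      ENNReal.ofReal ((1 + expVal c ρ X) / 2) * a +
        ENNReal.ofReal ((1 - expVal c ρ X) / 2) * b := by
  refine expect_measurement_ite ρ s.circuit _ ?_ a b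
  have h := trace_eq_sum_born ρ s.circuit (circuitMat_mul_monomial hT X) (fun i => by
    by_cases hi : i.val < n
    · simp [hi, hD i hi]
    · simp [hi])
  rw [trace_kron_one_mul, hc.trace_eq] at h
  apply Complex.ofReal_injective
  rw [h, Complex.ofReal_sum]
  refine Finset.sum_congr rfl fun z _ => ?_
  rw [I_pow_mul_neg_one_pow (hD.even_phase hc hT), Complex.ofReal_mul]
  congr 1
  have e : signPar X (s.record 50 z).mem = (phaseOf X s.mem % 4 / 2 +
      ∑ i : Fin (n + n), (if i.val < n then bit 31 X s.mem i else 0) * (z i : ℕ)) % 2 := by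
    have m30 : (s.record 50 z).mem 30 = s.mem 30 := Config.record_mem_ne _ (by norm_num) _
    have m31 : (s.record 50 z).mem 31 = s.mem 31 := Config.record_mem_ne _ (by norm_num) _
    have m32 : (s.record 50 z).mem 32 = s.mem 32 := Config.record_mem_ne _ (by norm_num) _
    rw [signPar, phaseOf, m30, m31, m32, ← phaseOf, Fin.sum_univ_add, Finset.sum_range]
    congr 2
    rw [← add_zero (∑ i : Fin n, _)]
    congr 1
    · refine Finset.sum_congr rfl fun j _ => ?_
      rw [bit_congr (μ := s.mem) X j m31]
      have := Config.record_mem_self s 50 z (Fin.castAdd n j)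
      simp only [Fin.val_castAdd] at this
      simp [this]
    · simp
  rw [e]
  split_ifs <;> simp

/-! ### Bell measurements -/

theorem kron_one_injective {A B : Op n} (h : kron A 1 = kron B 1) : A = B := by
  ext u y
  have := congrFun (congrFun h (Fin.append u u)) (Fin.append y u)
  have e : ∀ v : Fin n → Fin 2, (fun i => Fin.append v u (Fin.natAdd n i)) = u := fun v =>
    funext fun i => Fin.append_right v u i
  simp only [kron, Matrix.of_apply, Fin.append_left] at this
  rw [e u, e y, Matrix.one_apply_eq, mul_one, mul_one] at this
  exact this

theorem monomial_eq_word {μ : Memory} (hT : TabInv c μ []) (X : Finset (Fin (2 * n))) :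
    majoranaMonomial c X = word (phaseOf X μ) (fun j => bit 30 X μ j) (fun j => bit 31 X μ j) := by
  apply kron_one_injective
  have h := circuitMat_mul_monomial hT X
  simp only [circuitMat, List.map_nil, List.prod_nil, one_mul, mul_one] at h
  have h1 : (1 : Op n) = word 0 (fun _ => 0) (fun _ => 0) := word_zero.symm
  rw [h, h1, kron_word, imageWord]
  refine word_congr rfl (fun i => ?_) (fun i => ?_)
  all_goals
    refine Fin.addCases (fun j => ?_) (fun j => ?_) i
    · simp
    · rw [Fin.append_right]; simp

/-- On `P ⊗ P` the two copies have equal exponents. The `CNOT` doubles, and so cancels, the exponent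
of `X` on the second copy and the exponent of `Z` on the first one; the Hadamard gate turns the
remaining `X` on the first copy into `Z`. One circuit works for all Pauli words simultaneously. -/
theorem bellCircuit_spec (s : Config n) (hd : Dims n s.mem) (hs : s.circuit = [])
    (φ : ℕ) (x z : Fin n → ℕ) :
    circuitMat (bellCircuit.ex s).circuit *
        word (2 * φ) (Fin.append x x) (Fin.append z z) =
      word (2 * φ) (fun _ => 0) (Fin.append x z) * circuitMat (bellCircuit.ex s).circuit := by
  have key := ex_forE_induct (v := 43) (e := var 100) (T := n) (s := s)
    (p := seqs [.cnot (var 43) (var 100 + var 43), .hadamard (var 43)])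
    (by simp [Program.Keeps])
    (fun t μ L => Dims n μ ∧ circuitMat L *
        word (2 * φ) (Fin.append x x) (Fin.append z z) =
      word (2 * φ) (Fin.append (fun i => if i.val < t then 0 else x i)
          (fun i => if i.val < t then 0 else x i))
        (Fin.append (fun i => if i.val < t then x i else z i) z) * circuitMat L) ?_ ?_ ?_ ?_
  · have h := key.2
    rw [bellCircuit, h]
    congr 1
    refine word_congr rfl (fun i => ?_) (fun i => ?_)
    all_goals
      refine Fin.addCases (fun j => ?_) (fun j => ?_) i
      · simp
      · simp only [Fin.append_right, j.isLt, if_true]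
  · intro t μ f L h
    exact ⟨h.1.update f (by norm_num), h.2⟩
  · simpa using hd.1
  · rw [hs]
    exact ⟨hd, by simp [circuitMat]⟩
  · intro t ht s' ht' ⟨g1, g2⟩
    have hc : ((seqs [.cnot (var 43) (var 100 + var 43), .hadamard (var 43)]).ex s').circuit =
        Gate.H (Fin.castAdd n ⟨t, ht⟩) :: Gate.CNOT (Fin.castAdd n ⟨t, ht⟩) (Fin.natAdd n ⟨t, ht⟩)
          (by simp [Fin.ext_iff]; omega) :: s'.circuit := by
      have h1 : t < n + n := by omega
      have h2 : n ≠ 0 := by omega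
      simp [seqs, Program.ex, Config.emitCNOT, Config.emitH, Config.emit, ht', g1.1, ht, h1, h2]
      omega
    refine ⟨g1.congr rfl rfl, ?_⟩
    rw [hc]
    have e : ∀ (g g' : Gate (n + n)) L, circuitMat (g :: g' :: L) =
        g.mat * (g'.mat * circuitMat L) := fun g g' L => by simp [circuitMat]
    rw [e, mul_assoc, mul_assoc, g2, ← mul_assoc (Gate.mat _) (word _ _ _), gateCNOT_word,
      mul_assoc (word _ _ _), ← mul_assoc (Gate.mat _) (word _ _ _), gateH_word,
      mul_assoc (word _ _ _)]
    congr 1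
    refine word_congr ?_ (fun i => ?_) (fun i => ?_)
    · have hne : Fin.castAdd n (⟨t, ht⟩ : Fin n) ≠ Fin.natAdd n ⟨t, ht⟩ := by
        simp [Fin.ext_iff]; omega
      rw [Function.update_of_ne hne, Function.update_self, Fin.append_left, Fin.append_left,
        Fin.append_right]
      simp only [lt_self_iff_false, if_false]
      -- The reordering sign of the Hadamard gate is trivial because one of the two exponents is
      -- even.
      rw [show 2 * φ + 2 * (x ⟨t, ht⟩ * (z ⟨t, ht⟩ + z ⟨t, ht⟩)) =
        2 * φ + 4 * (x ⟨t, ht⟩ * z ⟨t, ht⟩) by ring]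
      omega
    all_goals
      refine Fin.addCases (fun j => ?_) (fun j => ?_) i
      · have h1 : Fin.castAdd n j ≠ Fin.natAdd n ⟨t, ht⟩ := by simp [Fin.ext_iff]; omega
        by_cases h : j = ⟨t, ht⟩
        · subst h
          have h1 : Fin.castAdd n (⟨t, ht⟩ : Fin n) ≠ Fin.natAdd n ⟨t, ht⟩ := by
            simp [Fin.ext_iff]; omega
          simp only [Function.update_self, Function.update_of_ne h1, Fin.append_left,
            Fin.append_right]
          simp [← two_mul]
        · have h2 : Fin.castAdd n j ≠ Fin.castAdd n ⟨t, ht⟩ := fun e =>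
            h (Fin.castAdd_injective _ _ e)
          have h3 : (j.val < t + 1) = (j.val < t) := by
            have : j.val ≠ t := fun e => h (Fin.ext e)
            exact propext (by omega)
          simp only [Function.update_of_ne h1, Function.update_of_ne h2, Fin.append_left, h3]
      · have h1 : Fin.natAdd n j ≠ Fin.castAdd n ⟨t, ht⟩ := by simp [Fin.ext_iff]; omega
        by_cases h : j = ⟨t, ht⟩
        · subst h
          simp only [Function.update_self, Function.update_of_ne h1, Fin.append_left,
            Fin.append_right]
          try simp [← two_mul]
        · have h2 : Fin.natAdd n j ≠ Fin.natAdd n ⟨t, ht⟩ := fun e =>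
            h (Fin.natAdd_injective _ _ e)
          have h3 : (j.val < t + 1) = (j.val < t) := by
            have : j.val ≠ t := fun e => h (Fin.ext e)
            exact propext (by omega)
          simp only [Function.update_of_ne h1, Function.update_of_ne h2, Fin.append_right, h3]

/-- The outcome measures `Γ ⊗ Γ`, whose expectation value in `ρ ⊗ ρ` is the square. Its phase `2φ`
is even, so only the parity of `φ` enters `bellPar`. -/
theorem bell_law (hc : IsMajorana c) (ρ : DensityMatrix n) (s : Config n)
    (hd : Dims n s.mem) (hs : s.circuit = [])
    (hT : TabInv c s.mem []) (X : Finset (Fin (2 * n))) (a b : ℝ≥0∞) :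
    expect (cliffordMeasurement ρ (bellCircuit.ex s).circuit)
      (fun z => if bellPar X ((bellCircuit.ex s).record 50 z).mem = 0 then a else b) =
      ENNReal.ofReal ((1 + expVal c ρ X ^ 2) / 2) * a +
        ENNReal.ofReal ((1 - expVal c ρ X ^ 2) / 2) * b := by
  refine expect_measurement_ite ρ _ _ ?_ a b
  have hk : kron (majoranaMonomial c X) (majoranaMonomial c X) =
      word (2 * phaseOf X s.mem) (Fin.append (fun j => bit 30 X s.mem j) fun j => bit 30 X s.mem j)
        (Fin.append (fun j => bit 31 X s.mem j) fun j => bit 31 X s.mem j) := by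
    rw [monomial_eq_word hT, kron_word, two_mul]
  have h := trace_eq_sum_born ρ (bellCircuit.ex s).circuit
    (A := kron (majoranaMonomial c X) (majoranaMonomial c X))
    (by rw [hk]; exact bellCircuit_spec s hd hs _ _ _) (fun i => rfl)
  rw [trace_kron_self_mul, hc.trace_eq] at h
  apply Complex.ofReal_injective
  rw [Complex.ofReal_pow, h, Complex.ofReal_sum]
  refine Finset.sum_congr rfl fun z _ => ?_
  rw [I_pow_mul_neg_one_pow (even_two_mul _), Complex.ofReal_mul]
  congr 1
  have e : bellPar X ((bellCircuit.ex s).record 50 z).mem = ((2 * phaseOf X s.mem) % 4 / 2 +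
      ∑ i : Fin (n + n), Fin.append (fun j : Fin n => bit 30 X s.mem j)
        (fun j : Fin n => bit 31 X s.mem j) i * (z i : ℕ)) % 2 := by
    have mm : ∀ a, a ≠ 43 → a ≠ 50 → ((bellCircuit.ex s).record 50 z).mem a = s.mem a :=
      fun a h1 h2 => by
        rw [Config.record_mem_ne _ h2, ex_keeps (by simp [bellCircuit, Program.Keeps, h1])]
    rw [bellPar, phaseOf, mm 30 (by norm_num) (by norm_num), mm 31 (by norm_num) (by norm_num),
      mm 32 (by norm_num) (by norm_num), ← phaseOf, Fin.sum_univ_add, Finset.sum_range,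
      Finset.sum_add_distrib]
    have e1 : ∑ j : Fin n, bit 30 X ((bellCircuit.ex s).record 50 z).mem j *
        ((bellCircuit.ex s).record 50 z).mem 50 [(j : ℕ)] =
        ∑ j : Fin n, Fin.append (fun j : Fin n => bit 30 X s.mem j)
        (fun j : Fin n => bit 31 X s.mem j) (Fin.castAdd n j) * (z (Fin.castAdd n j) : ℕ) := by
      refine Finset.sum_congr rfl fun j _ => ?_
      have := Config.record_mem_self (bellCircuit.ex s) 50 z (Fin.castAdd n j)
      rw [bit_congr X j (mm 30 (by norm_num) (by norm_num)), Fin.append_left, ← this]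
      rfl
    have e2 : ∑ j : Fin n, bit 31 X ((bellCircuit.ex s).record 50 z).mem j *
        ((bellCircuit.ex s).record 50 z).mem 50 [n + (j : ℕ)] =
        ∑ j : Fin n, Fin.append (fun j : Fin n => bit 30 X s.mem j)
        (fun j : Fin n => bit 31 X s.mem j) (Fin.natAdd n j) * (z (Fin.natAdd n j) : ℕ) := by
      refine Finset.sum_congr rfl fun j _ => ?_
      have := Config.record_mem_self (bellCircuit.ex s) 50 z (Fin.natAdd n j)
      rw [bit_congr X j (mm 31 (by norm_num) (by norm_num)), Fin.append_right, ← this]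
      rfl
    rw [e1, e2]
    omega
  rw [e]
  split_ifs <;> simp

end

/-! ## Exponential moments -/

/-- After centring, the variable `l (±1 - m)` lies in `[-1, 1]` because `|l| ≤ 1/2`, so `exp x ≤ 1 +
x + x^2` applies. The linear terms cancel, and the variance `1 - m^2` is at most one. -/
theorem exp_moment_le {m l : ℝ} (hm : |m| ≤ 1) (hl : |l| ≤ 1 / 2) :
    (1 + m) / 2 * Real.exp l + (1 - m) / 2 * Real.exp (-l) ≤ Real.exp (l * m + l ^ 2) := by
  obtain ⟨hm1, hm2⟩ := abs_le.1 hm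
  have h : ∀ x : ℝ, |x| ≤ 1 → Real.exp x ≤ 1 + x + x ^ 2 := fun x hx => by
    have := (abs_le.1 (Real.abs_exp_sub_one_sub_id_le hx)).2
    linarith
  have b1 : |l * (1 - m)| ≤ 1 := by
    rw [abs_mul]
    have : |1 - m| ≤ 2 := abs_le.2 ⟨by linarith, by linarith⟩
    nlinarith [abs_nonneg l, abs_nonneg (1 - m)]
  have b2 : |l * (-1 - m)| ≤ 1 := by
    rw [abs_mul]
    have : |-1 - m| ≤ 2 := abs_le.2 ⟨by linarith, by linarith⟩
    nlinarith [abs_nonneg l, abs_nonneg (-1 - m)]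
  have e1 : Real.exp l = Real.exp (l * m) * Real.exp (l * (1 - m)) := by
    rw [← Real.exp_add]; ring_nf
  have e2 : Real.exp (-l) = Real.exp (l * m) * Real.exp (l * (-1 - m)) := by
    rw [← Real.exp_add]; ring_nf
  rw [e1, e2, Real.exp_add]
  have key : (1 + m) / 2 * Real.exp (l * (1 - m)) + (1 - m) / 2 * Real.exp (l * (-1 - m)) ≤
      Real.exp (l ^ 2) := by
    calc _ ≤ (1 + m) / 2 * (1 + l * (1 - m) + (l * (1 - m)) ^ 2) +
          (1 - m) / 2 * (1 + l * (-1 - m) + (l * (-1 - m)) ^ 2) := by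
          gcongr
          · linarith
          · exact h _ b1
          · exact h _ b2
      _ = 1 + l ^ 2 * (1 - m ^ 2) := by ring
      _ ≤ 1 + l ^ 2 := by nlinarith [sq_nonneg l, sq_nonneg m, sq_nonneg (l * m)]
      _ ≤ _ := by linarith [Real.add_one_le_exp (l ^ 2)]
  calc _ = Real.exp (l * m) * ((1 + m) / 2 * Real.exp (l * (1 - m)) +
        (1 - m) / 2 * Real.exp (l * (-1 - m))) := by ring
    _ ≤ _ := by gcongr

/-- A nonnegative real potential, as a test function for expectations. -/
def expE (x : ℝ) : ℝ≥0∞ := ENNReal.ofReal (Real.exp x)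

theorem expE_add (x y : ℝ) : expE (x + y) = expE x * expE y := by
  rw [expE, Real.exp_add, ENNReal.ofReal_mul (Real.exp_pos x).le]; rfl

theorem expE_zero : expE 0 = 1 := by simp [expE]

theorem expE_pow (x : ℝ) (t : ℕ) : expE x ^ t = expE (t * x) := by
  induction t with
  | zero => simp [expE_zero]
  | succ t ih => rw [pow_succ, ih, ← expE_add]; congr 1; push_cast; ring

theorem one_le_expE {x : ℝ} (h : 0 ≤ x) : 1 ≤ expE x := by
  rw [expE, ← ENNReal.ofReal_one]
  exact ENNReal.ofReal_le_ofReal (Real.one_le_exp h)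

theorem expE_moment_le {m l : ℝ} (hm : |m| ≤ 1) (hl : |l| ≤ 1 / 2) :
    ENNReal.ofReal ((1 + m) / 2) * expE l + ENNReal.ofReal ((1 - m) / 2) * expE (-l) ≤
      expE (l * m + l ^ 2) := by
  obtain ⟨hm1, hm2⟩ := abs_le.1 hm
  rw [expE, expE, ← ENNReal.ofReal_mul (by linarith), ← ENNReal.ofReal_mul (by linarith),
    ← ENNReal.ofReal_add]
  · exact ENNReal.ofReal_le_ofReal (exp_moment_le hm hl)
  · exact mul_nonneg (by linarith) (Real.exp_pos _).le
  · exact mul_nonneg (by linarith) (Real.exp_pos _).le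

section
variable {n k : ℕ} {c : Fin (2 * n) → Fin n → Pauli}

/-- A single observable is an anticommuting family. -/
theorem IsMajorana.abs_expVal_le (hc : IsMajorana c) (ρ : DensityMatrix n)
    {X : Finset (Fin (2 * n))} (hX : Even X.card) : |expVal c ρ X| ≤ 1 := by
  have h := hc.sum_sq_le_one ρ {X} (by simpa using hX)
    (by
      intro A hA B hB hAB
      rw [Finset.mem_singleton] at hA hB
      exact absurd (hA.trans hB.symm) hAB)
  rw [Finset.sum_singleton] at h
  exact abs_le_one_iff_mul_self_le_one.2 (by nlinarith)

/-- One time offset works for all test functions and outcomes, so the classical evaluation can be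
analysed outcome by outcome. -/
theorem expect_measure_seq (ρ : DensityMatrix n) {p : Program} (hp : p.Det) (a : ℕ)
    (s : Config n) : ∃ t, ∀ Φ : Config n → ℝ≥0∞,
      expect ((Program.seq (.measure a) p).run ρ s) Φ =
        expect (cliffordMeasurement ρ s.circuit) fun z => Φ (p.ex ((s.tick t).record a z)) := by
  refine ⟨1 + (1 + ∑ j ∈ Finset.range (n + n), (2 + j.size)), fun Φ => ?_⟩
  rw [Program.run_seq, expect_bind, Program.run, expect_bind]
  refine expect_congr fun z _ => ?_
  rw [expect_pure, p.run_det ρ hp, expect_pure]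
  have e : ∀ x, (s.tick 1).tick x = s.tick (1 + x) := fun x => by
    simp [Config.tick, Nat.add_assoc]
  rw [e]

theorem expect_det_seq (ρ : DensityMatrix n) {p q : Program} (hp : p.Det) (s : Config n)
    (Φ : Config n → ℝ≥0∞) : expect ((Program.seq p q).run ρ s) Φ =
      expect (q.run ρ (p.ex (s.tick 1))) Φ := by
  rw [Program.run_seq, p.run_det ρ hp, PMF.pure_bind]

/-! ## Bell measurements -/

theorem det_bellUpdate : (forTuples k (bellUpdate k)).Det := by
  simp [forTuples, bellUpdate, image, Program.Det]

theorem keeps_bellUpdate {a : ℕ} (h : a ∉ ({27, 28, 40, 41, 42, 43, 46} : Finset ℕ)) :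
    (bellUpdate k).Keeps a := by
  simp only [Finset.mem_insert, Finset.mem_singleton, not_or] at h
  simp [bellUpdate, image, Program.Keeps, h]

theorem keeps_bellRound {a : ℕ} (h : a ∉ ({20, 27, 28, 40, 41, 42, 43, 46, 50} : Finset ℕ)) :
    (bellRound k).Keeps a := by
  simp only [Finset.mem_insert, Finset.mem_singleton, not_or] at h
  simp [bellRound, bellCircuit, forTuples, bellUpdate, image, Program.Keeps, h]

theorem bellPar_congr {X : Finset (Fin (2 * n))} {μ μ' : Memory} (h1 : μ' 30 = μ 30)
    (h2 : μ' 31 = μ 31) (h3 : μ' 32 = μ 32) (h4 : μ' 50 = μ 50) :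
    bellPar X μ' = bellPar X μ := by
  simp only [bellPar, phaseOf, bit, h1, h2, h3, h4]

/-- The result of the evaluation of a Bell measurement. -/
theorem bellLoop_spec (hn : 0 < n) (s : Config n) (hd : Dims n s.mem) {X : Finset (Fin (2 * n))}
    (hX : X.card = 2 * k) :
    ((forTuples k (bellUpdate k)).ex s).mem 27 (key X) =
        s.mem 27 (key X) + (if bellPar X s.mem = 0 then 1 else 0) ∧
      ((forTuples k (bellUpdate k)).ex s).mem 28 (key X) =
        s.mem 28 (key X) + if bellPar X s.mem = 0 then 0 else 1 := by
  constructor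
  · refine ex_forTuples_update hn (keeps_bellUpdate (by simp)) hd (keeps_bellUpdate (by simp))
      (keeps_bellUpdate (by simp)) {30, 31, 32, 50} (fun a ha => keeps_bellUpdate ?_) (by simp) 27
      (by norm_num) (fun X v => v + if bellPar X s.mem = 0 then 1 else 0)
      (fun s' X hX hd' hA => ?_) hX
    · simp only [Finset.mem_insert, Finset.mem_singleton] at ha
      rcases ha with rfl | rfl | rfl | rfl <;> simp
    · rw [(bellUpdate_spec s' hd' hX).1, bellPar_congr (hA _ (by simp)) (hA _ (by simp))
        (hA _ (by simp)) (hA _ (by simp))]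
  · refine ex_forTuples_update hn (keeps_bellUpdate (by simp)) hd (keeps_bellUpdate (by simp))
      (keeps_bellUpdate (by simp)) {30, 31, 32, 50} (fun a ha => keeps_bellUpdate ?_) (by simp) 28
      (by norm_num) (fun X v => v + if bellPar X s.mem = 0 then 0 else 1)
      (fun s' X hX hd' hA => ?_) hX
    · simp only [Finset.mem_insert, Finset.mem_singleton] at ha
      rcases ha with rfl | rfl | rfl | rfl <;> simp
    · rw [(bellUpdate_spec s' hd' hX).2, bellPar_congr (hA _ (by simp)) (hA _ (by simp))
        (hA _ (by simp)) (hA _ (by simp))]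

/-- The difference of the numbers of positive and negative outcomes of Bell measurements. -/
def bellDiff (X : Finset (Fin (2 * n))) (s : Config n) : ℝ :=
  (s.mem 27 (key X) : ℝ) - s.mem 28 (key X)

/-- A round moves `bellDiff` by a sign with mean `m_X ^ 2`, irrespective of the past. -/
theorem expect_bellRound_le (hn : 0 < n) (hc : IsMajorana c) (ρ : DensityMatrix n) (s : Config n)
    (hd : Dims n s.mem) (hs : s.circuit = []) (hT : TabInv c s.mem [])
    {X : Finset (Fin (2 * n))} (hX : X.card = 2 * k) {l : ℝ} (hl : |l| ≤ 1 / 2) :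
    expect ((bellRound k).run ρ s) (fun s' => expE (l * bellDiff X s')) ≤
      expE (l * expVal c ρ X ^ 2 + l ^ 2) * expE (l * bellDiff X s) := by
  rw [bellRound, expect_det_seq ρ (by simp [bellCircuit, Program.Det])]
  obtain ⟨t, ht⟩ := expect_measure_seq ρ (det_bellUpdate (k := k)) 50 (bellCircuit.ex (s.tick 1))
  rw [ht]
  have key1 : ∀ z, expE (l * bellDiff X ((forTuples k (bellUpdate k)).ex
      (((bellCircuit.ex (s.tick 1)).tick t).record 50 z))) =
      if bellPar X ((bellCircuit.ex (s.tick 1)).record 50 z).mem = 0 then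
        expE (l * bellDiff X s) * expE l else expE (l * bellDiff X s) * expE (-l) := by
    intro z
    have mm : ∀ a, a ≠ 43 → a ≠ 50 →
        (((bellCircuit.ex (s.tick 1)).tick t).record 50 z).mem a = s.mem a := fun a h1 h2 => by
      rw [Config.record_mem_ne _ h2, Config.tick_mem,
        ex_keeps (by simp [bellCircuit, Program.Keeps, h1])]
      rfl
    obtain ⟨h1, h2⟩ := bellLoop_spec (k := k) hn
      (((bellCircuit.ex (s.tick 1)).tick t).record 50 z)
      (hd.congr (mm _ (by norm_num) (by norm_num)) (mm _ (by norm_num) (by norm_num))) hX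
    rw [bellDiff, h1, h2, mm 27 (by norm_num) (by norm_num), mm 28 (by norm_num) (by norm_num)]
    change expE (l * (((s.mem 27 (key X) + if bellPar X ((bellCircuit.ex (s.tick 1)).record 50 z).mem
      = 0 then 1 else 0 : ℕ) : ℝ) - ((s.mem 28 (key X) + if bellPar X
        ((bellCircuit.ex (s.tick 1)).record 50 z).mem = 0 then 0 else 1 : ℕ) : ℝ))) = _
    split_ifs
    · rw [← expE_add, bellDiff]; congr 1; push_cast; ring
    · rw [← expE_add, bellDiff]; congr 1; push_cast; ring
  simp only [key1]
  rw [bell_law hc ρ (s.tick 1) hd hs hT]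
  have hm : |expVal c ρ X ^ 2| ≤ 1 := by
    rw [abs_pow]
    exact pow_le_one₀ (abs_nonneg _) (hc.abs_expVal_le ρ (hX ▸ even_two_mul k))
  calc _ = (ENNReal.ofReal ((1 + expVal c ρ X ^ 2) / 2) * expE l +
        ENNReal.ofReal ((1 - expVal c ρ X ^ 2) / 2) * expE (-l)) * expE (l * bellDiff X s) := by ring
    _ ≤ _ := by gcongr; exact expE_moment_le hm hl

/-- The invariant of the loop of Bell measurements. -/
def BellInv (s₀ s : Config n) : Prop :=
  s.circuit = [] ∧ ∀ a, a ∉ ({20, 27, 28, 40, 41, 42, 43, 46, 50} : Finset ℕ) →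
    s.mem a = s₀.mem a

theorem bellInv_step (ρ : DensityMatrix n) {s₀ s : Config n} (h : BellInv s₀ s) :
    ∀ s' ∈ ((bellRound k).run ρ (s.tick 1)).support, BellInv s₀ s' := by
  intro s' hs'
  refine ⟨?_, fun a ha => ?_⟩
  · rw [bellRound, Program.run_seq, PMF.mem_support_bind_iff] at hs'
    obtain ⟨s1, -, hs'⟩ := hs'
    rw [Program.run_seq, PMF.mem_support_bind_iff] at hs'
    obtain ⟨s2, h2, hs'⟩ := hs'
    rw [run_support_classical ρ (by simp [forTuples, bellUpdate, image, Program.Classical]) _ _ hs']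
    rw [Program.run, PMF.mem_support_bind_iff] at h2
    obtain ⟨z, -, h2⟩ := h2
    rw [PMF.mem_support_pure_iff] at h2
    rw [h2]
    rfl
  · rw [run_support_keeps ρ (keeps_bellRound ha) _ _ hs', Config.tick_mem, h.2 a ha]

/-- The exponential moment of a sum of `T` signs, by multiplying the bounds for the rounds; the
counters start at zero. -/
theorem expect_bellLoop_le (hn : 0 < n) (hc : IsMajorana c) (ρ : DensityMatrix n) (s : Config n)
    (hd : Dims n s.mem) (hs : s.circuit = []) (hT : TabInv c s.mem [])
    {X : Finset (Fin (2 * n))} (hX : X.card = 2 * k) (h27 : s.mem 27 (key X) = 0)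
    (h28 : s.mem 28 (key X) = 0) {l : ℝ} (hl : |l| ≤ 1 / 2) (T : ℕ) :
    expect (iterate (fun t => (bellRound k).run ρ (t.tick 1)) T s)
        (fun s' => expE (l * bellDiff X s')) ≤
      expE (T * (l * expVal c ρ X ^ 2 + l ^ 2)) := by
  refine (expect_iterate_le (Inv := BellInv s) (fun a ha b hb => bellInv_step ρ ha b hb)
    (r := expE (l * expVal c ρ X ^ 2 + l ^ 2)) (fun a ha => ?_) T s ⟨hs, fun a _ => rfl⟩).trans ?_
  · refine expect_bellRound_le hn hc ρ (a.tick 1) ?_ ha.1 ?_ hX hl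
    · exact hd.congr (ha.2 _ (by simp)) (ha.2 _ (by simp))
    · exact hT.congr (ha.2 _ (by simp)) (ha.2 _ (by simp)) (ha.2 _ (by simp))
  · rw [bellDiff, h27, h28, expE_pow]
    simp [expE_zero]

end

/-! ## The measurements for the signs -/

section
variable {n k : ℕ} {c : Fin (2 * n) → Fin n → Pauli}

/-- The observable is marked and commutes with all marked observables. -/
def Covered (k : ℕ) (c : Fin (2 * n) → Fin n → Pauli) (X : Finset (Fin (2 * n))) (μ : Memory) :
    Prop :=
  Marked k X μ ∧ ∀ M : Finset (Fin (2 * n)), M.card = 2 * k → Marked k M μ →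
    majoranaMonomial c X * majoranaMonomial c M = majoranaMonomial c M * majoranaMonomial c X

/-- The loop that evaluates the outcome of a measurement. -/
def signLoop (k : ℕ) : Program :=
  forTuples k (.ite (cellE 26 (keyE (Finset.range (2 * k)))) (signUpdate k) .skip)

/-- One measurement for the signs, after the random labels have been drawn. -/
def signTail (k : ℕ) : Program :=
  .seq resetTable <| .seq (markLoop k) <| .seq (.measure 50) (signLoop k)

theorem signRound_eq : signRound k = .seq (drawAll k) (signTail k) := rfl

theorem keeps_signUpdate {a : ℕ}
    (h : a ∉ ({4, 5, 6, 40, 41, 42, 43, 46, 48} : Finset ℕ)) : (signUpdate k).Keeps a := by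
  simp only [Finset.mem_insert, Finset.mem_singleton, not_or] at h
  simp [signUpdate, image, Program.Keeps, h]

theorem keeps_resetTable {a : ℕ} (h : a ∉ ({30, 31, 32, 43, 49} : Finset ℕ)) :
    resetTable.Keeps a := by
  simp only [Finset.mem_insert, Finset.mem_singleton, not_or] at h
  simp [resetTable, h]

theorem keeps_markLoop {a : ℕ}
    (h : a ∉ ({20, 30, 31, 32, 40, 41, 42, 43, 44, 45, 47, 49} : Finset ℕ)) :
    (markLoop k).Keeps a := by
  have h' : a ∉ ({30, 31, 32, 40, 41, 42, 43, 44, 45, 47, 49} : Finset ℕ) :=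
    fun hh => h (Finset.mem_insert_of_mem hh)
  simp only [Finset.mem_insert, not_or] at h
  simp [markLoop, forTuples, Program.Keeps, h.1, keeps_diagonalize h']

theorem keeps_signLoop {a : ℕ}
    (h : a ∉ ({4, 5, 6, 20, 40, 41, 42, 43, 46, 48} : Finset ℕ)) :
    (signLoop k).Keeps a := by
  have h' : a ∉ ({4, 5, 6, 40, 41, 42, 43, 46, 48} : Finset ℕ) := by
    simp only [Finset.mem_insert, Finset.mem_singleton, not_or] at h ⊢
    tauto
  have h20 : a ≠ 20 := by rintro rfl; simp at h
  simp [signLoop, forTuples, Program.Keeps, h20, keeps_signUpdate h']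

theorem signPar_congr {X : Finset (Fin (2 * n))} {μ μ' : Memory} (h1 : μ' 30 = μ 30)
    (h2 : μ' 31 = μ 31) (h3 : μ' 32 = μ 32) (h4 : μ' 50 = μ 50) :
    signPar X μ' = signPar X μ := by
  simp only [signPar, phaseOf, bit, h1, h2, h3, h4]

open Classical in
theorem signLoop_spec (hn : 0 < n) (s : Config n) (hd : Dims n s.mem) {X : Finset (Fin (2 * n))}
    (hX : X.card = 2 * k) :
    ((signLoop k).ex s).mem 4 (key X) = s.mem 4 (key X) +
        (if s.mem 26 (key X) ≠ 0 ∧ Diag X s.mem ∧ signPar X s.mem = 0 then 1 else 0) ∧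
      ((signLoop k).ex s).mem 5 (key X) = s.mem 5 (key X) +
        (if s.mem 26 (key X) ≠ 0 ∧ Diag X s.mem ∧ ¬ signPar X s.mem = 0 then 1 else 0) ∧
      ((signLoop k).ex s).mem 6 (key X) = s.mem 6 (key X) +
        (if s.mem 26 (key X) ≠ 0 ∧ Diag X s.mem then 1 else 0) := by
  have hk : ∀ a, a ∉ ({4, 5, 6, 40, 41, 42, 43, 46, 48} : Finset ℕ) →
      (Program.ite (cellE 26 (keyE (Finset.range (2 * k)))) (signUpdate k) .skip).Keeps a :=
    fun a ha => ⟨keeps_signUpdate ha, by simp [Program.Keeps]⟩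
  have hA : ∀ a ∈ ({26, 30, 31, 32, 50} : Finset ℕ),
      (Program.ite (cellE 26 (keyE (Finset.range (2 * k)))) (signUpdate k) .skip).Keeps a := by
    intro a ha
    simp only [Finset.mem_insert, Finset.mem_singleton] at ha
    rcases ha with rfl | rfl | rfl | rfl | rfl <;> exact hk _ (by simp)
  have main : ∀ (s' : Config n) (X : Finset (Fin (2 * n))), AtTuple k X s'.mem → Dims n s'.mem →
      (∀ a ∈ ({26, 30, 31, 32, 50} : Finset ℕ), s'.mem a = s.mem a) →
      ((Program.ite (cellE 26 (keyE (Finset.range (2 * k)))) (signUpdate k) .skip).ex s').mem 4 =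
        Function.update (s'.mem 4) (key X) (s'.mem 4 (key X) +
        (if s.mem 26 (key X) ≠ 0 ∧ Diag X s.mem ∧ signPar X s.mem = 0 then 1 else 0)) ∧
      ((Program.ite (cellE 26 (keyE (Finset.range (2 * k)))) (signUpdate k) .skip).ex s').mem 5 =
        Function.update (s'.mem 5) (key X) (s'.mem 5 (key X) +
        (if s.mem 26 (key X) ≠ 0 ∧ Diag X s.mem ∧ ¬ signPar X s.mem = 0 then 1 else 0)) ∧
      ((Program.ite (cellE 26 (keyE (Finset.range (2 * k)))) (signUpdate k) .skip).ex s').mem 6 =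
        Function.update (s'.mem 6) (key X) (s'.mem 6 (key X) +
        (if s.mem 26 (key X) ≠ 0 ∧ Diag X s.mem then 1 else 0)) := by
    intro s' X hX hd' hA
    have hD : Diag X s'.mem ↔ Diag X s.mem :=
      ⟨fun h => h.congr (hA 30 (by simp)).symm, fun h => h.congr (hA 30 (by simp))⟩
    have hP : signPar X s'.mem = signPar X s.mem := signPar_congr (hA _ (by simp))
      (hA _ (by simp)) (hA _ (by simp)) (hA _ (by simp))
    by_cases h0 : s.mem 26 (key X) = 0
    · rw [ex_ite_neg (by simp [hX.eval_keyE_range, hA, h0])]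
      simp [h0]
    · rw [ex_ite_pos (by simp [hX.eval_keyE_range, hA, h0])]
      generalize e : s'.tick _ = s2
      have m2 : s2.mem = s'.mem := by rw [← e]; rfl
      obtain ⟨r1, r2, r3⟩ := signUpdate_spec s2 (by rwa [m2]) (by rwa [m2] : AtTuple k X s2.mem)
      rw [r1, r2, r3, m2, hP]
      simp only [hD, ne_eq, h0, not_false_eq_true, true_and]
  refine ⟨?_, ?_, ?_⟩
  · exact ex_forTuples_update hn (hk _ (by simp)) hd (hk _ (by simp)) (hk _ (by simp)) _ hA
      (by simp) 4 (by norm_num) (fun X v => v +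
        if s.mem 26 (key X) ≠ 0 ∧ Diag X s.mem ∧ signPar X s.mem = 0 then 1 else 0)
      (fun s' X h1 h2 h3 => (main s' X h1 h2 h3).1) hX
  · exact ex_forTuples_update hn (hk _ (by simp)) hd (hk _ (by simp)) (hk _ (by simp)) _ hA
      (by simp) 5 (by norm_num) (fun X v => v +
        if s.mem 26 (key X) ≠ 0 ∧ Diag X s.mem ∧ ¬ signPar X s.mem = 0 then 1 else 0)
      (fun s' X h1 h2 h3 => (main s' X h1 h2 h3).2.1) hX
  · exact ex_forTuples_update hn (hk _ (by simp)) hd (hk _ (by simp)) (hk _ (by simp)) _ hA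
      (by simp) 6 (by norm_num) (fun X v => v +
        if s.mem 26 (key X) ≠ 0 ∧ Diag X s.mem then 1 else 0)
      (fun s' X h1 h2 h3 => (main s' X h1 h2 h3).2.2) hX

/-- The exponent of the potential for the estimate of an observable with expectation value `m`. -/
def signPot (X : Finset (Fin (2 * n))) (m l d : ℝ) (s : Config n) : ℝ :=
  l * ((s.mem 4 (key X) : ℝ) - s.mem 5 (key X) - m * s.mem 6 (key X)) - d * s.mem 6 (key X)

theorem det_signLoop : (signLoop k).Det := by
  simp [signLoop, forTuples, signUpdate, image, Program.Det]

theorem det_markLoop : (markLoop k).Det := by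
  simp [markLoop, forTuples, diagonalize, image, findPivot, clearX, clearZ, gateH, gateS, gateCNOT,
    Program.Det]

open Classical in
-- If `X` has become diagonal, its counters receive one sample with mean `m`, and the potential,
-- which subtracts `l m + d` per sample, shrinks in expectation by `exp (l^2 - d)`. Otherwise the
-- counters do not move. A covered observable is always diagonal; a diagonal one that is not covered
-- does no harm because its sample is unbiased and `l^2 ≤ d`.
theorem expect_signTail_le (hn : 0 < n) (hc : IsMajorana c) (ρ : DensityMatrix n) (s : Config n)
    (hd : Dims n s.mem) (hs : s.circuit = []) (hin : InputTable c s.mem)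
    {X : Finset (Fin (2 * n))} (hX : X.card = 2 * k) (h26 : s.mem 26 (key X) ≠ 0) {l d : ℝ}
    (hl : |l| ≤ 1 / 2) (hld : l ^ 2 ≤ d) :
    expect ((signTail k).run ρ s) (fun s' => expE (signPot X (expVal c ρ X) l d s')) ≤
      (if Covered k c X s.mem then expE (l ^ 2 - d) else 1) *
        expE (signPot X (expVal c ρ X) l d s) := by
  rw [signTail, expect_det_seq ρ (by simp [resetTable]), expect_det_seq ρ det_markLoop]
  have hT1 := resetTable_spec (s.tick 1) hd hin hs
  generalize e1 : resetTable.ex (s.tick 1) = s1 at hT1 ⊢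
  have k1 : ∀ a, a ∉ ({30, 31, 32, 43, 49} : Finset ℕ) → s1.mem a = s.mem a := fun a ha => by
    rw [← e1, ex_keeps (keeps_resetTable ha)]; rfl
  have hd1 : Dims n s1.mem := hd.congr (k1 _ (by simp)) (k1 _ (by simp))
  obtain ⟨hT2, hcov⟩ := markLoop_spec (k := k) hn (s1.tick 1) hd1 hT1
  generalize e2 : (markLoop k).ex (s1.tick 1) = s2 at hT2 hcov ⊢
  have k2 : ∀ a, a ∉ ({20, 30, 31, 32, 40, 41, 42, 43, 44, 45, 47, 49} : Finset ℕ) →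
      s2.mem a = s.mem a := fun a ha => by
    have h' : a ∉ ({30, 31, 32, 43, 49} : Finset ℕ) := by
      simp only [Finset.mem_insert, Finset.mem_singleton, not_or] at ha ⊢
      tauto
    rw [← e2, ex_keeps (keeps_markLoop ha), Config.tick_mem, k1 a h']
  have hd2 : Dims n s2.mem := hd.congr (k2 _ (by simp)) (k2 _ (by simp))
  have hD : Covered k c X s.mem → Diag X s2.mem := by
    rintro ⟨h1, h2⟩
    have hme : ∀ Y : Finset (Fin (2 * n)), Marked k Y (s1.tick 1).mem ↔ Marked k Y s.mem :=
      fun Y => Marked.congr (k1 _ (by simp)) (k1 _ (by simp)) (k1 _ (by simp))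
    exact hcov X hX ((hme X).2 h1) fun M hM hMm => h2 M hM ((hme M).1 hMm)
  obtain ⟨t, ht⟩ := expect_measure_seq ρ (det_signLoop (k := k)) 50 s2
  rw [ht]
  have mm : ∀ z a, a ≠ 50 → ((s2.tick t).record 50 z).mem a = s2.mem a := fun z a h =>
    Config.record_mem_ne _ h _
  have hDz : ∀ z, Diag X ((s2.tick t).record 50 z).mem ↔ Diag X s2.mem := fun z =>
    ⟨fun h => h.congr (mm z 30 (by norm_num)).symm, fun h => h.congr (mm z 30 (by norm_num))⟩
  have hm := hc.abs_expVal_le ρ (X := X) (hX ▸ even_two_mul k)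
  set m := expVal c ρ X with hmdef
  by_cases hDX : Diag X s2.mem
  · have key1 : ∀ z, expE (signPot X m l d ((signLoop k).ex ((s2.tick t).record 50 z))) =
        if signPar X (s2.record 50 z).mem = 0 then
          expE (signPot X m l d s) * expE (-(l * m) - d) * expE l
        else expE (signPot X m l d s) * expE (-(l * m) - d) * expE (-l) := by
      intro z
      obtain ⟨h1, h2, h3⟩ := signLoop_spec (k := k) hn ((s2.tick t).record 50 z)
        (hd2.congr (mm z _ (by norm_num)) (mm z _ (by norm_num))) hX
      simp only [hDz, hDX, true_and, and_true, mm z 26 (by norm_num), k2 26 (by simp), ne_eq, h26,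
        not_false_eq_true, if_true] at h1 h2 h3
      rw [mm z 4 (by norm_num), k2 4 (by simp)] at h1
      rw [mm z 5 (by norm_num), k2 5 (by simp)] at h2
      rw [mm z 6 (by norm_num), k2 6 (by simp)] at h3
      change _ = _ + (if signPar X (s2.record 50 z).mem = 0 then 1 else 0) at h1
      change _ = _ + (if ¬ signPar X (s2.record 50 z).mem = 0 then 1 else 0) at h2
      rw [signPot, h1, h2, h3]
      split_ifs
      · rw [← expE_add, ← expE_add, signPot]; congr 1; push_cast; ring
      · rw [← expE_add, ← expE_add, signPot]; congr 1; push_cast; ring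
    simp only [key1]
    rw [sign_law hc ρ s2 hT2 hDX, ← hmdef]
    calc _ = (ENNReal.ofReal ((1 + m) / 2) * expE l + ENNReal.ofReal ((1 - m) / 2) * expE (-l)) *
          (expE (signPot X m l d s) * expE (-(l * m) - d)) := by ring
      _ ≤ expE (l * m + l ^ 2) * (expE (signPot X m l d s) * expE (-(l * m) - d)) := by
          gcongr; exact expE_moment_le hm hl
      _ = expE (l ^ 2 - d) * expE (signPot X m l d s) := by
          simp only [← expE_add]; congr 1; ring
      _ ≤ _ := by
          gcongr
          split_ifs
          · exact le_rfl
          · rw [← expE_zero]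
            exact ENNReal.ofReal_le_ofReal (Real.exp_le_exp.2 (by linarith))
  · rw [if_neg fun h => hDX (hD h), one_mul]
    have key1 : ∀ z, expE (signPot X m l d ((signLoop k).ex ((s2.tick t).record 50 z))) =
        expE (signPot X m l d s) := by
      intro z
      obtain ⟨h1, h2, h3⟩ := signLoop_spec (k := k) hn ((s2.tick t).record 50 z)
        (hd2.congr (mm z _ (by norm_num)) (mm z _ (by norm_num))) hX
      simp only [hDz, hDX, false_and, and_false, if_false, add_zero] at h1 h2 h3
      rw [signPot, h1, h2, h3, mm z 4 (by norm_num), mm z 5 (by norm_num), mm z 6 (by norm_num),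
        k2 4 (by simp), k2 5 (by simp), k2 6 (by simp), signPot]
    simp only [key1, expect_const]
    exact le_rfl

theorem signTail_circuit (ρ : DensityMatrix n) (s : Config n) :
    ∀ s' ∈ ((signTail k).run ρ s).support, s'.circuit = [] := by
  intro s' hs'
  rw [signTail, Program.run_seq, PMF.mem_support_bind_iff] at hs'
  obtain ⟨s1, -, hs'⟩ := hs'
  rw [Program.run_seq, PMF.mem_support_bind_iff] at hs'
  obtain ⟨s2, -, hs'⟩ := hs'
  rw [Program.run_seq, PMF.mem_support_bind_iff] at hs'
  obtain ⟨s3, h3, hs'⟩ := hs'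
  rw [run_support_classical ρ (by simp [signLoop, forTuples, signUpdate, image,
    Program.Classical]) _ _ hs']
  rw [Program.run, PMF.mem_support_bind_iff] at h3
  obtain ⟨z, -, h3⟩ := h3
  rw [PMF.mem_support_pure_iff] at h3
  rw [h3]
  rfl

/-! ## Random labels -/

/-- The martingale version with a test function that varies with the round; it is applied to
conditional probabilities of the labels that are still to be drawn. -/
theorem expect_iterate_eq {α : Type} {f : α → PMF α} {T : ℕ} (Inv : ℕ → α → Prop)
    (F : ℕ → α → ℝ≥0∞)
    (hInv : ∀ t < T, ∀ a, Inv t a → ∀ b ∈ (f a).support, Inv (t + 1) b)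
    (h : ∀ t < T, ∀ a, Inv t a → expect (f a) (F (t + 1)) = F t a) (a : α) (ha : Inv 0 a) :
    expect (iterate f T a) (F T) = F 0 a := by
  induction T generalizing Inv F a with
  | zero => simp [iterate, expect_pure]
  | succ T ih =>
    rw [iterate, expect_bind, ← h 0 (by omega) a ha]
    exact expect_congr fun b hb => ih (fun t => Inv (t + 1)) (fun t => F (t + 1))
      (fun t ht => hInv (t + 1) (by omega)) (fun t ht => h (t + 1) (by omega)) b
      (hInv 0 (by omega) a ha b hb)

/-- The cell collects random bits in binary, and `w` is the part read so far. The reduction modulo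
`2 * var 105 + 1` never takes effect; it is in the program only to make the size of the value
evident to the running time analysis. -/
theorem drawBits (ρ : DensityMatrix n) {l : List Expr} {addr : List ℕ} {μ₀ : Memory}
    (hl : ∀ μ : Memory, (∀ a, a ≠ 22 → a ≠ 23 → μ a = μ₀ a) →
      l.map (fun e => e.eval μ) = addr) (g : (List ℕ → ℕ) → ℝ≥0∞) {tg : ℕ}
    (h105 : μ₀ 105 [] = tg) (T w : ℕ) (hw : (w + 1) * 2 ^ T ≤ 2 * tg + 1) (s : Config n)
    (hs : ∀ a, a ≠ 22 → a ≠ 23 → s.mem a = μ₀ a) (hsw : s.mem 23 addr = w) :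
    expect (iterate (fun t => (Program.seq (coinV 22) (setE 23 l
      ((2 * cellE 23 l + var 22) % (2 * var 105 + 1)))).run ρ (t.tick 1)) T s)
      (fun s' => g (s'.mem 23)) =
    ∑ v ∈ Finset.range (2 ^ T), (2⁻¹ : ℝ≥0∞) ^ T *
      g (Function.update (s.mem 23) addr (w * 2 ^ T + v)) := by
  induction T generalizing w s with
  | zero =>
    have : Function.update (s.mem 23) addr w = s.mem 23 := by rw [← hsw, Function.update_eq_self]
    simp [iterate, expect_pure, this]
  | succ T ih =>
    rw [iterate, expect_bind, Program.run_seq, expect_bind, coinV, Program.run, expect_bind]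
    simp only [expect_pure]
    rw [expect_fintype]
    have step : ∀ b : Fin 2, expect ((setE 23 l
        ((2 * cellE 23 l + var 22) % (2 * var 105 + 1))).run ρ
          ((((s.tick 1).tick 1).tick (1 + (Expr.cell 22 (![] : Fin 0 → Expr)).cost
            ((s.tick 1).tick 1).mem)).write 22
            (List.ofFn fun i => ((![] : Fin 0 → Expr) i).eval ((s.tick 1).tick 1).mem) b))
        (fun a => expect (iterate (fun t => (Program.seq (coinV 22) (setE 23 l
          ((2 * cellE 23 l + var 22) % (2 * var 105 + 1)))).run ρ (t.tick 1)) T a)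
          (fun s' => g (s'.mem 23))) =
        ∑ v ∈ Finset.range (2 ^ T), (2⁻¹ : ℝ≥0∞) ^ T *
          g (Function.update (s.mem 23) addr ((2 * w + b) * 2 ^ T + v)) := by
      intro b
      have hb : (b : ℕ) < 2 := b.isLt
      rw [Program.run_det ρ _ (by simp), expect_pure]
      generalize e1 : Config.write _ 22 _ _ = s1
      have m1 : ∀ a, a ≠ 22 → s1.mem a = s.mem a := fun a ha => by rw [← e1]; simp [ha]
      have m22 : s1.mem 22 [] = b := by rw [← e1]; simp
      have hl1 : l.map (fun e => e.eval s1.mem) = addr :=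
        hl _ fun a h1 h2 => by rw [m1 a h1, hs a h1 h2]
      have h105' : s1.mem 105 [] = tg := by
        rw [m1 _ (by norm_num), hs _ (by norm_num) (by norm_num), h105]
      -- The remaining `T` bits fit below the modulus, hence so does the prefix with one more bit.
      have hlt : 2 * w + b < 2 * tg + 1 := by
        have : 2 ^ (T + 1) ≥ 2 := by
          rw [pow_succ]; have := Nat.one_le_two_pow (n := T); omega
        nlinarith
      rw [ih (2 * w + b) ?_ _ ?_ ?_]
      · rw [ex_setE_mem_self, hl1, m1 23 (by norm_num)]
        simp only [Function.update_idem]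
      · refine le_trans ?_ hw
        rw [pow_succ, mul_comm (2 ^ T), ← mul_assoc]
        gcongr
        omega
      · intro a h1 h2
        rw [ex_setE_mem_ne h2, m1 a h1, hs a h1 h2]
      · rw [ex_setE_mem_self, hl1, Function.update_self]
        simp only [eval_mod, eval_add, eval_mul, eval_ofNat, eval_cellE, hl1, eval_var, m22,
          h105', m1 23 (by norm_num), hsw]
        exact Nat.mod_eq_of_lt hlt
    simp only [coinV] at step
    rw [Fin.sum_univ_two, step, step]
    simp only [PMF.uniformOfFintype_apply, Fintype.card_fin, Nat.cast_ofNat]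
    rw [show 2 ^ (T + 1) = 2 ^ T + 2 ^ T by ring, Finset.sum_range_add, Finset.mul_sum,
      Finset.mul_sum]
    congr 1
    · refine Finset.sum_congr rfl fun v _ => ?_
      rw [pow_succ, mul_comm _ (2⁻¹ : ℝ≥0∞), mul_assoc]
      congr 4
      simp; ring
    · refine Finset.sum_congr rfl fun v _ => ?_
      rw [pow_succ, mul_comm _ (2⁻¹ : ℝ≥0∞), mul_assoc]
      congr 4
      simp; ring

end

/-! ## The distribution of the random labels -/

section
variable {n k : ℕ}

theorem expect_drawOne (ρ : DensityMatrix n) {l : List Expr} {addr : List ℕ} (s : Config n)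
    (hl : ∀ μ : Memory, (∀ a, a ≠ 22 → a ≠ 23 → μ a = s.mem a) →
      l.map (fun e => e.eval μ) = addr) (g : (List ℕ → ℕ) → ℝ≥0∞) {tg m : ℕ}
    (h105 : s.mem 105 [] = tg) (h107 : s.mem 107 [] = m) (hm : 2 ^ m ≤ 2 * tg + 1) :
    expect ((drawOne l).run ρ s) (fun s' => g (s'.mem 23)) =
      ∑ v ∈ Finset.range (2 ^ m), (2⁻¹ : ℝ≥0∞) ^ m * g (Function.update (s.mem 23) addr v) := by
  rw [drawOne, expect_det_seq ρ (by simp), Program.run]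
  generalize e1 : (setE 23 l 0).ex (s.tick 1) = s1
  have m1 : ∀ a, a ≠ 23 → s1.mem a = s.mem a := fun a ha => by rw [← e1]; simp [ha]
  have hl0 : l.map (fun e => e.eval s.mem) = addr := hl _ fun _ _ _ => rfl
  have m23 : s1.mem 23 = Function.update (s.mem 23) addr 0 := by rw [← e1]; simp [hl0]
  have he : (var 107).eval s1.mem = m := by rw [eval_var, m1 _ (by norm_num), h107]
  rw [he, drawBits ρ hl g h105 m 0 (by simpa using hm) (s1.tick (1 + (var 107).cost s1.mem)) (fun a h1 h2 => m1 a h2)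
    (by simp [m23])]
  simp only [Config.tick_mem, m23, Function.update_idem, zero_mul, zero_add]

open Classical in
/-- The conditional probability that the labels have the given values when those at the addresses
in `B` have not been drawn yet. -/
def labelPot (B : List ℕ → Prop) (I : Finset (List ℕ)) (u : List ℕ → ℕ) (w : ℝ≥0∞)
    (r : List ℕ → ℕ) : ℝ≥0∞ :=
  ∏ p ∈ I, if B p then w else if r p = u p then 1 else 0

theorem labelPot_congr {B B' : List ℕ → Prop} (h : ∀ p, B p ↔ B' p) {I : Finset (List ℕ)}
    {u : List ℕ → ℕ} {w : ℝ≥0∞} {r : List ℕ → ℕ} : labelPot B I u w r = labelPot B' I u w r := by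
  have : B = B' := funext fun p => propext (h p)
  rw [this]

/-- Averaging over a fresh uniform label at `addr` replaces the indicator of the prescribed value by
its probability. If `addr` is not in `I`, nothing depends on it. -/
theorem sum_labelPot {B : List ℕ → Prop} {I : Finset (List ℕ)} {u : List ℕ → ℕ} {m : ℕ}
    {addr : List ℕ} (hB : ¬ B addr) (hu : ∀ p ∈ I, u p < 2 ^ m) (r : List ℕ → ℕ) :
    ∑ v ∈ Finset.range (2 ^ m), (2⁻¹ : ℝ≥0∞) ^ m *
        labelPot B I u (2⁻¹ ^ m) (Function.update r addr v) =
      labelPot (fun p => B p ∨ p = addr) I u (2⁻¹ ^ m) r := by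
  classical
  obtain ⟨B', hB'⟩ : ∃ B' : List ℕ → Prop, ∀ p, B' p ↔ B p ∨ p = addr := ⟨_, fun _ => Iff.rfl⟩
  rw [← labelPot_congr hB']
  have h2 : (2 : ℝ≥0∞) ^ m * 2⁻¹ ^ m = 1 := by
    rw [← mul_pow, ENNReal.mul_inv_cancel (by norm_num) (by norm_num), one_pow]
  have hne : ∀ v, ∀ p ∈ I.erase addr,
      (if B p then (2⁻¹ : ℝ≥0∞) ^ m else if Function.update r addr v p = u p then 1 else 0) =
        if B' p then 2⁻¹ ^ m else if r p = u p then 1 else 0 := by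
    intro v p hp
    have := (Finset.mem_erase.1 hp).1
    simp [hB', this]
  by_cases hI : addr ∈ I
  · have e : ∀ v, labelPot B I u (2⁻¹ ^ m) (Function.update r addr v) =
        (if v = u addr then 1 else 0) * ∏ p ∈ I.erase addr,
          (if B' p then (2⁻¹ : ℝ≥0∞) ^ m else if r p = u p then 1 else 0) := by
      intro v
      rw [labelPot, ← Finset.mul_prod_erase _ _ hI, Finset.prod_congr rfl (hne v)]
      simp [hB]
    simp only [e]
    rw [labelPot]
    rw [← Finset.mul_prod_erase _ _ hI, ← Finset.mul_sum, ← Finset.sum_mul, ← mul_assoc]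
    congr 1
    simp [hu addr hI, hB']
  · have e : ∀ v, labelPot B I u (2⁻¹ ^ m) (Function.update r addr v) =
        labelPot B' I u (2⁻¹ ^ m) r := by
      intro v
      rw [labelPot, labelPot]
      refine Finset.prod_congr rfl fun p hp => hne v p (Finset.mem_erase.2 ⟨?_, hp⟩)
      rintro rfl
      exact hI hp
    simp only [e, Finset.sum_const, Finset.card_range, nsmul_eq_mul]
    rw [← mul_assoc]
    push_cast
    rw [h2, one_mul]

theorem keeps_drawOne (l : List Expr) {a : ℕ} (h22 : a ≠ 22) (h23 : a ≠ 23) :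
    (drawOne l).Keeps a := by
  simp [drawOne, coinV, Program.Keeps, h22, h23]

theorem keeps_drawLength (j : ℕ) {a : ℕ} (h21 : a ≠ 21) (h22 : a ≠ 22) (h23 : a ≠ 23) :
    (drawLength j).Keeps a := by
  simp [drawLength, h21, keeps_drawOne _ h22 h23]

theorem map_dg_injOn {N j t t' : ℕ} (ht : t < N ^ j) (ht' : t' < N ^ j)
    (h : (List.range j).map (dg N t) = (List.range j).map (dg N t')) : t = t' := by
  rw [← ofDigits_map_dg ht, h, ofDigits_map_dg ht']

theorem exists_map_dg {N j : ℕ} {p : List ℕ} (hN : 1 < N) (hj : p.length = j)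
    (hp : ∀ v ∈ p, v < N) : ∃ t < N ^ j, p = (List.range j).map (dg N t) := by
  refine ⟨Nat.ofDigits N p, hj ▸ Nat.ofDigits_lt_base_pow_length hN hp, ?_⟩
  refine List.ext_getElem (by simp [hj]) fun i h1 h2 => ?_
  simp only [List.getElem_map, List.getElem_range]
  rw [dg, ofDigits_div_mod hp]
  simp [h1]

/-- Read backwards, the loop turns drawn addresses into undrawn ones. The enumeration of addresses
by digits is injective, so no address is drawn twice. -/
theorem expect_drawLength (ρ : DensityMatrix n) {N tg m j : ℕ} (hN : 1 < N) (s : Config n)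
    (h101 : s.mem 101 [] = N) (h105 : s.mem 105 [] = tg) (h107 : s.mem 107 [] = m)
    (hm : 2 ^ m ≤ 2 * tg + 1) {B : List ℕ → Prop} (hB : ∀ p, B p → p.length ≠ j)
    {I : Finset (List ℕ)} {u : List ℕ → ℕ} (hu : ∀ p ∈ I, u p < 2 ^ m) :
    expect ((drawLength j).run ρ s) (fun s' => labelPot B I u (2⁻¹ ^ m) (s'.mem 23)) =
      labelPot (fun p => B p ∨ (p.length = j ∧ ∀ v ∈ p, v < N)) I u (2⁻¹ ^ m) (s.mem 23) := by
  rw [drawLength, forE, expect_det_seq ρ (by simp), Program.run]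
  generalize e1 : (setE 21 [] 0).ex (s.tick 1) = s1
  have m1 : ∀ a, a ≠ 21 → s1.mem a = s.mem a := fun a ha => by rw [← e1]; simp [ha]
  have m21 : s1.mem 21 [] = 0 := by rw [← e1]; simp
  have hT : (powE (var 101) j).eval s1.mem = N ^ j := by
    rw [eval_powE, eval_var, m1 _ (by norm_num), h101]
  rw [hT]
  set addr : ℕ → List ℕ := fun t => (List.range j).map (dg N t) with haddr
  -- Before iteration `t` the undrawn addresses are those of `B` and those with numbers from `t` on.
  set F : ℕ → Config n → ℝ≥0∞ := fun t s' =>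
    labelPot (fun p => B p ∨ ∃ t', t ≤ t' ∧ t' < N ^ j ∧ p = addr t') I u (2⁻¹ ^ m) (s'.mem 23)
    with hF
  have e2 : ∀ s' : Config n, labelPot B I u (2⁻¹ ^ m) (s'.mem 23) = F (N ^ j) s' := fun s' =>
    labelPot_congr fun p => ⟨Or.inl, fun h => h.resolve_right fun ⟨t, h1, h2, _⟩ => by omega⟩
  simp only [e2]
  rw [expect_iterate_eq (fun t s' => s'.mem 21 [] = t ∧ s'.mem 101 [] = N ∧ s'.mem 105 [] = tg ∧
    s'.mem 107 [] = m) F]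
  · rw [hF]
    simp only [Config.tick_mem]
    rw [m1 23 (by norm_num)]
    refine labelPot_congr fun p => or_congr_right ⟨?_, ?_⟩
    · rintro ⟨t, -, -, rfl⟩
      refine ⟨by simp [haddr], fun v hv => ?_⟩
      simp only [haddr, List.mem_map] at hv
      obtain ⟨i, -, rfl⟩ := hv
      exact Nat.mod_lt _ (by omega)
    · rintro ⟨h1, h2⟩
      obtain ⟨t, ht, rfl⟩ := exists_map_dg hN h1 h2
      exact ⟨t, Nat.zero_le _, ht, rfl⟩
  · intro t ht a ⟨g1, g2, g3, g4⟩ b hb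
    rw [Program.run_seq, PMF.mem_support_bind_iff] at hb
    obtain ⟨a', ha', hb⟩ := hb
    rw [Program.run_det ρ _ (by simp), PMF.mem_support_pure_iff] at hb
    have kk : ∀ i, i ≠ 22 → i ≠ 23 → a'.mem i = a.mem i := fun i h1 h2 => by
      rw [run_support_keeps ρ (keeps_drawOne _ h1 h2) _ _ ha']; rfl
    rw [hb]
    simp [kk, g1, g2, g3, g4]
  · intro t ht a ⟨g1, g2, g3, g4⟩
    rw [Program.run_seq, expect_bind]
    have e3 : ∀ a' : Config n, expect ((setE 21 [] (var 21 + 1)).run ρ a') (F (t + 1)) =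
        F (t + 1) a' := fun a' => by
      rw [Program.run_det ρ _ (by simp), expect_pure, hF]
      simp
    simp only [e3]
    rw [hF]
    rw [expect_drawOne ρ ((a.tick 1).tick 1) (addr := addr t) ?_
      (labelPot (fun p => B p ∨ ∃ t', t + 1 ≤ t' ∧ t' < N ^ j ∧ p = addr t') I u (2⁻¹ ^ m))
      g3 g4 hm]
    · rw [sum_labelPot ?_ hu]
      · refine labelPot_congr fun p => ?_
        constructor
        · rintro ((h | ⟨t', h1, h2, h3⟩) | h)
          · exact Or.inl h
          · exact Or.inr ⟨t', by omega, h2, h3⟩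
          · exact Or.inr ⟨t, le_rfl, ht, h⟩
        · rintro (h | ⟨t', h1, h2, h3⟩)
          · exact Or.inl (Or.inl h)
          · rcases h1.eq_or_lt with rfl | h1
            · exact Or.inr h3
            · exact Or.inl (Or.inr ⟨t', h1, h2, h3⟩)
      · rintro (h | ⟨t', h1, h2, h3⟩)
        · exact hB _ h (by simp [haddr])
        · have := map_dg_injOn ht h2 h3
          omega
    · intro μ hμ
      simp only [List.map_map, haddr]
      refine List.map_congr_left fun i _ => ?_
      have h21 : μ 21 [] = t := by rw [hμ 21 (by norm_num) (by norm_num)]; exact g1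
      have h101 : μ 101 [] = N := by rw [hμ 101 (by norm_num) (by norm_num)]; exact g2
      simp [h21, h101, dg]
  · exact ⟨m21, by simpa [m1] using h101, by simpa [m1] using h105, by simpa [m1] using h107⟩

theorem keeps_drawAll {a : ℕ} (h21 : a ≠ 21) (h22 : a ≠ 22) (h23 : a ≠ 23) :
    (drawAll k).Keeps a := by
  simp only [drawAll, keeps_seqs, List.mem_map, forall_exists_index, and_imp,
    forall_apply_eq_imp_iff₂]
  exact fun i _ => keeps_drawLength _ h21 h22 h23

/-- The addresses of the random labels. -/
def IsLabelAddr (N k : ℕ) (p : List ℕ) : Prop :=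
  (∀ v ∈ p, v < N) ∧ Odd p.length ∧ p.length < 2 * k

/-- With every address in `I` undrawn the potential is a constant: prescribed labels are hit
independently with probability `2^(-m)` each. The old contents of the cells are irrelevant, so
rounds are independent of the past. -/
theorem expect_drawAll (ρ : DensityMatrix n) {N tg m : ℕ} (hN : 1 < N) (s : Config n)
    (h101 : s.mem 101 [] = N) (h105 : s.mem 105 [] = tg) (h107 : s.mem 107 [] = m)
    (hm : 2 ^ m ≤ 2 * tg + 1) {I : Finset (List ℕ)} (hI : ∀ p ∈ I, IsLabelAddr N k p)
    {u : List ℕ → ℕ} (hu : ∀ p ∈ I, u p < 2 ^ m) :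
    expect ((drawAll k).run ρ s)
      (fun s' => labelPot (fun _ => False) I u (2⁻¹ ^ m) (s'.mem 23)) = (2⁻¹ ^ m) ^ I.card := by
  have main : ∀ (r i : ℕ) (s : Config n), i + r = k → s.mem 101 [] = N → s.mem 105 [] = tg →
      s.mem 107 [] = m →
      expect ((seqs ((List.range' i r).map fun i => drawLength (2 * i + 1))).run ρ s)
        (fun s' => labelPot (fun _ => False) I u (2⁻¹ ^ m) (s'.mem 23)) =
      labelPot (fun p => (∀ v ∈ p, v < N) ∧ Odd p.length ∧ p.length < 2 * k ∧ 2 * i + 1 ≤ p.length)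
        I u (2⁻¹ ^ m) (s.mem 23) := by
    intro r
    induction r with
    | zero =>
      intro i s hi _ _ _
      rw [List.range'_zero, List.map_nil, seqs, Program.run, expect_pure]
      exact labelPot_congr fun p => ⟨False.elim, fun h => by omega⟩
    | succ r ih =>
      intro i s hi h101 h105 h107
      rw [List.range'_succ, List.map_cons, seqs, Program.run_seq, expect_bind,
        expect_congr (g := fun s' => labelPot (fun p => (∀ v ∈ p, v < N) ∧ Odd p.length ∧
          p.length < 2 * k ∧ 2 * (i + 1) + 1 ≤ p.length) I u (2⁻¹ ^ m) (s'.mem 23)),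
        expect_drawLength ρ hN (s.tick 1) h101 h105 h107 hm
          (fun p h => by have := h.2.2.2; omega) hu]
      · refine labelPot_congr fun p => ?_
        constructor
        · rintro (⟨h1, h2, h3, h4⟩ | ⟨h1, h2⟩)
          · exact ⟨h1, h2, h3, by omega⟩
          · exact ⟨h2, ⟨i, h1⟩, by omega, by omega⟩
        · rintro ⟨h1, h2, h3, h4⟩
          rcases h4.eq_or_lt with h | h
          · exact Or.inr ⟨h.symm, h1⟩
          · obtain ⟨q, hq⟩ := h2
            exact Or.inl ⟨h1, ⟨q, hq⟩, h3, by omega⟩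
      · intro s' hs'
        have kk : ∀ a, a ≠ 21 → a ≠ 22 → a ≠ 23 → s'.mem a = s.mem a := fun a h1 h2 h3 => by
          rw [run_support_keeps ρ (keeps_drawLength _ h1 h2 h3) _ _ hs']; rfl
        refine ih (i + 1) s' (by omega) ?_ ?_ ?_
        · rw [kk _ (by norm_num) (by norm_num) (by norm_num), h101]
        · rw [kk _ (by norm_num) (by norm_num) (by norm_num), h105]
        · rw [kk _ (by norm_num) (by norm_num) (by norm_num), h107]
  rw [drawAll, List.range_eq_range', main k 0 s (by omega) h101 h105 h107, labelPot,
    Finset.prod_congr rfl (g := fun _ => (2⁻¹ : ℝ≥0∞) ^ m), Finset.prod_const]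
  intro p hp
  obtain ⟨h1, h2, h3⟩ := hI p hp
  have h4 : 2 * 0 + 1 ≤ p.length := by
    obtain ⟨q, hq⟩ := h2
    omega
  exact if_pos ⟨h1, h2, h3, h4⟩

end

/-! ## The labels -/

section
variable {n k : ℕ}

/-- The labels for the set `A` are a numbering of the set `U`. -/
structure Labels {N : ℕ} (A U : Finset (Fin N)) (μ : Memory) : Prop where
  ne_zero_iff : ∀ v : Fin N, μ 24 (v.val :: key A) ≠ 0 ↔ v ∈ U
  inj : ∀ v ∈ U, ∀ w ∈ U, μ 24 (v.val :: key A) = μ 24 (w.val :: key A) → v = w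
  le : ∀ v : Fin N, μ 24 (v.val :: key A) ≤ μ 25 (key A)
  count : μ 25 (key A) = U.card

section
variable {N : ℕ} {A U : Finset (Fin N)} {μ μ' : Memory}

theorem Labels.congr (h : Labels A U μ) (h24 : μ' 24 = μ 24) (h25 : μ' 25 = μ 25) :
    Labels A U μ' := by
  refine ⟨?_, ?_, ?_, ?_⟩
  · rw [h24]; exact h.1
  · rw [h24]; exact h.2
  · rw [h24, h25]; exact h.3
  · rw [h25]; exact h.4

/-- The new label is one more than the counter, which bounds all labels in use. In particular labels
start at `1`, and `0` means that there is no label. -/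
theorem Labels.insert (h : Labels A U μ) {v : Fin N} (hv : v ∉ U)
    (h24 : μ' 24 = Function.update (μ 24) (v.val :: key A) (μ 25 (key A) + 1))
    (h25 : μ' 25 = Function.update (μ 25) (key A) (μ 25 (key A) + 1)) :
    Labels A (insert v U) μ' := by
  have e : ∀ w : Fin N, w ≠ v → μ' 24 (w.val :: key A) = μ 24 (w.val :: key A) := fun w hw => by
    rw [h24, Function.update_of_ne]
    intro h'
    exact hw (Fin.ext (List.cons.inj h').1)
  have ev : μ' 24 (v.val :: key A) = μ 25 (key A) + 1 := by rw [h24, Function.update_self]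
  have ek : μ' 25 (key A) = μ 25 (key A) + 1 := by rw [h25, Function.update_self]
  refine ⟨fun w => ?_, fun w hw x hx hwx => ?_, fun w => ?_, ?_⟩
  · by_cases hw : w = v
    · subst hw; simp [ev]
    · rw [e w hw, h.ne_zero_iff, Finset.mem_insert]; simp [hw]
  · by_cases hw' : w = v
    · by_cases hx' : x = v
      · rw [hw', hx']
      · rw [hw', ev, e x hx'] at hwx
        have := h.le x
        omega
    · by_cases hx' : x = v
      · rw [hx', ev, e w hw'] at hwx
        have := h.le w
        omega
      · rw [e w hw', e x hx'] at hwx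
        exact h.inj w (Finset.mem_of_mem_insert_of_ne hw hw') x
          (Finset.mem_of_mem_insert_of_ne hx hx') hwx
  · rw [ek]
    by_cases hw : w = v
    · rw [hw, ev]
    · rw [e w hw]; exact (h.le w).trans (Nat.le_succ _)
  · rw [ek, h.count, Finset.card_insert_of_notMem hv]

theorem Labels.update_of_ne {B : Finset (Fin N)} (h : Labels B U μ) (hAB : B ≠ A) {v x y : ℕ}
    (h24 : μ' 24 = Function.update (μ 24) (v :: key A) x)
    (h25 : μ' 25 = Function.update (μ 25) (key A) y) : Labels B U μ' := by
  have hk : key B ≠ key A := fun h => hAB (key_injective h)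
  have e24 : ∀ w : ℕ, μ' 24 (w :: key B) = μ 24 (w :: key B) := fun w => by
    rw [h24, Function.update_of_ne]
    intro h'
    exact hk (List.cons.inj h').2
  have e25 : μ' 25 (key B) = μ 25 (key B) := by rw [h25, Function.update_of_ne hk]
  refine ⟨?_, ?_, ?_, ?_⟩
  · simp only [e24]; exact h.1
  · simp only [e24]; exact h.2
  · simp only [e24, e25]; exact h.3
  · rw [e25]; exact h.4

end

/-- The program that labels the element at one position. -/
def labelOne (J : Finset ℕ) (i : ℕ) : Program := .seq (setE 25 (keyE J) (cellE 25 (keyE J) + 1))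
  (setE 24 (dgE i :: keyE J) (cellE 25 (keyE J)))

theorem labelOne_spec {X : Finset (Fin (2 * n))} {J : Finset ℕ} (hJ : J ⊆ Finset.range (2 * k))
    (i : ℕ) (s : Config n) (hX : AtTuple k X s.mem) :
    ((labelOne J i).ex s).mem 24 = Function.update (s.mem 24) (el X i :: key (subAt X J))
        (s.mem 25 (key (subAt X J)) + 1) ∧
      ((labelOne J i).ex s).mem 25 = Function.update (s.mem 25) (key (subAt X J))
        (s.mem 25 (key (subAt X J)) + 1) := by
  have hX' : AtTuple k X ((setE 25 (keyE J) (cellE 25 (keyE J) + 1)).ex (s.tick 1)).mem :=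
    hX.congr (by simp) (by simp)
  rw [labelOne, ex_seq]
  constructor
  · rw [ex_setE_mem_self, List.map_cons, hX'.eval_keyE hJ, hX'.eval_dgE, eval_cellE,
      hX'.eval_keyE hJ, ex_setE_mem_ne (by norm_num), ex_setE_mem_self]
    simp [hX.eval_keyE hJ]
  · rw [ex_setE_mem_ne (by norm_num), ex_setE_mem_self]
    simp [hX.eval_keyE hJ]

/-- Besides the numbering for the kernel at hand, this records that other kernels are unaffected and
that no label is ever removed. -/
theorem labelList_spec {X : Finset (Fin (2 * n))} {J : Finset ℕ} (hJ : J ⊆ Finset.range (2 * k))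
    {U : Finset (Fin (2 * n))} (l : List ℕ) (hl : l.Nodup) (hlt : ∀ i ∈ l, i < 2 * k)
    (s : Config n) (hX : AtTuple k X s.mem)
    (hU : ∀ i ∈ l, ∀ v : Fin (2 * n), el X i = v → v ∉ U)
    (h : Labels (subAt X J) U s.mem) :
    Labels (subAt X J) (subAt X l.toFinset ∪ U) ((seqs (l.map (labelOne J))).ex s).mem ∧
      (∀ (B V : Finset (Fin (2 * n))), B ≠ subAt X J → Labels B V s.mem →
        Labels B V ((seqs (l.map (labelOne J))).ex s).mem) ∧
      ∀ a, s.mem 24 a ≠ 0 → ((seqs (l.map (labelOne J))).ex s).mem 24 a ≠ 0 := by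
  induction l generalizing s U with
  | nil =>
    have : subAt X (([] : List ℕ).toFinset) = ∅ := by ext; simp [mem_subAt]
    rw [this, Finset.empty_union]
    exact ⟨h, fun B V _ h => h, fun a h => h⟩
  | cons i l ih =>
    rw [List.map_cons, seqs, ex_seq]
    obtain ⟨r1, r2⟩ := labelOne_spec hJ i (s.tick 1) hX
    have hX' : AtTuple k X ((labelOne J i).ex (s.tick 1)).mem :=
      hX.congr (ex_keeps (by simp [labelOne, Program.Keeps]) _)
        (ex_keeps (by simp [labelOne, Program.Keeps]) _)
    generalize (labelOne J i).ex (s.tick 1) = s1 at *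
    have hi : i < X.card := by rw [hX.1]; exact hlt i (by simp)
    have hvU : elF hi ∉ U := hU i (by simp) _ rfl
    have h1 := h.insert hvU (μ' := s1.mem) r1 r2
    obtain ⟨g1, g2, g3⟩ := ih (U := insert (elF hi) U) hl.of_cons
      (fun j hj => hlt j (by simp [hj])) s1 hX' (fun j hj v hv => by
        rw [Finset.mem_insert, not_or]
        refine ⟨?_, hU j (by simp [hj]) v hv⟩
        rintro rfl
        have : j = i := el_inj (by rw [hX.1]; exact hlt j (by simp [hj])) hi hv
        exact (List.nodup_cons.1 hl).1 (this ▸ hj)) h1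
    refine ⟨?_, fun B V hB hV => g2 B V hB (hV.update_of_ne hB r1 r2), fun a ha => g3 a ?_⟩
    · have e : subAt X (i :: l).toFinset ∪ U = subAt X l.toFinset ∪ insert (elF hi) U := by
        ext v
        simp only [Finset.mem_union, mem_subAt, List.mem_toFinset, List.mem_cons,
          Finset.mem_insert]
        constructor
        · rintro (⟨j, rfl | hj, hv⟩ | hv)
          · exact Or.inr (Or.inl (Fin.ext hv.symm))
          · exact Or.inl ⟨j, hj, hv⟩
          · exact Or.inr (Or.inr hv)
        · rintro (⟨j, hj, hv⟩ | rfl | hv)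
          · exact Or.inl ⟨j, Or.inr hj, hv⟩
          · exact Or.inl ⟨i, Or.inl rfl, rfl⟩
          · exact Or.inr hv
      rw [e]
      exact g1
    · rw [r1]
      by_cases h' : a = el X i :: key (subAt X J)
      · subst h'; simp
      · rw [Function.update_of_ne h']; exact ha

/-- The labels for each odd set `A` come from a family of selected observables that pairwise
intersect in `A`. -/
def LabelInv (k : ℕ) (S : Finset (Fin (2 * n)) → Prop) (μ : Memory) : Prop :=
  ∀ A : Finset (Fin (2 * n)), ∃ F : Finset (Finset (Fin (2 * n))),
    (∀ X ∈ F, X.card = 2 * k ∧ S X ∧ A ⊆ X) ∧ (∀ X ∈ F, ∀ Y ∈ F, X ≠ Y → X ∩ Y = A) ∧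
    Labels A (F.biUnion fun X => X \ A) μ

theorem LabelInv.congr {S : Finset (Fin (2 * n)) → Prop} {μ μ' : Memory} (h : LabelInv k S μ)
    (h24 : μ' 24 = μ 24) (h25 : μ' 25 = μ 25) : LabelInv k S μ' := fun A => by
  obtain ⟨F, h1, h2, h3⟩ := h A
  exact ⟨F, h1, h2, h3.congr h24 h25⟩

/-- One of the elements outside of the given positions has a label. -/
def Hit (k : ℕ) (X : Finset (Fin (2 * n))) (J : Finset ℕ) (μ : Memory) : Prop :=
  ∃ i ∈ coPos k J, μ 24 (el X i :: key (subAt X J)) ≠ 0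

theorem sdiff_subAt {X : Finset (Fin (2 * n))} (hX : X.card = 2 * k) {J : Finset ℕ}
    (hJ : J ⊆ Finset.range (2 * k)) : subAt X (coPos k J).toFinset = X \ subAt X J := by
  ext v
  simp only [mem_subAt, List.mem_toFinset, mem_coPos, Finset.mem_sdiff]
  constructor
  · rintro ⟨i, ⟨hi, hiJ⟩, hv⟩
    have hi' : i < X.card := by rw [hX]; exact hi
    have : elF hi' = v := Fin.ext hv
    refine ⟨this ▸ elF_mem hi', ?_⟩
    rintro ⟨j, hj, hjv⟩
    have hj' : j < X.card := by rw [hX]; exact Finset.mem_range.1 (hJ hj)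
    exact hiJ (el_inj hi' hj' (hv.trans hjv.symm) ▸ hj)
  · rintro ⟨hv, hvJ⟩
    obtain ⟨i, hi, h⟩ := exists_el hv
    exact ⟨i, ⟨hX ▸ hi, fun hJ => hvJ ⟨i, hJ, h⟩⟩, h⟩

theorem keeps_labelOne (J : Finset ℕ) (i : ℕ) {a : ℕ} (h24 : a ≠ 24) (h25 : a ≠ 25) :
    (labelOne J i).Keeps a := by simp [labelOne, Program.Keeps, h24, h25]

theorem keeps_labelSet (J : Finset ℕ) {a : ℕ} (h24 : a ≠ 24) (h25 : a ≠ 25) :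
    (labelSet k J).Keeps a := by
  refine ⟨by simp [Program.Keeps], ?_⟩
  rw [keeps_seqs]
  intro p hp
  obtain ⟨i, -, rfl⟩ := List.mem_map.1 hp
  exact keeps_labelOne J i h24 h25

/-- The greedy step. Either some element of `X` outside the kernel is labelled already, and nothing
happens, or the petal of `X` is disjoint from all earlier petals, and `X` joins the sunflower. In
both cases `X` contains a labelled element outside the kernel afterwards. -/
theorem labelSet_spec {S : Finset (Fin (2 * n)) → Prop} {X : Finset (Fin (2 * n))} {J : Finset ℕ}
    (hJ : J ∈ posSets k) (s : Config n) (hX : AtTuple k X s.mem) (hS : S X)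
    (h : LabelInv k S s.mem) :
    LabelInv k S ((labelSet k J).ex s).mem ∧ Hit k X J ((labelSet k J).ex s).mem ∧
      ∀ a, s.mem 24 a ≠ 0 → ((labelSet k J).ex s).mem 24 a ≠ 0 := by
  obtain ⟨hJr, hodd⟩ := mem_posSets hJ
  have hcond : (sumE ((coPos k J).map fun i => cellE 24 (dgE i :: keyE J))).eval s.mem = 0 ↔
      ¬ Hit k X J s.mem := by
    rw [eval_sumE, List.sum_eq_zero_iff, Hit]
    simp only [List.map_map, List.mem_map, Function.comp_apply, eval_cellE, List.map_cons,
      hX.eval_dgE, hX.eval_keyE hJr, forall_exists_index, and_imp, forall_apply_eq_imp_iff₂,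
      not_exists, not_and, not_not]
  by_cases hh : Hit k X J s.mem
  · have : (labelSet k J).ex s = Program.skip.ex (s.tick _) :=
      ex_ite_pos fun h0 => hcond.1 h0 hh
    rw [this]
    exact ⟨h, hh, fun a ha => ha⟩
  have e : (labelSet k J).ex s = (seqs ((coPos k J).map (labelOne J))).ex (s.tick _) :=
    ex_ite_neg (hcond.2 hh)
  rw [e]
  generalize hs2 : s.tick _ = s2
  have m2 : s2.mem = s.mem := by rw [← hs2]; rfl
  obtain ⟨F, f1, f2, f3⟩ := h (subAt X J)
  -- The labelled elements are exactly those in the petals.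
  have hdisj : ∀ v ∈ X \ subAt X J, v ∉ F.biUnion fun X' => X' \ subAt X J := by
    intro v hv hvF
    rw [← f3.ne_zero_iff] at hvF
    rw [← sdiff_subAt hX.1 hJr, mem_subAt] at hv
    obtain ⟨i, hi, hiv⟩ := hv
    exact hh ⟨i, List.mem_toFinset.1 hi, by rw [hiv]; exact hvF⟩
  obtain ⟨g1, g2, g3⟩ := labelList_spec (X := X) hJr
    (U := F.biUnion fun X' => X' \ subAt X J) (coPos k J) (Finset.sort_nodup _ _)
    (fun i hi => (mem_coPos.1 hi).1) s2 (by rwa [m2]) (fun i hi v hv => by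
      refine hdisj v ?_
      rw [← sdiff_subAt hX.1 hJr, mem_subAt]
      exact ⟨i, List.mem_toFinset.2 hi, hv⟩) (by rwa [m2])
  rw [sdiff_subAt hX.1 hJr] at g1
  have hAX : subAt X J ⊆ X := subAt_subset (by rw [hX.1]; exact hJr)
  refine ⟨fun A => ?_, ?_, by rwa [m2] at g3⟩
  · by_cases hA : A = subAt X J
    · subst hA
      refine ⟨insert X F, ?_, ?_, ?_⟩
      · intro Y hY
        rcases Finset.mem_insert.1 hY with rfl | hY
        · exact ⟨hX.1, hS, hAX⟩
        · exact f1 Y hY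
      -- Both sets contain the kernel, and disjoint petals leave nothing else in common.
      · have key : ∀ Y ∈ F, X ∩ Y = subAt X J := by
          intro Y hY
          refine Finset.Subset.antisymm (fun v hv => ?_)
            (Finset.subset_inter hAX (f1 Y hY).2.2)
          by_contra hvA
          obtain ⟨hvX, hvY⟩ := Finset.mem_inter.1 hv
          exact hdisj v (Finset.mem_sdiff.2 ⟨hvX, hvA⟩)
            (Finset.mem_biUnion.2 ⟨Y, hY, Finset.mem_sdiff.2 ⟨hvY, hvA⟩⟩)
        intro Y hY Z hZ hYZ
        rcases Finset.mem_insert.1 hY with hY' | hY'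
        · rcases Finset.mem_insert.1 hZ with hZ' | hZ'
          · exact absurd (hY'.trans hZ'.symm) hYZ
          · rw [hY']; exact key Z hZ'
        · rcases Finset.mem_insert.1 hZ with hZ' | hZ'
          · rw [hZ', Finset.inter_comm]; exact key Y hY'
          · exact f2 Y hY' Z hZ' hYZ
      · rw [Finset.biUnion_insert]
        exact g1
    · obtain ⟨F', h1, h2, h3⟩ := h A
      exact ⟨F', h1, h2, g2 A _ hA (by rwa [m2])⟩
  -- The petal is not empty: an odd set of positions cannot be all of the `2 * k` positions.
  · have hne : (coPos k J) ≠ [] := by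
      intro h0
      have : Finset.range (2 * k) \ J = ∅ := by
        rw [← Finset.sort_toFinset (r := (· ≤ ·)) (Finset.range (2 * k) \ J),
          show (Finset.range (2 * k) \ J).sort (· ≤ ·) = coPos k J from rfl, h0]
        rfl
      have h1 : J = Finset.range (2 * k) :=
        Finset.Subset.antisymm hJr (Finset.sdiff_eq_empty_iff_subset.1 this)
      rw [h1, Finset.card_range] at hodd
      exact (Nat.not_odd_iff_even.2 (even_two_mul k)) hodd
    obtain ⟨i, hi⟩ := List.exists_mem_of_ne_nil _ hne
    refine ⟨i, hi, ?_⟩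
    have hi' : i < X.card := by rw [hX.1]; exact (mem_coPos.1 hi).1
    refine (g1.ne_zero_iff (elF hi')).2 (Finset.mem_union_left _ ?_)
    rw [← sdiff_subAt hX.1 hJr, mem_subAt]
    exact ⟨i, List.mem_toFinset.2 hi, rfl⟩

theorem labelSets_spec {S : Finset (Fin (2 * n)) → Prop} {X : Finset (Fin (2 * n))}
    (l : List (Finset ℕ)) (hl : ∀ J ∈ l, J ∈ posSets k) (s : Config n) (hX : AtTuple k X s.mem)
    (hS : S X) (h : LabelInv k S s.mem) :
    LabelInv k S ((seqs (l.map (labelSet k))).ex s).mem ∧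
      (∀ J ∈ l, Hit k X J ((seqs (l.map (labelSet k))).ex s).mem) ∧
      ∀ a, s.mem 24 a ≠ 0 → ((seqs (l.map (labelSet k))).ex s).mem 24 a ≠ 0 := by
  induction l generalizing s with
  | nil => exact ⟨h, by simp, fun a ha => ha⟩
  | cons J l ih =>
    rw [List.map_cons, seqs, ex_seq]
    obtain ⟨r1, r2, r3⟩ := labelSet_spec (hl J (by simp)) (s.tick 1) hX hS h
    have hX' : AtTuple k X ((labelSet k J).ex (s.tick 1)).mem :=
      hX.congr (ex_keeps (keeps_labelSet J (by norm_num) (by norm_num)) _)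
        (ex_keeps (keeps_labelSet J (by norm_num) (by norm_num)) _)
    obtain ⟨g1, g2, g3⟩ := ih (fun J hJ => hl J (by simp [hJ])) _ hX' r1
    refine ⟨g1, fun J' hJ' => ?_, fun a ha => g3 a (r3 a ha)⟩
    rcases List.mem_cons.1 hJ' with rfl | hJ'
    · obtain ⟨i, hi, h'⟩ := r2
      exact ⟨i, hi, g3 _ h'⟩
    · exact g2 J' hJ'

theorem keeps_labelSets {a : ℕ} (h24 : a ≠ 24) (h25 : a ≠ 25) :
    (seqs ((posSets k).map (labelSet k))).Keeps a := by
  rw [keeps_seqs]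
  intro p hp
  obtain ⟨J, -, rfl⟩ := List.mem_map.1 hp
  exact keeps_labelSet J h24 h25

/-- Maximality of the greedy sunflowers: since labels persist, every selected observable keeps the
labelled elements it had when its turn was over. -/
theorem labelAll_spec (hn : 0 < n) (s : Config n) (hd : Dims n s.mem) (h24 : ∀ a, s.mem 24 a = 0)
    (h25 : ∀ a, s.mem 25 a = 0) :
    LabelInv k (fun X : Finset (Fin (2 * n)) => s.mem 26 (key X) ≠ 0) ((labelAll k).ex s).mem ∧
      ∀ X : Finset (Fin (2 * n)), X.card = 2 * k → s.mem 26 (key X) ≠ 0 → ∀ J ∈ posSets k,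
        Hit k X J ((labelAll k).ex s).mem := by
  set S : Finset (Fin (2 * n)) → Prop := fun X => s.mem 26 (key X) ≠ 0
  have key := ex_forTuples_induct (N := 2 * n) (k := k) (by omega) (s := s)
    (p := .ite (cellE 26 (keyE (Finset.range (2 * k))))
    (seqs ((posSets k).map (labelSet k))) .skip)
    ⟨keeps_labelSets (by norm_num) (by norm_num), by simp [Program.Keeps]⟩ hd.2
    (fun t μ _ => Dims n μ ∧ μ 26 = s.mem 26 ∧ LabelInv k S μ ∧
      ∀ X : Finset (Fin (2 * n)), X.card = 2 * k → S X → codeOf X < t → ∀ J ∈ posSets k,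
        Hit k X J μ) ?_ ?_ ?_ ?_ ?_
  · exact ⟨key.2.2.1, fun X hX hS => key.2.2.2 X hX hS (hX ▸ codeOf_lt (by omega) X)⟩
  · intro t μ f L ⟨g1, g2, g3, g4⟩
    refine ⟨g1.update f (by norm_num), by simpa using g2, g3.congr (by simp) (by simp),
      fun X hX hS ht J hJ => ?_⟩
    obtain ⟨i, hi, h⟩ := g4 X hX hS ht J hJ
    exact ⟨i, hi, by simpa using h⟩
  -- All sunflowers start empty.
  · refine ⟨hd, rfl, fun A => ⟨∅, by simp, by simp, ?_⟩, by simp⟩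
    rw [Finset.biUnion_empty]
    exact ⟨by simp [h24], by simp, by simp [h24], by simp [h25]⟩
  · exact fun t μ L h => h.1.2
  · intro t μ L hX ⟨g1, g2, g3, g4⟩
    refine ⟨g1, g2, g3, fun X hXc hS ht => g4 X hXc hS ?_⟩
    have := hX X hXc
    omega
  · intro X s' hX ⟨g1, g2, g3, g4⟩
    have hcond : (cellE 26 (keyE (Finset.range (2 * k)))).eval s'.mem = s.mem 26 (key X) := by
      rw [eval_cellE, hX.eval_keyE_range, g2]
    by_cases hS : S X
    · rw [ex_ite_pos (by rw [hcond]; exact hS)]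
      generalize e : s'.tick _ = s2
      have m2 : s2.mem = s'.mem := by rw [← e]; rfl
      obtain ⟨r1, r2, r3⟩ := labelSets_spec (posSets k) (fun J hJ => hJ) s2 (by rwa [m2]) hS
        (by rwa [m2])
      have kk : ∀ a, a ≠ 24 → a ≠ 25 →
          ((seqs ((posSets k).map (labelSet k))).ex s2).mem a = s'.mem a := fun a h1 h2 => by
        rw [ex_keeps (keeps_labelSets h1 h2), m2]
      refine ⟨g1.congr (kk _ (by norm_num) (by norm_num)) (kk _ (by norm_num) (by norm_num)),
        by rw [kk _ (by norm_num) (by norm_num), g2], r1, fun Y hY hYS ht J hJ => ?_⟩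
      rcases Nat.lt_succ_iff_lt_or_eq.1 ht with h | h
      · obtain ⟨i, hi, h'⟩ := g4 Y hY hYS h J hJ
        exact ⟨i, hi, r3 _ (by rwa [m2])⟩
      · rw [codeOf_inj (hY.trans hX.1.symm) h]
        exact r2 J hJ
    · rw [ex_ite_neg (by rw [hcond]; simpa [S] using hS)]
      refine ⟨g1, g2, g3, fun Y hY hYS ht J hJ => ?_⟩
      rcases Nat.lt_succ_iff_lt_or_eq.1 ht with h | h
      · exact g4 Y hY hYS h J hJ
      · rw [codeOf_inj (hY.trans hX.1.symm) h] at hYS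
        exact absurd hYS hS

end

/-! ## The probability that an observable is covered -/

section
variable {n k : ℕ} {c : Fin (2 * n) → Fin n → Pauli} {S : Finset (Fin (2 * n)) → Prop} {W : ℕ}

/-- Families of selected observables with odd intersections are small. -/
def SmallCliques (k : ℕ) (S : Finset (Fin (2 * n)) → Prop) (W : ℕ) : Prop :=
  ∀ F : Finset (Finset (Fin (2 * n))), (∀ X ∈ F, X.card = 2 * k ∧ S X) →
    (∀ X ∈ F, ∀ Y ∈ F, X ≠ Y → Odd (X ∩ Y).card) → F.card ≤ W

/-- The members of a sunflower with an odd kernel form a family with odd intersections, so there are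
at most `W`, and each contributes at most `2 * k` elements. The larger factor `2 * k + 2` leaves the
slack that the union bound for `k = 1` needs. -/
theorem LabelInv.label_le {μ : Memory} (h : LabelInv k S μ) (hW : SmallCliques k S W)
    {A : Finset (Fin (2 * n))} (hA : Odd A.card) (v : Fin (2 * n)) :
    μ 24 (v.val :: key A) ≤ (2 * k + 2) * W := by
  obtain ⟨F, h1, h2, h3⟩ := h A
  calc _ ≤ μ 25 (key A) := h3.le v
    _ = (F.biUnion fun X => X \ A).card := h3.count
    _ ≤ F.card * (2 * k) := Finset.card_biUnion_le_card_mul _ _ _ fun X hX =>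
        (Finset.card_le_card Finset.sdiff_subset).trans (h1 X hX).1.le
    _ ≤ W * (2 * k + 2) := Nat.mul_le_mul (hW F (fun X hX => ⟨(h1 X hX).1, (h1 X hX).2.1⟩)
        fun X hX Y hY hXY => by rw [h2 X hX Y hY hXY]; exact hA) (by omega)
    _ = _ := mul_comm _ _

theorem LabelInv.inj {μ : Memory} (h : LabelInv k S μ) {A : Finset (Fin (2 * n))}
    {v w : Fin (2 * n)} (hv : μ 24 (v.val :: key A) ≠ 0)
    (hvw : μ 24 (v.val :: key A) = μ 24 (w.val :: key A)) : v = w := by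
  obtain ⟨F, h1, h2, h3⟩ := h A
  exact h3.inj v ((h3.ne_zero_iff v).1 hv) w ((h3.ne_zero_iff w).1 (hvw ▸ hv)) hvw

theorem IsMajorana.commute_of_even (hc : IsMajorana c) {X Y : Finset (Fin (2 * n))}
    (hY : Even Y.card) (h : Even (X ∩ Y).card) :
    majoranaMonomial c X * majoranaMonomial c Y = majoranaMonomial c Y * majoranaMonomial c X := by
  rw [hc.monomial_mul hY, h.neg_one_pow, one_smul]

/-- Marked observables commute if all odd sets of positions are taken into account. -/
theorem Marked.even_inter (hk : k ≠ 1) {μ : Memory} (hL : LabelInv k S μ)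
    {X Y : Finset (Fin (2 * n))} (hX : X.card = 2 * k) (hY : Y.card = 2 * k) (hXm : Marked k X μ)
    (hYm : Marked k Y μ) : Even (X ∩ Y).card := by
  by_contra hodd
  rw [Nat.not_even_iff_odd] at hodd
  -- The odd intersection corresponds to a set of positions in each of the two observables, possibly
  -- different ones, but its labels are stored under the same address.
  have key1 : ∀ Z : Finset (Fin (2 * n)), Z.card = 2 * k → Marked k Z μ → X ∩ Y ⊆ Z →
      ∃ v ∈ Z, v ∉ X ∩ Y ∧ μ 24 (v.val :: key (X ∩ Y)) = μ 23 (key (X ∩ Y)) + 1 := by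
    intro Z hZ hZm hsub
    obtain ⟨J, hJ, hJZ⟩ := exists_subAt hsub
    have hJp : J ∈ posSets k := by
      have : J.card = (X ∩ Y).card := by rw [← hJZ, card_subAt hJ]
      rw [hZ] at hJ
      simp [posSets, hk, hJ, this, hodd]
    obtain ⟨i, hi, h⟩ := hZm.2 J hJp
    rw [mem_coPos, ← hZ] at hi
    refine ⟨elF hi.1, elF_mem hi.1, ?_, ?_⟩
    · rw [← hJZ, elF_mem_subAt hJ hi.1]; exact hi.2
    · rw [hJZ] at h; exact h
  obtain ⟨v, hv, hvA, hvl⟩ := key1 X hX hXm Finset.inter_subset_left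
  obtain ⟨w, hw, hwA, hwl⟩ := key1 Y hY hYm Finset.inter_subset_right
  have : v = w := hL.inj (by rw [hvl]; exact Nat.succ_ne_zero _) (hvl.trans hwl.symm)
  subst this
  exact hvA (Finset.mem_inter.2 ⟨hv, hw⟩)

theorem labelPot_eq_one_of_ne {I : Finset (List ℕ)} {u : List ℕ → ℕ} {w : ℝ≥0∞} {r : List ℕ → ℕ} :
    (labelPot (fun _ => False) I u w r ≠ 0 → ∀ p ∈ I, r p = u p) ∧
      labelPot (fun _ => False) I u w r ≤ 1 ∧
      ((∀ p ∈ I, r p = u p) → labelPot (fun _ => False) I u w r = 1) := by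
  refine ⟨fun h p hp => ?_, ?_, fun h => ?_⟩
  · have := Finset.prod_ne_zero_iff.1 h p hp
    by_contra hne
    simp [hne] at this
  · refine Finset.prod_le_one' fun p _ => ?_
    rw [if_neg not_false]
    split_ifs <;> simp
  · refine Finset.prod_eq_one fun p hp => ?_
    rw [if_neg not_false, if_pos (h p hp)]

theorem isLabelAddr_subAt {X : Finset (Fin (2 * n))} (hX : X.card = 2 * k)
    {J : Finset ℕ} (hJ : J ∈ posSets k) : IsLabelAddr (2 * n) k (key (subAt X J)) := by
  obtain ⟨h1, h2⟩ := mem_posSets hJ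
  have hc : (subAt X J).card = J.card := card_subAt (by rw [hX]; exact h1)
  refine ⟨fun v hv => lt_of_mem_key hv, ?_, ?_⟩
  · rw [length_key, hc]; exact h2
  · rw [length_key, hc]
    have h3 := Finset.card_le_card h1
    rw [Finset.card_range] at h3
    refine lt_of_le_of_ne h3 fun h => ?_
    rw [h] at h2
    exact Nat.not_odd_iff_even.2 (even_two_mul k) h2

open Classical in
-- For each kernel in `X` fix one labelled element outside of it. If all drawn numbers agree with
-- these labels, `X` is marked. The kernels at different positions have different addresses, so this
-- is an event about `(posSets k).length` independent draws.
theorem expect_marked (hn : 0 < n) (ρ : DensityMatrix n) (s : Config n) {m : ℕ}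
    (h101 : s.mem 101 [] = 2 * n) (h105 : s.mem 105 [] = (2 * k + 2) * W)
    (h107 : s.mem 107 [] = m) (hm1 : (2 * k + 2) * W < 2 ^ m)
    (hm2 : 2 ^ m ≤ 2 * ((2 * k + 2) * W)) (hW : SmallCliques k S W) (hL : LabelInv k S s.mem)
    {X : Finset (Fin (2 * n))} (hX : X.card = 2 * k) (h26 : s.mem 26 (key X) ≠ 0)
    (hHit : ∀ J ∈ posSets k, Hit k X J s.mem) :
    ((2⁻¹ : ℝ≥0∞) ^ m) ^ (posSets k).length ≤
      expect ((drawAll k).run ρ s) (fun s' => if Marked k X s'.mem then 1 else 0) := by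
  set I := ((posSets k).map fun J => key (subAt X J)).toFinset with hI
  have hinj : ∀ J ∈ posSets k, ∀ J' ∈ posSets k, key (subAt X J) = key (subAt X J') → J = J' :=
    fun J hJ J' hJ' h => subAt_injective (by rw [hX]; exact (mem_posSets hJ).1)
      (by rw [hX]; exact (mem_posSets hJ').1) (key_injective h)
  have hcard : I.card = (posSets k).length := by
    rw [hI, List.toFinset_card_of_nodup, List.length_map]
    exact (nodup_posSets k).map_on fun J hJ J' hJ' h => hinj J hJ J' hJ' h
  have hex : ∀ p, ∃ w, p ∈ I → ∃ J ∈ posSets k, ∃ i ∈ coPos k J, key (subAt X J) = p ∧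
      s.mem 24 (el X i :: p) = w + 1 := by
    intro p
    by_cases hp : p ∈ I
    · rw [hI, List.mem_toFinset, List.mem_map] at hp
      obtain ⟨J, hJ, rfl⟩ := hp
      obtain ⟨i, hi, h⟩ := hHit J hJ
      exact ⟨s.mem 24 (el X i :: key (subAt X J)) - 1, fun _ => ⟨J, hJ, i, hi, rfl, by omega⟩⟩
    · exact ⟨0, fun h => absurd h hp⟩
  choose u hu using hex
  -- Draws range over `0, …, 2 ^ m - 1` and labels start at `1`; a label of at most `(2 * k + 2) * W
  -- < 2 ^ m`, lowered by one, can be drawn.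
  have hu2 : ∀ p ∈ I, u p < 2 ^ m := by
    intro p hp
    obtain ⟨J, hJ, i, hi, hJp, h⟩ := hu p hp
    have hi' : i < X.card := by rw [hX]; exact (mem_coPos.1 hi).1
    have := hL.label_le hW (A := subAt X J) (by
      rw [card_subAt (by rw [hX]; exact (mem_posSets hJ).1)]
      exact (mem_posSets hJ).2) (elF hi')
    rw [hJp] at this
    change s.mem 24 (el X i :: p) ≤ _ at this
    omega
  rw [← hcard, ← expect_drawAll ρ (N := 2 * n) (by omega) s h101 h105 h107 (by omega)
    (I := I) (fun p hp => by
      rw [hI, List.mem_toFinset, List.mem_map] at hp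
      obtain ⟨J, hJ, rfl⟩ := hp
      exact isLabelAddr_subAt hX hJ) hu2]
  refine expect_mono fun s' hs' => ?_
  by_cases h0 : labelPot (fun _ => False) I u (2⁻¹ ^ m) (s'.mem 23) = 0
  · rw [h0]; exact zero_le
  have hr := labelPot_eq_one_of_ne.1 h0
  have kk : ∀ a, a ≠ 21 → a ≠ 22 → a ≠ 23 → s'.mem a = s.mem a := fun a h1 h2 h3 =>
    run_support_keeps ρ (keeps_drawAll h1 h2 h3) _ _ hs'
  rw [if_pos]
  · exact labelPot_eq_one_of_ne.2.1
  · refine ⟨by rwa [kk _ (by norm_num) (by norm_num) (by norm_num)], fun J hJ => ?_⟩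
    have hp : key (subAt X J) ∈ I := by
      rw [hI, List.mem_toFinset, List.mem_map]; exact ⟨J, hJ, rfl⟩
    obtain ⟨J', hJ', i, hi, hJp, h⟩ := hu _ hp
    have := hinj J' hJ' J hJ hJp
    subst this
    refine ⟨i, hi, ?_⟩
    rw [kk _ (by norm_num) (by norm_num) (by norm_num), h, hr _ hp]

theorem inv_two_pow_le {m T : ℕ} (h : 2 ^ m ≤ T) : ((T : ℝ≥0∞))⁻¹ ≤ 2⁻¹ ^ m := by
  rw [← ENNReal.inv_pow, ENNReal.inv_le_inv]
  exact_mod_cast h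

open Classical in
-- With all odd kernels in use, marked observables commute, so being marked already means being
-- covered.
theorem expect_covered_of_ne_one (hc : IsMajorana c) (hk1 : k ≠ 1) (hn : 0 < n)
    (ρ : DensityMatrix n) (s : Config n) {m : ℕ}
    (h101 : s.mem 101 [] = 2 * n) (h105 : s.mem 105 [] = (2 * k + 2) * W)
    (h107 : s.mem 107 [] = m) (hm1 : (2 * k + 2) * W < 2 ^ m)
    (hm2 : 2 ^ m ≤ 2 * ((2 * k + 2) * W)) (hW : SmallCliques k S W) (hL : LabelInv k S s.mem)
    {X : Finset (Fin (2 * n))} (hX : X.card = 2 * k) (h26 : s.mem 26 (key X) ≠ 0)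
    (hHit : ∀ J ∈ posSets k, Hit k X J s.mem) :
    ((2⁻¹ : ℝ≥0∞) ^ m) ^ (posSets k).length ≤
      expect ((drawAll k).run ρ s) (fun s' => if Covered k c X s'.mem then 1 else 0) := by
  refine (expect_marked hn ρ s h101 h105 h107 hm1 hm2 hW hL hX h26 hHit).trans
    (expect_mono fun s' hs' => ?_)
  by_cases h : Marked k X s'.mem
  · have kk : ∀ a, a ≠ 21 → a ≠ 22 → a ≠ 23 → s'.mem a = s.mem a := fun a h1 h2 h3 =>
      run_support_keeps ρ (keeps_drawAll h1 h2 h3) _ _ hs'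
    have hL' : LabelInv k S s'.mem := hL.congr (kk _ (by norm_num) (by norm_num) (by norm_num))
      (kk _ (by norm_num) (by norm_num) (by norm_num))
    rw [if_pos h, if_pos]
    exact ⟨h, fun M hM hMm => hc.commute_of_even (hM ▸ even_two_mul k)
      (h.even_inter hk1 hL' hX hM hMm)⟩
  · rw [if_neg h]; exact zero_le

/-! ### Two-body observables -/

theorem posSets_one : posSets 1 = [{0}] := by simp [posSets]

theorem coPos_one : coPos 1 {0} = [1] := by
  rw [coPos, show Finset.range (2 * 1) \ {0} = {1} by decide, Finset.sort_singleton]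

theorem key_subAt_zero {X : Finset (Fin (2 * n))} (hX : X.card = 2 * 1) :
    key (subAt X {0}) = [el X 0] := by
  rw [key_subAt (by rw [hX]; decide)]; simp

theorem marked_one {X : Finset (Fin (2 * n))} (hX : X.card = 2 * 1) {μ : Memory} :
    Marked 1 X μ ↔ μ 26 (key X) ≠ 0 ∧ μ 24 [el X 1, el X 0] = μ 23 [el X 0] + 1 := by
  simp [Marked, posSets_one, coPos_one, key_subAt_zero hX]

/-- Each selected two-body observable anticommutes with few others. -/
theorem SmallCliques.card_odd_inter_le (hW : SmallCliques 1 S W) {X : Finset (Fin (2 * n))}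
    (hX : X.card = 2 * 1) {F : Finset (Finset (Fin (2 * n)))}
    (hF : ∀ M ∈ F, M.card = 2 * 1 ∧ S M ∧ Odd (X ∩ M).card) : F.card ≤ 2 * W := by
  -- Distinct pairs through a common index meet in that index only, so the members through each of
  -- the two elements of `X` form a family of at most `W`.
  have h1 : F ⊆ X.biUnion fun v => F.filter fun M => v ∈ M := by
    intro M hM
    obtain ⟨v, hv⟩ := Finset.card_pos.1 (hF M hM).2.2.pos
    rw [Finset.mem_inter] at hv
    exact Finset.mem_biUnion.2 ⟨v, hv.1, Finset.mem_filter.2 ⟨hM, hv.2⟩⟩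
  calc F.card ≤ _ := Finset.card_le_card h1
    _ ≤ X.card * W := Finset.card_biUnion_le_card_mul _ _ _ fun v _ => hW _ (fun M hM =>
        ⟨(hF M (Finset.mem_filter.1 hM).1).1, (hF M (Finset.mem_filter.1 hM).1).2.1⟩)
        fun M hM M' hM' hne => by
          rw [Finset.mem_filter] at hM hM'
          have h0 : 0 < (M ∩ M').card := Finset.card_pos.2 ⟨v, Finset.mem_inter.2 ⟨hM.2, hM'.2⟩⟩
          have h2 : (M ∩ M').card < 2 := by
            by_contra hge
            have e1 := Finset.eq_of_subset_of_card_le (Finset.inter_subset_left (s₁ := M) (s₂ := M'))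
              (by have := (hF M hM.1).1; omega)
            have e2 := Finset.eq_of_subset_of_card_le (Finset.inter_subset_right (s₁ := M) (s₂ := M'))
              (by have := (hF M' hM'.1).1; omega)
            exact hne (e1.symm.trans e2)
          rw [show (M ∩ M').card = 1 by omega]
          exact odd_one
    _ = 2 * W := by rw [hX]

open Classical in
-- The event that `X` is marked has probability at least `w = 2^(-m)`. It fails to be covered only
-- if some anticommuting `M` is marked as well. There are at most `2 * W` candidates, each of them
-- is marked together with `X` with probability at most `w^2`, and `2 * W * w ≤ 1/2`, so at least
-- half of the event survives. Using one kernel per pair keeps the bound linear in `w`.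
theorem expect_covered_one (hc : IsMajorana c) (hn : 0 < n)
    (ρ : DensityMatrix n) (s : Config n) {m : ℕ}
    (h101 : s.mem 101 [] = 2 * n) (h105 : s.mem 105 [] = (2 * 1 + 2) * W)
    (h107 : s.mem 107 [] = m) (hm1 : (2 * 1 + 2) * W < 2 ^ m)
    (hm2 : 2 ^ m ≤ 2 * ((2 * 1 + 2) * W)) (hW : SmallCliques 1 S W) (hL : LabelInv 1 S s.mem)
    (hS : ∀ M : Finset (Fin (2 * n)), s.mem 26 (key M) ≠ 0 → S M)
    {X : Finset (Fin (2 * n))} (hX : X.card = 2 * 1) (h26 : s.mem 26 (key X) ≠ 0)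
    (hHit : ∀ J ∈ posSets 1, Hit 1 X J s.mem) :
    2⁻¹ * (2⁻¹ : ℝ≥0∞) ^ m ≤
      expect ((drawAll 1).run ρ s) (fun s' => if Covered 1 c X s'.mem then 1 else 0) := by
  set w : ℝ≥0∞ := 2⁻¹ ^ m with hw
  have hlab : s.mem 24 [el X 1, el X 0] ≠ 0 := by
    have := hHit {0} (by simp [posSets_one])
    simpa [Hit, coPos_one, key_subAt_zero hX] using this
  have hle : ∀ M : Finset (Fin (2 * n)), M.card = 2 * 1 →
      s.mem 24 [el M 1, el M 0] - 1 < 2 ^ m := by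
    intro M hM
    have := hL.label_le hW (A := subAt M {0}) (by
      rw [card_subAt (by rw [hM]; decide)]; simp) (elF (X := M) (i := 1) (by omega))
    rw [key_subAt_zero hM] at this
    change s.mem 24 [el M 1, el M 0] ≤ _ at this
    omega
  -- The candidates for a conflict. Pairs with the same smaller index as `X` are left out; they are
  -- dealt with deterministically below.
  set F : Finset (Finset (Fin (2 * n))) := Finset.univ.filter fun M => M.card = 2 * 1 ∧
    s.mem 26 (key M) ≠ 0 ∧ Odd (X ∩ M).card ∧ s.mem 24 [el M 1, el M 0] ≠ 0 ∧ el M 0 ≠ el X 0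
  have hF : F.card ≤ 2 * W := hW.card_odd_inter_le hX fun M hM => by
    obtain ⟨_, h1, h2, h3, _⟩ := Finset.mem_filter.1 hM
    exact ⟨h1, hS _ h2, h3⟩
  let u : Finset (Fin (2 * n)) → List ℕ → ℕ := fun M p =>
    if p = [el X 0] then s.mem 24 [el X 1, el X 0] - 1 else s.mem 24 [el M 1, el M 0] - 1
  have hu : ∀ M : Finset (Fin (2 * n)), M.card = 2 * 1 → ∀ p, u M p < 2 ^ m := by
    intro M hM p
    by_cases h : p = [el X 0]
    · simp only [u, if_pos h]; exact hle X hX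
    · simp only [u, if_neg h]; exact hle M hM
  have hadd : ∀ M : Finset (Fin (2 * n)), M.card = 2 * 1 → IsLabelAddr (2 * n) 1 [el M 0] := by
    intro M hM
    rw [← key_subAt_zero hM]
    exact isLabelAddr_subAt hM (by simp [posSets_one])
  have e1 := expect_drawAll ρ (N := 2 * n) (k := 1) (by omega) s h101 h105 h107 (by omega)
    (I := {[el X 0]}) (u := u X) (by simpa using hadd X hX) fun p _ => hu X hX p
  have e2 : ∀ M ∈ F, expect ((drawAll 1).run ρ s) (fun s' => labelPot (fun _ => False)
      {[el X 0], [el M 0]} (u M) w (s'.mem 23)) = w ^ 2 := by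
    intro M hM
    obtain ⟨_, h1, h2, h3, h4, h5⟩ := Finset.mem_filter.1 hM
    have := expect_drawAll ρ (N := 2 * n) (k := 1) (by omega) s h101 h105 h107 (by omega)
      (I := {[el X 0], [el M 0]}) (u := u M) (by
        intro p hp
        rw [Finset.mem_insert, Finset.mem_singleton] at hp
        rcases hp with rfl | rfl
        · exact hadd X hX
        · exact hadd M h1) fun p _ => hu M h1 p
    rwa [Finset.card_pair (by simpa using h5.symm)] at this
  have key1 : w ≤ expect ((drawAll 1).run ρ s)
      (fun s' => if Covered 1 c X s'.mem then 1 else 0) + 2⁻¹ * w := by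
    calc w = expect ((drawAll 1).run ρ s) (fun s' =>
          labelPot (fun _ => False) {[el X 0]} (u X) w (s'.mem 23)) := by rw [e1]; simp [hw]
      _ ≤ expect ((drawAll 1).run ρ s) (fun s' => (if Covered 1 c X s'.mem then 1 else 0) +
          ∑ M ∈ F, labelPot (fun _ => False) {[el X 0], [el M 0]} (u M) w (s'.mem 23)) := by
          refine expect_mono fun s' hs' => ?_
          have kk : ∀ a, a ≠ 21 → a ≠ 22 → a ≠ 23 → s'.mem a = s.mem a := fun a h1 h2 h3 =>
            run_support_keeps ρ (keeps_drawAll h1 h2 h3) _ _ hs'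
          have k24 := kk 24 (by norm_num) (by norm_num) (by norm_num)
          have k25 := kk 25 (by norm_num) (by norm_num) (by norm_num)
          have k26 := kk 26 (by norm_num) (by norm_num) (by norm_num)
          by_cases h0 : labelPot (fun _ => False) {[el X 0]} (u X) w (s'.mem 23) = 0
          · rw [h0]; exact zero_le
          have hr := labelPot_eq_one_of_ne.1 h0 [el X 0] (by simp)
          have hr' : s'.mem 23 [el X 0] = s.mem 24 [el X 1, el X 0] - 1 := by
            rw [hr]; simp [u]
          refine labelPot_eq_one_of_ne.2.1.trans ?_
          by_cases hcov : Covered 1 c X s'.mem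
          · rw [if_pos hcov]; exact le_self_add
          have hXm : Marked 1 X s'.mem := by
            rw [marked_one hX, k26, k24, hr']
            exact ⟨h26, by omega⟩
          have : ∃ M : Finset (Fin (2 * n)), M.card = 2 * 1 ∧ Marked 1 M s'.mem ∧
              majoranaMonomial c X * majoranaMonomial c M ≠
                majoranaMonomial c M * majoranaMonomial c X := by
            by_contra hno
            push Not at hno
            exact hcov ⟨hXm, hno⟩
          obtain ⟨M, hM, hMm, hne⟩ := this
          have hodd : Odd (X ∩ M).card := by
            rw [← Nat.not_even_iff_odd]
            exact fun h => hne (hc.commute_of_even (hM ▸ even_two_mul 1) h)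
          obtain ⟨hM26, hMl⟩ := (marked_one hM).1 hMm
          rw [k26] at hM26
          rw [k24] at hMl
          -- With the same smaller index, `X` and `M` would be marked through the same draw; labels
          -- are injective, so the larger indices would agree too.
          have hM0 : el M 0 ≠ el X 0 := by
            intro h
            apply hne
            have h1 : elF (X := X) (i := 1) (by omega) = elF (X := M) (i := 1) (by omega) := by
              refine hL.inj (A := subAt X {0}) ?_ ?_ <;> rw [key_subAt_zero hX]
              · exact hlab
              · change s.mem 24 [el X 1, el X 0] = s.mem 24 [el M 1, el X 0]
                rw [← h, hMl, h, hr']; omega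
            have h2 : el X 1 = el M 1 := congrArg Fin.val h1
            have : X = M := key_injective (by
              rw [key_eq_map, key_eq_map, hX, hM]
              simp [List.range_succ, h2, h])
            rw [this]
          have hMF : M ∈ F := by
            simp only [F, Finset.mem_filter, Finset.mem_univ, true_and]
            exact ⟨hM, hM26, hodd, by omega, hM0⟩
          rw [if_neg hcov, zero_add]
          refine le_trans (le_of_eq ?_) (Finset.single_le_sum (fun _ _ => zero_le) hMF)
          refine (labelPot_eq_one_of_ne.2.2 fun p hp => ?_).symm
          rw [Finset.mem_insert, Finset.mem_singleton] at hp
          rcases hp with rfl | rfl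
          · simp [u, hr']
          · simp [u, hM0, hMl]
      _ = expect ((drawAll 1).run ρ s) (fun s' => if Covered 1 c X s'.mem then 1 else 0) +
          ∑ M ∈ F, w ^ 2 := by
          rw [expect_add, expect_sum, Finset.sum_congr rfl e2]
      _ ≤ _ := by
          gcongr
          rw [Finset.sum_const, nsmul_eq_mul, pow_two, ← mul_assoc]
          gcongr
          -- This is where the factor `2 * k + 2`, here `4`, in the bound for the labels is used.
          have h4 : ((4 * W : ℕ) : ℝ≥0∞) * w ≤ 1 := by
            rw [hw, ← ENNReal.inv_pow]
            refine ENNReal.mul_inv_le_one ((2:ℝ≥0∞)^m) |>.trans' ?_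
            gcongr
            exact_mod_cast (by omega : 4 * W ≤ 2 ^ m)
          calc (F.card : ℝ≥0∞) * w ≤ ((2 * W : ℕ) : ℝ≥0∞) * w := by gcongr
            _ = 2⁻¹ * (((4 * W : ℕ) : ℝ≥0∞) * w) := by
                rw [← mul_assoc]
                congr 1
                rw [show 4 * W = 2 * (2 * W) by ring, Nat.cast_mul 2 (2 * W), ← mul_assoc,
                  Nat.cast_ofNat, ENNReal.inv_mul_cancel (by norm_num) (by norm_num), one_mul]
            _ ≤ 2⁻¹ := mul_le_of_le_one_right' h4
  have hwt : 2⁻¹ * w ≠ ⊤ := by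
    rw [hw, ← ENNReal.inv_pow]
    exact ENNReal.mul_ne_top (by simp) (by simp)
  have : 2⁻¹ * w + 2⁻¹ * w = w := by rw [← add_mul, ENNReal.inv_two_add_inv_two, one_mul]
  rw [← ENNReal.add_le_add_iff_right hwt, this]
  exact key1

open Classical in
/-- A selected observable is covered with a probability that does not depend on the number of
qubits. -/
theorem expect_covered (hc : IsMajorana c) (hn : 0 < n)
    (ρ : DensityMatrix n) (s : Config n) {m : ℕ}
    (h101 : s.mem 101 [] = 2 * n) (h105 : s.mem 105 [] = (2 * k + 2) * W)
    (h107 : s.mem 107 [] = m) (hm1 : (2 * k + 2) * W < 2 ^ m)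
    (hm2 : 2 ^ m ≤ 2 * ((2 * k + 2) * W)) (hW : SmallCliques k S W) (hL : LabelInv k S s.mem)
    (hS : ∀ M : Finset (Fin (2 * n)), s.mem 26 (key M) ≠ 0 → S M)
    {X : Finset (Fin (2 * n))} (hX : X.card = 2 * k) (h26 : s.mem 26 (key X) ≠ 0)
    (hHit : ∀ J ∈ posSets k, Hit k X J s.mem) :
    ((2 * (2 * ((2 * k + 2) * W)) ^ (posSets k).length : ℕ) : ℝ≥0∞)⁻¹ ≤
      expect ((drawAll k).run ρ s) (fun s' => if Covered k c X s'.mem then 1 else 0) := by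
  have h1 : ((2 * (2 * ((2 * k + 2) * W)) ^ (posSets k).length : ℕ) : ℝ≥0∞)⁻¹ ≤
      2⁻¹ * (2⁻¹ ^ m) ^ (posSets k).length := by
    rw [Nat.cast_mul, Nat.cast_pow, ENNReal.mul_inv (by simp) (by simp), ENNReal.inv_pow]
    gcongr
    · simp
    · exact inv_two_pow_le hm2
  refine h1.trans ?_
  -- The extra factor `2` in the claimed bound is needed for `k = 1` only, where half of the
  -- probability is lost to conflicts.
  by_cases hk1 : k = 1
  · subst hk1
    have := expect_covered_one hc hn ρ s h101 h105 h107 hm1 hm2 hW hL hS hX h26 hHit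
    simpa [posSets_one] using this
  · refine (mul_le_of_le_one_left' ?_).trans
      (expect_covered_of_ne_one hc hk1 hn ρ s h101 h105 h107 hm1 hm2 hW hL hX h26 hHit)
    simp

end

/-! ## The loop of measurements for the signs -/

theorem exp_neg_le {y : ℝ} (h0 : 0 ≤ y) (h1 : y ≤ 1 / 2) : Real.exp (-y) ≤ 1 - y / 2 := by
  have := (abs_le.1 (Real.abs_exp_sub_one_sub_id_le (x := -y) (by
    rw [abs_neg, abs_of_nonneg h0]; linarith))).2
  nlinarith

open Classical in
-- The expectation is `1 - P (1 - exp (-y))`, where `P ≥ q` is the probability of `A`, and `1 - exp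
-- (-y) ≥ y / 2` for small `y`.
theorem expect_ite_expE_le {α : Type} {p : PMF α} {A : α → Prop} {q y : ℝ} (h0 : 0 ≤ y)
    (h1 : y ≤ 1 / 2) (hq : ENNReal.ofReal q ≤ expect p fun a => if A a then 1 else 0) :
    expect p (fun a => if A a then expE (-y) else 1) ≤ expE (-(q * y / 2)) := by
  set P := expect p fun a => if A a then (1 : ℝ≥0∞) else 0
  set Q := expect p fun a => if A a then (0 : ℝ≥0∞) else 1
  have hPQ : P + Q = 1 := by
    rw [← expect_add]
    refine (expect_congr fun a _ => ?_).trans (expect_const p 1)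
    split_ifs <;> simp
  have hP : P ≠ ⊤ := ne_top_of_le_ne_top ENNReal.one_ne_top (hPQ ▸ le_self_add)
  have hQ : Q ≠ ⊤ := ne_top_of_le_ne_top ENNReal.one_ne_top (hPQ ▸ le_add_self)
  have hr : P.toReal + Q.toReal = 1 := by
    rw [← ENNReal.toReal_add hP hQ, hPQ, ENNReal.toReal_one]
  have e : expect p (fun a => if A a then expE (-y) else 1) = expE (-y) * P + Q := by
    rw [← expect_mul_left, ← expect_add]
    refine expect_congr fun a _ => ?_
    split_ifs <;> simp
  have hq' : q ≤ P.toReal := (ENNReal.ofReal_le_iff_le_toReal hP).1 hq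
  rw [e, ← ENNReal.ofReal_toReal hP, ← ENNReal.ofReal_toReal hQ, expE, expE,
    ← ENNReal.ofReal_mul (Real.exp_pos _).le,
    ← ENNReal.ofReal_add (by positivity) ENNReal.toReal_nonneg]
  refine ENNReal.ofReal_le_ofReal ?_
  have h2 := Real.add_one_le_exp (-(q * y / 2))
  have h3 := mul_le_mul_of_nonneg_right (exp_neg_le h0 h1) (ENNReal.toReal_nonneg (a := P))
  nlinarith [mul_le_mul_of_nonneg_right hq' h0]

section
variable {n k : ℕ} {c : Fin (2 * n) → Fin n → Pauli}

/-- The invariant of the loop of measurements for the signs. -/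
def SignInv (k : ℕ) (s₀ s : Config n) : Prop :=
  s.circuit = [] ∧ (∀ a, a = 3 ∨ a = 24 ∨ a = 25 ∨ a = 26 ∨ 100 ≤ a → s.mem a = s₀.mem a) ∧
    ∀ X : Finset (Fin (2 * n)), X.card = 2 * k → s₀.mem 26 (key X) = 0 →
      s.mem 4 (key X) = s₀.mem 4 (key X) ∧ s.mem 5 (key X) = s₀.mem 5 (key X) ∧
        s.mem 6 (key X) = s₀.mem 6 (key X)

theorem SignInv.refl {s : Config n} (hs : s.circuit = []) : SignInv k s s :=
  ⟨hs, fun _ _ => rfl, fun _ _ _ => ⟨rfl, rfl, rfl⟩⟩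

/-- The last clause says that counters of observables that were not selected never move, so their
estimates stay at the initial value. -/
theorem signInv_step (hn : 0 < n) (ρ : DensityMatrix n) {s₀ s : Config n} (hd : Dims n s₀.mem)
    (h : SignInv k s₀ s) : ∀ s' ∈ ((signRound k).run ρ (s.tick 1)).support, SignInv k s₀ s' := by
  intro s' hs'
  rw [signRound_eq, Program.run_seq, PMF.mem_support_bind_iff] at hs'
  obtain ⟨s1, h1, hs'⟩ := hs'
  have hcirc := signTail_circuit ρ s1 s' hs'
  rw [signTail, Program.run_seq, PMF.mem_support_bind_iff] at hs'
  obtain ⟨s2, h2, hs'⟩ := hs'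
  rw [Program.run_seq, PMF.mem_support_bind_iff] at hs'
  obtain ⟨s3, h3, hs'⟩ := hs'
  rw [Program.run_seq, PMF.mem_support_bind_iff] at hs'
  obtain ⟨s4, h4, hs'⟩ := hs'
  have kk : ∀ a, a = 3 ∨ a = 24 ∨ a = 25 ∨ a = 26 ∨ 100 ≤ a ∨ a = 4 ∨ a = 5 ∨ a = 6 →
      s4.mem a = s.mem a := by
    intro a ha
    rw [run_support_keeps ρ (p := .measure 50) (a := a) (by
        simp only [Program.Keeps]; omega) _ _ h4, Config.tick_mem,
      run_support_keeps ρ (keeps_markLoop (k := k) (a := a) (by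
        simp only [Finset.mem_insert, Finset.mem_singleton]; omega)) _ _ h3, Config.tick_mem,
      run_support_keeps ρ (keeps_resetTable (a := a) (by
        simp only [Finset.mem_insert, Finset.mem_singleton]; omega)) _ _ h2, Config.tick_mem,
      run_support_keeps ρ (keeps_drawAll (k := k) (a := a) (by omega) (by omega) (by omega)) _ _ h1]
    rfl
  refine ⟨hcirc, fun a ha => ?_, fun X hX h26 => ?_⟩
  · rw [run_support_keeps ρ (keeps_signLoop (k := k) (a := a) (by
      simp only [Finset.mem_insert, Finset.mem_singleton]; omega)) _ _ hs', kk a (by omega),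
      h.2.1 a ha]
  · rw [Program.run_det ρ _ det_signLoop, PMF.mem_support_pure_iff] at hs'
    have hd4 : Dims n s4.mem := hd.congr ((kk _ (by omega)).trans (h.2.1 _ (by omega)))
      ((kk _ (by omega)).trans (h.2.1 _ (by omega)))
    obtain ⟨r1, r2, r3⟩ := signLoop_spec (k := k) hn s4 hd4 hX
    have h26' : s4.mem 26 (key X) = 0 := by rw [kk _ (by omega), h.2.1 _ (by omega), h26]
    obtain ⟨i1, i2, i3⟩ := h.2.2 X hX h26
    rw [hs', r1, r2, r3, h26', kk 4 (by omega), kk 5 (by omega), kk 6 (by omega), i1, i2, i3]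
    simp

/-- Combines the contraction for fixed labels with the probability of being covered. Every round
helps by a fixed factor in expectation, although it contributes a sample only sometimes. -/
theorem expect_signRound_le (hn : 0 < n) (hc : IsMajorana c) (ρ : DensityMatrix n) (s : Config n)
    (hd : Dims n s.mem) (hs : s.circuit = []) (hin : InputTable c s.mem) {W m : ℕ} (hW0 : 0 < W)
    (h105 : s.mem 105 [] = (2 * k + 2) * W)
    (h107 : s.mem 107 [] = m) (hm1 : (2 * k + 2) * W < 2 ^ m)
    (hm2 : 2 ^ m ≤ 2 * ((2 * k + 2) * W)) {S : Finset (Fin (2 * n)) → Prop}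
    (hW : SmallCliques k S W) (hL : LabelInv k S s.mem)
    (hS : ∀ M : Finset (Fin (2 * n)), s.mem 26 (key M) ≠ 0 → S M)
    {X : Finset (Fin (2 * n))} (hX : X.card = 2 * k) (h26 : s.mem 26 (key X) ≠ 0)
    (hHit : ∀ J ∈ posSets k, Hit k X J s.mem) {l d y : ℝ} (hl : |l| ≤ 1 / 2) (hy : y = d - l ^ 2)
    (hy0 : 0 ≤ y) (hy1 : y ≤ 1 / 2) :
    expect ((signRound k).run ρ s) (fun s' => expE (signPot X (expVal c ρ X) l d s')) ≤
      expE (-(((2 * (2 * ((2 * k + 2) * W)) ^ (posSets k).length : ℕ) : ℝ)⁻¹ * y / 2)) *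
        expE (signPot X (expVal c ρ X) l d s) := by
  classical
  rw [signRound_eq, Program.run_seq, expect_bind]
  have kk : ∀ s' ∈ ((drawAll k).run ρ (s.tick 1)).support, ∀ a, a ≠ 21 → a ≠ 22 → a ≠ 23 →
      s'.mem a = s.mem a := fun s' hs' a h1 h2 h3 =>
    (run_support_keeps ρ (keeps_drawAll (k := k) h1 h2 h3) (s.tick 1) s' hs').trans rfl
  have hcl : (drawAll k).Classical := by
    simp [drawAll, drawLength, drawOne, Program.Classical, coinV]
  calc _ ≤ expect ((drawAll k).run ρ (s.tick 1)) (fun s' =>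
        expE (signPot X (expVal c ρ X) l d s) *
          if Covered k c X s'.mem then expE (-y) else 1) := by
        refine expect_mono fun s' hs' => ?_
        have k' := kk s' hs'
        refine (expect_signTail_le hn hc ρ s' (hd.congr (k' _ (by norm_num) (by norm_num)
          (by norm_num)) (k' _ (by norm_num) (by norm_num) (by norm_num)))
          ((run_support_classical ρ hcl _ _ hs').trans hs)
          (fun a q => by rw [k' 3 (by norm_num) (by norm_num) (by norm_num)]; exact hin a q) hX
          (by rwa [k' 26 (by norm_num) (by norm_num) (by norm_num)]) hl (d := d)
          (by linarith)).trans ?_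
        rw [show l ^ 2 - d = -y by rw [hy]; ring, mul_comm, signPot, signPot,
          k' 4 (by norm_num) (by norm_num) (by norm_num),
          k' 5 (by norm_num) (by norm_num) (by norm_num),
          k' 6 (by norm_num) (by norm_num) (by norm_num)]
    _ = expE (signPot X (expVal c ρ X) l d s) * expect ((drawAll k).run ρ (s.tick 1)) (fun s' =>
          if Covered k c X s'.mem then expE (-y) else 1) := expect_mul_left _ _ _
    _ ≤ _ := by
        rw [mul_comm]
        gcongr
        refine expect_ite_expE_le hy0 hy1 ?_
        rw [ENNReal.ofReal_inv_of_pos (by positivity), ENNReal.ofReal_natCast]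
        exact expect_covered hc hn ρ (s.tick 1) hd.2 h105 h107 hm1 hm2 hW hL hS hX h26 hHit

/-- The estimate of an expectation value in the memory. -/
def estR (X : Finset (Fin (2 * n))) (s : Config n) : ℝ :=
  ((s.mem 4 (key X) : ℝ) - s.mem 5 (key X)) / s.mem 6 (key X)

/-- With `l = ±e/2` and `d = e^2/2` the potential is `(e/2) N (±(estR - m) - e)` for `N` samples, so
a deviation beyond `e` makes one of the two exponents nonnegative. No lower bound for `N` is needed
here. -/
theorem one_le_of_lt_abs_estR {X : Finset (Fin (2 * n))} {s : Config n} {m e : ℝ} (he : 0 ≤ e)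
    (h : e < |estR X s - m|) : 1 ≤ expE (signPot X m (e / 2) (e ^ 2 / 2) s) +
      expE (signPot X m (-(e / 2)) (e ^ 2 / 2) s) := by
  -- Without samples the exponents are opposite numbers, and one of them is nonnegative in any case.
  rcases Nat.eq_zero_or_pos (s.mem 6 (key X)) with h0 | h0
  · rcases le_total (0 : ℝ) ((s.mem 4 (key X) : ℝ) - s.mem 5 (key X)) with h1 | h1
    · exact (one_le_expE (by simp only [signPot, h0]; push_cast; nlinarith)).trans le_self_add
    · exact (one_le_expE (by simp only [signPot, h0]; push_cast; nlinarith)).trans le_add_self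
  · have h0' : (0 : ℝ) < s.mem 6 (key X) := by exact_mod_cast h0
    have e1 : estR X s * s.mem 6 (key X) = (s.mem 4 (key X) : ℝ) - s.mem 5 (key X) := by
      rw [estR]; field_simp
    rcases lt_abs.1 h with h1 | h1
    · refine (one_le_expE ?_).trans le_self_add
      rw [signPot, ← e1]
      nlinarith [mul_nonneg he (mul_pos h0' (sub_pos.2 h1)).le]
    · refine (one_le_expE ?_).trans le_add_self
      rw [signPot, ← e1]
      nlinarith [mul_nonneg he (mul_pos h0' (sub_pos.2 h1)).le]

open Classical in
/-- The loop of measurements for the signs estimates the expectation value of each selected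
observable. -/
theorem expect_signLoop_le (hn : 0 < n) (hc : IsMajorana c) (ρ : DensityMatrix n) (s : Config n)
    (hd : Dims n s.mem) (hs : s.circuit = []) (hin : InputTable c s.mem) {W m : ℕ} (hW0 : 0 < W)
    (h105 : s.mem 105 [] = (2 * k + 2) * W)
    (h107 : s.mem 107 [] = m) (hm1 : (2 * k + 2) * W < 2 ^ m)
    (hm2 : 2 ^ m ≤ 2 * ((2 * k + 2) * W)) {S : Finset (Fin (2 * n)) → Prop}
    (hW : SmallCliques k S W) (hL : LabelInv k S s.mem)
    (hS : ∀ M : Finset (Fin (2 * n)), s.mem 26 (key M) ≠ 0 → S M)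
    {X : Finset (Fin (2 * n))} (hX : X.card = 2 * k) (h26 : s.mem 26 (key X) ≠ 0)
    (hHit : ∀ J ∈ posSets k, Hit k X J s.mem) (h4 : s.mem 4 (key X) = 0)
    (h5 : s.mem 5 (key X) = 0) (h6 : s.mem 6 (key X) = 0)
    {e : ℝ} (he0 : 0 < e) (he1 : e ≤ 1) (T : ℕ) :
    expect (iterate (fun t => (signRound k).run ρ (t.tick 1)) T s)
        (fun s' => if e < |estR X s' - expVal c ρ X| then 1 else 0) ≤
      2 * expE (-(T * ((2 * (2 * ((2 * k + 2) * W)) ^ (posSets k).length : ℕ) : ℝ)⁻¹ * e ^ 2 / 8))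
      := by
  set q : ℝ := ((2 * (2 * ((2 * k + 2) * W)) ^ (posSets k).length : ℕ) : ℝ)⁻¹ with hq
  -- Here `d - l^2 = e^2/2 - e^2/4 = e^2/4`, and `expect_ite_expE_le` halves it once more, which
  -- gives the `8` in the exponent.
  have main : ∀ l : ℝ, |l| = e / 2 →
      expect (iterate (fun t => (signRound k).run ρ (t.tick 1)) T s)
        (fun s' => expE (signPot X (expVal c ρ X) l (e ^ 2 / 2) s')) ≤
      expE (-(T * q * e ^ 2 / 8)) := by
    intro l hl
    have hl2 : l ^ 2 = e ^ 2 / 4 := by rw [← sq_abs, hl]; ring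
    refine (expect_iterate_le (Inv := SignInv k s) (fun a ha b hb => signInv_step hn ρ hd ha b hb)
      (r := expE (-(q * (e ^ 2 / 4) / 2))) (fun a ha => ?_) T s (SignInv.refl hs)).trans ?_
    · have h' := ha.2.1
      have m24 := h' 24 (by omega)
      have m25 := h' 25 (by omega)
      have m26 := h' 26 (by omega)
      refine expect_signRound_le hn hc ρ (a.tick 1) (hd.congr (h' _ (by omega)) (h' _ (by omega)))
        ha.1 (fun i j => ?_) hW0 ?_ ?_ hm1 hm2 hW (hL.congr m24 m25) ?_ hX ?_ ?_
        (y := e ^ 2 / 4) ?_ ?_ ?_ ?_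
      · rw [Config.tick_mem, h' 3 (by omega)]; exact hin i j
      · rw [Config.tick_mem, h' 105 (by omega), h105]
      · rw [Config.tick_mem, h' 107 (by omega), h107]
      · intro M hM
        rw [Config.tick_mem, m26] at hM
        exact hS M hM
      · rwa [Config.tick_mem, m26]
      · intro J hJ
        obtain ⟨i, hi, h⟩ := hHit J hJ
        exact ⟨i, hi, by rwa [Config.tick_mem, m24]⟩
      · rw [hl]; linarith
      · rw [hl2]; ring
      · positivity
      · nlinarith
    · rw [expE_pow, signPot, h4, h5, h6, ← expE_add]
      refine le_of_eq (congrArg expE ?_)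
      push_cast; ring
  calc _ ≤ expect (iterate (fun t => (signRound k).run ρ (t.tick 1)) T s) (fun s' =>
        expE (signPot X (expVal c ρ X) (e / 2) (e ^ 2 / 2) s') +
          expE (signPot X (expVal c ρ X) (-(e / 2)) (e ^ 2 / 2) s')) := by
        refine expect_mono fun s' _ => ?_
        split_ifs with h
        · exact one_le_of_lt_abs_estR he0.le h
        · exact zero_le
    _ ≤ _ := by
        rw [expect_add, two_mul]
        have : |e / 2| = e / 2 := abs_of_pos (by linarith)
        exact add_le_add (main _ this) (main _ (by rw [abs_neg, this]))

theorem iterate_signInv (hn : 0 < n) (ρ : DensityMatrix n) {s : Config n} (hd : Dims n s.mem)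
    (hs : s.circuit = []) (T : ℕ) :
    ∀ s' ∈ (iterate (fun t => (signRound k).run ρ (t.tick 1)) T s).support, SignInv k s s' :=
  iterate_support (fun _ => SignInv k s) (SignInv.refl hs)
    fun _ _ _ ha b hb => signInv_step hn ρ hd ha b hb

end

/-! ## The selection of observables -/

section
variable {n k : ℕ} {c : Fin (2 * n) → Fin n → Pauli}

/-- The Bell measurements suggest that the expectation value of the observable is large. -/
def Selected (T E : ℕ) (X : Finset (Fin (2 * n))) (s : Config n) : Prop :=
  75 * T + s.mem 28 (key X) * E ^ 2 < s.mem 27 (key X) * E ^ 2 + 1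

theorem Selected.iff {T E : ℕ} (hE : 0 < E) {X : Finset (Fin (2 * n))} {s : Config n} :
    Selected T E X s ↔ 75 * (T : ℝ) / E ^ 2 ≤ bellDiff X s := by
  have hE' : (0 : ℝ) < (E : ℝ) ^ 2 := by positivity
  rw [Selected, Nat.lt_succ_iff, div_le_iff₀ hE', bellDiff, sub_mul, le_sub_iff_add_le]
  norm_cast

/-- The selection is correct for the observable with square expectation value `v`. -/
def GoodSelection (T E : ℕ) (v : ℝ) (X : Finset (Fin (2 * n))) (s : Config n) : Prop :=
  (Selected T E X s → 125 / 2 / (E : ℝ) ^ 2 ≤ v) ∧ (¬ Selected T E X s → v ≤ 100 / (E : ℝ) ^ 2)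

/-- In units of `g = 12.5 / E^2` the threshold is `6 g`, while errors mean `v < 5 g` above the
threshold or `v > 8 g` below it. Either way the average deviates from `v` by at least `g`. -/
theorem one_le_of_not_goodSelection {T E : ℕ} (hE : 0 < E) {v : ℝ} {X : Finset (Fin (2 * n))}
    {s : Config n} (h : ¬ GoodSelection T E v X s) {g : ℝ} (hg : g = 25 / 2 / (E : ℝ) ^ 2) :
    1 ≤ expE (-(g / 2 * (T * (v + g)))) * expE (g / 2 * bellDiff X s) +
      expE (-(-(g / 2) * (T * (v - g)))) * expE (-(g / 2) * bellDiff X s) := by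
  have hE' : (0 : ℝ) < (E : ℝ) ^ 2 := by positivity
  have hg0 : 0 < g := by rw [hg]; positivity
  have h1 : (75 : ℝ) * T / E ^ 2 = T * (6 * g) := by rw [hg]; ring
  rw [← expE_add, ← expE_add]
  rw [GoodSelection, not_and_or, Classical.not_imp, Classical.not_imp, Selected.iff hE, h1,
    show (125 : ℝ) / 2 / E ^ 2 = 5 * g by rw [hg]; ring,
    show (100 : ℝ) / E ^ 2 = 8 * g by rw [hg]; ring] at h
  have hT : (0 : ℝ) ≤ T := by positivity
  rcases h with ⟨h2, h3⟩ | ⟨h2, h3⟩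
  · refine (one_le_expE ?_).trans le_self_add
    have : (T : ℝ) * (v + g) ≤ bellDiff X s := by
      refine le_trans ?_ h2
      gcongr
      linarith
    nlinarith
  · refine (one_le_expE ?_).trans le_add_self
    have : bellDiff X s ≤ T * (v - g) := by
      refine (not_le.1 h2).le.trans ?_
      gcongr
      linarith
    nlinarith

open Classical in
-- The moment bound with `l = ±g/2` gives the exponent `-T g^2 / 4`, and `g^2 / 4 = 39.0625 / E^4`.
theorem expect_goodSelection (hn : 0 < n) (hc : IsMajorana c) (ρ : DensityMatrix n) (s : Config n)
    (hd : Dims n s.mem) (hs : s.circuit = []) (hT : TabInv c s.mem [])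
    {X : Finset (Fin (2 * n))} (hX : X.card = 2 * k) (h27 : s.mem 27 (key X) = 0)
    (h28 : s.mem 28 (key X) = 0) {E : ℕ} (hE : 10 ≤ E) (T : ℕ) :
    expect (iterate (fun t => (bellRound k).run ρ (t.tick 1)) T s)
        (fun s' => if GoodSelection T E (expVal c ρ X ^ 2) X s' then 0 else 1) ≤
      2 * expE (-(T * (39 / (E : ℝ) ^ 4))) := by
  set g : ℝ := 25 / 2 / (E : ℝ) ^ 2 with hg
  have hE' : (0 : ℝ) < E := by positivity
  have hE2 : (100 : ℝ) ≤ (E : ℝ) ^ 2 := by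
    have : (10 : ℝ) ≤ E := by exact_mod_cast hE
    nlinarith
  have hg0 : 0 < g := by positivity
  have hg1 : g ≤ 1 := by rw [hg, div_le_one (by positivity)]; linarith
  have hgg : g ^ 2 / 4 = 625 / 16 / (E : ℝ) ^ 4 := by rw [hg]; field_simp; norm_num
  have habs : |g / 2| ≤ 1 / 2 := by rw [abs_of_pos (by linarith)]; linarith
  have hle : ∀ z : ℝ, z = g ^ 2 / 4 → expE (-(T * z)) ≤ expE (-(T * (39 / (E : ℝ) ^ 4))) := by
    intro z hz
    refine ENNReal.ofReal_le_ofReal (Real.exp_le_exp.2 ?_)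
    rw [hz, hgg, neg_le_neg_iff]
    gcongr
    norm_num
  calc _ ≤ expect (iterate (fun t => (bellRound k).run ρ (t.tick 1)) T s) (fun s' =>
        expE (-(g / 2 * (T * (expVal c ρ X ^ 2 + g)))) * expE (g / 2 * bellDiff X s') +
        expE (-(-(g / 2) * (T * (expVal c ρ X ^ 2 - g)))) * expE (-(g / 2) * bellDiff X s')) := by
        refine expect_mono fun s' _ => ?_
        split_ifs with h
        · exact zero_le
        · exact one_le_of_not_goodSelection (by omega) h hg
    _ ≤ _ := by
        rw [expect_add, two_mul, expect_mul_left, expect_mul_left]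
        refine add_le_add ?_ ?_
        · refine (mul_le_mul_right (expect_bellLoop_le hn hc ρ s hd hs hT hX h27 h28 habs T)
            _).trans ?_
          rw [← expE_add]
          refine le_trans (le_of_eq (congrArg expE ?_)) (hle _ rfl)
          ring
        · refine (mul_le_mul_right (expect_bellLoop_le hn hc ρ s hd hs hT hX h27 h28
            (l := -(g / 2)) (by rwa [abs_neg]) T) _).trans ?_
          rw [← expE_add]
          refine le_trans (le_of_eq (congrArg expE ?_)) (hle _ rfl)
          ring

theorem keeps_selectLarge {a : ℕ} (h20 : a ≠ 20) (h26 : a ≠ 26) : (selectLarge k).Keeps a := by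
  simp [selectLarge, forTuples, Program.Keeps, h20, h26]

theorem det_selectLarge : (selectLarge k).Det := by
  simp [selectLarge, forTuples, Program.Det]

theorem classical_selectLarge : (selectLarge k).Classical := by
  simp [selectLarge, forTuples, Program.Classical]

theorem eval_bellRounds (k : ℕ) (μ : Memory) :
    (bellRounds k).eval μ = k * μ 106 [] * μ 102 [] ^ 4 := by
  simp [bellRounds]

theorem eval_signRounds (k : ℕ) (μ : Memory) : (signRounds k).eval μ =
    k * μ 106 [] * μ 102 [] ^ 2 * (2 * (2 * μ 105 []) ^ (posSets k).length) := by
  simp [signRounds]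

theorem selectLarge_spec (hn : 0 < n) (s : Config n) (hd : Dims n s.mem)
    {X : Finset (Fin (2 * n))} (hX : X.card = 2 * k) :
    ((selectLarge k).ex s).mem 26 (key X) ≠ 0 ↔
      Selected ((bellRounds k).eval s.mem) (s.mem 102 []) X s := by
  classical
  have hk : ∀ a, a ≠ 26 → (setE 26 (keyE (Finset.range (2 * k)))
    (ltE (75 * bellRounds k + cellE 28 (keyE (Finset.range (2 * k))) * powE (var 102) 2)
      (cellE 27 (keyE (Finset.range (2 * k))) * powE (var 102) 2 + 1))).Keeps a := fun a ha => by
    simp [ha]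
  have := ex_forTuples_update hn (hk 20 (by norm_num)) hd (hk 100 (by norm_num))
    (hk 101 (by norm_num)) {27, 28, 102, 106} (fun a ha => hk a (by
      simp only [Finset.mem_insert, Finset.mem_singleton] at ha; omega)) (by simp) 26
    (by norm_num) (fun X _ => if Selected ((bellRounds k).eval s.mem) (s.mem 102 []) X s then 1
      else 0) (fun s' X hX hd' hA => ?_) hX
  · rw [selectLarge, this]
    split_ifs with h <;> simp [h]
  · rw [ex_setE_mem_self, hX.eval_keyE_range]
    congr 1
    simp [Selected, eval_bellRounds, hX.eval_keyE_range, hA]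

end

/-! ## The error probability of the main part -/

section
variable {n k : ℕ} {c : Fin (2 * n) → Fin n → Pauli}

theorem det_labelAll : (labelAll k).Det := by
  simp [labelAll, forTuples, labelSet, Program.Det]

theorem classical_labelAll : (labelAll k).Classical := by
  simp [labelAll, forTuples, labelSet, Program.Classical]

theorem keeps_labelAll {a : ℕ} (h20 : a ≠ 20) (h24 : a ≠ 24) (h25 : a ≠ 25) :
    (labelAll k).Keeps a := by
  simp [labelAll, forTuples, Program.Keeps, h20, keeps_labelSet _ h24 h25]

/-- The observables. -/
def observables (n k : ℕ) : Finset (Finset (Fin (2 * n))) := Finset.powersetCard (2 * k) Finset.univ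

theorem mem_observables {X : Finset (Fin (2 * n))} : X ∈ observables n k ↔ X.card = 2 * k := by
  simp [observables]

/-- The estimates of the expectation values are accurate. -/
def Accurate (k : ℕ) (c : Fin (2 * n) → Fin n → Pauli) (ρ : DensityMatrix n) (e : ℝ)
    (s : Config n) : Prop :=
  ∀ X ∈ observables n k, |estR X s - expVal c ρ X| ≤ e

theorem ite_accurate_le {ρ : DensityMatrix n} {e : ℝ} {s : Config n}
    [Decidable (Accurate k c ρ e s)] :
    (if Accurate k c ρ e s then 0 else 1 : ℝ≥0∞) ≤
      ∑ X ∈ observables n k, if e < |estR X s - expVal c ρ X| then 1 else 0 := by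
  split_ifs with h
  · exact zero_le
  · simp only [Accurate, not_forall, not_le] at h
    obtain ⟨X, hX, h⟩ := h
    refine le_trans ?_ (Finset.single_le_sum (fun _ _ => zero_le) hX)
    rw [if_pos h]

open Classical in
/-- The error probability after a correct selection of observables. -/
theorem expect_sign_failure (hn : 0 < n) (hc : IsMajorana c) (ρ : DensityMatrix n) (s : Config n)
    (hd : Dims n s.mem) (hs : s.circuit = []) (hin : InputTable c s.mem) {E L m : ℕ} (hE : 10 < E)
    (h102 : s.mem 102 [] = E) (h105 : s.mem 105 [] = (2 * k + 2) * (8 * E ^ 2 / 500))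
    (h106 : s.mem 106 [] = L) (h107 : s.mem 107 [] = m)
    (hm1 : (2 * k + 2) * (8 * E ^ 2 / 500) < 2 ^ m)
    (hm2 : 2 ^ m ≤ 2 * ((2 * k + 2) * (8 * E ^ 2 / 500)))
    (h4 : ∀ p, s.mem 4 p = 0) (h5 : ∀ p, s.mem 5 p = 0) (h6 : ∀ p, s.mem 6 p = 0)
    (h24 : ∀ p, s.mem 24 p = 0) (h25 : ∀ p, s.mem 25 p = 0)
    (hgood : ∀ X ∈ observables n k, GoodSelection (k * L * E ^ 4) E (expVal c ρ X ^ 2) X s) :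
    expect ((Program.seq (selectLarge k) (.seq (labelAll k)
        (.rep (signRounds k) (signRound k)))).run ρ s)
      (fun s' => if Accurate k c ρ (10 / E) s' then 0 else 1) ≤
      ∑ _X ∈ observables n k, 2 * expE (-(25 / 2 * (k * L))) := by
  rw [expect_det_seq ρ det_selectLarge, expect_det_seq ρ det_labelAll]
  have hsel := fun (X : Finset (Fin (2 * n))) (hX : X.card = 2 * k) =>
    selectLarge_spec hn (s.tick 1) hd hX
  have c1 : ((selectLarge k).ex (s.tick 1)).circuit = [] :=
    (ex_classical det_selectLarge classical_selectLarge (s.tick 1)).trans hs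
  have k1 : ∀ a, a ≠ 20 → a ≠ 26 → ((selectLarge k).ex (s.tick 1)).mem a = s.mem a :=
    fun a h1 h2 => ex_keeps (keeps_selectLarge h1 h2) _
  generalize (selectLarge k).ex (s.tick 1) = s1 at hsel c1 k1 ⊢
  have hd1 : Dims n s1.mem := hd.congr (k1 _ (by norm_num) (by norm_num))
    (k1 _ (by norm_num) (by norm_num))
  obtain ⟨hL, hHit⟩ := labelAll_spec (k := k) hn (s1.tick 1) hd1
    (fun p => by rw [Config.tick_mem, k1 24 (by norm_num) (by norm_num), h24])
    (fun p => by rw [Config.tick_mem, k1 25 (by norm_num) (by norm_num), h25])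
  have c2 : ((labelAll k).ex (s1.tick 1)).circuit = [] :=
    (ex_classical det_labelAll classical_labelAll (s1.tick 1)).trans c1
  have k2 : ∀ a, a ≠ 20 → a ≠ 24 → a ≠ 25 →
      ((labelAll k).ex (s1.tick 1)).mem a = s1.mem a :=
    fun a h1 h2 h3 => ex_keeps (keeps_labelAll h1 h2 h3) _
  rw [Config.tick_mem] at hL hHit
  generalize (labelAll k).ex (s1.tick 1) = s2 at hL hHit c2 k2 ⊢
  have k3 : ∀ a, a ≠ 20 → a ≠ 24 → a ≠ 25 → a ≠ 26 → s2.mem a = s.mem a :=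
    fun a h1 h2 h3 h4 => (k2 a h1 h2 h3).trans (k1 a h1 h4)
  have m26 : s2.mem 26 = s1.mem 26 := k2 26 (by norm_num) (by norm_num) (by norm_num)
  have hd2 : Dims n s2.mem := hd.congr (k3 _ (by norm_num) (by norm_num) (by norm_num) (by norm_num))
    (k3 _ (by norm_num) (by norm_num) (by norm_num) (by norm_num))
  have e2 : ∀ a, a ∈ ({3, 4, 5, 6, 102, 105, 106, 107} : Finset ℕ) → s2.mem a = s.mem a := by
    intro a ha
    simp only [Finset.mem_insert, Finset.mem_singleton] at ha
    exact k3 a (by omega) (by omega) (by omega) (by omega)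
  have hE' : (0 : ℝ) < E := by exact_mod_cast (by omega : 0 < E)
  have h122 : 122 ≤ E ^ 2 + 1 := by nlinarith
  have hgood' : ∀ X : Finset (Fin (2 * n)), X.card = 2 * k →
      (s1.mem 26 (key X) ≠ 0 → 125 / 2 / (E : ℝ) ^ 2 ≤ expVal c ρ X ^ 2) ∧
      (s1.mem 26 (key X) = 0 → expVal c ρ X ^ 2 ≤ 100 / (E : ℝ) ^ 2) := by
    intro X hX
    have h1 := hgood X (mem_observables.2 hX)
    have h2 := hsel X hX
    rw [eval_bellRounds, Config.tick_mem, h102, h106] at h2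
    exact ⟨fun h => h1.1 (h2.1 h), fun h => h1.2 fun h' => h2.2 h' h⟩
  -- A family with odd intersections anticommutes, and each member uses up `62.5 / E^2 = 500 / (8
  -- E^2)` of a total of one.
  have hW : SmallCliques k (fun X : Finset (Fin (2 * n)) => s1.mem 26 (key X) ≠ 0) (8 * E ^ 2 / 500) := by
    intro F hF hodd
    have h1 := hc.sum_sq_le_one ρ F (fun X hX => (hF X hX).1 ▸ even_two_mul k) hodd
    have h2 : (F.card : ℝ) * (125 / 2 / (E : ℝ) ^ 2) ≤ 1 := by
      rw [← nsmul_eq_mul, ← Finset.sum_const]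
      exact (Finset.sum_le_sum fun X hX => (hgood' X (hF X hX).1).1 (hF X hX).2).trans h1
    rw [Nat.le_div_iff_mul_le (by norm_num)]
    rw [← mul_div_assoc, div_le_one (by positivity)] at h2
    have h3 : (F.card : ℝ) * 500 ≤ 8 * (E : ℝ) ^ 2 := by linarith
    exact_mod_cast h3
  rw [Program.run]
  generalize hs3 : s2.tick (1 + (signRounds k).cost s2.mem) = s3
  have m3 : s3.mem = s2.mem := by rw [← hs3]; rfl
  have c3 : s3.circuit = [] := by rw [← hs3]; exact c2
  have hT : (signRounds k).eval s2.mem =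
      k * L * E ^ 2 * (2 * (2 * ((2 * k + 2) * (8 * E ^ 2 / 500))) ^ (posSets k).length) := by
    rw [eval_signRounds, e2 102 (by simp), e2 105 (by simp), e2 106 (by simp), h102, h105, h106]
  rw [hT]
  refine (expect_mono fun s' _ => ite_accurate_le).trans ?_
  rw [expect_sum]
  refine Finset.sum_le_sum fun X hX => ?_
  rw [mem_observables] at hX
  have z : ∀ a, a = 4 ∨ a = 5 ∨ a = 6 → s3.mem a (key X) = 0 := by
    rintro a (rfl | rfl | rfl) <;> rw [m3, e2 _ (by simp)]
    · exact h4 _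
    · exact h5 _
    · exact h6 _
  -- An observable that was not selected keeps the estimate `0 / 0 = 0`, whose error is at most `10
  -- / E` with certainty.
  by_cases h26 : s1.mem 26 (key X) = 0
  · refine le_trans (b := (0 : ℝ≥0∞)) ?_ zero_le
    refine (expect_mono (g := fun _ => 0) fun s' hs' => ?_).trans (expect_const _ 0).le
    obtain ⟨-, -, h⟩ := iterate_signInv hn ρ (by rwa [m3] : Dims n s3.mem) c3 _ s' hs'
    obtain ⟨g1, g2, g3⟩ := h X hX (by rw [m3, m26, h26])
    rw [if_neg]
    rw [not_lt, estR, g1, g2, g3, z 4 (by simp), z 5 (by simp), z 6 (by simp)]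
    simp only [Nat.cast_zero, sub_zero, div_zero, zero_sub, abs_neg]
    refine abs_le_of_sq_le_sq ?_ (by positivity)
    refine ((hgood' X hX).2 h26).trans (le_of_eq ?_)
    rw [div_pow]; norm_num
  · refine (expect_signLoop_le hn hc ρ s3 (by rwa [m3]) c3
      (fun a q => by rw [m3, e2 3 (by simp)]; exact hin a q) (W := 8 * E ^ 2 / 500)
      (Nat.div_pos (by omega) (by norm_num)) (by rw [m3, e2 105 (by simp), h105])
      (by rw [m3, e2 107 (by simp), h107]) hm1 hm2 hW (by rw [m3]; exact hL)
      (fun M hM => by rwa [m3, m26] at hM) hX (by rwa [m3, m26])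
      (by rw [m3]; exact hHit X hX h26) (z 4 (by simp)) (z 5 (by simp)) (z 6 (by simp))
      (e := 10 / E) (by positivity) ?_ _).trans ?_
    · rw [div_le_one hE']
      exact_mod_cast hE.le
    · gcongr
      -- The number of rounds is `k L E^2` divided by the covering probability, so with `e = 10 / E`
      -- the exponent is `100 k L / 8`.
      refine le_of_eq (congrArg expE ?_)
      have hP : ((2 * (2 * ((2 * k + 2) * (8 * E ^ 2 / 500))) ^ (posSets k).length : ℕ) : ℝ) ≠ 0 := by
        have : 0 < 8 * E ^ 2 / 500 := Nat.div_pos (by omega) (by norm_num)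
        exact_mod_cast (by positivity : 0 < 2 * (2 * ((2 * k + 2) * (8 * E ^ 2 / 500))) ^
          (posSets k).length).ne'
      rw [Nat.cast_mul (k * L * E ^ 2)]
      generalize ((2 * (2 * ((2 * k + 2) * (8 * E ^ 2 / 500))) ^ (posSets k).length : ℕ) : ℝ) = P
        at hP
      push_cast
      field_simp
      ring

open Classical in
-- Either the selection is wrong for some observable, or it is right for all of them and the second
-- stage fails. The first event is bounded after the Bell measurements, the second one from every
-- state that they can lead to.
theorem expect_main_failure (hn : 0 < n) (hc : IsMajorana c) (ρ : DensityMatrix n) (s : Config n)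
    (hd : Dims n s.mem) (hs : s.circuit = []) (hin : InputTable c s.mem) {E L m : ℕ} (hE : 10 < E)
    (h102 : s.mem 102 [] = E) (h105 : s.mem 105 [] = (2 * k + 2) * (8 * E ^ 2 / 500))
    (h106 : s.mem 106 [] = L) (h107 : s.mem 107 [] = m)
    (hm1 : (2 * k + 2) * (8 * E ^ 2 / 500) < 2 ^ m)
    (hm2 : 2 ^ m ≤ 2 * ((2 * k + 2) * (8 * E ^ 2 / 500)))
    (h0 : ∀ a ∈ ({4, 5, 6, 24, 25, 27, 28} : Finset ℕ), ∀ p, s.mem a p = 0) :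
    expect ((mainPart k).run ρ s) (fun s' => if Accurate k c ρ (10 / E) s' then 0 else 1) ≤
      ∑ _X ∈ observables n k, 2 * expE (-(39 * (k * L))) +
        ∑ _X ∈ observables n k, 2 * expE (-(25 / 2 * (k * L))) := by
  rw [mainPart, expect_det_seq ρ (by simp [resetTable])]
  have hT1 := resetTable_spec (s.tick 1) hd hin hs
  have c1 : (resetTable.ex (s.tick 1)).circuit = [] :=
    (ex_classical (by simp [resetTable]) (by simp [resetTable]) (s.tick 1)).trans hs
  have k1 : ∀ a, a ∉ ({30, 31, 32, 43, 49} : Finset ℕ) →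
      (resetTable.ex (s.tick 1)).mem a = s.mem a := fun a ha => ex_keeps (keeps_resetTable ha) _
  generalize resetTable.ex (s.tick 1) = s1 at hT1 c1 k1 ⊢
  rw [c1] at hT1
  rw [Program.run_seq, expect_bind, Program.run]
  simp only [Config.tick_mem]
  generalize hs2 : (s1.tick 1).tick (1 + (bellRounds k).cost s1.mem) = s2
  have m2 : s2.mem = s1.mem := by rw [← hs2]; rfl
  have c2 : s2.circuit = [] := by rw [← hs2]; exact c1
  have hT : (bellRounds k).eval s1.mem = k * L * E ^ 4 := by
    rw [eval_bellRounds, k1 102 (by simp), k1 106 (by simp), h102, h106]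
  rw [hT]
  have hd2 : Dims n s2.mem := hd.congr ((congrFun m2 _).trans (k1 _ (by simp)))
    ((congrFun m2 _).trans (k1 _ (by simp)))
  have hE' : (0 : ℝ) < E := by exact_mod_cast (by omega : 0 < E)
  calc _ ≤ expect (iterate (fun t => (bellRound k).run ρ (t.tick 1)) (k * L * E ^ 4) s2)
        (fun s' => (∑ X ∈ observables n k,
          if GoodSelection (k * L * E ^ 4) E (expVal c ρ X ^ 2) X s' then 0 else 1) +
          ∑ _X ∈ observables n k, 2 * expE (-(25 / 2 * (k * L)))) := by
        refine expect_mono fun s' hs' => ?_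
        have hinv : BellInv s2 s' := iterate_support (fun _ => BellInv s2) ⟨c2, fun _ _ => rfl⟩
          (fun _ _ _ ha b hb => bellInv_step ρ ha b hb) s' hs'
        have k3 : ∀ a, a ∉ ({20, 27, 28, 30, 31, 32, 40, 41, 42, 43, 46, 49, 50} : Finset ℕ) →
            s'.mem a = s.mem a := fun a ha => by
          simp only [Finset.mem_insert, Finset.mem_singleton] at ha
          rw [hinv.2 a (by simp only [Finset.mem_insert, Finset.mem_singleton]; tauto), m2,
            k1 a (by simp only [Finset.mem_insert, Finset.mem_singleton]; tauto)]
        by_cases hg : ∀ X ∈ observables n k,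
            GoodSelection (k * L * E ^ 4) E (expVal c ρ X ^ 2) X s'
        · refine (expect_sign_failure hn hc ρ s' (hd.congr (k3 _ (by simp)) (k3 _ (by simp)))
            hinv.1 (fun a q => by rw [k3 3 (by simp)]; exact hin a q) hE (by rw [k3 _ (by simp), h102])
            (by rw [k3 _ (by simp), h105]) (by rw [k3 _ (by simp), h106])
            (by rw [k3 _ (by simp), h107]) hm1 hm2 ?_ ?_ ?_ ?_ ?_ hg).trans le_add_self
          all_goals
            intro p
            rw [k3 _ (by simp)]
            exact h0 _ (by simp) p
        · push Not at hg
          obtain ⟨X, hX, hg⟩ := hg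
          refine le_trans ?_ le_self_add
          refine le_trans ?_ (Finset.single_le_sum (fun _ _ => zero_le) hX)
          rw [if_neg hg]
          refine (expect_mono (g := fun _ => 1) fun a _ => ?_).trans (expect_const _ 1).le
          split_ifs <;> simp
    _ ≤ _ := by
        rw [expect_add, expect_const, expect_sum]
        refine add_le_add_left (Finset.sum_le_sum fun X hX => ?_) _
        rw [mem_observables] at hX
        refine (expect_goodSelection hn hc ρ s2 hd2 c2
          (hT1.congr (congrFun m2 _) (congrFun m2 _) (congrFun m2 _)) hX ?_ ?_ hE.le _).trans
          (le_of_eq ?_)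
        · rw [m2, k1 27 (by simp), h0 _ (by simp)]
        · rw [m2, k1 28 (by simp), h0 _ (by simp)]
        · congr 2
          push_cast
          field_simp

/-- The error probability is small. -/
theorem sum_failure_le (hk : 1 ≤ k) (hn : 2 ≤ n) {L : ℕ} (hL : n < 2 ^ L) :
    ∑ _X ∈ observables n k, 2 * expE (-(39 * (k * L))) +
        ∑ _X ∈ observables n k, 2 * expE (-(25 / 2 * (k * L))) ≤ ENNReal.ofReal (1 / 100) := by
  have hL1 : 1 ≤ L := by
    rcases Nat.eq_zero_or_pos L with h | h
    · subst h; simp at hL; omega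
    · exact h
  have hkL : (1 : ℝ) ≤ k * L := by exact_mod_cast Nat.mul_pos hk hL1
  -- From `(2n)^(2k) ≤ 2^(4 k L)`, as `2 n ≤ 2^(2 L)`. This is less than the exponents `12.5 k L`
  -- and `39 k L` by a margin of at least `8.5`.
  have hN : ((observables n k).card : ℝ) ≤ Real.exp (4 * (k * L)) := by
    have h1 : (observables n k).card ≤ 2 ^ (4 * (k * L)) := by
      rw [observables, Finset.card_powersetCard, Finset.card_univ, Fintype.card_fin]
      calc _ ≤ (2 * n) ^ (2 * k) := Nat.choose_le_pow _ _
        _ ≤ (2 ^ (2 * L)) ^ (2 * k) := by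
            gcongr
            calc 2 * n ≤ 2 ^ L * 2 ^ L := Nat.mul_le_mul (by
                  calc 2 = 2 ^ 1 := rfl
                    _ ≤ _ := Nat.pow_le_pow_right (by norm_num) hL1) hL.le
              _ = _ := by rw [← pow_add, two_mul]
        _ = _ := by rw [← pow_mul]; ring_nf
    calc ((observables n k).card : ℝ) ≤ 2 ^ (4 * (k * L)) := by exact_mod_cast h1
      _ ≤ Real.exp 1 ^ (4 * (k * L)) := by
          gcongr
          linarith [Real.add_one_le_exp 1]
      _ = _ := by rw [← Real.exp_nat_mul]; push_cast; ring_nf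
  have h8 : Real.exp (-(17 / 2 : ℝ)) ≤ 1 / 400 := by
    have h1 : (2.7 : ℝ) ≤ Real.exp 1 := by linarith [Real.exp_one_gt_d9]
    have h2 : (400 : ℝ) ≤ Real.exp 1 ^ 8 := le_trans (by norm_num) (pow_le_pow_left₀ (by norm_num) h1 8)
    rw [Real.exp_neg, one_div]
    refine inv_anti₀ (by norm_num) (h2.trans ?_)
    rw [← Real.exp_nat_mul]
    exact Real.exp_le_exp.2 (by norm_num)
  have hone : ∀ a : ℝ, 25 / 2 ≤ a → ∑ _X ∈ observables n k, 2 * expE (-(a * (k * L))) ≤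
      ENNReal.ofReal (1 / 200) := by
    intro a ha
    rw [Finset.sum_const, nsmul_eq_mul, expE, ← ENNReal.ofReal_natCast (observables n k).card,
      ← ENNReal.ofReal_ofNat 2, ← ENNReal.ofReal_mul (by norm_num),
      ← ENNReal.ofReal_mul (by positivity)]
    refine ENNReal.ofReal_le_ofReal ?_
    calc _ ≤ Real.exp (4 * (k * L)) * (2 * Real.exp (-(a * (k * L)))) := by gcongr
      _ = 2 * Real.exp (4 * (k * L) + -(a * (k * L))) := by rw [Real.exp_add]; ring
      _ ≤ 2 * Real.exp (-(17 / 2)) := by gcongr; nlinarith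
      _ ≤ _ := by linarith
  refine (add_le_add (hone 39 (by norm_num)) (hone (25 / 2) le_rfl)).trans (le_of_eq ?_)
  rw [← ENNReal.ofReal_add (by norm_num) (by norm_num)]
  norm_num

end

/-! ## The number of copies -/

section
variable {n k : ℕ}

theorem copies_measure (ρ : DensityMatrix n) (a : ℕ) (s : Config n) :
    ∀ s' ∈ ((Program.measure a).run ρ s).support, s'.copies = s.copies + 2 := by
  intro s' hs'
  rw [Program.run, PMF.mem_support_bind_iff] at hs'
  obtain ⟨z, -, hs'⟩ := hs'
  rw [PMF.mem_support_pure_iff] at hs'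
  rw [hs']
  rfl

theorem copies_bellRound (ρ : DensityMatrix n) (s : Config n) :
    ∀ s' ∈ ((bellRound k).run ρ s).support, s'.copies = s.copies + 2 := by
  intro s' hs'
  rw [bellRound, Program.run_seq, PMF.mem_support_bind_iff] at hs'
  obtain ⟨s1, h1, hs'⟩ := hs'
  rw [Program.run_seq, PMF.mem_support_bind_iff] at hs'
  obtain ⟨s2, h2, hs'⟩ := hs'
  rw [run_support_noMeas ρ (by simp [forTuples, bellUpdate, image, Program.NoMeas]) _ _ hs',
    copies_measure ρ _ _ _ h2, Config.tick_copies,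
    run_support_noMeas ρ (by simp [bellCircuit, Program.NoMeas]) _ _ h1, Config.tick_copies]

theorem copies_signRound (ρ : DensityMatrix n) (s : Config n) :
    ∀ s' ∈ ((signRound k).run ρ s).support, s'.copies = s.copies + 2 := by
  intro s' hs'
  rw [signRound_eq, Program.run_seq, PMF.mem_support_bind_iff] at hs'
  obtain ⟨s1, h1, hs'⟩ := hs'
  rw [signTail, Program.run_seq, PMF.mem_support_bind_iff] at hs'
  obtain ⟨s2, h2, hs'⟩ := hs'
  rw [Program.run_seq, PMF.mem_support_bind_iff] at hs'
  obtain ⟨s3, h3, hs'⟩ := hs'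
  rw [Program.run_seq, PMF.mem_support_bind_iff] at hs'
  obtain ⟨s4, h4, hs'⟩ := hs'
  rw [run_support_noMeas ρ (by simp [signLoop, forTuples, signUpdate, image, Program.NoMeas]) _ _
    hs', copies_measure ρ _ _ _ h4, Config.tick_copies,
    run_support_noMeas ρ (by simp [markLoop, forTuples, diagonalize, image, findPivot, clearX,
      clearZ, gateH, gateS, gateCNOT, Program.NoMeas]) _ _ h3, Config.tick_copies,
    run_support_noMeas ρ (by simp [resetTable]) _ _ h2, Config.tick_copies,
    run_support_noMeas ρ (by simp [drawAll, drawLength, drawOne, coinV, Program.NoMeas]) _ _ h1,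
    Config.tick_copies]

theorem copies_rep (ρ : DensityMatrix n) {p : Program}
    (hp : ∀ s, ∀ s' ∈ (p.run ρ s).support, s'.copies = s.copies + 2) (e : Expr) (s : Config n) :
    ∀ s' ∈ ((Program.rep e p).run ρ s).support, s'.copies = s.copies + 2 * e.eval s.mem := by
  rw [Program.run]
  refine iterate_support (fun t (s' : Config n) => s'.copies = s.copies + 2 * t) rfl fun t _ a ha b hb => ?_
  rw [hp _ _ hb, Config.tick_copies, ha]
  ring

/-- The count is exact: every round takes two copies, and the parameters that determine the numbers
of rounds never change. -/
theorem copies_mainPart (ρ : DensityMatrix n) (s : Config n) :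
    ∀ s' ∈ ((mainPart k).run ρ s).support,
      s'.copies = s.copies + 2 * ((bellRounds k).eval s.mem + (signRounds k).eval s.mem) := by
  intro s' hs'
  rw [mainPart, Program.run_seq, PMF.mem_support_bind_iff] at hs'
  obtain ⟨s1, h1, hs'⟩ := hs'
  rw [Program.run_seq, PMF.mem_support_bind_iff] at hs'
  obtain ⟨s2, h2, hs'⟩ := hs'
  rw [Program.run_seq, PMF.mem_support_bind_iff] at hs'
  obtain ⟨s3, h3, hs'⟩ := hs'
  rw [Program.run_seq, PMF.mem_support_bind_iff] at hs'
  obtain ⟨s4, h4, hs'⟩ := hs'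
  have k1 : ∀ a, 100 ≤ a → s1.mem a = s.mem a := fun a ha => by
    rw [run_support_keeps ρ (keeps_resetTable (a := a) (by
      simp only [Finset.mem_insert, Finset.mem_singleton]; omega)) _ _ h1, Config.tick_mem]
  have k4 : ∀ a, 100 ≤ a → s4.mem a = s.mem a := fun a ha => by
    rw [run_support_keeps ρ (keeps_labelAll (k := k) (a := a) (by omega) (by omega) (by omega)) _ _
        h4, Config.tick_mem,
      run_support_keeps ρ (keeps_selectLarge (k := k) (a := a) (by omega) (by omega)) _ _ h3,
      Config.tick_mem,
      run_support_keeps ρ (p := .rep (bellRounds k) (bellRound k))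
        (keeps_bellRound (k := k) (a := a) (by
        simp only [Finset.mem_insert, Finset.mem_singleton]; omega)) _ _ h2, Config.tick_mem,
      k1 a ha]
  rw [copies_rep ρ (copies_signRound (k := k) ρ) _ _ _ hs',
    run_support_noMeas ρ (by simp [labelAll, forTuples, labelSet, Program.NoMeas]) _ _ h4,
    Config.tick_copies,
    run_support_noMeas ρ (by simp [selectLarge, forTuples, Program.NoMeas]) _ _ h3,
    Config.tick_copies, copies_rep ρ (copies_bellRound (k := k) ρ) _ _ _ h2, Config.tick_copies,
    run_support_noMeas ρ (by simp [resetTable]) _ _ h1, Config.tick_copies, Config.tick_mem,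
    eval_bellRounds, eval_bellRounds, eval_signRounds, eval_signRounds, k1 102 (by norm_num),
    k1 106 (by norm_num), k4 102 (by norm_num), k4 105 (by norm_num), k4 106 (by norm_num)]
  ring

/-! ## The parameters -/

theorem keeps_bitLength {a b : ℕ} (h8 : b ≠ 8) (h9 : b ≠ 9) : (bitLength a).Keeps b := by
  simp [bitLength, Program.Keeps, h8, h9]

theorem det_bitLength (a : ℕ) : (bitLength a).Det := by simp [bitLength, Program.Det]

/-- The loop halves the number and counts until it is zero. It runs `v` times, which is enough
because the bit length of `v` is at most `v`; this is affordable because the parameters themselves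
are polynomially bounded. -/
theorem bitLength_spec {a : ℕ} (h8 : a ≠ 8) (h9 : a ≠ 9) (s : Config n) :
    ((bitLength a).ex s).mem 9 [] = (s.mem a []).size := by
  set v := s.mem a [] with hv
  rw [bitLength, ex_seq, ex_seq]
  generalize hs2 : (setE 9 [] 0).ex (((setE 8 [] (var a)).ex (s.tick 1)).tick 1) = s2
  have e8 : s2.mem 8 [] = v := by rw [← hs2]; simp [hv]
  have e9 : s2.mem 9 [] = 0 := by rw [← hs2]; simp
  have ea : s2.mem a [] = v := by rw [← hs2]; simp [h8, h9, hv]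
  have key := ex_rep_induct (e := var a) (p := .seq (setE 9 [] (var 9 + ltE 0 (var 8)))
    (setE 8 [] (var 8 / 2))) (s := s2)
    (fun t s' => s'.mem 8 [] = v / 2 ^ t ∧ s'.mem 9 [] = min t v.size)
    (fun c => by simp [e8, e9]) (fun t _ s' hs' => by
      obtain ⟨g8, g9⟩ := hs'
      rw [ex_seq]
      refine ⟨?_, ?_⟩
      · simp [g8, Nat.div_div_eq_div_mul, pow_succ]
      · rw [ex_setE_mem_ne (by norm_num), ex_setE_mem_self]
        simp only [Config.tick_mem, List.map_nil, Function.update_self, eval_add, eval_var,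
          eval_ltE, eval_zero, g8, g9]
        have h1 : 0 < v / 2 ^ t ↔ t < v.size := by
          rw [Nat.lt_size, Nat.div_pos_iff]
          exact ⟨fun h => h.2, fun h => ⟨by positivity, h⟩⟩
        split_ifs with h
        · have := h1.1 h; omega
        · have := mt h1.2 h; omega)
  rw [key.2, eval_var, ea, min_eq_right (Nat.size_le.2 Nat.lt_two_pow_self)]

/-- The inverse precision. -/
def invPrec (ε : ℚ) : ℕ := 10 * ε.den / ε.num.toNat + 1

/-- The bound for the number of labels. -/
def labelBound (k : ℕ) (ε : ℚ) : ℕ := (2 * k + 2) * (8 * invPrec ε ^ 2 / 500)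

/-- The part of the protocol that computes the parameters. -/
def preamble (k : ℕ) : List Program := [setE 100 [] (var 0), setE 101 [] (2 * var 0),
  setE 102 [] (10 * var 2 / var 1 + 1), setE 105 [] (.const (2 * k + 2) * (8 * powE (var 102) 2 / 500)),
  bitLength 100, setE 106 [] (var 9), bitLength 105, setE 107 [] (var 9)]

/-- Run deterministic programs in sequence. -/
def exList (l : List Program) (s : Config n) : Config n := l.foldl (fun s p => p.ex (s.tick 1)) s

end

/-! ### Cost of computing the parameters -/

/-- Bounds for the bit lengths in the memory and the running time. -/
def Cheap {n : ℕ} (w : ℕ) (s : Config n) : Prop := SizeLe s.mem w ∧ s.time ≤ w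

theorem Program.Eff.exists_cheap {p : Program} (hp : p.Eff) (hd : p.Det) {f : ℕ → ℕ}
    (hf : PolyBdd f) : ∃ f', PolyBdd f' ∧ ∀ (n : ℕ) (_ : DensityMatrix n) (s : Config n) (K : ℕ),
      1 ≤ K → n ≤ K → ParLe s.mem K → Cheap (f K) s → Cheap (f' K) (p.ex (s.tick 1)) := by
  obtain ⟨g, hg, h⟩ := hp
  refine ⟨fun K => f K + 1 + g (f K + 1 + K), (hf.add (.const 1)).add
    (hg.comp ((hf.add (.const 1)).add .id) fun K hK => by omega), fun n ρ s K hK hn hpar hs => ?_⟩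
  have hmem : p.ex (s.tick 1) ∈ (p.run ρ (s.tick 1)).support := by
    rw [p.run_det ρ hd, PMF.mem_support_pure_iff]
  obtain ⟨h1, h2⟩ := h n ρ (s.tick 1) (f K + 1) K (by omega) hK hn hpar
    (fun a l => (hs.1 a l).trans (by omega)) _ hmem
  have ht := hs.2
  have e : (s.tick 1).time = s.time + 1 := rfl
  exact ⟨fun a l => (h1 a l).trans (by dsimp only; omega), by dsimp only; omega⟩

/-- The bound on the parameters is required before each program of the list, since it is what limits
the loops in there. -/
theorem exists_cheap_exList (l : List Program) (hl : ∀ p ∈ l, p.Eff ∧ p.Det) {f : ℕ → ℕ}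
    (hf : PolyBdd f) : ∃ f', PolyBdd f' ∧ ∀ (n : ℕ) (_ : DensityMatrix n) (s : Config n) (K : ℕ),
      1 ≤ K → n ≤ K → (∀ j < l.length, ParLe (exList (l.take j) s).mem K) → Cheap (f K) s →
        Cheap (f' K) (exList l s) := by
  induction l generalizing f with
  | nil => exact ⟨f, hf, fun n _ s K _ _ _ h => h⟩
  | cons p l ih =>
    obtain ⟨f₁, hf₁, h₁⟩ := (hl p (by simp)).1.exists_cheap (hl p (by simp)).2 hf
    obtain ⟨f₂, hf₂, h₂⟩ := ih (fun q hq => hl q (by simp [hq])) hf₁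
    refine ⟨f₂, hf₂, fun n ρ s K hK hn hpar hs => ?_⟩
    refine h₂ n ρ _ K hK hn (fun j hj => ?_) (h₁ n ρ s K hK hn (hpar 0 (by simp)) hs)
    exact hpar (j + 1) (by simpa using hj)

section
variable {n k : ℕ}

theorem setE_step (s : Config n) (a : ℕ) {e : Expr} {v : ℕ} (he : e.eval s.mem = v) :
    ((setE a [] e).ex (s.tick 1)).mem a [] = v ∧
      (∀ b, b ≠ a → ((setE a [] e).ex (s.tick 1)).mem b = s.mem b) ∧
      ∀ K, ParLe s.mem K → v ≤ K → ParLe ((setE a [] e).ex (s.tick 1)).mem K := by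
  refine ⟨by simp [he], fun b hb => by simp [hb], fun K hK hv b hb l => ?_⟩
  by_cases h : b = a
  · subst h
    rw [ex_setE_mem_self, List.map_nil, Function.update_apply]
    split_ifs
    · exact (he ▸ hv : e.eval s.mem ≤ K)
    · exact hK b hb l
  · rw [ex_setE_mem_ne h]; exact hK b hb l

theorem bitLength_step (s : Config n) {a v : ℕ} (ha : 100 ≤ a) (hv : s.mem a [] = v) :
    ((bitLength a).ex (s.tick 1)).mem 9 [] = v.size ∧
      (∀ b, b ≠ 8 → b ≠ 9 → ((bitLength a).ex (s.tick 1)).mem b = s.mem b) ∧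
      ∀ K, ParLe s.mem K → ParLe ((bitLength a).ex (s.tick 1)).mem K := by
  have h2 : ∀ b, b ≠ 8 → b ≠ 9 → ((bitLength a).ex (s.tick 1)).mem b = s.mem b :=
    fun b h8 h9 => ex_keeps (keeps_bitLength h8 h9) _
  refine ⟨?_, h2, fun K hK b hb l => ?_⟩
  · rw [bitLength_spec (by omega) (by omega), Config.tick_mem, hv]
  · rw [h2 b (by omega) (by omega)]; exact hK b hb l

/-- The memory after the parameters have been computed. -/
structure Prepared (k : ℕ) (c : Fin (2 * n) → Fin n → Pauli) (ε : ℚ) (s : Config n) : Prop where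
  dims : Dims n s.mem
  h102 : s.mem 102 [] = invPrec ε
  h105 : s.mem 105 [] = labelBound k ε
  h106 : s.mem 106 [] = n.size
  h107 : s.mem 107 [] = (labelBound k ε).size
  keep : ∀ a, 3 ≤ a → a ≠ 8 → a ≠ 9 → a < 100 → s.mem a = (initial c ε).mem a

/-- The second half controls the parameters at every intermediate point, as `exists_cheap_exList`
demands. -/
theorem preamble_spec (c : Fin (2 * n) → Fin n → Pauli) (ε : ℚ) :
    Prepared k c ε (exList (preamble k) (initial c ε)) ∧
      ∀ K, 2 * n ≤ K → invPrec ε ≤ K → labelBound k ε ≤ K → ∀ j ≤ (preamble k).length,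
        ParLe (exList ((preamble k).take j) (initial c ε)).mem K := by
  set s0 := initial c ε with hs0
  have p0 : ∀ K, ParLe s0.mem K := by
    intro K a ha l
    have : s0.mem a l = 0 := by
      rw [hs0, initial]
      dsimp only
      split <;> omega
    omega
  obtain ⟨v1, k1, p1⟩ := setE_step s0 100 (e := var 0) (v := n) (by rw [eval_var]; rfl)
  set s1 := (setE 100 [] (var 0)).ex (s0.tick 1) with hs1
  obtain ⟨v2, k2, p2⟩ := setE_step s1 101 (e := 2 * var 0) (v := 2 * n) (by
    rw [eval_mul, eval_var, k1 0 (by norm_num)]; rfl)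
  set s2 := (setE 101 [] (2 * var 0)).ex (s1.tick 1) with hs2
  obtain ⟨v3, k3, p3⟩ := setE_step s2 102 (e := 10 * var 2 / var 1 + 1) (v := invPrec ε) (by
    rw [eval_add, eval_div, eval_mul, eval_var, eval_var, k2 1 (by norm_num), k2 2 (by norm_num),
      k1 1 (by norm_num), k1 2 (by norm_num)]
    rfl)
  set s3 := (setE 102 [] (10 * var 2 / var 1 + 1)).ex (s2.tick 1) with hs3
  obtain ⟨v4, k4, p4⟩ := setE_step s3 105 (e := .const (2 * k + 2) * (8 * powE (var 102) 2 / 500))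
    (v := labelBound k ε) (by simp [v3, labelBound])
  set s4 := (setE 105 [] (.const (2 * k + 2) * (8 * powE (var 102) 2 / 500))).ex (s3.tick 1) with hs4
  obtain ⟨v5, k5, p5⟩ := bitLength_step s4 (a := 100) (v := n) le_rfl (by
    rw [k4 _ (by norm_num), k3 _ (by norm_num), k2 _ (by norm_num), v1])
  set s5 := (bitLength 100).ex (s4.tick 1) with hs5
  obtain ⟨v6, k6, p6⟩ := setE_step s5 106 (e := var 9) (v := n.size) (by rw [eval_var, v5])
  set s6 := (setE 106 [] (var 9)).ex (s5.tick 1) with hs6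
  obtain ⟨v7, k7, p7⟩ := bitLength_step s6 (a := 105) (v := labelBound k ε) (by norm_num) (by
    rw [k6 _ (by norm_num), k5 _ (by norm_num) (by norm_num), v4])
  set s7 := (bitLength 105).ex (s6.tick 1) with hs7
  obtain ⟨v8, k8, p8⟩ := setE_step s7 107 (e := var 9) (v := (labelBound k ε).size) (by
    rw [eval_var, v7])
  set s8 := (setE 107 [] (var 9)).ex (s7.tick 1) with hs8
  have e8 : exList (preamble k) s0 = s8 := rfl
  have k48 : ∀ a, a ≠ 8 → a ≠ 9 → a ≠ 106 → a ≠ 107 → s8.mem a = s4.mem a :=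
    fun a h8 h9 h6 h7 => by rw [k8 a h7, k7 a h8 h9, k6 a h6, k5 a h8 h9]
  constructor
  · rw [e8]
    refine ⟨⟨?_, ?_⟩, ?_, ?_, ?_, v8, fun a h3 h8 h9 h100 => ?_⟩
    · rw [k48 _ (by norm_num) (by norm_num) (by norm_num) (by norm_num), k4 _ (by norm_num),
        k3 _ (by norm_num), k2 _ (by norm_num), v1]
    · rw [k48 _ (by norm_num) (by norm_num) (by norm_num) (by norm_num), k4 _ (by norm_num),
        k3 _ (by norm_num), v2]
    · rw [k48 _ (by norm_num) (by norm_num) (by norm_num) (by norm_num), k4 _ (by norm_num), v3]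
    · rw [k48 _ (by norm_num) (by norm_num) (by norm_num) (by norm_num), v4]
    · rw [k8 _ (by norm_num), k7 _ (by norm_num) (by norm_num), v6]
    · rw [k48 a h8 h9 (by omega) (by omega), k4 a (by omega), k3 a (by omega), k2 a (by omega),
        k1 a (by omega)]
  · intro K h1 h2 h3 j hj
    have hsz : ∀ m : ℕ, m.size ≤ m := fun m => Nat.size_le.2 Nat.lt_two_pow_self
    have q1 := p1 K (p0 K) (by omega)
    have q2 := p2 K q1 h1
    have q3 := p3 K q2 h2
    have q4 := p4 K q3 h3
    have q5 := p5 K q4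
    have q6 := p6 K q5 ((hsz n).trans (by omega))
    have q7 := p7 K q6
    have q8 := p8 K q7 ((hsz _).trans h3)
    have hj' : j ≤ 8 := hj
    interval_cases j
    · exact p0 K
    · exact q1
    · exact q2
    · exact q3
    · exact q4
    · exact q5
    · exact q6
    · exact q7
    · exact q8

theorem preamble_eff_det (k : ℕ) : ∀ p ∈ preamble k, p.Eff ∧ p.Det := by
  intro p hp
  simp only [preamble, List.mem_cons, List.not_mem_nil, or_false] at hp
  rcases hp with rfl | rfl | rfl | rfl | rfl | rfl | rfl | rfl
  · exact ⟨.setE _ _ _, by simp⟩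
  · exact ⟨.setE _ _ _, by simp⟩
  · exact ⟨.setE _ _ _, by simp⟩
  · exact ⟨.setE _ _ _, by simp⟩
  · exact ⟨(poly_bitLength le_rfl).eff, det_bitLength _⟩
  · exact ⟨.setE _ _ _, by simp⟩
  · exact ⟨(poly_bitLength (by norm_num)).eff, det_bitLength _⟩
  · exact ⟨.setE _ _ _, by simp⟩

theorem exList_circuit {l : List Program} (hl : ∀ p ∈ l, p.Det ∧ p.Classical) (s : Config n) :
    (exList l s).circuit = s.circuit := by
  induction l generalizing s with
  | nil => rfl
  | cons p l ih =>
    exact (ih (fun q hq => hl q (by simp [hq])) _).trans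
      (ex_classical (hl p (by simp)).1 (hl p (by simp)).2 (s.tick 1))

theorem exList_copies (ρ : DensityMatrix n) {l : List Program} (hl : ∀ p ∈ l, p.Det ∧ p.NoMeas)
    (s : Config n) : (exList l s).copies = s.copies := by
  induction l generalizing s with
  | nil => rfl
  | cons p l ih =>
    refine (ih (fun q hq => hl q (by simp [hq])) _).trans ?_
    refine run_support_noMeas ρ (hl p (by simp)).2 (s.tick 1) _ ?_
    rw [p.run_det ρ (hl p (by simp)).1, PMF.mem_support_pure_iff]

theorem preamble_classical (k : ℕ) : ∀ p ∈ preamble k, p.Det ∧ p.Classical := by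
  simp [preamble, bitLength, Program.Det, Program.Classical]

theorem preamble_noMeas (k : ℕ) : ∀ p ∈ preamble k, p.Det ∧ p.NoMeas := by
  simp [preamble, bitLength, Program.Det, Program.NoMeas]

end

/-! ## The sample bound -/

theorem eval_chiPoly_one (w : ℝ) : (chiPoly 1).eval w = w + 1 := by simp [chiPoly]

theorem eval_chiPoly (k : ℕ) (w : ℝ) : (chiPoly (k + 2)).eval w =
    ((2 * ((k : ℝ) + 2) - 1) * w * (chiPoly (k + 1)).eval w) ^ (2 * (k + 2)) := by
  simp [chiPoly]

theorem le_eval_chiPoly {w : ℝ} (hw : 4 ≤ w) (k : ℕ) : w ≤ (chiPoly (k + 1)).eval w := by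
  induction k with
  | zero => rw [eval_chiPoly_one]; linarith
  | succ k ih =>
    rw [eval_chiPoly]
    have hk : (0 : ℝ) ≤ k := by positivity
    have h1 : w ≤ (2 * ((k : ℝ) + 2) - 1) * w * (chiPoly (k + 1)).eval w := by
      calc w = 1 * w * 1 := by ring
        _ ≤ _ := by gcongr <;> first | linarith | nlinarith
    exact h1.trans (le_self_pow₀ (by linarith) (by omega))

/-- The constant is sharp for the leading terms: `6^8 = 20736 * 3^4`. -/
theorem chiPoly_two_bound {w : ℝ} (hw : 4 ≤ w) :
    ((2 * (2 : ℕ) + 2) * w) ^ 2 ^ (2 * 2 - 1) ≤ 20736 * (chiPoly 2).eval w := by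
  rw [eval_chiPoly, eval_chiPoly_one]
  calc _ = 20736 * ((3 * w * w) ^ 4) := by norm_num; ring
    _ ≤ _ := by
        rw [show 2 * (0 + 2) = 4 by norm_num]
        gcongr
        · norm_num
        · linarith

theorem chiPoly_three_bound {w : ℝ} (hw : 4 ≤ w) :
    ((2 * (3 : ℕ) + 2) * w) ^ 2 ^ (2 * 3 - 1) ≤ 4 * (chiPoly 3).eval w := by
  have h1 : 81 * w ^ 8 ≤ (chiPoly 2).eval w := by
    rw [eval_chiPoly, eval_chiPoly_one]
    calc _ = (3 * w * w) ^ 4 := by ring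
      _ ≤ _ := by
        rw [show 2 * (0 + 2) = 4 by norm_num]
        gcongr
        · norm_num
        · linarith
  rw [eval_chiPoly]
  calc _ = 8 ^ 32 * w ^ 32 := by norm_num; ring
    _ ≤ (4 * 405 ^ 6 * 4 ^ 22) * w ^ 32 := by gcongr; norm_num
    _ ≤ (4 * 405 ^ 6 * w ^ 22) * w ^ 32 := by gcongr
    _ = 4 * (5 * w * (81 * w ^ 8)) ^ 6 := by ring
    _ ≤ _ := by
        rw [show 2 * (1 + 2) = 6 by norm_num]
        gcongr
        norm_num

/-- From one `k` to the next the exponent on the left grows by the factor `4`, and the base at most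
doubles, so it is at most squared. The new left side is thus at most the eighth power of the old
one, and `chiPoly` is raised to a power of at least `8`. The factor `4` is absorbed by `(2k - 1) ω`.
-/
theorem chiPoly_bound {w : ℝ} (hw : 4 ≤ w) (k : ℕ) :
    ((2 * (k + 3 : ℕ) + 2) * w) ^ 2 ^ (2 * (k + 3) - 1) ≤ 4 * (chiPoly (k + 3)).eval w := by
  induction k with
  | zero => exact chiPoly_three_bound hw
  | succ k ih =>
    set b : ℝ := (2 * (k + 3 : ℕ) + 2) * w with hb
    have hk : (0 : ℝ) ≤ k := by positivity
    have hb1 : 8 * w ≤ b := by rw [hb]; push_cast; nlinarith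
    have hf1 : 1 ≤ b ^ 2 ^ (2 * (k + 3) - 1) := one_le_pow₀ (by linarith)
    rw [show k + 1 + 3 = k + 2 + 2 by ring, eval_chiPoly]
    have h1 : b ^ 2 ^ (2 * (k + 3) - 1) ≤
        (2 * (((k + 2 : ℕ) : ℝ) + 2) - 1) * w * (chiPoly (k + 2 + 1)).eval w := by
      have h2 : 4 ≤ (2 * (((k + 2 : ℕ) : ℝ) + 2) - 1) * w := by push_cast; nlinarith
      calc _ ≤ 4 * (chiPoly (k + 3)).eval w := ih
        _ ≤ _ := by
          gcongr
          have := le_eval_chiPoly hw (k + 2)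
          linarith
    have h3 : (2 * ((k + 2 + 2 : ℕ) : ℝ) + 2) * w ≤ b ^ 2 := by
      have : (2 * ((k + 2 + 2 : ℕ) : ℝ) + 2) * w ≤ 2 * b := by
        rw [hb]; push_cast; nlinarith
      nlinarith
    calc _ ≤ (b ^ 2) ^ 2 ^ (2 * (k + 2 + 2) - 1) := by gcongr
      _ = (b ^ 2 ^ (2 * (k + 3) - 1)) ^ 8 := by
          rw [← pow_mul, ← pow_mul]
          congr 1
          rw [show 2 * (k + 2 + 2) - 1 = (2 * (k + 3) - 1) + 2 by omega, pow_add]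
          ring
      _ ≤ (b ^ 2 ^ (2 * (k + 3) - 1)) ^ (2 * (k + 2 + 2)) := pow_le_pow_right₀ hf1 (by omega)
      _ ≤ ((2 * (((k + 2 : ℕ) : ℝ) + 2) - 1) * w * (chiPoly (k + 2 + 1)).eval w) ^
          (2 * (k + 2 + 2)) := by gcongr
      _ ≤ _ := by
          refine le_mul_of_one_le_left ?_ (by norm_num)
          exact pow_nonneg (le_trans (by linarith) h1) _

/-- Half of the subsets of a nonempty set are odd, by the alternating sum over all subsets. -/
theorem length_posSets_le {k : ℕ} (hk : k ≠ 1) : (posSets k).length ≤ 2 ^ (2 * k - 1) := by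
  rcases Nat.eq_zero_or_pos k with h0 | h0
  · subst h0; simp [posSets, Finset.filter_singleton]
  rw [posSets, if_neg hk, Finset.length_toList]
  set A := (Finset.range (2 * k)).powerset with hA
  have h1 := Finset.sum_powerset_neg_one_pow_card_of_nonempty (x := Finset.range (2 * k))
    (by simpa using by omega)
  have h2 : ∑ J ∈ A, (-1 : ℤ) ^ J.card =
      (A.filter fun J => ¬ Odd J.card).card - (A.filter fun J => Odd J.card).card := by
    rw [← Finset.sum_filter_not_add_sum_filter A (fun J => Odd J.card),
      Finset.sum_congr rfl (g := fun _ => (1 : ℤ)) fun J hJ => ?_,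
      Finset.sum_congr (s₁ := A.filter fun J => Odd J.card) rfl (g := fun _ => (-1 : ℤ))
        fun J hJ => ?_]
    · simp; ring
    · exact (Finset.mem_filter.1 hJ).2.neg_one_pow
    · exact (Nat.not_odd_iff_even.1 (Finset.mem_filter.1 hJ).2).neg_one_pow
  have h3 := Finset.card_filter_add_card_filter_not (s := A) (fun J => Odd J.card)
  have h4 : A.card = 2 * 2 ^ (2 * k - 1) := by
    rw [hA, Finset.card_powerset, Finset.card_range, ← pow_succ']
    congr 1; omega
  rw [h2] at h1
  omega

/-- The inverse covering probability is dominated by the polynomial of the sample bound. The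
constant is dictated by `k = 2`. For `k = 1` the left side is linear, thanks to the single kernel in
`posSets 1`. -/
theorem pow_posSets_le {w : ℝ} (hw : 4 ≤ w) {k : ℕ} (hk : 1 ≤ k) :
    ((2 * k + 2) * w) ^ (posSets k).length ≤ 20736 * (chiPoly k).eval w := by
  by_cases hk1 : k = 1
  · subst hk1
    rw [posSets_one, eval_chiPoly_one]
    norm_num
    linarith
  have hb : 1 ≤ (2 * (k : ℝ) + 2) * w := by
    have : (0 : ℝ) ≤ k := by positivity
    nlinarith
  refine (pow_le_pow_right₀ hb (length_posSets_le hk1)).trans ?_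
  by_cases hk2 : k = 2
  · subst hk2; exact chiPoly_two_bound hw
  obtain ⟨j, rfl⟩ : ∃ j, k = j + 3 := ⟨k - 3, by omega⟩
  refine (chiPoly_bound hw j).trans ?_
  have := le_eval_chiPoly hw (j + 2)
  have h2 : 0 ≤ (chiPoly (j + 3)).eval w := by linarith
  nlinarith

/-- The bit length is at most `1 + log n / log 2`, and `2 / log 2 < 3` takes care of both summands
as `n ≥ 2`. -/
theorem size_le_log {n : ℕ} (hn : 2 ≤ n) : (n.size : ℝ) ≤ 3 * Real.log n := by
  have hpos : 0 < n.size := Nat.size_pos.2 (by omega)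
  have h1 : 2 ^ (n.size - 1) ≤ n := Nat.lt_size.1 (by omega)
  have h2 : ((n.size - 1 : ℕ) : ℝ) * Real.log 2 ≤ Real.log n := by
    rw [← Real.log_pow]
    exact Real.log_le_log (by positivity) (by exact_mod_cast h1)
  have h3 : Real.log 2 ≤ Real.log n := Real.log_le_log (by norm_num) (by exact_mod_cast hn)
  have h4 := Real.log_two_gt_d9
  have h5 : ((n.size - 1 : ℕ) : ℝ) = n.size - 1 := by push_cast [Nat.cast_sub hpos]; ring
  rw [h5] at h2
  have h6 : (1 : ℝ) ≤ n.size := by exact_mod_cast hpos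
  nlinarith

section
variable {ε : ℚ}

theorem num_toNat_cast (h0 : 0 < ε) : ((ε.num.toNat : ℕ) : ℝ) = (ε : ℝ) * ε.den := by
  have h1 : ((ε.num.toNat : ℕ) : ℤ) = ε.num := Int.toNat_of_nonneg (Rat.num_pos.2 h0).le
  have h2 : ε * ε.den = ε.num := Rat.mul_den_eq_num ε
  have h3 : ((ε.num.toNat : ℕ) : ℚ) = ε * ε.den := by rw [h2, ← h1]; push_cast; rfl
  exact_mod_cast congrArg (fun q : ℚ => (q : ℝ)) h3

theorem lt_invPrec (h0 : 0 < ε) : 10 / (ε : ℝ) < invPrec ε := by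
  have hε : (0 : ℝ) < ε := by exact_mod_cast h0
  have hd : (0 : ℝ) < ε.den := by exact_mod_cast ε.den_pos
  have h1 : 10 * ε.den < invPrec ε * ε.num.toNat := by
    rw [invPrec, mul_comm (_ + 1)]
    have h : 0 < ε.num.toNat := by
      have := Rat.num_pos.2 h0
      omega
    exact Nat.lt_mul_div_succ _ h
  have h2 : (10 * ε.den : ℝ) < invPrec ε * ((ε : ℝ) * ε.den) := by
    rw [← num_toNat_cast h0]; exact_mod_cast h1
  rw [div_lt_iff₀ hε]
  nlinarith

theorem invPrec_le (h0 : 0 < ε) (h1 : ε < 1) : (invPrec ε : ℝ) ≤ 11 / ε := by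
  have hε : (0 : ℝ) < ε := by exact_mod_cast h0
  have hε1 : (ε : ℝ) < 1 := by exact_mod_cast h1
  have hd : (0 : ℝ) < ε.den := by exact_mod_cast ε.den_pos
  have h2 : ((10 * ε.den / ε.num.toNat : ℕ) : ℝ) ≤ 10 / ε := by
    refine Nat.cast_div_le.trans (le_of_eq ?_)
    rw [num_toNat_cast h0]
    push_cast
    field_simp
  have h3 : 1 ≤ 1 / (ε : ℝ) := by rw [le_div_iff₀ hε]; linarith
  rw [invPrec]
  push_cast
  calc _ ≤ 10 / (ε : ℝ) + 1 / ε := add_le_add h2 h3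
    _ = _ := by ring

theorem ten_lt_invPrec (h0 : 0 < ε) (h1 : ε < 1) : 10 < invPrec ε := by
  have hε : (0 : ℝ) < ε := by exact_mod_cast h0
  have hε1 : (ε : ℝ) < 1 := by exact_mod_cast h1
  have h2 : (10 : ℝ) ≤ 10 / ε := by rw [le_div_iff₀ hε]; linarith
  exact_mod_cast h2.trans_lt (lt_invPrec h0)

/-- With `invPrec ε ≤ 11 / ε` the numerical constant is `8 * 121 / 500 = 1.936`, just below `2`;
this produces the argument `4 / ε^2` of the polynomial. -/
theorem labelBound_le (k : ℕ) (h0 : 0 < ε) (h1 : ε < 1) :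
    2 * (labelBound k ε : ℝ) ≤ (2 * k + 2) * (4 / (ε : ℝ) ^ 2) := by
  have hε : (0 : ℝ) < ε := by exact_mod_cast h0
  have h2 := invPrec_le h0 h1
  have h3 : ((8 * invPrec ε ^ 2 / 500 : ℕ) : ℝ) ≤ 2 / (ε : ℝ) ^ 2 := by
    refine Nat.cast_div_le.trans ?_
    push_cast
    calc (8 * (invPrec ε : ℝ) ^ 2 / 500 : ℝ) ≤ 8 * (11 / (ε : ℝ)) ^ 2 / 500 := by gcongr
      _ = (968 / 500) / (ε : ℝ) ^ 2 := by rw [div_pow]; ring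
      _ ≤ _ := by gcongr; norm_num
  rw [labelBound]
  push_cast at h3 ⊢
  calc _ ≤ 2 * ((2 * (k : ℝ) + 2) * (2 / (ε : ℝ) ^ 2)) := by gcongr
    _ = _ := by ring

/-- The number of copies is within the sample bound. -/
theorem rounds_le {n k : ℕ} (hn : 2 ≤ n) (hk : 1 ≤ k) (h0 : 0 < ε) (h1 : ε < 1) :
    2 * ((k * n.size * (invPrec ε : ℝ) ^ 4) + k * n.size * (invPrec ε : ℝ) ^ 2 *
      (2 * (2 * (labelBound k ε : ℝ)) ^ (posSets k).length)) ≤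
    6 * (14641 + 242 * 20736) *
      (k * Real.log n * (chiPoly k).eval (4 / (ε : ℝ) ^ 2) / (ε : ℝ) ^ 2) := by
  have hε : (0 : ℝ) < ε := by exact_mod_cast h0
  have hε1 : (ε : ℝ) < 1 := by exact_mod_cast h1
  set w : ℝ := 4 / (ε : ℝ) ^ 2 with hw
  have hw4 : 4 ≤ w := by
    rw [hw, le_div_iff₀ (by positivity)]
    nlinarith
  obtain ⟨j, rfl⟩ : ∃ j, k = j + 1 := ⟨k - 1, by omega⟩
  have hP := le_eval_chiPoly hw4 j
  have hpow := pow_posSets_le hw4 hk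
  set P := (chiPoly (j + 1)).eval w
  have hL := size_le_log hn
  have hE := invPrec_le h0 h1
  have hE2 : (invPrec ε : ℝ) ^ 2 ≤ 121 * (1 / (ε : ℝ) ^ 2) := by
    calc _ ≤ (11 / (ε : ℝ)) ^ 2 := by gcongr
      _ = _ := by rw [div_pow]; ring
  have hE4 : (invPrec ε : ℝ) ^ 4 ≤ 14641 * (1 / (ε : ℝ) ^ 2) * P := by
    calc (invPrec ε : ℝ) ^ 4 = ((invPrec ε : ℝ) ^ 2) ^ 2 := by ring
      _ ≤ (121 * (1 / (ε : ℝ) ^ 2)) ^ 2 := by gcongr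
      _ = 14641 * (1 / (ε : ℝ) ^ 2) * (w / 4) := by rw [hw]; ring
      _ ≤ _ := by gcongr; linarith
  have hlab : (2 * (labelBound (j + 1) ε : ℝ)) ^ (posSets (j + 1)).length ≤ 20736 * P := by
    refine (pow_le_pow_left₀ (by positivity) (labelBound_le (j + 1) h0 h1) _).trans hpow
  have hP0 : 0 ≤ P := by linarith
  have hlog : 0 ≤ Real.log n := Real.log_natCast_nonneg n
  have hkL : ((j + 1 : ℕ) : ℝ) * n.size ≤ (j + 1 : ℕ) * (3 * Real.log n) := by gcongr
  have hsum : (invPrec ε : ℝ) ^ 4 + (invPrec ε : ℝ) ^ 2 *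
      (2 * (2 * (labelBound (j + 1) ε : ℝ)) ^ (posSets (j + 1)).length) ≤
      (14641 + 242 * 20736) * ((1 / (ε : ℝ) ^ 2) * P) := by
    calc _ ≤ 14641 * (1 / (ε : ℝ) ^ 2) * P + 121 * (1 / (ε : ℝ) ^ 2) * (2 * (20736 * P)) := by
          gcongr
      _ = _ := by ring
  calc _ = 2 * (((j + 1 : ℕ) : ℝ) * n.size * ((invPrec ε : ℝ) ^ 4 + (invPrec ε : ℝ) ^ 2 *
      (2 * (2 * (labelBound (j + 1) ε : ℝ)) ^ (posSets (j + 1)).length))) := by ring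
    _ ≤ 2 * (((j + 1 : ℕ) * (3 * Real.log n)) *
        ((14641 + 242 * 20736) * ((1 / (ε : ℝ) ^ 2) * P))) := by gcongr
    _ = _ := by ring

end

/-! ## Correctness of the protocol -/

/-- The protocol. -/
def protocolFor (k : ℕ) : Program := (preamble k).foldr .seq (mainPart k)

section
variable {n k : ℕ} {c : Fin (2 * n) → Fin n → Pauli} {ε : ℚ}

theorem run_foldr_seq (ρ : DensityMatrix n) {l : List Program} (hl : ∀ p ∈ l, p.Det)
    (q : Program) (s : Config n) : (l.foldr .seq q).run ρ s = q.run ρ (exList l s) := by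
  induction l generalizing s with
  | nil => rfl
  | cons p l ih =>
    rw [List.foldr_cons, Program.run_seq, p.run_det ρ (hl p (by simp)), PMF.pure_bind,
      ih fun q hq => hl q (by simp [hq])]
    rfl

theorem run_protocolFor (ρ : DensityMatrix n) (s : Config n) :
    (protocolFor k).run ρ s = (mainPart k).run ρ (exList (preamble k) s) :=
  run_foldr_seq ρ (fun p hp => (preamble_eff_det k p hp).2) _ s

theorem Accurate.succeeds (hc : IsMajorana c) {ρ : DensityMatrix n} {e : ℝ} {s : Config n}
    (h : Accurate k c ρ e s) (he : e ≤ ε) : s.Succeeds k c ε ρ := by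
  intro X hX
  have h1 := h X (mem_observables.2 hX)
  have e1 : ((s.estimate X : ℚ) : ℂ) = ((estR X s : ℝ) : ℂ) := by
    simp only [Config.estimate, estR, key]
    push_cast
    rfl
  rw [e1, hc.trace_eq, ← Complex.ofReal_sub, Complex.norm_real, Real.norm_eq_abs]
  exact h1.trans he

theorem protocol_succeeds (hk : 1 ≤ k) (hn : 2 ≤ n) (hc : IsMajorana c) (h0 : 0 < ε) (h1 : ε < 1)
    (ρ : DensityMatrix n) : (99 / 100 : ℝ≥0∞) ≤
      ((protocolFor k).run ρ (initial c ε)).toOuterMeasure {s | s.Succeeds k c ε ρ} := by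
  classical
  have hε : (0 : ℝ) < ε := by exact_mod_cast h0
  obtain ⟨hP, -⟩ := preamble_spec (k := k) c ε
  have hs : (exList (preamble k) (initial c ε)).circuit = [] :=
    exList_circuit (preamble_classical k) _
  rw [run_protocolFor]
  generalize exList (preamble k) (initial c ε) = s at hP hs ⊢
  have hE := ten_lt_invPrec h0 h1
  have hW : 0 < labelBound k ε := Nat.mul_pos (by omega) (Nat.div_pos (by nlinarith) (by norm_num))
  have hinput : InputTable c s.mem := fun a q => by
    rw [hP.keep 3 le_rfl (by norm_num) (by norm_num) (by norm_num)]
    simp [initial]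
  have hzero : ∀ a ∈ ({4, 5, 6, 24, 25, 27, 28} : Finset ℕ), ∀ p, s.mem a p = 0 := by
    intro a ha p
    simp only [Finset.mem_insert, Finset.mem_singleton] at ha
    rw [hP.keep a (by omega) (by omega) (by omega) (by omega), initial]
    dsimp only
    split <;> omega
  have hfail := (expect_main_failure (k := k) (by omega) hc ρ s hP.dims hs hinput hE hP.h102 hP.h105
    -- The number of bits of a label is the bit length of the bound, so `2 ^ m` exceeds the bound by
    -- a factor of at most two.
    hP.h106 hP.h107 (Nat.lt_size_self _) (by
      have := Nat.lt_size.1 (Nat.sub_lt (Nat.size_pos.2 hW) one_pos)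
      calc 2 ^ (labelBound k ε).size = 2 * 2 ^ ((labelBound k ε).size - 1) := by
            rw [← pow_succ']; congr 1; have := Nat.size_pos.2 hW; omega
        _ ≤ 2 * labelBound k ε := Nat.mul_le_mul_left 2 this) hzero).trans
    (sum_failure_le hk hn (Nat.lt_size_self n))
  have e99 : (99 / 100 : ℝ≥0∞) = 1 - ENNReal.ofReal (1 / 100) := by
    rw [← ENNReal.ofReal_one, ← ENNReal.ofReal_sub _ (by norm_num),
      show (99 / 100 : ℝ≥0∞) = ENNReal.ofReal (99 / 100) by
        rw [ENNReal.ofReal_div_of_pos (by norm_num)]; simp]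
    norm_num
  rw [e99]
  refine one_sub_le_toOuterMeasure _ _ ((expect_mono fun s' _ => ?_).trans hfail)
  by_cases h : Accurate k c ρ (10 / invPrec ε) s'
  · rw [Set.indicator_of_notMem]
    · exact zero_le
    · rw [Set.notMem_compl_iff]
      refine h.succeeds hc ?_
      have := lt_invPrec h0
      rw [div_lt_iff₀ hε] at this
      rw [div_le_iff₀ (by exact_mod_cast (by omega : 0 < invPrec ε))]
      linarith
  · rw [if_neg h]
    exact Set.indicator_apply_le' (fun _ => le_rfl) fun _ => zero_le

theorem protocol_copies (hk : 1 ≤ k) (hn : 2 ≤ n) (h0 : 0 < ε) (h1 : ε < 1)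
    (ρ : DensityMatrix n) : ∀ s ∈ ((protocolFor k).run ρ (initial c ε)).support,
      (s.copies : ℝ) ≤ 6 * (14641 + 242 * 20736) *
        (k * Real.log n * (chiPoly k).eval (4 / (ε : ℝ) ^ 2) / (ε : ℝ) ^ 2) := by
  intro s' hs'
  obtain ⟨hP, -⟩ := preamble_spec (k := k) c ε
  rw [run_protocolFor] at hs'
  rw [copies_mainPart ρ _ _ hs', exList_copies ρ (preamble_noMeas k), eval_bellRounds,
    eval_signRounds, hP.h102, hP.h105, hP.h106]
  refine le_trans (le_of_eq ?_) (rounds_le hn hk h0 h1)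
  simp [initial]

/-- A number that bounds the parameters. -/
def paramBound (n k : ℕ) (ε : ℚ) : ℕ := 2 * n + invPrec ε + labelBound k ε + ε.den.size

/-- The coefficient collects `2` for `2 n`, `11` for the inverse precision, `4 k + 4` for the bound
on the labels and `1` for the length of the denominator; the square comes from the labels. -/
theorem paramBound_le (hn : 2 ≤ n) (h0 : 0 < ε) (h1 : ε < 1) : (paramBound n k ε : ℝ) ≤
    (4 * k + 18 : ℕ) * ((n : ℝ) + 1 / (ε : ℝ) + (ε.den.size : ℝ)) ^ 2 := by
  have hε : (0 : ℝ) < ε := by exact_mod_cast h0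
  have hi : 0 ≤ 1 / (ε : ℝ) := by positivity
  have hs : (0 : ℝ) ≤ ε.den.size := by positivity
  have hn' : (2 : ℝ) ≤ n := by exact_mod_cast hn
  have hE := invPrec_le h0 h1
  have hlab := labelBound_le k h0 h1
  set y := (n : ℝ) + 1 / (ε : ℝ) + (ε.den.size : ℝ) with hy
  have hk : (0 : ℝ) ≤ k := by positivity
  have h2 : 11 / (ε : ℝ) ≤ 11 * y := by
    calc 11 / (ε : ℝ) = 11 * (1 / ε) := by ring
      _ ≤ _ := by rw [hy]; gcongr; linarith
  have h3 : (labelBound k ε : ℝ) ≤ (4 * k + 4) * y ^ 2 := by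
    calc (labelBound k ε : ℝ) ≤ (4 * k + 4) * (1 / (ε : ℝ)) ^ 2 := by
          rw [div_pow, one_pow]
          have : (2 * (k : ℝ) + 2) * (4 / (ε : ℝ) ^ 2) = 2 * ((4 * k + 4) * (1 / (ε : ℝ) ^ 2)) := by
            ring
          linarith
      _ ≤ _ := by rw [hy]; gcongr; linarith
  have hy1 : y ≤ y ^ 2 := by nlinarith
  rw [paramBound]
  push_cast
  nlinarith

/-- Since `ε < 1`, the numerator is no longer than the denominator, so the length of the latter
suffices to describe the input. -/
theorem sizeLe_initial (hn : 2 ≤ n) (h1 : ε < 1) :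
    SizeLe (initial c ε).mem (paramBound n k ε) := by
  have hsz : ∀ m : ℕ, m.size ≤ m := fun m => Nat.size_le.2 Nat.lt_two_pow_self
  have hnum : ε.num.toNat ≤ ε.den := by
    have := Rat.num_lt_denom_iff.2 h1
    omega
  intro a l
  rw [initial]
  dsimp only
  split
  · exact (hsz n).trans (by rw [paramBound]; omega)
  · exact (Nat.size_le_size hnum).trans (by rw [paramBound]; omega)
  · rw [paramBound]; omega
  · split
    · refine (hsz _).trans (le_trans (b := 3) ?_ (by rw [paramBound]; omega))
      generalize c _ _ = P
      cases P <;> simp [Pauli.code]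
    · simp
  · simp

end

/-- The cost of the preamble and the resulting bit lengths are polynomial in `paramBound`, the cost
of the main part is polynomial in both, and `paramBound` is at most quadratic in `n + 1/ε` plus the
bit length. -/
theorem protocol_time (k : ℕ) : ∃ A d : ℕ, ∀ (n : ℕ), 2 ≤ n →
    ∀ (c : Fin (2 * n) → Fin n → Pauli) (ε : ℚ), 0 < ε → ε < 1 → ∀ (ρ : DensityMatrix n),
      ∀ s ∈ ((protocolFor k).run ρ (initial c ε)).support,
        (s.time : ℝ) ≤ A * ((n : ℝ) + 1 / (ε : ℝ) + (ε.den.size : ℝ)) ^ d := by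
  obtain ⟨f, hf, h⟩ := exists_cheap_exList (preamble k) (preamble_eff_det k) PolyBdd.id
  obtain ⟨g, hg, hmain⟩ := (poly_mainPart k).eff
  obtain ⟨b, hb⟩ := hf.add (hg.comp ((hf.add (.const 1)).add .id) fun K hK => by omega)
  refine ⟨b * (4 * k + 18) ^ b, 2 * b, fun n hn c ε h0 h1 ρ s hs => ?_⟩
  set K := paramBound n k ε with hK
  have hK1 : 1 ≤ K := by rw [hK, paramBound]; omega
  have hnK : n ≤ K := by rw [hK, paramBound]; omega
  obtain ⟨-, hpar⟩ := preamble_spec (k := k) c ε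
  have hpar' := hpar K (by rw [hK, paramBound]; omega) (by rw [hK, paramBound]; omega)
    (by rw [hK, paramBound]; omega)
  have hch := h n ρ (initial c ε) K hK1 hnK (fun j hj => hpar' j hj.le)
    ⟨sizeLe_initial hn h1, Nat.zero_le _⟩
  rw [run_protocolFor] at hs
  have hfin := hpar' (preamble k).length le_rfl
  rw [List.take_length] at hfin
  have ht := (hmain n ρ _ (f K + 1) K (by omega) hK1 hnK hfin
    (fun a l => (hch.1 a l).trans (by omega)) s hs).2
  have htot : s.time ≤ b * K ^ b :=
    (ht.trans (Nat.add_le_add_right hch.2 _)).trans (hb K hK1)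
  have hKy := paramBound_le (k := k) hn h0 h1
  set y := (n : ℝ) + 1 / (ε : ℝ) + (ε.den.size : ℝ)
  calc (s.time : ℝ) ≤ b * (K : ℝ) ^ b := by exact_mod_cast htot
    _ ≤ b * ((4 * k + 18 : ℕ) * y ^ 2) ^ b := by gcongr
    _ = _ := by rw [mul_pow, ← pow_mul]; push_cast; ring

end ShadowTomography
end

theorem theorem6 :
    ∃ C : ℝ, 0 < C ∧ ∀ k : ℕ, 1 ≤ k →
      ∃ (protocol : Program) (A d : ℕ),
        ∀ (n : ℕ), 2 ≤ n →
        ∀ (c : Fin (2 * n) → Fin n → Pauli), IsMajorana c →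
        ∀ (ε : ℚ), 0 < ε → ε < 1 →
        ∀ (ρ : DensityMatrix n),
          (99 / 100 : ENNReal) ≤
            (protocol.run ρ (initial c ε)).toOuterMeasure {s | s.Succeeds k c ε ρ} ∧
          ∀ s ∈ (protocol.run ρ (initial c ε)).support,
            (s.copies : ℝ) ≤
              C * (k * Real.log n * (chiPoly k).eval (4 / (ε : ℝ) ^ 2) / (ε : ℝ) ^ 2) ∧
            (s.time : ℝ) ≤ A * ((n : ℝ) + 1 / (ε : ℝ) + (ε.den.size : ℝ)) ^ d := by
  -- The factor `6` is two copies per round times the `3` of `size_le_log`; `14641 = 11^4` belongs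
  -- to the Bell measurements, `242 = 2 * 11^2` and the constant of `pow_posSets_le` to the signs.
  refine ⟨6 * (14641 + 242 * 20736), by norm_num, fun k hk => ?_⟩
  obtain ⟨A, d, hT⟩ := protocol_time k
  exact ⟨protocolFor k, A, d, fun n hn c hc ε h0 h1 ρ => ⟨protocol_succeeds hk hn hc h0 h1 ρ,
    fun s hs => ⟨protocol_copies hk hn h0 h1 ρ s hs, hT n hn c ε h0 h1 ρ s hs⟩⟩⟩
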